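/- **Setting.** Let $\Sigma=\{1,\dots,d\}$, let $P(\Sigma)\subset\mathbb R^d$ be the simplex of probability vectors, $|\cdot|$ the Euclidean norm, $T>0$, $0<\kappa\le M$, $A=[\kappa,M]^d$. Let $L:\Sigma\times A\to\mathbb R$ be continuous in its second variable and $F,G:\Sigma\times P(\Sigma)\to\mathbb R$ be bounded. Put $H(x,p)=\sup_{a\in A}\{-a\cdot p-L(x,a)\}$ and assume that for all $(x,p)\in\Sigma\times\mathbb R^d$ the supremum has a unique maximizer $\alpha^*(x,p)$. Write $\Delta g(x)=(g(y)-g(x))_{y\in\Sigma}$ for $g:\Sigma\to\mathbb R$ (and $\Delta^x$ for the difference in the variable $x\in\Sigma$ of a function of several variables), and $\Delta^j g(\boldsymbol x)$ for the difference in the $j$-th entry of $g:\Sigma^N\to\mathbb R$. Let $m^N_{\boldsymbol x}=\frac1N\sum_j\delta_{x_j}$ and $m^{N,i}_{\boldsymbol x}=\frac1{N-1}\sum_{j\ne i}\delta_{x_j}$ (for $N=1$ the latter is read as the zero vector, and $F(x,0),G(x,0)$ are arbitrary numbers). Assume (H1): $H(x,\cdot)$ and $\alpha^*(x,\cdot)$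 are Lipschitz on $\{|p|\le K\}$, where $K\ge 2\sqrt d\,\big(T(\|L\|_\infty+\|F\|_\infty)+\|G\|_\infty\big)$. For $\varphi:P(\Sigma)\to\mathbb R$ let $[D^m\varphi(m,y)]_z=\lim_{s\to0^+}\frac{\varphi(m+s(\delta_z-\delta_y))-\varphi(m)}s$, the limit being taken across admissible $s$ (those with $m+s(\delta_z-\delta_y)\in P(\Sigma)$); $\varphi$ is $C^1$ if these limits exist and define (at points and directions without admissible $s>0$: extend to) a function $D^m\varphi(\cdot,y)$ continuous on $P(\Sigma)$. Assume that $U:[0,T]\times\Sigma\times P(\Sigma)\to\mathbb R$ is a regular solution of the master equation: $U$ is continuous, $C^1$ in $t$ and $C^1$ in $m$, $D^mU(t,x,\cdot)$ is Lipschitz in $m$ uniformly in $(t,x)$, $U(T,x,m)=G(x,m)$, and everywhere $$-\partial_tU+H(x,\Delta^xU)-\int_\Sigma D^mU(t,x,m,y)\cdot\alpha^*(y,\Delta^yU(t,y,m))\,dm(y)=F(x,m).$$ For $N\ge1$ and $m_0\in P(\Sigma)$ let $(v^{N,i})_{i\le N}$ be the classical solution on $[0,T]\times\Sigma^N$ of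 $$-\partial_tv^{N,i}-\sum_{j\ne i}\alpha^*(x_j,\Delta^jv^{N,j})\cdot\Delta^jv^{N,i}+H(x_i,\Delta^iv^{N,i})=F(x_i,m^{N,i}_{\boldsymbol x}),\qquad v^{N,i}(T,\boldsymbol x)=G(x_i,m^{N,i}_{\boldsymbol x}).$$ On a probability space let $\mathcal N_1,\dots,\mathcal N_N$ be i.i.d. Poisson random measures on $[0,T]\times[0,M]^d$ with intensity $dt\otimes\nu$, where $\nu$ is the sum over $j$ of the Lebesgue measures on the segments $\{\xi\in[0,M]^d:\xi_i=0\ \forall i\ne j\}$, and let $Z_1,\dots,Z_N$ be i.i.d. with law $m_0$ and independent of $(\mathcal N_i)_i$. Let $f(x,\xi,a)=\sum_{y\in\Sigma}(y-x)\mathbf 1_{]0,a_y[}(\xi_y)$, and let $\boldsymbol Y$ and $\tilde{\boldsymbol X}$ be càdlàg solutions on $[0,T]$, driven by the same noise, of $$Y_i(t)=Z_i+\int_0^t\!\!\int f\big(Y_i(s^-),\xi,\alpha^*(Y_i(s^-),\Delta^iv^{N,i}(s,\boldsymbol Y_{s^-}))\big)\,\mathcal N_i(ds,d\xi),$$ $$\tilde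 X_i(t)=Z_i+\int_0^t\!\!\int f\big(\tilde X_i(s^-),\xi,\alpha^*(\tilde X_i(s^-),\Delta^xU(s,\tilde X_i(s^-),\mathrm{Law}(\tilde X_i(s))))\big)\,\mathcal N_i(ds,d\xi).$$ Finally let $(u,m)$ be the solution on $[0,T]$ of the mean field game system $$-\tfrac{d}{dt}u(t,x)+H(x,\Delta^xu(t,x))=F(x,m(t)),\quad \tfrac{d}{dt}m_x(t)=\sum_ym_y(t)\,\alpha^*_x(y,\Delta^yu(t,y)),\quad u(T,x)=G(x,m(T)),\quad m(0)=m_0,$$ with $m(t)\in P(\Sigma)$ and the convention $\alpha^*_x(x,\cdot)=-\sum_{y\ne x}\alpha^*_y(x,\cdot)$ in the second equation. **Theorem 3.2.** There is a constant $C>0$, independent of $N$, $m_0$, $i$ and of the probability space, such that for all $N\ge1$ and $m_0\in P(\Sigma)$: the processes $\tilde X_1,\dots,\tilde X_N$ are i.i.d. on path space, with $\mathrm{Law}(\tilde X_i(t))=m(t)$ for all $t\in[0,T]$; $$\mathbb E\Big[\sup_{t\in[0,T]}|Y_i(t)-\tilde X_i(t)|\Big]\le C N^{-1/9}\quad(i=1,\dots,N);\qquad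 \mathbb E\Big[\sup_{t\in[0,T]}|m^N_{\boldsymbol Y_t}-m(t)|\Big]\le CN^{-1/9}.$$ -/

import Mathlib

open Set Filter Topology MeasureTheory ProbabilityTheory
open scoped ENNReal NNReal

noncomputable section

namespace FiniteMFG

/-- The vector space `ℝ^d`, with its Euclidean norm. -/
abbrev Vec (d : ℕ) := EuclideanSpace ℝ (Fin d)

/-- The space `P(Σ)` of probability vectors on `Σ`, where `Σ` is modelled by `Fin d`. -/
def simplex (d : ℕ) : Set (Vec d) := {m | (∀ x, 0 ≤ m x) ∧ ∑ x, m x = 1}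

/-- The Dirac mass `δ_x`. -/
def dirac {d : ℕ} (x : Fin d) : Vec d := EuclideanSpace.single x 1

/-- The finite difference `Δ g (x) = (g y - g x)_y`. -/
def diff {d : ℕ} (g : Fin d → ℝ) (x : Fin d) : Vec d := WithLp.toLp 2 fun y => g y - g x

/-- The finite difference `Δ^j g (x)` of `g : Σ^N → ℝ` in its `j`-th entry. -/
def diffAt {d N : ℕ} (j : Fin N) (g : (Fin N → Fin d) → ℝ) (x : Fin N → Fin d) : Vec d :=
  WithLp.toLp 2 fun y => g (Function.update x j y) - g x

/-- The empirical measure `m^N_x` of all players. -/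
def empirical {d N : ℕ} (x : Fin N → Fin d) : Vec d :=
  (1 / (N : ℝ)) • ∑ j, dirac (x j)

/-- The empirical measure `m^{N,i}_x` of all players except the `i`-th.
(For `N = 1` there are no other players, and this is the zero vector.) -/
def empiricalOther {d N : ℕ} (i : Fin N) (x : Fin N → Fin d) : Vec d :=
  (1 / ((N : ℝ) - 1)) • ∑ j ∈ Finset.univ.erase i, dirac (x j)

/-- The data of the game: the horizon `T`, the bounds `κ, M` of the control set, the Lagrangian
`L`, the running cost `F` and the terminal cost `G`. Only the values of `L x` on the control set
and of `F x`, `G x` on the simplex are used (except that, for a single player, the empirical measure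
of the others is the zero vector). -/
structure Game (d : ℕ) where
  T : ℝ
  κ : ℝ
  M : ℝ
  L : Fin d → Vec d → ℝ
  F : Fin d → Vec d → ℝ
  G : Fin d → Vec d → ℝ

namespace Game

variable {d : ℕ} (𝒢 : Game d)

/-- The control set `A = [κ, M]^d`. -/
def controls : Set (Vec d) := {a | ∀ y, a y ∈ Icc 𝒢.κ 𝒢.M}

/-- `a` maximizes `-a·p - L(x,a)` over the control set. -/
def IsOptimal (x : Fin d) (p a : Vec d) : Prop :=
  a ∈ 𝒢.controls ∧ ∀ b ∈ 𝒢.controls, - inner ℝ b p - 𝒢.L x b ≤ - inner ℝ a p - 𝒢.L x a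

open Classical in
/-- The maximizer `α*(x,p)`, when there is one. -/
def optControl (x : Fin d) (p : Vec d) : Vec d :=
  if h : ∃ a, 𝒢.IsOptimal x p a then h.choose else 0

/-- The Hamiltonian `H(x,p) = sup_{a ∈ A} (-a·p - L(x,a))`. -/
def hamiltonian (x : Fin d) (p : Vec d) : ℝ :=
  sSup ((fun a => - inner ℝ a p - 𝒢.L x a) '' 𝒢.controls)

/-- The standing assumptions: `T > 0`, `0 < κ ≤ M`, `L` is continuous in the control, and the
maximizer in the definition of the Hamiltonian exists and is unique. -/
structure Standing : Prop where
  T_pos : 0 < 𝒢.T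
  κ_pos : 0 < 𝒢.κ
  κ_le_M : 𝒢.κ ≤ 𝒢.M
  L_cont : ∀ x, ContinuousOn (𝒢.L x) 𝒢.controls
  unique_max : ∀ x p, ∃! a, 𝒢.IsOptimal x p a

/-- Assumption (H1): `H` and `α*` are Lipschitz in `p` on the ball `|p| ≤ K`. -/
def H1 (K : ℝ) : Prop :=
  ∃ Λ : ℝ≥0, ∀ x, LipschitzOnWith Λ (𝒢.hamiltonian x) (Metric.closedBall 0 K) ∧
    LipschitzOnWith Λ (𝒢.optControl x) (Metric.closedBall 0 K)

/-- `D` is the derivative `D^m φ` of `φ : P(Σ) → ℝ`, and `φ` is `C¹`: `[D m y]_z` is the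
right derivative at `s = 0` of `s ↦ φ(m + s (δ_z - δ_y))`, taken across the admissible `s` (those for
which the point stays in `P(Σ)`), and `D · y` is continuous on `P(Σ)`. -/
def IsC1Deriv (φ : Vec d → ℝ) (D : Vec d → Fin d → Vec d) : Prop :=
  (∀ m ∈ simplex d, ∀ y z : Fin d,
    HasDerivWithinAt (fun s : ℝ => φ (m + s • (dirac z - dirac y))) (D m y z)
      {s | 0 ≤ s ∧ m + s • (dirac z - dirac y) ∈ simplex d} 0) ∧
  ∀ y, ContinuousOn (fun m => D m y) (simplex d)

/-- `U` is a regular solution of the master equation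
`-∂_t U + H(x, Δ^x U) - ∫ D^m U(t,x,m,y) · α*(y, Δ^y U(t,y,m)) dm(y) = F(x,m)`,
`U(T,x,m) = G(x,m)` on `[0,T] × Σ × P(Σ)`: it is continuous, `C¹` in `t` (one-sided at the
endpoints) and in `m`, solves the equation, and `D^m U(t,x,·)` is Lipschitz uniformly
in `(t,x)`. -/
def IsRegularSolution (U : ℝ → Fin d → Vec d → ℝ) : Prop :=
  ∃ (Ut : ℝ → Fin d → Vec d → ℝ) (D : ℝ → Fin d → Vec d → Fin d → Vec d),
    (∀ x, ContinuousOn (fun q : ℝ × Vec d => U q.1 x q.2) (Icc 0 𝒢.T ×ˢ simplex d)) ∧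
    (∀ x, ∀ m ∈ simplex d, (∀ t ∈ Icc 0 𝒢.T,
      HasDerivWithinAt (fun s => U s x m) (Ut t x m) (Icc 0 𝒢.T) t) ∧
      ContinuousOn (fun t => Ut t x m) (Icc 0 𝒢.T)) ∧
    (∀ t ∈ Icc 0 𝒢.T, ∀ x, IsC1Deriv (U t x) (D t x)) ∧
    (∀ t ∈ Icc 0 𝒢.T, ∀ x, ∀ m ∈ simplex d,
      - Ut t x m + 𝒢.hamiltonian x (diff (fun y => U t y m) x)
        - ∑ y, m y * inner ℝ (D t x m y) (𝒢.optControl y (diff (fun z => U t z m) y))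
        = 𝒢.F x m) ∧
    (∀ x, ∀ m ∈ simplex d, U 𝒢.T x m = 𝒢.G x m) ∧
    ∃ Λ : ℝ≥0, ∀ t ∈ Icc 0 𝒢.T, ∀ x y, LipschitzOnWith Λ (fun m => D t x m y) (simplex d)

/-- `v = (v^{N,i})_i` is a classical solution of the Hamilton-Jacobi-Bellman system
`-∂_t v^{N,i} - ∑_{j ≠ i} α*(x_j, Δ^j v^{N,j}) · Δ^j v^{N,i} + H(x_i, Δ^i v^{N,i}) = F(x_i, m^{N,i}_x)`,
`v^{N,i}(T,x) = G(x_i, m^{N,i}_x)`. -/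
def IsHJBSolution {N : ℕ} (v : Fin N → ℝ → (Fin N → Fin d) → ℝ) : Prop :=
  ∀ i x,
    (∀ t ∈ Icc 0 𝒢.T, HasDerivWithinAt (fun s => v i s x)
      (- (∑ j ∈ Finset.univ.erase i,
            inner ℝ (𝒢.optControl (x j) (diffAt j (v j t) x)) (diffAt j (v i t) x))
        + 𝒢.hamiltonian (x i) (diffAt i (v i t) x) - 𝒢.F (x i) (empiricalOther i x))
      (Icc 0 𝒢.T) t) ∧
    v i 𝒢.T x = 𝒢.G (x i) (empiricalOther i x)

/-- `(u, m)` solves the mean field game system on `[0,T]` with `m(0) = m₀`: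
`-u' + H(x, Δ^x u) = F(x, m(t))`, `m_x' = ∑_y m_y α*_x(y, Δ^y u)`, `u(T,x) = G(x, m(T))`, with
the convention `α*_x(x, ·) = -∑_{y ≠ x} α*_y(x, ·)` for the diagonal rates. -/
def IsMFGSolution (m₀ : Vec d) (u : ℝ → Fin d → ℝ) (m : ℝ → Vec d) : Prop :=
  (∀ t ∈ Icc 0 𝒢.T, m t ∈ simplex d) ∧
  (∀ t ∈ Icc 0 𝒢.T, ∀ x, HasDerivWithinAt (fun s => u s x)
    (𝒢.hamiltonian x (diff (u t) x) - 𝒢.F x (m t)) (Icc 0 𝒢.T) t) ∧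
  (∀ t ∈ Icc 0 𝒢.T, ∀ x, HasDerivWithinAt (fun s => m s x)
    (∑ y ∈ Finset.univ.erase x, m t y * 𝒢.optControl y (diff (u t) y) x
      - m t x * ∑ y ∈ Finset.univ.erase x, 𝒢.optControl x (diff (u t) x) y) (Icc 0 𝒢.T) t) ∧
  (∀ x, u 𝒢.T x = 𝒢.G x (m 𝒢.T)) ∧
  m 0 = m₀

end Game

/-- `Nm` is a Poisson random measure with finite intensity `ν` under `P`: a random finite point
measure whose mass on each measurable set `B` is Poisson distributed with parameter `ν B`, its
masses on pairwise disjoint sets being independent. -/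
structure IsPoissonRandomMeasure {Ω E : Type*} [MeasurableSpace Ω] [MeasurableSpace E]
    (P : Measure Ω) (Nm : Ω → Measure E) (ν : Measure E) : Prop where
  measurable : Measurable Nm
  point_measure : ∀ᵐ ω ∂P, ∃ s : Multiset E, Nm ω = (s.map Measure.dirac).sum
  law : ∀ B, MeasurableSet B →
    P.map (fun ω => Nm ω B) = (poissonMeasure (ν B).toNNReal).map (fun n : ℕ => (n : ℝ≥0∞))
  indep : ∀ (n : ℕ) (B : Fin n → Set E), (∀ k, MeasurableSet (B k)) →
    Pairwise (fun k l => Disjoint (B k) (B l)) → iIndepFun (fun k ω => Nm ω (B k)) P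

/-- The measure `ν(E) = ∑_j ℓ(E ∩ Ξ_j)` on the mark space, where `Ξ_j` is the segment `[0,M]` of the
`j`-th coordinate axis. It is carried by `Ξ = [0,M]^d`. -/
def markIntensity (d : ℕ) (M : ℝ) : Measure (Fin d → ℝ) :=
  ∑ j, (volume.restrict (Icc 0 M)).map (fun u : ℝ => (Pi.single j u : Fin d → ℝ))

/-- The intensity `dt ⊗ ν(dξ)` on `[0,T] × Ξ`. -/
def intensity (d : ℕ) (T M : ℝ) : Measure (ℝ × (Fin d → ℝ)) :=
  (volume.restrict (Icc 0 T)).prod (markIntensity d M)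

/-- The jump function `f(x,ξ,a) = ∑_y (y - x) 𝟙_{]0,a_y[}(ξ_y)`. -/
def jump {d : ℕ} (x : Fin d) (ξ : Fin d → ℝ) (a : Vec d) : ℝ :=
  ∑ y : Fin d, (((y : ℕ) : ℝ) - ((x : ℕ) : ℝ)) * (Ioo 0 (a y)).indicator (fun _ => 1) (ξ y)

/-- The path `x` is càdlàg on `[0,T]`. -/
def IsCadlagOn {d : ℕ} (T : ℝ) (x : ℝ → Fin d) : Prop :=
  (∀ t ∈ Ico 0 T, ContinuousWithinAt x (Ici t) t) ∧
  ∀ t ∈ Ioc 0 T, ∃ y, Tendsto x (𝓝[<] t) (𝓝 y)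

/-- The law of a `Σ`-valued random variable, as a vector in `ℝ^d`. -/
def lawVec {d : ℕ} {Ω : Type*} [MeasurableSpace Ω] (P : Measure Ω) (X : Ω → Fin d) : Vec d :=
  WithLp.toLp 2 fun x => P.real {ω | X ω = x}

/-- The driving noise of `N` players: i.i.d. Poisson random measures with intensity
`dt ⊗ ν`, i.i.d. initial states with law `m₀`, and the initial states independent of the Poisson
measures. -/
structure IsNoise {d N : ℕ} {Ω : Type*} [MeasurableSpace Ω] (P : Measure Ω) (T M : ℝ)
    (m₀ : Vec d) (Z : Fin N → Ω → Fin d) (Nm : Fin N → Ω → Measure (ℝ × (Fin d → ℝ))) : Prop where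
  poisson : ∀ i, IsPoissonRandomMeasure P (Nm i) (intensity d T M)
  indep_poisson : iIndepFun Nm P
  measurable_init : ∀ i, Measurable (Z i)
  law_init : ∀ i, lawVec P (Z i) = m₀
  indep_init : iIndepFun Z P
  indep : IndepFun (fun ω i => Z i ω) (fun ω i => Nm i ω) P

/-- `X` is a càdlàg solution on `[0,T]` of the system
`X_i(t) = Z_i + ∫_0^t ∫_Ξ f(X_i(s⁻), ξ, β^i(s, X_{s⁻})) N_i(ds,dξ)` driven by feedbacks `β^i`. -/
structure SolvesSDE {d N : ℕ} {Ω : Type*} [MeasurableSpace Ω] (P : Measure Ω) (T : ℝ)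
    (Z : Fin N → Ω → Fin d) (Nm : Fin N → Ω → Measure (ℝ × (Fin d → ℝ)))
    (β : Fin N → ℝ → (Fin N → Fin d) → Vec d) (X : Fin N → ℝ → Ω → Fin d) : Prop where
  measurable : ∀ i, ∀ t ∈ Icc 0 T, Measurable (X i t)
  cadlag : ∀ᵐ ω ∂P, ∀ i, IsCadlagOn T (fun t => X i t ω)
  eqn : ∀ᵐ ω ∂P, ∀ i, ∀ t ∈ Icc 0 T,
    ((X i t ω : ℕ) : ℝ) = ((Z i ω : ℕ) : ℝ) + ∫ q in Ioc 0 t ×ˢ univ,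
      jump (Function.leftLim (fun r => X i r ω) q.1) q.2
        (β i q.1 (fun j => Function.leftLim (fun r => X j r ω) q.1)) ∂(Nm i ω)

namespace Game

variable {d : ℕ} (𝒢 : Game d)

/-- The equilibrium feedback `α*(x_i, Δ^i v^{N,i}(t,x))` of the `N`-player game. -/
def nashFeedback {N : ℕ} (v : Fin N → ℝ → (Fin N → Fin d) → ℝ) :
    Fin N → ℝ → (Fin N → Fin d) → Vec d :=
  fun i t x => 𝒢.optControl (x i) (diffAt i (v i t) x)

/-- The feedback `α*(x_i, Δ^x U(t, x_i, μ_i(t)))` induced by `U` along flows of measures `μ_i`. -/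
def limitFeedback {N : ℕ} (U : ℝ → Fin d → Vec d → ℝ) (μ : Fin N → ℝ → Vec d) :
    Fin N → ℝ → (Fin N → Fin d) → Vec d :=
  fun i t x => 𝒢.optControl (x i) (diff (fun y => U t y (μ i t)) (x i))

end Game

end FiniteMFG

end

open FiniteMFG

open FiniteMFG

/-! The functions u^i(t,x) = U(t, x_i, m^{N,i}_x) almost solve the Nash system. Moving one other
player shifts m^{N,i} by 1/(N-1) times a difference of Dirac masses, so Δ^j u^i is D^m U/(N-1) up to
O(N^{-2}), and the sum over j ≠ i reproduces the integral in the master equation with a residual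
O(1/N) (`abs_residual_le`). Because α* is bounded below by κ > 0, Dynkin's formula for (u^i -
v^{N,i})² along Y contains the coercive term κ|Δ^i(u^i - v^{N,i})|², which absorbs the first order
errors (`energy_le`). The terminal data agree, so integration in time gives ∫ E|Δ^i(u^i - v^{N,i})|²
= O(N^{-2}) (`integral_sq_le`). Along Y, the Nash feedback is therefore O(1/N)-close in mean to the
feedback given by U at the empirical measure.

Two solutions driven by the same noise separate at player i only through a point whose mark lies
between the two rates. The probability of separation is thus at most the time integral of the mean
difference of the rates (`SolvesSDE.real_exists_ne_le`). This difference is bounded by the error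
above, by the fraction of players already separated, and by the distance of the empirical measure of
the limit processes from their law, which is O(N^{-1/2}). Gronwall's inequality for the sum over
players gives separation probabilities O(N^{-1/2}) (`Game.Estimates.real_exists_ne_le`), which
control the running distance because Σ is finite. For the supremum of the empirical measure, a grid
of n time steps costs n/√N + 1/n, and n ≈ N^{1/4} gives N^{-1/4}. Both rates are better than
N^{-1/9}.

The law of each limit process solves a nonlinear Kolmogorov equation with Lipschitz drift started at
m₀. By uniqueness all laws are one flow, so the limit players have common deterministic rates and
each is the same functional of its own noise; hence they are i.i.d. A second order expansion on the
simplex provides a chain rule for U along flows, and a backward Gronwall argument shows U(t,x,m(t))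
= u(t,x) for a mean field game solution. So m is the same flow (`eq_value`, `limitFlow_unique`).

The stochastic calculus is elementary. In a short interval ]a,b] the noise has two or more points
with probability O((b-a)²); otherwise the new state is an explicit function `step` of the old one
and of the noise, which is independent of the state at a. A quantity whose increments are O((b-a)²)
is constant, so one-step expansions yield Dynkin's formula exactly, and a one-sided version yields
the coupling bound. Since (H1) holds only on a ball, maximum principles bound v, u and U first, so
that all relevant differences stay in it. -/

namespace FiniteMFG

/-! ### Atoms of a finite family of sets. -/

section Atoms

variable {E κ : Type*}

/-- The atoms inside `A` of the algebra of sets generated by the family `B`. -/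
def atomSet (A : Set E) (B : κ → Set E) (J : Finset κ) : Set E :=
  {q | q ∈ A ∧ ∀ k, q ∈ B k ↔ k ∈ J}

lemma atomSet_subset (A : Set E) (B : κ → Set E) (J : Finset κ) : atomSet A B J ⊆ A :=
  fun _ h => h.1

lemma disjoint_atomSet (A : Set E) (B : κ → Set E) {J J' : Finset κ} (h : J ≠ J') :
    Disjoint (atomSet A B J) (atomSet A B J') := by
  rw [Set.disjoint_left]
  intro q hq hq'
  exact h (Finset.ext fun k => (hq.2 k).symm.trans (hq'.2 k))

variable [MeasurableSpace E]

lemma measurableSet_atomSet [Fintype κ] {A : Set E} {B : κ → Set E} (hA : MeasurableSet A)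
    (hB : ∀ k, MeasurableSet (B k)) (J : Finset κ) : MeasurableSet (atomSet A B J) := by
  have : atomSet A B J = A ∩ ⋂ k, {q | q ∈ B k ↔ k ∈ J} := by
    ext q; simp [atomSet]
  rw [this]
  refine hA.inter (MeasurableSet.iInter fun k => ?_)
  by_cases hk : k ∈ J
  · simpa [hk] using hB k
  · have h : {q | q ∈ B k ↔ k ∈ J} = (B k)ᶜ := by ext q; simp [hk]
    rw [h]
    exact (hB k).compl

/-- Masses of overlapping sets become linear in the masses of disjoint atoms, on which a Poisson
random measure is independent by definition. -/
lemma measure_inter_eq_sum_atomSet [Fintype κ] [DecidableEq κ] {A : Set E} {B : κ → Set E}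
    (hA : MeasurableSet A) (hB : ∀ k, MeasurableSet (B k)) (μ : Measure E) (k : κ) :
    μ (B k ∩ A) = ∑ J with k ∈ J, μ (atomSet A B J) := by
  classical
  have : B k ∩ A = ⋃ J ∈ Finset.univ.filter (fun J : Finset κ => k ∈ J), atomSet A B J := by
    ext q
    simp only [mem_inter_iff, Finset.mem_filter, Finset.mem_univ, true_and, mem_iUnion]
    constructor
    · rintro ⟨hk, hq⟩
      exact ⟨Finset.univ.filter (fun l => q ∈ B l), by simpa using hk, hq, by simp⟩
    · rintro ⟨J, hJ, hq⟩
      exact ⟨(hq.2 k).2 hJ, hq.1⟩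
  rw [this, measure_biUnion_finset]
  · intro J _ J' _ h
    exact disjoint_atomSet A B h
  · exact fun J _ => measurableSet_atomSet hA hB J

end Atoms

/-! ### The σ-algebra on the space of measures. -/

section Measures

variable {E : Type*} [MeasurableSpace E]

/-- A random measure may be treated as the process of its masses; questions of law and independence
then reduce to finite-dimensional marginals. -/
lemma measurableSpace_measure_eq_comap :
    (Measure.instMeasurableSpace : MeasurableSpace (Measure E)) =
      MeasurableSpace.comap (fun μ (B : {B : Set E // MeasurableSet B}) => μ B) inferInstance := by
  apply le_antisymm
  · refine iSup₂_le fun s hs => ?_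
    rw [← measurable_iff_comap_le]
    have h : Measurable[MeasurableSpace.comap
        (fun μ (B : {B : Set E // MeasurableSet B}) => μ B) inferInstance]
        (fun (μ : Measure E) (B : {B : Set E // MeasurableSet B}) => μ B) :=
      comap_measurable _
    exact (measurable_pi_apply (⟨s, hs⟩ : {B : Set E // MeasurableSet B})).comp h
  · rw [← measurable_iff_comap_le]
    exact measurable_pi_lambda _ fun B => Measure.measurable_coe B.2

lemma comap_measure_eq_comap {Ω : Type*} (X : Ω → Measure E) :
    MeasurableSpace.comap X Measure.instMeasurableSpace =
      MeasurableSpace.comap (fun ω (B : {B : Set E // MeasurableSet B}) => X ω B)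
        inferInstance := by
  rw [measurableSpace_measure_eq_comap, MeasurableSpace.comap_comp]
  rfl

lemma measurable_restrict_measure {A : Set E} (hA : MeasurableSet A) :
    Measurable (fun μ : Measure E => μ.restrict A) := by
  refine Measure.measurable_of_measurable_coe _ fun s hs => ?_
  simp_rw [Measure.restrict_apply hs]
  exact Measure.measurable_coe (hs.inter hA)

end Measures

/-! ### Independence and uniqueness in law for Poisson random measures. -/

namespace IsPoissonRandomMeasure

variable {Ω E : Type*} [MeasurableSpace Ω] [MeasurableSpace E] {P : Measure Ω}
  {Nm Nm' : Ω → Measure E} {ν : Measure E}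

lemma measurable_apply (h : IsPoissonRandomMeasure P Nm ν) {B : Set E} (hB : MeasurableSet B) :
    Measurable (fun ω => Nm ω B) :=
  (Measure.measurable_coe hB).comp h.measurable

lemma iIndepFun_apply (h : IsPoissonRandomMeasure P Nm ν) {κ : Type*} [Fintype κ] {B : κ → Set E}
    (hB : ∀ k, MeasurableSet (B k)) (hd : Pairwise fun k l => Disjoint (B k) (B l)) :
    iIndepFun (fun k ω => Nm ω (B k)) P := by
  let e := Fintype.equivFin κ
  have := h.indep (Fintype.card κ) (fun k => B (e.symm k)) (fun k => hB _)
    (fun k l hkl => hd (e.symm.injective.ne hkl))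
  have h2 := this.precomp e.injective
  simpa [Function.comp_def] using h2

lemma map_apply_eq (h : IsPoissonRandomMeasure P Nm ν) (h' : IsPoissonRandomMeasure P Nm' ν)
    {B : Set E} (hB : MeasurableSet B) :
    P.map (fun ω => Nm ω B) = P.map (fun ω => Nm' ω B) := by
  rw [h.law B hB, h'.law B hB]

/-- The restrictions of a Poisson random measure to disjoint sets are independent. -/
theorem indepFun_restrict [IsProbabilityMeasure P] (h : IsPoissonRandomMeasure P Nm ν)
    {A A' : Set E} (hA : MeasurableSet A) (hA' : MeasurableSet A') (hd : Disjoint A A') :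
    IndepFun (fun ω => (Nm ω).restrict A) (fun ω => (Nm ω).restrict A') P := by
  classical
  rw [IndepFun_iff_Indep, comap_measure_eq_comap, comap_measure_eq_comap, ← IndepFun_iff_Indep]
  refine IndepFun.process_indepFun_process
    (X := fun (B : {B : Set E // MeasurableSet B}) ω => (Nm ω).restrict A B)
    (Y := fun (B : {B : Set E // MeasurableSet B}) ω => (Nm ω).restrict A' B) ?_ ?_ ?_
  · intro B
    exact (Measure.measurable_coe B.2).comp ((measurable_restrict_measure hA).comp h.measurable)
  · intro B
    exact (Measure.measurable_coe B.2).comp ((measurable_restrict_measure hA').comp h.measurable)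
  intro I J
  -- One disjoint family contains the atoms inside `A` and those inside `A'`, so a single use of
  -- independence over disjoint sets serves both sides.
  let S : Finset I ⊕ Finset J → Set E :=
    Sum.elim (atomSet A (fun k : I => (k : Set E))) (atomSet A' (fun k : J => (k : Set E)))
  have hS : ∀ k, MeasurableSet (S k) := by
    rintro (k | k)
    · exact measurableSet_atomSet hA (fun k => k.1.2) k
    · exact measurableSet_atomSet hA' (fun k => k.1.2) k
  have hSd : Pairwise fun k l => Disjoint (S k) (S l) := by
    rintro (k | k) (l | l) hkl
    · exact disjoint_atomSet _ _ (fun h => hkl (by rw [h]))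
    · exact hd.mono (atomSet_subset _ _ _) (atomSet_subset _ _ _)
    · exact hd.symm.mono (atomSet_subset _ _ _) (atomSet_subset _ _ _)
    · exact disjoint_atomSet _ _ (fun h => hkl (by rw [h]))
  have hind := h.iIndepFun_apply hS hSd
  have h2 := hind.indepFun_finset (Finset.univ.image Sum.inl) (Finset.univ.image Sum.inr)
    (by
      rw [Finset.disjoint_left]
      simp) (fun k => h.measurable_apply (hS k))
  have h3 := h2.comp
    (φ := fun (g : (Finset.univ.image (Sum.inl : Finset I → Finset I ⊕ Finset J)) → ℝ≥0∞) (k : I) =>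
      ∑ K with k ∈ K, g ⟨Sum.inl K, by simp⟩)
    (ψ := fun (g : (Finset.univ.image (Sum.inr : Finset J → Finset I ⊕ Finset J)) → ℝ≥0∞) (k : J) =>
      ∑ K with k ∈ K, g ⟨Sum.inr K, by simp⟩)
    (by fun_prop) (by fun_prop)
  have e1 : (fun ω (k : I) => (Nm ω).restrict A (k : Set E)) = fun ω (k : I) =>
      ∑ K with k ∈ K, Nm ω (S (Sum.inl K)) := by
    funext ω k
    rw [Measure.restrict_apply k.1.2]
    exact measure_inter_eq_sum_atomSet hA (fun k : I => k.1.2) (Nm ω) k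
  have e2 : (fun ω (k : J) => (Nm ω).restrict A' (k : Set E)) = fun ω (k : J) =>
      ∑ K with k ∈ K, Nm ω (S (Sum.inr K)) := by
    funext ω k
    rw [Measure.restrict_apply k.1.2]
    exact measure_inter_eq_sum_atomSet hA' (fun k : J => k.1.2) (Nm ω) k
  rw [e1, e2]
  exact h3

/-- Two Poisson random measures with the same intensity have the same law. -/
theorem identDistrib [IsProbabilityMeasure P] (h : IsPoissonRandomMeasure P Nm ν)
    (h' : IsPoissonRandomMeasure P Nm' ν) : IdentDistrib Nm Nm' P P := by
  classical
  refine ⟨h.measurable.aemeasurable, h'.measurable.aemeasurable, ?_⟩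
  have key : ∀ {N : Ω → Measure E}, IsPoissonRandomMeasure P N ν →
      Measurable (fun ω (B : {B : Set E // MeasurableSet B}) => N ω B) := fun hN =>
    measurable_pi_lambda _ fun B => hN.measurable_apply B.2
  have hproc : IdentDistrib (fun ω (B : {B : Set E // MeasurableSet B}) => Nm ω B)
      (fun ω (B : {B : Set E // MeasurableSet B}) => Nm' ω B) P P := by
    refine (identDistrib_iff_forall_finset_identDistrib
      (X := fun (B : {B : Set E // MeasurableSet B}) ω => Nm ω B)
      (Y := fun (B : {B : Set E // MeasurableSet B}) ω => Nm' ω B)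
      (key h).aemeasurable (key h').aemeasurable).2 fun I => ?_
    -- On the atoms both vectors of masses have independent Poisson components with equal
    -- parameters; sums over atoms carry the equality of laws to the original sets.
    let S : Finset I → Set E := atomSet univ (fun k : I => (k : Set E))
    have hS : ∀ k, MeasurableSet (S k) := fun k =>
      measurableSet_atomSet MeasurableSet.univ (fun k => k.1.2) k
    have hSd : Pairwise fun k l => Disjoint (S k) (S l) := fun k l hkl => disjoint_atomSet _ _ hkl
    have h1 : IdentDistrib (fun ω (K : Finset I) => Nm ω (S K)) (fun ω K => Nm' ω (S K)) P P :=
      IdentDistrib.pi (fun K => ⟨(h.measurable_apply (hS K)).aemeasurable,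
        (h'.measurable_apply (hS K)).aemeasurable, map_apply_eq h h' (hS K)⟩)
        (h.iIndepFun_apply hS hSd) (h'.iIndepFun_apply hS hSd)
    have h2 := h1.comp (u := fun (g : Finset I → ℝ≥0∞) (k : I) => ∑ K with k ∈ K, g K)
      (by fun_prop)
    have e : ∀ N : Ω → Measure E,
        (fun ω => I.restrict (fun B : {B : Set E // MeasurableSet B} => N ω B)) =
        (fun (g : Finset I → ℝ≥0∞) (k : I) => ∑ K with k ∈ K, g K) ∘ fun ω K => N ω (S K) := by
      intro N
      funext ω k
      have := measure_inter_eq_sum_atomSet MeasurableSet.univ (fun k : I => k.1.2) (N ω) k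
      rw [inter_univ] at this
      exact this
    rw [e, e]
    exact h2
  ext s hs
  rw [measurableSpace_measure_eq_comap] at hs
  obtain ⟨s', hs', rfl⟩ := hs
  rw [Measure.map_apply h.measurable, Measure.map_apply h'.measurable]
  · exact hproc.measure_mem_eq hs'
  all_goals
    rw [measurableSpace_measure_eq_comap]
    exact ⟨s', hs', rfl⟩

end IsPoissonRandomMeasure

/-! ### Probabilities of no point, one point and several points. -/

namespace IsPoissonRandomMeasure

variable {Ω E : Type*} [MeasurableSpace Ω] [MeasurableSpace E] {P : Measure Ω}
  {Nm : Ω → Measure E} {ν : Measure E}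

lemma measure_eq_natCast (h : IsPoissonRandomMeasure P Nm ν) {B : Set E} (hB : MeasurableSet B)
    (n : ℕ) : P {ω | Nm ω B = n} = poissonMeasure (ν B).toNNReal {n} := by
  have h1 : P {ω | Nm ω B = n} = P.map (fun ω => Nm ω B) {(n : ℝ≥0∞)} := by
    rw [Measure.map_apply (h.measurable_apply hB) (measurableSet_singleton _)]
    rfl
  rw [h1, h.law B hB, Measure.map_apply (by fun_prop) (measurableSet_singleton _)]
  congr 1
  ext k
  simp

lemma real_eq_zero (h : IsPoissonRandomMeasure P Nm ν) {B : Set E} (hB : MeasurableSet B) :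
    P.real {ω | Nm ω B = 0} = Real.exp (-(ν.real B)) := by
  have := h.measure_eq_natCast hB 0
  rw [Nat.cast_zero] at this
  rw [measureReal_def, this, poissonMeasure_singleton, ENNReal.toReal_ofReal (by positivity)]
  simp [measureReal_def, ENNReal.toReal]

lemma real_eq_one (h : IsPoissonRandomMeasure P Nm ν) {B : Set E} (hB : MeasurableSet B) :
    P.real {ω | Nm ω B = 1} = Real.exp (-(ν.real B)) * ν.real B := by
  have := h.measure_eq_natCast hB 1
  rw [Nat.cast_one] at this
  rw [measureReal_def, this, poissonMeasure_singleton, ENNReal.toReal_ofReal (by positivity)]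
  simp [measureReal_def, ENNReal.toReal]

lemma real_ne_zero [IsProbabilityMeasure P] (h : IsPoissonRandomMeasure P Nm ν) {B : Set E}
    (hB : MeasurableSet B) :
    P.real {ω | Nm ω B ≠ 0} = 1 - Real.exp (-(ν.real B)) := by
  rw [← h.real_eq_zero hB, ← probReal_compl_eq_one_sub]
  · rfl
  · exact h.measurable_apply hB (measurableSet_singleton _)

lemma real_ne_zero_le [IsProbabilityMeasure P] (h : IsPoissonRandomMeasure P Nm ν) {B : Set E}
    (hB : MeasurableSet B) : P.real {ω | Nm ω B ≠ 0} ≤ ν.real B := by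
  rw [h.real_ne_zero hB]
  linarith [Real.add_one_le_exp (-(ν.real B))]

/-- `1 - exp (-λ)` lies between `λ - λ²` and `λ`. This is what makes a jump rate the first order
term of a jump probability. -/
lemma abs_real_ne_zero_sub_le [IsProbabilityMeasure P] (h : IsPoissonRandomMeasure P Nm ν)
    {B : Set E} (hB : MeasurableSet B) :
    |P.real {ω | Nm ω B ≠ 0} - ν.real B| ≤ ν.real B ^ 2 := by
  have h0 : 0 ≤ ν.real B := measureReal_nonneg
  rw [abs_le]
  refine ⟨?_, by nlinarith [h.real_ne_zero_le hB]⟩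
  rw [h.real_ne_zero hB]
  have h1 : Real.exp (-(ν.real B)) * (1 + ν.real B) ≤ 1 := by
    have := Real.add_one_le_exp (ν.real B)
    calc Real.exp (-(ν.real B)) * (1 + ν.real B)
        ≤ Real.exp (-(ν.real B)) * Real.exp (ν.real B) := by gcongr; linarith
      _ = 1 := by rw [← Real.exp_add]; simp
  have h2 := Real.exp_pos (-(ν.real B))
  nlinarith

lemma ae_eq_zero (h : IsPoissonRandomMeasure P Nm ν) {B : Set E} (hB : MeasurableSet B)
    [IsProbabilityMeasure P] (h0 : ν B = 0) : ∀ᵐ ω ∂P, Nm ω B = 0 := by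
  have h1 := h.real_ne_zero_le hB
  rw [measureReal_def ν, h0, ENNReal.toReal_zero] at h1
  have h2 : P.real {ω | Nm ω B ≠ 0} = 0 := le_antisymm h1 measureReal_nonneg
  rwa [measureReal_eq_zero_iff] at h2

/-- By `exp (-λ) ≥ 1 - λ`, the values 0 and 1 have total probability `exp (-λ) (1 + λ) ≥ 1 - λ²`. -/
lemma real_not_le_one [IsProbabilityMeasure P] (h : IsPoissonRandomMeasure P Nm ν)
    {B : Set E} (hB : MeasurableSet B) :
    P.real {ω | ¬ Nm ω B ≤ 1} ≤ ν.real B ^ 2 := by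
  have h0 : 0 ≤ ν.real B := measureReal_nonneg
  have hm := h.measurable_apply hB
  have h1 : {ω | ¬ Nm ω B ≤ 1} ⊆ ({ω | Nm ω B = 0} ∪ {ω | Nm ω B = 1})ᶜ := by
    intro ω hω
    simp only [mem_compl_iff, mem_union, mem_ofPred_eq, not_or] at hω ⊢
    constructor <;> intro hh <;> simp [hh] at hω
  refine (measureReal_mono h1).trans ?_
  have hm0 : MeasurableSet {ω | Nm ω B = 0} := hm (measurableSet_singleton _)
  have hm1 : MeasurableSet {ω | Nm ω B = 1} := hm (measurableSet_singleton _)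
  rw [probReal_compl_eq_one_sub (hm0.union hm1), measureReal_union _ hm1, h.real_eq_zero hB,
    h.real_eq_one hB]
  · have h1 : (1 - ν.real B) * (1 + ν.real B) ≤ Real.exp (-(ν.real B)) * (1 + ν.real B) := by
      gcongr
      linarith [Real.add_one_le_exp (-(ν.real B))]
    nlinarith
  · rw [Set.disjoint_left]
    intro ω h1 h2
    simp only [mem_ofPred_eq] at h1 h2
    simp [h1] at h2

end IsPoissonRandomMeasure

/-! ### Finite point measures. -/

section PointMeasure

variable {E : Type*} [MeasurableSpace E]

/-- `μ` is a finite sum of Dirac masses. -/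
def IsPointMeasure (μ : Measure E) : Prop :=
  ∃ s : Multiset E, μ = (s.map Measure.dirac).sum

lemma restrict_sum_dirac (s : Multiset E) {A : Set E} (hA : MeasurableSet A)
    [DecidablePred (· ∈ A)] :
    ((s.map Measure.dirac).sum).restrict A = ((s.filter (· ∈ A)).map Measure.dirac).sum := by
  classical
  induction s using Multiset.induction_on with
  | empty => simp
  | cons a s ih =>
    rw [Multiset.map_cons, Multiset.sum_cons, Measure.restrict_add, ih, restrict_dirac' hA,
      Multiset.filter_cons]
    split_ifs with h <;> simp

lemma sum_dirac_univ (s : Multiset E) : (s.map Measure.dirac).sum univ = s.card := by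
  induction s using Multiset.induction_on with
  | empty => simp
  | cons a s ih =>
    rw [Multiset.map_cons, Multiset.sum_cons, Measure.add_apply, ih]
    simp [add_comm]

lemma integrable_sum_dirac [MeasurableSingletonClass E] (s : Multiset E) (f : E → ℝ) :
    Integrable f (s.map Measure.dirac).sum := by
  induction s using Multiset.induction_on with
  | empty => simp
  | cons a s ih =>
    rw [Multiset.map_cons, Multiset.sum_cons]
    exact (integrable_dirac (by simp)).add_measure ih

lemma IsPointMeasure.integrable [MeasurableSingletonClass E] {μ : Measure E}
    (h : IsPointMeasure μ) (f : E → ℝ) : Integrable f μ := by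
  obtain ⟨s, rfl⟩ := h
  exact integrable_sum_dirac s f

lemma IsPointMeasure.restrict_eq_dirac {μ : Measure E} (h : IsPointMeasure μ) {A : Set E}
    (hA : MeasurableSet A) (h0 : μ A ≠ 0) (h1 : μ A ≤ 1) :
    ∃ q ∈ A, μ.restrict A = Measure.dirac q := by
  classical
  obtain ⟨s, rfl⟩ := h
  have hr := restrict_sum_dirac s hA
  have hu : ((s.map Measure.dirac).sum) A = (s.filter (· ∈ A)).card := by
    rw [← sum_dirac_univ, ← hr, Measure.restrict_apply_univ]
  rw [hu] at h0 h1
  have hc : (s.filter (· ∈ A)).card = 1 := by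
    have h0' : (s.filter (· ∈ A)).card ≠ 0 := by exact_mod_cast h0
    have h1' : (s.filter (· ∈ A)).card ≤ 1 := by exact_mod_cast h1
    omega
  obtain ⟨q, hq⟩ := Multiset.card_eq_one.1 hc
  refine ⟨q, ?_, by rw [hr, hq]; simp⟩
  have : q ∈ s.filter (· ∈ A) := by rw [hq]; simp
  exact (Multiset.mem_filter.1 this).2

end PointMeasure

/-! ### Independence of the noise on disjoint sets. -/

section Independence

variable {Ω : Type*} [MeasurableSpace Ω] {P : Measure Ω}

/-- Indexing the two restrictions of one player's noise by `Bool` lets all restrictions of all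
players form one doubly indexed family. -/
lemma IndepFun.iIndepFun_bool {β : Type*} [MeasurableSpace β] [IsProbabilityMeasure P]
    {f : Bool → Ω → β} (hf : IndepFun (f true) (f false) P) : iIndepFun f P := by
  rw [iIndepFun_iff_measure_inter_preimage_eq_mul]
  intro S s hs
  have hS : ∀ S : Finset Bool, S = ∅ ∨ S = {true} ∨ S = {false} ∨ S = Finset.univ := by decide
  rcases hS S with rfl | rfl | rfl | rfl
  · simp
  · simp
  · simp
  · have := hf.measure_inter_preimage_eq_mul (s true) (s false) (hs _ (by simp)) (hs _ (by simp))
    have e : ⋂ i, f i ⁻¹' s i = f true ⁻¹' s true ∩ f false ⁻¹' s false := by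
      ext ω; simp [and_comm]
    simpa [e] using this

/-- Both joint laws factor, and associativity of the product of measures regroups the factors. In
its use `f` is the vector of initial states, while `g` and `k` are the noise on two disjoint sets.
-/
lemma IndepFun.prodMk_assoc {α β γ : Type*} [MeasurableSpace α] [MeasurableSpace β]
    [MeasurableSpace γ] [IsProbabilityMeasure P] {f : Ω → α} {g : Ω → β} {k : Ω → γ}
    (hf : Measurable f) (hg : Measurable g) (hk : Measurable k)
    (h1 : IndepFun f (fun ω => (g ω, k ω)) P) (h2 : IndepFun g k P) :
    IndepFun (fun ω => (f ω, g ω)) k P := by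
  have : IsProbabilityMeasure (P.map f) := Measure.isProbabilityMeasure_map hf.aemeasurable
  have : IsProbabilityMeasure (P.map g) := Measure.isProbabilityMeasure_map hg.aemeasurable
  have : IsProbabilityMeasure (P.map k) := Measure.isProbabilityMeasure_map hk.aemeasurable
  have h3 : IndepFun f g P := h1.comp (φ := id) (ψ := Prod.fst) measurable_id measurable_fst
  rw [indepFun_iff_map_prod_eq_prod_map_map (hf.prodMk hg).aemeasurable hk.aemeasurable,
    (indepFun_iff_map_prod_eq_prod_map_map hf.aemeasurable hg.aemeasurable).1 h3]
  have e1 := (indepFun_iff_map_prod_eq_prod_map_map hf.aemeasurable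
    (hg.prodMk hk).aemeasurable).1 h1
  rw [(indepFun_iff_map_prod_eq_prod_map_map hg.aemeasurable hk.aemeasurable).1 h2] at e1
  have e2 : (fun ω => ((f ω, g ω), k ω)) =
    MeasurableEquiv.prodAssoc.symm ∘ fun ω => (f ω, (g ω, k ω)) := rfl
  rw [e2, ← Measure.map_map (MeasurableEquiv.measurable _) (hf.prodMk (hg.prodMk hk)), e1,
    ← Measure.prodAssoc_prod, MeasurableEquiv.map_symm_map]

/-- For i.i.d. noise, the initial states and the restrictions of the Poisson measures to `A` are
independent of their restrictions to a set disjoint from `A`. -/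
theorem IsNoise.indepFun_restrict {d N : ℕ} [IsProbabilityMeasure P] {T M : ℝ} {m₀ : Vec d}
    {Z : Fin N → Ω → Fin d} {Nm : Fin N → Ω → Measure (ℝ × (Fin d → ℝ))}
    (h : IsNoise P T M m₀ Z Nm) {A A' : Set (ℝ × (Fin d → ℝ))} (hA : MeasurableSet A)
    (hA' : MeasurableSet A') (hd : Disjoint A A') :
    IndepFun (fun ω => (fun i => Z i ω, fun i => (Nm i ω).restrict A))
      (fun ω i => (Nm i ω).restrict A') P := by
  classical
  have hmA : ∀ i, Measurable fun ω => (Nm i ω).restrict A := fun i =>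
    (measurable_restrict_measure hA).comp (h.poisson i).measurable
  have hmA' : ∀ i, Measurable fun ω => (Nm i ω).restrict A' := fun i =>
    (measurable_restrict_measure hA').comp (h.poisson i).measurable
  have hZ : Measurable fun ω i => Z i ω := measurable_pi_lambda _ h.measurable_init
  have hpair : Measurable fun (μ : Fin N → Measure (ℝ × (Fin d → ℝ))) =>
      (fun i => (μ i).restrict A, fun i => (μ i).restrict A') :=
    (measurable_pi_lambda _ fun i =>
      (measurable_restrict_measure hA).comp (measurable_pi_apply i)).prodMk
    (measurable_pi_lambda _ fun i =>
      (measurable_restrict_measure hA').comp (measurable_pi_apply i))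
  refine IndepFun.prodMk_assoc hZ (measurable_pi_lambda _ hmA) (measurable_pi_lambda _ hmA')
    (h.indep.comp measurable_id hpair) ?_
  -- `true` marks the restriction to `A`, `false` the one to `A'`. Independence within each player
  -- and across players makes the whole family independent, and it is then split along the Boolean
  -- index.
  let X : Fin N → Bool → Ω → Measure (ℝ × (Fin d → ℝ)) := fun i b ω =>
    (Nm i ω).restrict (if b then A else A')
  have hX : ∀ i b, Measurable (X i b) := by
    rintro i (_ | _)
    · simpa [X] using hmA' i
    · simpa [X] using hmA i
  have h1 : iIndepFun (fun i ω => (X i · ω)) P := by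
    refine h.indep_poisson.comp (g := fun _ μ (b : Bool) => μ.restrict (if b then A else A')) ?_
    intro i
    refine measurable_pi_lambda _ ?_
    rintro (_ | _)
    · simpa using measurable_restrict_measure hA'
    · simpa using measurable_restrict_measure hA
  have h2 : ∀ i, iIndepFun (X i) P := fun i => by
    refine IndepFun.iIndepFun_bool ?_
    simpa [X] using (h.poisson i).indepFun_restrict hA hA' hd
  have h3 := (iIndepFun_uncurry' hX h1 h2).indepFun_finset
    (Finset.univ.image fun i => (i, true)) (Finset.univ.image fun i => (i, false))
    (by rw [Finset.disjoint_left]; simp) (fun p => hX p.1 p.2)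
  have h4 := h3.comp
    (φ := fun (g : (Finset.univ.image fun i : Fin N => (i, true)) → Measure (ℝ × (Fin d → ℝ)))
      (i : Fin N) => g ⟨(i, true), by simp⟩)
    (ψ := fun (g : (Finset.univ.image fun i : Fin N => (i, false)) → Measure (ℝ × (Fin d → ℝ)))
      (i : Fin N) => g ⟨(i, false), by simp⟩)
    (measurable_pi_lambda _ fun i => measurable_pi_apply _)
    (measurable_pi_lambda _ fun i => measurable_pi_apply _)
  exact h4

end Independence

/-! ### Intensity of slabs and of acceptance regions. -/

section Intensity

lemma measurable_pi_single {d : ℕ} (j : Fin d) :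
    Measurable (fun u : ℝ => (Pi.single j u : Fin d → ℝ)) := by
  refine measurable_pi_lambda _ fun k => ?_
  by_cases h : k = j
  · subst h; simpa using measurable_id'
  · simp [h]

lemma markIntensity_univ (d : ℕ) (M : ℝ) : markIntensity d M univ = d * ENNReal.ofReal M := by
  rw [markIntensity, Measure.finsetSum_apply]
  have : ∀ j : Fin d, ((volume.restrict (Icc 0 M)).map
      (fun u : ℝ => (Pi.single j u : Fin d → ℝ))) univ = ENNReal.ofReal M := fun j => by
    rw [Measure.map_apply (measurable_pi_single j) MeasurableSet.univ]
    simp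
  simp [this]

instance isFiniteMeasure_markIntensity (d : ℕ) (M : ℝ) : IsFiniteMeasure (markIntensity d M) :=
  ⟨by rw [markIntensity_univ]; exact ENNReal.mul_lt_top (by simp) (by simp)⟩

lemma intensity_slab_real {d : ℕ} {T M a b : ℝ} (hM : 0 ≤ M) (ha : 0 ≤ a) (hab : a ≤ b)
    (hb : b ≤ T) : (intensity d T M).real (Ioc a b ×ˢ univ) = (b - a) * (d * M) := by
  rw [intensity, measureReal_prod_prod, measureReal_def, measureReal_def, markIntensity_univ,
    Measure.restrict_apply measurableSet_Ioc, inter_eq_left.2 (Ioc_subset_Icc_self.trans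
      (Icc_subset_Icc ha hb)), Real.volume_Ioc, ENNReal.toReal_ofReal (by linarith)]
  simp [hM]

/-- A mark on one of the coordinate axes. -/
def onAxis {d : ℕ} (ξ : Fin d → ℝ) : Prop := ∃ j, ∀ k, k ≠ j → ξ k = 0

lemma measurableSet_onAxis (d : ℕ) : MeasurableSet {ξ : Fin d → ℝ | onAxis ξ} := by
  have : {ξ : Fin d → ℝ | onAxis ξ} = ⋃ j, ⋂ k, ⋂ (_ : k ≠ j), {ξ | ξ k = 0} := by
    ext ξ; simp [onAxis]
  rw [this]
  exact MeasurableSet.iUnion fun j => MeasurableSet.iInter fun k => MeasurableSet.iInter fun _ =>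
    measurableSet_eq_fun (measurable_pi_apply k) measurable_const

lemma markIntensity_not_onAxis (d : ℕ) (M : ℝ) :
    markIntensity d M {ξ | onAxis ξ}ᶜ = 0 := by
  rw [markIntensity, Measure.finsetSum_apply]
  refine Finset.sum_eq_zero fun j _ => ?_
  rw [Measure.map_apply (measurable_pi_single j) (measurableSet_onAxis d).compl]
  have : (fun u : ℝ => (Pi.single j u : Fin d → ℝ)) ⁻¹' {ξ | onAxis ξ}ᶜ = ∅ := by
    ext u
    simp only [mem_preimage, mem_compl_iff, mem_ofPred_eq, mem_empty_iff_false, iff_false,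
      not_not]
    exact ⟨j, fun k hk => by simp [hk]⟩
  rw [this]; simp

lemma intensity_not_onAxis (d : ℕ) (T M : ℝ) :
    intensity d T M (univ ×ˢ {ξ | onAxis ξ}ᶜ) = 0 := by
  rw [intensity, Measure.prod_prod, markIntensity_not_onAxis, mul_zero]

/-- Only the `y`-th axis contributes: on every other axis the `y`-th coordinate is zero, which `h0`
excludes. -/
lemma markIntensity_coord {d : ℕ} {M : ℝ} (y : Fin d) {S : Set ℝ} (hS : MeasurableSet S)
    (h0 : S ⊆ Ioi 0) : markIntensity d M {ξ | ξ y ∈ S} = volume (S ∩ Icc 0 M) := by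
  have hm : MeasurableSet {ξ : Fin d → ℝ | ξ y ∈ S} := measurable_pi_apply y hS
  rw [markIntensity, Measure.finsetSum_apply, Finset.sum_eq_single y]
  · rw [Measure.map_apply (measurable_pi_single y) hm, ← Measure.restrict_apply hS]
    congr 1
    ext u; simp
  · intro j _ hj
    rw [Measure.map_apply (measurable_pi_single j) hm]
    have : (fun u : ℝ => (Pi.single j u : Fin d → ℝ)) ⁻¹' {ξ | ξ y ∈ S} = ∅ := by
      ext u
      simp only [mem_preimage, mem_ofPred_eq, Pi.single_eq_of_ne hj.symm, mem_empty_iff_false,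
        iff_false]
      exact fun h => lt_irrefl (0 : ℝ) (h0 h)
    rw [this]; simp
  · simp

/-- The set of points of `]a,b] × Ξ` whose `y`-th mark coordinate is accepted at the rate `g`. -/
def region {d : ℕ} (a b : ℝ) (g : ℝ → ℝ) (y : Fin d) : Set (ℝ × (Fin d → ℝ)) :=
  {q | q.1 ∈ Ioc a b ∧ q.2 y ∈ Ioo 0 (g q.1)}

lemma region_subset {d : ℕ} (a b : ℝ) (g : ℝ → ℝ) (y : Fin d) :
    region a b g y ⊆ Ioc a b ×ˢ univ := fun _ hq => ⟨hq.1, mem_univ _⟩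

lemma measurableSet_region {d : ℕ} (a b : ℝ) {g : ℝ → ℝ} (hg : Measurable g) (y : Fin d) :
    MeasurableSet (region a b g y) := by
  have hy : Measurable fun q : ℝ × (Fin d → ℝ) => q.2 y :=
    (measurable_pi_apply y).comp measurable_snd
  exact (measurable_fst measurableSet_Ioc).inter
    ((measurableSet_lt measurable_const hy).inter
      (measurableSet_lt hy (hg.comp measurable_fst)))

/-- Thinning: the slice at time `r` is an interval of length `g r` on the `y`-th axis. The bound by
`M` keeps it inside the mark space. -/
lemma intensity_region {d : ℕ} {T M a b : ℝ} (ha : 0 ≤ a) (hab : a ≤ b)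
    (hb : b ≤ T) {g : ℝ → ℝ} (hg : Continuous g) (h0 : ∀ r, 0 ≤ g r) (hM : ∀ r, g r ≤ M)
    (y : Fin d) : (intensity d T M).real (region a b g y) = ∫ r in a..b, g r := by
  have hsec : ∀ r, markIntensity d M (Prod.mk r ⁻¹' region a b g y) =
      (Ioc a b).indicator (fun r => ENNReal.ofReal (g r)) r := by
    intro r
    by_cases hr : r ∈ Ioc a b
    · have e : Prod.mk r ⁻¹' region a b g y = {ξ : Fin d → ℝ | ξ y ∈ Ioo 0 (g r)} := by
        ext ξ; simp only [region, mem_preimage, mem_ofPred_eq, hr, true_and]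
      rw [e, markIntensity_coord y measurableSet_Ioo (fun u hu => hu.1), indicator_of_mem hr,
        inter_eq_left.2 (Ioo_subset_Icc_self.trans (Icc_subset_Icc_right (hM r))),
        Real.volume_Ioo, sub_zero]
    · have e : Prod.mk r ⁻¹' region a b g y = (∅ : Set (Fin d → ℝ)) := by
        ext ξ
        simp only [region, mem_preimage, mem_ofPred_eq, hr, false_and, mem_empty_iff_false]
      rw [e, indicator_of_notMem hr, measure_empty]
  rw [measureReal_def, intensity, Measure.prod_apply (measurableSet_region a b hg.measurable y)]
  simp_rw [hsec]
  rw [lintegral_indicator measurableSet_Ioc, Measure.restrict_restrict measurableSet_Ioc,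
    inter_eq_left.2 (Ioc_subset_Icc_self.trans (Icc_subset_Icc ha hb)),
    intervalIntegral.integral_of_le hab, integral_eq_lintegral_of_nonneg_ae
      (ae_of_all _ h0) hg.aestronglyMeasurable]

lemma intensity_symmDiff_region_le {d : ℕ} {T M a b : ℝ} (ha : 0 ≤ a) (hab : a ≤ b)
    (hb : b ≤ T) {g g' : ℝ → ℝ} (hg : Continuous g) (hg' : Continuous g')
    (y : Fin d) : (intensity d T M).real (symmDiff (region a b g y) (region a b g' y)) ≤
      ∫ r in a..b, |g r - g' r| := by
  have hsec : ∀ r, markIntensity d M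
      (Prod.mk r ⁻¹' symmDiff (region a b g y) (region a b g' y)) ≤
      (Ioc a b).indicator (fun r => ENNReal.ofReal |g r - g' r|) r := by
    intro r
    by_cases hr : r ∈ Ioc a b
    · have e : Prod.mk r ⁻¹' symmDiff (region a b g y) (region a b g' y) =
          {ξ : Fin d → ℝ | ξ y ∈ symmDiff (Ioo 0 (g r)) (Ioo 0 (g' r))} := by
        ext ξ; simp only [region, mem_preimage, Set.mem_symmDiff, mem_ofPred_eq, hr, true_and]
      -- A mark accepted by exactly one of the two rates lies between them.
      have hs : symmDiff (Ioo 0 (g r)) (Ioo 0 (g' r)) ⊆ Ico (min (g r) (g' r))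
          (max (g r) (g' r)) := by
        rintro u (⟨h1, h2⟩ | ⟨h1, h2⟩)
        · have : g' r ≤ u := by
            by_contra! h; exact h2 ⟨h1.1, h⟩
          exact ⟨(min_le_right _ _).trans this, h1.2.trans_le (le_max_left _ _)⟩
        · have : g r ≤ u := by
            by_contra! h; exact h2 ⟨h1.1, h⟩
          exact ⟨(min_le_left _ _).trans this, h1.2.trans_le (le_max_right _ _)⟩
      rw [e, markIntensity_coord y (measurableSet_Ioo.symmDiff measurableSet_Ioo),
        indicator_of_mem hr]
      · refine (measure_mono (inter_subset_left.trans hs)).trans ?_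
        rw [Real.volume_Ico, max_sub_min_eq_abs']
      · rintro u (⟨h1, -⟩ | ⟨h1, -⟩) <;> exact h1.1
    · have e : Prod.mk r ⁻¹' symmDiff (region a b g y) (region a b g' y) =
          (∅ : Set (Fin d → ℝ)) := by
        ext ξ
        simp only [region, mem_preimage, Set.mem_symmDiff, mem_ofPred_eq, hr, false_and,
          mem_empty_iff_false, or_false]
      rw [e, measure_empty]
      exact zero_le
  have hc : Continuous fun r => |g r - g' r| := (hg.sub hg').abs
  rw [measureReal_def, intensity, Measure.prod_apply
    ((measurableSet_region a b hg.measurable y).symmDiff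
      (measurableSet_region a b hg'.measurable y)),
    intervalIntegral.integral_of_le hab, integral_eq_lintegral_of_nonneg_ae
      (ae_of_all _ fun r => abs_nonneg _) hc.aestronglyMeasurable]
  refine ENNReal.toReal_mono ?_ ((lintegral_mono hsec).trans_eq ?_)
  · exact (hc.integrableOn_Ioc (μ := volume)).lintegral_lt_top.ne
  · rw [lintegral_indicator measurableSet_Ioc, Measure.restrict_restrict measurableSet_Ioc,
      inter_eq_left.2 (Ioc_subset_Icc_self.trans (Icc_subset_Icc ha hb))]

end Intensity

/-- A feedback which is continuous in time, with rates in `[0,M]`. -/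
structure IsRegularFeedback {d N : ℕ} (M : ℝ) (β : Fin N → ℝ → (Fin N → Fin d) → Vec d) :
    Prop where
  continuous : ∀ i x y, Continuous fun t => β i t x y
  nonneg : ∀ i t x y, 0 ≤ β i t x y
  le : ∀ i t x y, β i t x y ≤ M

/-! ### Paths across an interval with at most one point of noise. -/

section Path

variable {d N : ℕ}

/-- The time slab `]a,b] × Ξ`. -/
def slab (d : ℕ) (a b : ℝ) : Set (ℝ × (Fin d → ℝ)) := Ioc a b ×ˢ univ

lemma measurableSet_slab (d : ℕ) (a b : ℝ) : MeasurableSet (slab d a b) :=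
  measurableSet_Ioc.prod MeasurableSet.univ

lemma region_subset_slab (a b : ℝ) (g : ℝ → ℝ) (y : Fin d) : region a b g y ⊆ slab d a b :=
  region_subset a b g y

lemma slab_mono {a a' b b' : ℝ} (ha : a' ≤ a) (hb : b ≤ b') : slab d a b ⊆ slab d a' b' :=
  prod_mono (Ioc_subset_Ioc ha hb) le_rfl

/-- There is at most one point of all the measures together in the slab `]a,b] × Ξ`. -/
def IsSparse (μ : Fin N → Measure (ℝ × (Fin d → ℝ))) (a b : ℝ) : Prop :=
  (∀ i, μ i (slab d a b) ≤ 1) ∧ ∀ i j, i ≠ j → μ i (slab d a b) = 0 ∨ μ j (slab d a b) = 0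

lemma IsSparse.mono {μ : Fin N → Measure (ℝ × (Fin d → ℝ))} {a a' b b' : ℝ}
    (h : IsSparse μ a' b') (ha : a' ≤ a) (hb : b ≤ b') : IsSparse μ a b :=
  ⟨fun i => (measure_mono (slab_mono ha hb)).trans (h.1 i), fun i j hij =>
    (h.2 i j hij).imp (fun h0 => measure_mono_null (slab_mono ha hb) h0)
      (fun h0 => measure_mono_null (slab_mono ha hb) h0)⟩

/-- In state `x`, the noise on `]a,b]` makes player `i` jump to `y`. -/
def IsHit (β : Fin N → ℝ → (Fin N → Fin d) → Vec d) (a b : ℝ)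
    (μ : Fin N → Measure (ℝ × (Fin d → ℝ))) (x : Fin N → Fin d) (i : Fin N) (y : Fin d) : Prop :=
  μ i (region a b (fun r => β i r x y) y) ≠ 0

open Classical in
/-- The state at time `b` of the system started at time `a` in `x`, when there is at most one point
of noise in the time interval `]a,b]`. -/
noncomputable def step (β : Fin N → ℝ → (Fin N → Fin d) → Vec d) (a b : ℝ)
    (μ : Fin N → Measure (ℝ × (Fin d → ℝ))) (x : Fin N → Fin d) : Fin N → Fin d := fun i =>
  if h : ∃ y, IsHit β a b μ x i y then h.choose else x i

/-- The path `X` solves the equation driven by the point measures `μ`. -/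
structure IsPath (T : ℝ) (z : Fin N → Fin d) (μ : Fin N → Measure (ℝ × (Fin d → ℝ)))
    (β : Fin N → ℝ → (Fin N → Fin d) → Vec d) (X : Fin N → ℝ → Fin d) : Prop where
  point : ∀ i, IsPointMeasure (μ i)
  axis : ∀ i, μ i (univ ×ˢ {ξ | onAxis ξ}ᶜ) = 0
  eqn : ∀ i, ∀ t ∈ Icc 0 T, ((X i t : ℕ) : ℝ) = ((z i : ℕ) : ℝ) + ∫ q in Ioc 0 t ×ˢ univ,
      jump (Function.leftLim (X i) q.1) q.2
        (β i q.1 (fun j => Function.leftLim (X j) q.1)) ∂(μ i)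

namespace IsPath

variable {T : ℝ} {z : Fin N → Fin d} {μ : Fin N → Measure (ℝ × (Fin d → ℝ))}
  {β : Fin N → ℝ → (Fin N → Fin d) → Vec d} {X : Fin N → ℝ → Fin d}

lemma zero (h : IsPath T z μ β X) (hT : 0 ≤ T) (i : Fin N) : X i 0 = z i := by
  have := h.eqn i 0 ⟨le_rfl, hT⟩
  simp only [Ioc_self, empty_prod, Measure.restrict_empty, integral_zero_measure, add_zero,
    Nat.cast_inj] at this
  exact Fin.ext this

lemma increment (h : IsPath T z μ β X) {a b : ℝ} (ha : 0 ≤ a) (hab : a ≤ b) (hb : b ≤ T)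
    (i : Fin N) : ((X i b : ℕ) : ℝ) = ((X i a : ℕ) : ℝ) + ∫ q in slab d a b,
      jump (Function.leftLim (X i) q.1) q.2
        (β i q.1 (fun j => Function.leftLim (X j) q.1)) ∂(μ i) := by
  rw [h.eqn i b ⟨ha.trans hab, hb⟩, h.eqn i a ⟨ha, hab.trans hb⟩]
  have e : (Ioc 0 b ×ˢ univ : Set (ℝ × (Fin d → ℝ))) = Ioc 0 a ×ˢ univ ∪ slab d a b := by
    rw [slab, ← union_prod, Ioc_union_Ioc_eq_Ioc ha hab]
  rw [e, setIntegral_union, add_assoc]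
  · rw [Set.disjoint_left]
    rintro q ⟨⟨-, h1⟩, -⟩ ⟨⟨h2, -⟩, -⟩
    exact absurd h1 (not_le.2 h2)
  · exact measurableSet_slab d a b
  · exact ((h.point i).integrable _).integrableOn
  · exact ((h.point i).integrable _).integrableOn

lemma eq_of_slab_eq_zero (h : IsPath T z μ β X) {a b : ℝ} (ha : 0 ≤ a) (hab : a ≤ b) (hb : b ≤ T)
    {i : Fin N} (h0 : μ i (slab d a b) = 0) : X i b = X i a := by
  have := h.increment ha hab hb i
  rw [Measure.restrict_eq_zero.2 h0, integral_zero_measure, add_zero, Nat.cast_inj] at this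
  exact Fin.ext this

/-- Without noise strictly before `r`, the path is constant on `]a, r[`. -/
lemma leftLim_eq (h : IsPath T z μ β X) {a r : ℝ} (ha : 0 ≤ a) (har : a < r) (hr : r ≤ T)
    {i : Fin N} (h0 : ∀ s ∈ Ioo a r, μ i (slab d a s) = 0) :
    Function.leftLim (X i) r = X i a := by
  refine leftLim_eq_of_tendsto (tendsto_nhds_of_eventually_eq ?_)
  filter_upwards [Ioo_mem_nhdsLT har] with s hs
  exact h.eq_of_slab_eq_zero ha hs.1.le (hs.2.le.trans hr) (h0 s hs)

lemma jump_of_onAxis {x j : Fin d} {ξ : Fin d → ℝ} {a : Vec d} (hj : ∀ k, k ≠ j → ξ k = 0) :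
    jump x ξ a = (((j : ℕ) : ℝ) - ((x : ℕ) : ℝ)) *
      (Ioo 0 (a j)).indicator (fun _ => 1) (ξ j) := by
  rw [jump, Finset.sum_eq_single j]
  · intro k _ hk
    rw [hj k hk, indicator_of_notMem (by simp), mul_zero]
  · simp

/-- When there is at most one point of noise, the state of the system is given by `step`. -/
theorem eq_step (h : IsPath T z μ β X) {a b : ℝ} (ha : 0 ≤ a) (hab : a ≤ b) (hb : b ≤ T)
    (hs : IsSparse μ a b) : (fun i => X i b) = step β a b μ (fun i => X i a) := by
  funext i
  by_cases h0 : μ i (slab d a b) = 0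
  · have hn : ¬ ∃ y, IsHit β a b μ (fun i => X i a) i y := by
      rintro ⟨y, hy⟩
      exact hy (measure_mono_null (region_subset a b _ y) h0)
    rw [step, dif_neg hn, h.eq_of_slab_eq_zero ha hab hb h0]
  obtain ⟨⟨r, ξ⟩, hq, hr⟩ := (h.point i).restrict_eq_dirac (measurableSet_slab d a b) h0 (hs.1 i)
  have hrab : r ∈ Ioc a b := hq.1
  have hax : onAxis ξ := by
    by_contra hna
    have : (μ i).restrict (slab d a b) (univ ×ˢ {ξ | onAxis ξ}ᶜ) = 0 :=
      le_antisymm ((Measure.restrict_apply_le _ _).trans (h.axis i).le) zero_le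
    rw [hr, Measure.dirac_apply' _ (MeasurableSet.univ.prod (measurableSet_onAxis d).compl),
      indicator_of_mem (by exact ⟨mem_univ _, hna⟩)] at this
    simp at this
  obtain ⟨j, hj⟩ := hax
  -- Just before the point all players still occupy their sites at time `a`: player `i` has no
  -- earlier point, and by sparsity the others have none at all.
  have hlim : ∀ k, Function.leftLim (X k) r = X k a := by
    intro k
    refine h.leftLim_eq ha hrab.1 (hrab.2.trans hb) fun s hsr => ?_
    by_cases hk : k = i
    · subst hk
      have : (μ k) (slab d a s) = (μ k).restrict (slab d a b) (slab d a s) := by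
        rw [Measure.restrict_apply' (measurableSet_slab d a b),
          inter_eq_left.2 (slab_mono le_rfl (hsr.2.le.trans hrab.2))]
      rw [this, hr, Measure.dirac_apply' _ (measurableSet_slab d a s), indicator_of_notMem]
      rintro ⟨h1, -⟩
      exact absurd h1.2 (not_le.2 hsr.2)
    · exact measure_mono_null (slab_mono le_rfl (hsr.2.le.trans hrab.2))
        ((hs.2 k i hk).resolve_right h0)
  have hhit : ∀ y, IsHit β a b μ (fun i => X i a) i y ↔
      ξ y ∈ Ioo 0 (β i r (fun i => X i a) y) := by
    intro y
    have e : μ i (region a b (fun r => β i r (fun i => X i a) y) y) =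
        (μ i).restrict (slab d a b) (region a b (fun r => β i r (fun i => X i a) y) y) := by
      rw [Measure.restrict_apply' (measurableSet_slab d a b),
        inter_eq_left.2 (region_subset_slab a b _ y)]
    rw [IsHit, e, hr]
    by_cases hm : (r, ξ) ∈ region a b (fun r => β i r (fun i => X i a) y) y
    · rw [Measure.dirac_apply_of_mem hm]
      simpa using hm.2
    · rw [Measure.dirac_apply, indicator_of_notMem hm]
      simp only [ne_eq, not_true_eq_false, false_iff]
      exact fun h' => hm ⟨hrab, h'⟩
  have hinc := h.increment ha hab hb i
  rw [hr, integral_dirac, hlim i, jump_of_onAxis hj] at hinc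
  simp only [hlim] at hinc
  by_cases hacc : ξ j ∈ Ioo 0 (β i r (fun i => X i a) j)
  · have hex : ∃ y, IsHit β a b μ (fun i => X i a) i y := ⟨j, (hhit j).2 hacc⟩
    -- The open interval `]0, a_y[` excludes zero coordinates, so a point on the `j`-th axis can be
    -- accepted only for the target `j`, and the choice made in `step` is forced.
    have hch : hex.choose = j := by
      by_contra hne
      have := (hhit _).1 hex.choose_spec
      rw [hj _ hne] at this
      exact lt_irrefl _ this.1
    rw [step, dif_pos hex, hch]
    rw [indicator_of_mem hacc, mul_one, add_sub_cancel, Nat.cast_inj] at hinc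
    exact Fin.ext hinc
  · have hn : ¬ ∃ y, IsHit β a b μ (fun i => X i a) i y := by
      rintro ⟨y, hy⟩
      have hy' := (hhit y).1 hy
      by_cases hyj : y = j
      · subst hyj; exact hacc hy'
      · rw [hj y hyj] at hy'
        exact lt_irrefl _ hy'.1
    rw [step, dif_neg hn]
    rw [indicator_of_notMem hacc, mul_zero, add_zero, Nat.cast_inj] at hinc
    exact Fin.ext hinc

end IsPath

end Path

/-! ### Grid approximation by measurable functionals of the noise. -/

section Measurability

variable {d N : ℕ} {M : ℝ} {β : Fin N → ℝ → (Fin N → Fin d) → Vec d}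

/-- The state takes finitely many values, and the measures enter only through finitely many events,
namely which acceptance regions are charged. -/
lemma measurable_step (hβ : IsRegularFeedback M β) (a b : ℝ) :
    Measurable fun p : (Fin N → Fin d) × (Fin N → Measure (ℝ × (Fin d → ℝ))) =>
      step β a b p.2 p.1 := by
  classical
  refine measurable_from_prod_countable_right fun x => ?_
  have h1 : Measurable fun (μ : Fin N → Measure (ℝ × (Fin d → ℝ))) (i : Fin N) (y : Fin d) =>
      IsHit β a b μ x i y := by
    refine measurable_pi_lambda _ fun i => measurable_pi_lambda _ fun y => ?_
    rw [← measurableSet_setOfPred]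
    have : Measurable fun μ : Fin N → Measure (ℝ × (Fin d → ℝ)) =>
        μ i (region a b (fun r => β i r x y) y) :=
      (Measure.measurable_coe (measurableSet_region a b
        (hβ.continuous i x y).measurable y)).comp (measurable_pi_apply i)
    exact (this (measurableSet_singleton 0)).compl
  have h2 : Measurable fun (g : Fin N → Fin d → Prop) (i : Fin N) =>
      if h : ∃ y, g i y then h.choose else x i := Measurable.of_discrete
  exact h2.comp h1

lemma isHit_restrict {a b s : ℝ} (hb : b ≤ s) (μ : Fin N → Measure (ℝ × (Fin d → ℝ)))
    (x : Fin N → Fin d) :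
    IsHit β a b (fun i => (μ i).restrict (Iic s ×ˢ univ)) x = IsHit β a b μ x := by
  funext i y
  rw [IsHit, IsHit, Measure.restrict_apply' (measurableSet_Iic.prod MeasurableSet.univ),
    inter_eq_left.2]
  exact fun q hq => ⟨hq.1.2.trans hb, mem_univ _⟩

lemma isHit_restrict_Ioi {a b s : ℝ} (ha : s ≤ a) (μ : Fin N → Measure (ℝ × (Fin d → ℝ)))
    (x : Fin N → Fin d) :
    IsHit β a b (fun i => (μ i).restrict (Ioi s ×ˢ univ)) x = IsHit β a b μ x := by
  funext i y
  rw [IsHit, IsHit, Measure.restrict_apply' (measurableSet_Ioi.prod MeasurableSet.univ),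
    inter_eq_left.2]
  exact fun q hq => ⟨ha.trans_lt hq.1.1, mem_univ _⟩

lemma step_congr {a b : ℝ} {μ μ' : Fin N → Measure (ℝ × (Fin d → ℝ))} {x : Fin N → Fin d}
    (h : IsHit β a b μ x = IsHit β a b μ' x) : step β a b μ x = step β a b μ' x := by
  unfold step
  rw [h]

/-- The state at time `s` of the system started from `z`, computed by `step` on a grid of `n`
intervals, up to the `k`-th. -/
noncomputable def gridState (β : Fin N → ℝ → (Fin N → Fin d) → Vec d) (s : ℝ) (n : ℕ)
    (z : Fin N → Fin d) (μ : Fin N → Measure (ℝ × (Fin d → ℝ))) : ℕ → (Fin N → Fin d)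
  | 0 => z
  | k + 1 => step β (s * (k / n)) (s * ((k + 1 : ℕ) / n)) μ (gridState β s n z μ k)

lemma measurable_gridState (hβ : IsRegularFeedback M β) (s : ℝ) (n k : ℕ) :
    Measurable fun p : (Fin N → Fin d) × (Fin N → Measure (ℝ × (Fin d → ℝ))) =>
      gridState β s n p.1 p.2 k := by
  induction k with
  | zero => exact measurable_fst
  | succ k ih => exact (measurable_step hβ _ _).comp (ih.prodMk measurable_snd)

/-- All intervals of the grid lie in `[0, s]`. This is the source of adaptedness. -/
lemma gridState_restrict {s : ℝ} (hs : 0 ≤ s) {n : ℕ} (z : Fin N → Fin d)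
    (μ : Fin N → Measure (ℝ × (Fin d → ℝ))) {k : ℕ} (hk : k ≤ n) :
    gridState β s n z (fun i => (μ i).restrict (Iic s ×ˢ univ)) k = gridState β s n z μ k := by
  induction k with
  | zero => rfl
  | succ k ih =>
    rw [gridState, gridState, ih (by omega)]
    refine step_congr (isHit_restrict ?_ _ _)
    refine mul_le_of_le_one_right hs (div_le_one_of_le₀ ?_ (by positivity))
    exact_mod_cast hk

lemma IsPath.eq_gridState {T : ℝ} {z : Fin N → Fin d} {μ : Fin N → Measure (ℝ × (Fin d → ℝ))}
    {X : Fin N → ℝ → Fin d} (h : IsPath T z μ β X) {s : ℝ} (hs : s ∈ Icc 0 T) {n : ℕ}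
    (hsp : ∀ k < n, IsSparse μ (s * (k / n)) (s * ((k + 1 : ℕ) / n))) {k : ℕ} (hk : k ≤ n) :
    (fun i => X i (s * (k / n))) = gridState β s n z μ k := by
  induction k with
  | zero =>
    funext i
    simpa [gridState] using h.zero (hs.1.trans hs.2) i
  | succ k ih =>
    have hn : (0 : ℝ) < n := by
      have : 0 < n := by omega
      exact_mod_cast this
    rw [gridState, ← ih (by omega)]
    refine h.eq_step (by have := hs.1; positivity) ?_ ?_ (hsp k (by omega))
    · have := hs.1
      gcongr
      simp
    · refine (mul_le_of_le_one_right hs.1 (div_le_one_of_le₀ ?_ hn.le)).trans hs.2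
      exact_mod_cast hk

/-- The limit of a sequence of measurable maps to a countable discrete space, and a
given map where the sequence is not eventually constant, is measurable. -/
lemma exists_measurable_limit {α S : Type*} [MeasurableSpace α] [MeasurableSpace S] [Countable S]
    [MeasurableSingletonClass S] {f : ℕ → α → S} {g : α → S} (hf : ∀ n, Measurable (f n))
    (hg : Measurable g) :
    ∃ F : α → S, Measurable F ∧ ∀ v x, (∀ᶠ n in atTop, f n v = x) → F v = x := by
  classical
  have hE : ∀ x, MeasurableSet {v | ∀ᶠ n in atTop, f n v = x} := by
    intro x
    have : {v | ∀ᶠ n in atTop, f n v = x} = ⋃ n, ⋂ m, ⋂ (_ : n ≤ m), f m ⁻¹' {x} := by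
      ext v; simp [eventually_atTop]
    rw [this]
    exact MeasurableSet.iUnion fun n => MeasurableSet.iInter fun m => MeasurableSet.iInter fun _ =>
      hf m (measurableSet_singleton x)
  have huniq : ∀ v x y, (∀ᶠ n in atTop, f n v = x) → (∀ᶠ n in atTop, f n v = y) → x = y := by
    intro v x y hx hy
    obtain ⟨n, hn⟩ := (hx.and hy).exists
    exact hn.1.symm.trans hn.2
  let F : α → S := fun v => if h : ∃ x, ∀ᶠ n in atTop, f n v = x then h.choose else g v
  have hF : ∀ v x, (∀ᶠ n in atTop, f n v = x) → F v = x := by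
    intro v x hx
    have h : ∃ x, ∀ᶠ n in atTop, f n v = x := ⟨x, hx⟩
    simp only [F, dif_pos h]
    exact huniq v _ _ h.choose_spec hx
  refine ⟨F, measurable_to_countable' fun x => ?_, hF⟩
  have : F ⁻¹' {x} = {v | ∀ᶠ n in atTop, f n v = x} ∪
      ((⋃ y, {v | ∀ᶠ n in atTop, f n v = y})ᶜ ∩ g ⁻¹' {x}) := by
    ext v
    simp only [mem_preimage, mem_singleton_iff, mem_union, mem_ofPred_eq, mem_inter_iff,
      mem_compl_iff, mem_iUnion]
    by_cases h : ∃ y, ∀ᶠ n in atTop, f n v = y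
    · obtain ⟨y, hy⟩ := h
      rw [hF v y hy]
      constructor
      · rintro rfl; exact Or.inl hy
      · rintro (h1 | h1)
        · exact huniq v _ _ hy h1
        · exact absurd ⟨y, hy⟩ h1.1
    · have : F v = g v := by simp only [F, dif_neg h]
      rw [this]
      constructor
      · intro h1; exact Or.inr ⟨h, h1⟩
      · rintro (h1 | h1)
        · exact absurd ⟨x, h1⟩ h
        · exact h1.2
  rw [this]
  exact (hE x).union ((MeasurableSet.iUnion hE).compl.inter (hg (measurableSet_singleton x)))

end Measurability

/-! ### Rarity of two points in a short interval. -/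

section Noise

variable {d N : ℕ} {Ω : Type*} [MeasurableSpace Ω] {P : Measure Ω} [IsProbabilityMeasure P]
  {T M : ℝ} {m₀ : Vec d} {Z : Fin N → Ω → Fin d} {Nm : Fin N → Ω → Measure (ℝ × (Fin d → ℝ))}

/-- The probability of at least two points in a short time interval is of second order. -/
theorem IsNoise.real_not_isSparse_le (h : IsNoise P T M m₀ Z Nm) (hM : 0 ≤ M) {a b : ℝ}
    (ha : 0 ≤ a) (hab : a ≤ b) (hb : b ≤ T) :
    P.real {ω | ¬ IsSparse (fun i => Nm i ω) a b} ≤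
      (N + (N : ℝ) ^ 2) * (d * M) ^ 2 * (b - a) ^ 2 := by
  classical
  have hs := measurableSet_slab d a b
  have hI : (intensity d T M).real (slab d a b) = (b - a) * (d * M) :=
    intensity_slab_real hM ha hab hb
  -- Sparsity fails when one player has at least two points or two players have at least one each.
  -- Both kinds of event are of second order, the latter by independence of the players.
  have hsub : {ω | ¬ IsSparse (fun i => Nm i ω) a b} ⊆
      (⋃ i, {ω | ¬ Nm i ω (slab d a b) ≤ 1}) ∪
        ⋃ p : {p : Fin N × Fin N // p.1 ≠ p.2},
          ({ω | Nm p.1.1 ω (slab d a b) ≠ 0} ∩ {ω | Nm p.1.2 ω (slab d a b) ≠ 0}) := by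
    intro ω hω
    simp only [mem_ofPred_eq, IsSparse, not_and_or, not_forall] at hω
    rcases hω with ⟨i, hi⟩ | ⟨i, j, hij, h1⟩
    · exact Or.inl (mem_iUnion.2 ⟨i, hi⟩)
    · rw [not_or] at h1
      exact Or.inr (mem_iUnion.2 ⟨⟨(i, j), hij⟩, h1⟩)
  have hpair : ∀ p : {p : Fin N × Fin N // p.1 ≠ p.2},
      P.real ({ω | Nm p.1.1 ω (slab d a b) ≠ 0} ∩ {ω | Nm p.1.2 ω (slab d a b) ≠ 0}) ≤
        ((b - a) * (d * M)) ^ 2 := by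
    rintro ⟨⟨i, j⟩, hij⟩
    have hind := (h.indep_poisson.indepFun hij).comp (Measure.measurable_coe hs)
      (Measure.measurable_coe hs)
    have := hind.measure_inter_preimage_eq_mul {0}ᶜ {0}ᶜ (measurableSet_singleton _).compl
      (measurableSet_singleton _).compl
    have e : P.real ({ω | Nm i ω (slab d a b) ≠ 0} ∩ {ω | Nm j ω (slab d a b) ≠ 0}) =
        P.real {ω | Nm i ω (slab d a b) ≠ 0} * P.real {ω | Nm j ω (slab d a b) ≠ 0} := by
      rw [measureReal_def, measureReal_def, measureReal_def, ← ENNReal.toReal_mul]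
      exact congrArg ENNReal.toReal this
    simp only [e]
    rw [sq, ← hI]
    exact mul_le_mul ((h.poisson i).real_ne_zero_le hs) ((h.poisson j).real_ne_zero_le hs)
      measureReal_nonneg measureReal_nonneg
  have hone : ∀ i, P.real {ω | ¬ Nm i ω (slab d a b) ≤ 1} ≤ ((b - a) * (d * M)) ^ 2 := fun i => by
    rw [← hI]
    exact (h.poisson i).real_not_le_one hs
  have hcard : (Fintype.card {p : Fin N × Fin N // p.1 ≠ p.2} : ℝ) ≤ (N : ℝ) ^ 2 := by
    have := Fintype.card_subtype_le (fun p : Fin N × Fin N => p.1 ≠ p.2)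
    rw [Fintype.card_prod, Fintype.card_fin] at this
    calc (Fintype.card {p : Fin N × Fin N // p.1 ≠ p.2} : ℝ) ≤ ((N * N : ℕ) : ℝ) := by
          exact_mod_cast this
      _ = (N : ℝ) ^ 2 := by push_cast; ring
  calc P.real {ω | ¬ IsSparse (fun i => Nm i ω) a b}
      ≤ _ := measureReal_mono hsub
    _ ≤ _ := measureReal_union_le _ _
    _ ≤ ∑ i : Fin N, ((b - a) * (d * M)) ^ 2 +
        ∑ p : {p : Fin N × Fin N // p.1 ≠ p.2}, ((b - a) * (d * M)) ^ 2 :=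
      add_le_add ((measureReal_iUnion_fintype_le _).trans (Finset.sum_le_sum fun i _ => hone i))
        ((measureReal_iUnion_fintype_le _).trans (Finset.sum_le_sum fun p _ => hpair p))
    _ = (N + Fintype.card {p : Fin N × Fin N // p.1 ≠ p.2}) * (d * M) ^ 2 * (b - a) ^ 2 := by
      simp only [Finset.sum_const, Finset.card_univ, Fintype.card_fin, nsmul_eq_mul]
      ring
    _ ≤ _ := by gcongr

lemma IsNoise.ae_isPath (h : IsNoise P T M m₀ Z Nm)
    {β : Fin N → ℝ → (Fin N → Fin d) → Vec d} {X : Fin N → ℝ → Ω → Fin d}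
    (hX : SolvesSDE P T Z Nm β X) :
    ∀ᵐ ω ∂P, IsPath T (fun i => Z i ω) (fun i => Nm i ω) β (fun i t => X i t ω) := by
  have h1 : ∀ᵐ ω ∂P, ∀ i, IsPointMeasure (Nm i ω) :=
    ae_all_iff.2 fun i => (h.poisson i).point_measure
  have h2 : ∀ᵐ ω ∂P, ∀ i, Nm i ω (univ ×ˢ {ξ | onAxis ξ}ᶜ) = 0 := ae_all_iff.2 fun i =>
    (h.poisson i).ae_eq_zero (MeasurableSet.univ.prod (measurableSet_onAxis d).compl)
      (intensity_not_onAxis d T M)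
  filter_upwards [h1, h2, hX.eqn] with ω h1 h2 h3
  exact ⟨h1, h2, h3⟩

end Noise

/-- The state at time `s` of a solution is a fixed measurable function of the initial states and
of the noise up to time `s`. -/
theorem exists_adapted_functional {d N : ℕ} {T M : ℝ} (hM : 0 ≤ M)
    {β : Fin N → ℝ → (Fin N → Fin d) → Vec d} (hβ : IsRegularFeedback M β) {s : ℝ}
    (hs : s ∈ Icc 0 T) :
    ∃ Φ : (Fin N → Fin d) × (Fin N → Measure (ℝ × (Fin d → ℝ))) → (Fin N → Fin d),
      Measurable Φ ∧ ∀ {Ω : Type*} [MeasurableSpace Ω] (P : Measure Ω) [IsProbabilityMeasure P]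
        (m₀ : Vec d) (Z : Fin N → Ω → Fin d) (Nm : Fin N → Ω → Measure (ℝ × (Fin d → ℝ)))
        (X : Fin N → ℝ → Ω → Fin d), IsNoise P T M m₀ Z Nm → SolvesSDE P T Z Nm β X →
        ∀ᵐ ω ∂P, (fun i => X i s ω) =
          Φ (fun i => Z i ω, fun i => (Nm i ω).restrict (Iic s ×ˢ univ)) := by
  -- The functional is the eventual value of the computation on dyadic grids, with the initial state
  -- as default where no eventual value exists.
  obtain ⟨Φ, hΦ, hlim⟩ := exists_measurable_limit
    (f := fun n (p : (Fin N → Fin d) × (Fin N → Measure (ℝ × (Fin d → ℝ)))) =>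
      gridState β s (2 ^ n) p.1 p.2 (2 ^ n)) (g := Prod.fst)
    (fun n => measurable_gridState hβ s (2 ^ n) (2 ^ n)) measurable_fst
  refine ⟨Φ, hΦ, ?_⟩
  intro Ω _ P _ m₀ Z Nm X hN hX
  let c : ℝ := (N + (N : ℝ) ^ 2) * (d * M) ^ 2 * s ^ 2
  have hc : 0 ≤ c := by positivity
  -- The `n`-th grid has an interval that is not sparse. There are `2 ^ n` intervals, each bad with
  -- probability at most `c / 4 ^ n`, so the sum over `n` converges and Borel–Cantelli makes all
  -- sufficiently fine grids exact almost surely.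
  let bad : ℕ → Set Ω := fun n => ⋃ k : Fin (2 ^ n),
    {ω | ¬ IsSparse (fun i => Nm i ω) (s * ((k : ℕ) / (2 ^ n : ℕ)))
      (s * (((k : ℕ) + 1 : ℕ) / (2 ^ n : ℕ)))}
  have hbad : ∀ n, P (bad n) ≤ ENNReal.ofReal (c * (1 / 2) ^ n) := by
    intro n
    rw [← ofReal_measureReal]
    refine ENNReal.ofReal_le_ofReal ?_
    have h2n : (0 : ℝ) < ((2 ^ n : ℕ) : ℝ) := by positivity
    have hk : ∀ k : Fin (2 ^ n), P.real {ω | ¬ IsSparse (fun i => Nm i ω)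
        (s * ((k : ℕ) / (2 ^ n : ℕ))) (s * (((k : ℕ) + 1 : ℕ) / (2 ^ n : ℕ)))} ≤
        c * (1 / ((2 ^ n : ℕ) : ℝ)) ^ 2 := by
      intro k
      have h0 := hs.1
      refine (hN.real_not_isSparse_le hM (by positivity) ?_ ?_).trans_eq ?_
      · gcongr; simp
      · refine (mul_le_of_le_one_right hs.1 (div_le_one_of_le₀ ?_ h2n.le)).trans hs.2
        exact_mod_cast k.2
      · simp only [c]
        push_cast
        ring
    calc P.real (bad n) ≤ ∑ k : Fin (2 ^ n), c * (1 / ((2 ^ n : ℕ) : ℝ)) ^ 2 :=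
          (measureReal_iUnion_fintype_le _).trans (Finset.sum_le_sum fun k _ => hk k)
      _ = c * (1 / 2) ^ n := by
          simp only [Finset.sum_const, Finset.card_univ, Fintype.card_fin, nsmul_eq_mul]
          have e : ((1 : ℝ) / 2) ^ n = 1 / ((2 ^ n : ℕ) : ℝ) := by push_cast; rw [one_div_pow]
          rw [e]; field_simp
  have hsum : ∑' n, P (bad n) ≠ ∞ := by
    refine ne_top_of_le_ne_top ?_ (ENNReal.tsum_le_tsum hbad)
    have hsm : Summable fun n : ℕ => c * (1 / 2 : ℝ) ^ n := summable_geometric_two.mul_left c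
    rw [← ENNReal.ofReal_tsum_of_nonneg (fun n => by positivity) hsm]
    exact ENNReal.ofReal_ne_top
  filter_upwards [ae_eventually_notMem hsum, hN.ae_isPath hX] with ω h1 h2
  symm
  refine hlim _ _ ?_
  filter_upwards [h1] with n hn
  rw [gridState_restrict hs.1 _ _ le_rfl]
  have h3 := h2.eq_gridState hs (n := 2 ^ n) (fun k hk => by
    by_contra h
    exact hn (mem_iUnion.2 ⟨⟨k, hk⟩, h⟩)) (k := 2 ^ n) le_rfl
  rw [← h3]
  have h2n : ((2 ^ n : ℕ) : ℝ) ≠ 0 := by positivity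
  rw [div_self h2n, mul_one]

/-! ### Functions with quadratically small increments. -/

section Real

/-- A function whose increments are bounded by a multiple of the square of the length of the
interval is nonincreasing. -/
lemma le_of_forall_sub_le_sq {Q : ℝ → ℝ} {T C : ℝ}
    (h : ∀ a b, 0 ≤ a → a ≤ b → b ≤ T → Q b - Q a ≤ C * (b - a) ^ 2) {a b : ℝ} (ha : 0 ≤ a)
    (hab : a ≤ b) (hb : b ≤ T) : Q b ≤ Q a := by
  -- Over `n` equal pieces the quadratic errors add up to `C (b - a)² / n`, which tends to zero.
  have key : ∀ n : ℕ, 0 < n → Q b - Q a ≤ C * (b - a) ^ 2 / n := by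
    intro n hn
    have hn' : (0 : ℝ) < n := by exact_mod_cast hn
    let t : ℕ → ℝ := fun k => a + (b - a) * (k / n)
    have ht : ∀ k, t (k + 1) - t k = (b - a) / n := by
      intro k; simp only [t]; push_cast; ring
    have htm : ∀ k ≤ n, t k ≤ b := by
      intro k hk
      have : (k : ℝ) / n ≤ 1 := div_le_one_of_le₀ (by exact_mod_cast hk) hn'.le
      simp only [t]; nlinarith
    have ht0 : ∀ k, 0 ≤ t k := fun k => by
      have : 0 ≤ (b - a) * (k / n) := mul_nonneg (by linarith) (by positivity)
      simp only [t]; linarith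
    have hstep : 0 ≤ (b - a) / n := div_nonneg (by linarith) hn'.le
    have hsum : Q (t n) - Q (t 0) = ∑ k ∈ Finset.range n, (Q (t (k + 1)) - Q (t k)) :=
      (Finset.sum_range_sub (fun k => Q (t k)) n).symm
    have e1 : t n = b := by simp only [t]; field_simp; ring
    have e0 : t 0 = a := by simp [t]
    rw [e1, e0] at hsum
    rw [hsum]
    calc ∑ k ∈ Finset.range n, (Q (t (k + 1)) - Q (t k))
        ≤ ∑ k ∈ Finset.range n, C * ((b - a) / n) ^ 2 := by
          refine Finset.sum_le_sum fun k hk => ?_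
          rw [← ht k]
          have := ht k
          exact h _ _ (ht0 k) (by linarith)
            ((htm _ (by have := Finset.mem_range.1 hk; omega)).trans hb)
      _ = C * (b - a) ^ 2 / n := by
          rw [Finset.sum_const, Finset.card_range, nsmul_eq_mul]; field_simp
  have hlim : Tendsto (fun n : ℕ => C * (b - a) ^ 2 / (n : ℝ)) atTop (𝓝 0) :=
    tendsto_const_div_atTop_nhds_zero_nat _
  have := ge_of_tendsto hlim (eventually_atTop.2 ⟨1, fun n hn => key n (by omega)⟩)
  linarith

lemma eq_of_forall_abs_sub_le_sq {Q : ℝ → ℝ} {T C : ℝ}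
    (h : ∀ a b, 0 ≤ a → a ≤ b → b ≤ T → |Q b - Q a| ≤ C * (b - a) ^ 2) {a b : ℝ} (ha : 0 ≤ a)
    (hab : a ≤ b) (hb : b ≤ T) : Q b = Q a := by
  refine le_antisymm (le_of_forall_sub_le_sq
    (fun a b h1 h2 h3 => (le_abs_self _).trans (h a b h1 h2 h3)) ha hab hb) ?_
  have := le_of_forall_sub_le_sq (Q := fun t => -Q t) (fun a b h1 h2 h3 => by
    have := (neg_abs_le (Q b - Q a))
    have := h a b h1 h2 h3
    linarith) ha hab hb
  linarith

/-- The fundamental theorem of calculus for an integrand continuous on a compact interval. -/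
lemma hasDerivWithinAt_of_eq_integral {q h : ℝ → ℝ} {T : ℝ} (hh : ContinuousOn h (Icc 0 T))
    (hq : ∀ t ∈ Icc 0 T, q t = q 0 + ∫ r in (0 : ℝ)..t, h r) {t : ℝ} (ht : t ∈ Icc 0 T) :
    HasDerivWithinAt q (h t) (Icc 0 T) t := by
  have hT : 0 ≤ T := ht.1.trans ht.2
  -- The integrand is extended by constants beyond the endpoints, so that the two-sided theorem
  -- applies at every point of `[0, T]`.
  let h' : ℝ → ℝ := IccExtend hT ((Icc 0 T).domRestrict h)
  have hc : Continuous h' := (continuousOn_iff_continuous_domRestrict.1 hh).Icc_extend'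
  have he : ∀ r ∈ Icc 0 T, h' r = h r := fun r hr => by
    simp only [h', IccExtend_of_mem hT _ hr, domRestrict_apply]
  have h1 : HasDerivAt (fun t => q 0 + ∫ r in (0 : ℝ)..t, h' r) (h' t) t :=
    (intervalIntegral.integral_hasDerivAt_right (hc.intervalIntegrable _ _)
      (hc.stronglyMeasurableAtFilter _ _) hc.continuousAt).const_add _
  have hq' : ∀ s ∈ Icc 0 T, q s = q 0 + ∫ r in (0 : ℝ)..s, h' r := by
    intro s hs
    rw [hq s hs]
    congr 1
    refine intervalIntegral.integral_congr fun r hr => ?_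
    rw [uIcc_of_le hs.1] at hr
    exact (he r ⟨hr.1, hr.2.trans hs.2⟩).symm
  rw [← he t ht]
  exact h1.hasDerivWithinAt.congr hq' (hq' t ht)

end Real

/-! ### Expectations of finite-valued processes. -/

section FiniteValued

variable {Ω : Type*} [MeasurableSpace Ω] {P : Measure Ω} [IsProbabilityMeasure P]
  {S : Type*} [Fintype S] [MeasurableSpace S] [MeasurableSingletonClass S]

lemma integrable_comp_fintype {W : Ω → S} (hW : Measurable W) (g : S → ℝ) :
    Integrable (fun ω => g (W ω)) P :=
  (integrable_map_measure (Measurable.of_discrete (f := g)).aestronglyMeasurable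
    hW.aemeasurable).1 Integrable.of_finite

lemma integral_comp_fintype {W : Ω → S} (hW : Measurable W) (g : S → ℝ) :
    ∫ ω, g (W ω) ∂P = ∑ s, P.real {ω | W ω = s} * g s := by
  rw [← integral_map hW.aemeasurable (Measurable.of_discrete (f := g)).aestronglyMeasurable,
    integral_fintype Integrable.of_finite]
  refine Finset.sum_congr rfl fun s _ => ?_
  rw [map_measureReal_apply hW (measurableSet_singleton s), smul_eq_mul]
  rfl

lemma abs_integral_sub_le {W W' : Ω → S} (hW : Measurable W) (hW' : Measurable W') {g : S → ℝ}
    {B : ℝ} (hg : ∀ s, |g s| ≤ B) :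
    |∫ ω, g (W ω) ∂P - ∫ ω, g (W' ω) ∂P| ≤ 2 * B * P.real {ω | W ω ≠ W' ω} := by
  classical
  have hm : MeasurableSet {ω | W ω ≠ W' ω} := (measurableSet_eq_fun hW hW').compl
  rw [← integral_sub (integrable_comp_fintype hW g) (integrable_comp_fintype hW' g)]
  have h1 : ∫ ω, {ω | W ω ≠ W' ω}.indicator (fun _ => 2 * B) ω ∂P =
      2 * B * P.real {ω | W ω ≠ W' ω} := by
    rw [integral_indicator_const _ hm, smul_eq_mul, mul_comm]
  rw [← h1, ← Real.norm_eq_abs]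
  refine norm_integral_le_of_norm_le ((integrable_const _).indicator hm) (ae_of_all _ fun ω => ?_)
  by_cases h : W ω = W' ω
  · rw [indicator_of_notMem (by simpa using h), h]; simp
  · rw [indicator_of_mem (by simpa using h), Real.norm_eq_abs]
    have := abs_sub (g (W ω)) (g (W' ω))
    linarith [hg (W ω), hg (W' ω)]

variable {W : ℝ → Ω → S} {T L B : ℝ} {φ : ℝ → S → ℝ}

/-- The probability of a state is the expectation of an indicator, which changes by at most twice
the probability of having moved; hence it is Lipschitz in time. -/
lemma continuousOn_real_eq (hW : ∀ t ∈ Icc 0 T, Measurable (W t))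
    (hL : ∀ a b, 0 ≤ a → a ≤ b → b ≤ T → P.real {ω | W b ω ≠ W a ω} ≤ L * (b - a)) (s : S) :
    ContinuousOn (fun r => P.real {ω | W r ω = s}) (Icc 0 T) := by
  classical
  have hL0 : ∀ a b, 0 ≤ a → a ≤ b → b ≤ T → |P.real {ω | W b ω = s} - P.real {ω | W a ω = s}| ≤
      2 * L * |b - a| := by
    intro a b ha hab hb
    have e : ∀ r ∈ Icc 0 T, P.real {ω | W r ω = s} =
        ∫ ω, (fun s' => if s' = s then (1 : ℝ) else 0) (W r ω) ∂P := by
      intro r hr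
      rw [integral_comp_fintype (hW r hr) (fun s' => if s' = s then (1 : ℝ) else 0)]
      simp
    rw [e b ⟨ha.trans hab, hb⟩, e a ⟨ha, hab.trans hb⟩]
    have := abs_integral_sub_le (P := P) (hW b ⟨ha.trans hab, hb⟩) (hW a ⟨ha, hab.trans hb⟩)
      (g := fun s' => if s' = s then (1 : ℝ) else 0) (B := 1)
      (fun s' => by split_ifs <;> simp)
    rw [abs_of_nonneg (by linarith : 0 ≤ b - a)]
    linarith [hL a b ha hab hb]
  have hlip : LipschitzOnWith (Real.toNNReal (2 * L)) (fun r => P.real {ω | W r ω = s})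
      (Icc 0 T) := by
    refine LipschitzOnWith.of_dist_le_mul fun a ha b hb => ?_
    rw [Real.dist_eq, Real.dist_eq]
    have h2 : 2 * L * |a - b| ≤ (Real.toNNReal (2 * L) : ℝ) * |a - b| := by
      gcongr; exact Real.le_coe_toNNReal _
    rcases le_total a b with hab | hab
    · rw [abs_sub_comm]
      rw [abs_sub_comm] at h2
      exact ((hL0 a b ha.1 hab hb.2).trans h2).trans_eq (by rw [abs_sub_comm])
    · exact (hL0 b a hb.1 hab ha.2).trans h2
  exact hlip.continuousOn

lemma continuousOn_integral_comp (hW : ∀ t ∈ Icc 0 T, Measurable (W t))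
    (hL : ∀ a b, 0 ≤ a → a ≤ b → b ≤ T → P.real {ω | W b ω ≠ W a ω} ≤ L * (b - a))
    (hφ : ∀ s, ContinuousOn (fun r => φ r s) (Icc 0 T)) :
    ContinuousOn (fun r => ∫ ω, φ r (W r ω) ∂P) (Icc 0 T) := by
  have e : ∀ r ∈ Icc 0 T, ∫ ω, φ r (W r ω) ∂P = ∑ s, P.real {ω | W r ω = s} * φ r s :=
    fun r hr => integral_comp_fintype (hW r hr) (φ r)
  refine ContinuousOn.congr ?_ e
  exact continuousOn_finsetSum _ fun s _ => (continuousOn_real_eq hW hL s).mul (hφ s)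

/-- Freezing the state at time `a` costs a probability `O(b - a)` of having moved, integrated over a
length `b - a`. -/
lemma abs_integral_integral_comp_sub_le (hW : ∀ t ∈ Icc 0 T, Measurable (W t)) (hL0 : 0 ≤ L)
    (hL : ∀ a b, 0 ≤ a → a ≤ b → b ≤ T → P.real {ω | W b ω ≠ W a ω} ≤ L * (b - a))
    (hφ : ∀ s, Continuous (fun r => φ r s)) (hB0 : 0 ≤ B) (hB : ∀ r s, |φ r s| ≤ B)
    {a b : ℝ} (ha : 0 ≤ a) (hab : a ≤ b) (hb : b ≤ T) :
    |(∫ r in a..b, ∫ ω, φ r (W r ω) ∂P) - ∫ r in a..b, ∫ ω, φ r (W a ω) ∂P| ≤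
      2 * B * L * (b - a) ^ 2 := by
  have h1 : IntervalIntegrable (fun r => ∫ ω, φ r (W r ω) ∂P) volume a b := by
    refine ContinuousOn.intervalIntegrable ?_
    rw [uIcc_of_le hab]
    exact (continuousOn_integral_comp hW hL fun s => (hφ s).continuousOn).mono
      (Icc_subset_Icc ha hb)
  have h2 : IntervalIntegrable (fun r => ∫ ω, φ r (W a ω) ∂P) volume a b := by
    refine Continuous.intervalIntegrable ?_ _ _
    have e : (fun r => ∫ ω, φ r (W a ω) ∂P) = fun r => ∑ s, P.real {ω | W a ω = s} * φ r s := by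
      funext r; exact integral_comp_fintype (hW a ⟨ha, hab.trans hb⟩) (φ r)
    rw [e]
    exact continuous_finsetSum _ fun s _ => continuous_const.mul (hφ s)
  rw [← intervalIntegral.integral_sub h1 h2, ← Real.norm_eq_abs]
  refine (intervalIntegral.norm_integral_le_of_norm_le_const (C := 2 * B * L * (b - a)) ?_).trans ?_
  · intro r hr
    rw [uIoc_of_le hab] at hr
    rw [Real.norm_eq_abs]
    refine (abs_integral_sub_le (hW r ⟨ha.trans hr.1.le, hr.2.trans hb⟩)
      (hW a ⟨ha, hab.trans hb⟩) (hB r)).trans ?_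
    have h3 := hL a r ha hr.1.le (hr.2.trans hb)
    have h4 : L * (r - a) ≤ L * (b - a) := by gcongr; exact hr.2
    calc 2 * B * P.real {ω | W r ω ≠ W a ω} ≤ 2 * B * (L * (b - a)) := by gcongr; linarith
      _ = 2 * B * L * (b - a) := by ring
  · rw [abs_of_nonneg (by linarith : 0 ≤ b - a)]
    exact le_of_eq (by ring)

end FiniteValued

/-! ### Jump probabilities and independence of the future noise. -/

section Solution

variable {d N : ℕ} {Ω : Type*} [MeasurableSpace Ω] {P : Measure Ω}
  {T M : ℝ} {m₀ : Vec d} {Z : Fin N → Ω → Fin d} {Nm : Fin N → Ω → Measure (ℝ × (Fin d → ℝ))}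
  {β β' : Fin N → ℝ → (Fin N → Fin d) → Vec d} {X Y : Fin N → ℝ → Ω → Fin d}

lemma SolvesSDE.measurable_state (hX : SolvesSDE P T Z Nm β X) {t : ℝ} (ht : t ∈ Icc 0 T) :
    Measurable fun ω i => X i t ω := measurable_pi_lambda _ fun i => hX.measurable i t ht

lemma indepFun_real_inter_eq_mul {α γ : Type*} [MeasurableSpace α] [MeasurableSpace γ]
    {f : Ω → α} {g : Ω → γ} (h : IndepFun f g P) {A : Set α} {B : Set γ} (hA : MeasurableSet A)
    (hB : MeasurableSet B) :
    P.real (f ⁻¹' A ∩ g ⁻¹' B) = P.real (f ⁻¹' A) * P.real (g ⁻¹' B) := by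
  rw [measureReal_def, measureReal_def, measureReal_def, ← ENNReal.toReal_mul,
    h.measure_inter_preimage_eq_mul _ _ hA hB]

variable [IsProbabilityMeasure P]

/-- A player moves only if its noise has a point in the slab, whose intensity is `d M (b - a)`. -/
lemma SolvesSDE.real_ne_le (hX : SolvesSDE P T Z Nm β X) (hN : IsNoise P T M m₀ Z Nm)
    (hM : 0 ≤ M) (i : Fin N) {a b : ℝ} (ha : 0 ≤ a) (hab : a ≤ b) (hb : b ≤ T) :
    P.real {ω | X i b ω ≠ X i a ω} ≤ d * M * (b - a) := by
  have h1 : P.real {ω | X i b ω ≠ X i a ω} ≤ P.real {ω | Nm i ω (slab d a b) ≠ 0} := by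
    rw [measureReal_def, measureReal_def]
    refine ENNReal.toReal_mono (measure_ne_top _ _) (measure_mono_ae ?_)
    filter_upwards [hN.ae_isPath hX] with ω hω h hn
    exact h (hω.eq_of_slab_eq_zero ha hab hb hn)
  refine h1.trans (((hN.poisson i).real_ne_zero_le (measurableSet_slab d a b)).trans_eq ?_)
  rw [slab, intensity_slab_real hM ha hab hb]
  ring

lemma SolvesSDE.real_state_ne_le (hX : SolvesSDE P T Z Nm β X) (hN : IsNoise P T M m₀ Z Nm)
    (hM : 0 ≤ M) {a b : ℝ} (ha : 0 ≤ a) (hab : a ≤ b) (hb : b ≤ T) :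
    P.real {ω | (fun i => X i b ω) ≠ fun i => X i a ω} ≤ N * (d * M) * (b - a) := by
  have hsub : {ω | (fun i => X i b ω) ≠ fun i => X i a ω} ⊆ ⋃ i, {ω | X i b ω ≠ X i a ω} := by
    intro ω hω
    obtain ⟨i, hi⟩ := Function.ne_iff.1 hω
    exact mem_iUnion.2 ⟨i, hi⟩
  refine (measureReal_mono hsub).trans ((measureReal_iUnion_fintype_le _).trans
    ((Finset.sum_le_sum fun i _ => hX.real_ne_le hN hM i ha hab hb).trans_eq ?_))
  simp only [Finset.sum_const, Finset.card_univ, Fintype.card_fin, nsmul_eq_mul]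
  ring

/-- The states at time `s` of two solutions with the same noise are independent of the noise
after `s`. -/
theorem SolvesSDE.indepFun_pair (hN : IsNoise P T M m₀ Z Nm) (hM : 0 ≤ M)
    (hβ : IsRegularFeedback M β) (hβ' : IsRegularFeedback M β') (hY : SolvesSDE P T Z Nm β Y)
    (hX : SolvesSDE P T Z Nm β' X) {s : ℝ} (hs : s ∈ Icc 0 T) :
    IndepFun (fun ω => ((fun i => Y i s ω), (fun i => X i s ω)))
      (fun ω i => (Nm i ω).restrict (Ioi s ×ˢ univ)) P := by
  -- Both states are functionals of the same initial states and past noise, so the pair is treated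
  -- jointly, as the coupling requires.
  obtain ⟨Φ, hΦ, h1⟩ := exists_adapted_functional hM hβ hs
  obtain ⟨Φ', hΦ', h2⟩ := exists_adapted_functional hM hβ' hs
  have hind := hN.indepFun_restrict (A := Iic s ×ˢ univ) (A' := Ioi s ×ˢ univ)
    (measurableSet_Iic.prod MeasurableSet.univ) (measurableSet_Ioi.prod MeasurableSet.univ)
    (by
      rw [Set.disjoint_left]
      rintro q ⟨h1, -⟩ ⟨h2, -⟩
      exact absurd (mem_Iic.1 h1) (not_le.2 h2))
  refine (hind.comp (hΦ.prodMk hΦ') measurable_id).congr ?_ (ae_eq_refl _)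
  filter_upwards [h1 P m₀ Z Nm Y hN hY, h2 P m₀ Z Nm X hN hX] with ω e1 e2
  simp only [Function.comp_apply]
  rw [e1, e2]

end Solution

/-! ### The generator and the linear form of a step. -/

section Generator

variable {d N : ℕ}

/-- The generator of the controlled system, applied to `g : Σ^N → ℝ`. -/
def generator (β : Fin N → ℝ → (Fin N → Fin d) → Vec d) (g : (Fin N → Fin d) → ℝ) (r : ℝ)
    (x : Fin N → Fin d) : ℝ :=
  ∑ i, ∑ y, β i r x y * (g (Function.update x i y) - g x)

lemma measurableSet_isHit {M : ℝ} {β : Fin N → ℝ → (Fin N → Fin d) → Vec d}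
    (hβ : IsRegularFeedback M β) (a b : ℝ) (x : Fin N → Fin d) (i : Fin N) (y : Fin d) :
    MeasurableSet {μ : Fin N → Measure (ℝ × (Fin d → ℝ)) | IsHit β a b μ x i y} := by
  have : Measurable fun μ : Fin N → Measure (ℝ × (Fin d → ℝ)) =>
      μ i (region a b (fun r => β i r x y) y) :=
    (Measure.measurable_coe (measurableSet_region a b
      (hβ.continuous i x y).measurable y)).comp (measurable_pi_apply i)
  exact (this (measurableSet_singleton 0)).compl

/-- A single point belongs to one player and lies on one axis, so it can be accepted for one target
only. -/
lemma IsHit.eq_of_isSparse {μ : Fin N → Measure (ℝ × (Fin d → ℝ))} {a b : ℝ}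
    (hp : ∀ i, IsPointMeasure (μ i)) (hax : ∀ i, μ i (univ ×ˢ {ξ | onAxis ξ}ᶜ) = 0)
    (hs : IsSparse μ a b) {β : Fin N → ℝ → (Fin N → Fin d) → Vec d} {x : Fin N → Fin d}
    {i i' : Fin N} {y y' : Fin d} (h : IsHit β a b μ x i y) (h' : IsHit β a b μ x i' y') :
    i = i' ∧ y = y' := by
  have hne : ∀ {i y}, IsHit β a b μ x i y → μ i (slab d a b) ≠ 0 := fun h h0 =>
    h (measure_mono_null (region_subset_slab a b _ _) h0)
  have hii : i = i' := by
    by_contra hii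
    exact (hs.2 i i' hii).elim (hne h) (hne h')
  subst hii
  refine ⟨rfl, ?_⟩
  obtain ⟨⟨r, ξ⟩, hq, hr⟩ := (hp i).restrict_eq_dirac (measurableSet_slab d a b) (hne h) (hs.1 i)
  have key : ∀ y, IsHit β a b μ x i y → 0 < ξ y := by
    intro y hy
    have e : μ i (region a b (fun r => β i r x y) y) =
        (μ i).restrict (slab d a b) (region a b (fun r => β i r x y) y) := by
      rw [Measure.restrict_apply' (measurableSet_slab d a b),
        inter_eq_left.2 (region_subset_slab a b _ y)]
    rw [IsHit, e, hr, Measure.dirac_apply] at hy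
    by_contra hneg
    exact hy (indicator_of_notMem (fun hm => hneg hm.2.1) _)
  have hax' : onAxis ξ := by
    by_contra hna
    have : (μ i).restrict (slab d a b) (univ ×ˢ {ξ | onAxis ξ}ᶜ) = 0 :=
      le_antisymm ((Measure.restrict_apply_le _ _).trans (hax i).le) zero_le
    rw [hr, Measure.dirac_apply' _ (MeasurableSet.univ.prod (measurableSet_onAxis d).compl),
      indicator_of_mem (by exact ⟨mem_univ _, hna⟩)] at this
    simp at this
  obtain ⟨j, hj⟩ := hax'
  have hj' : ∀ y, IsHit β a b μ x i y → y = j := by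
    intro y hy
    by_contra hne
    have := key y hy
    rw [hj y hne] at this
    exact lt_irrefl _ this
  rw [hj' y h, hj' y' h']

-- At most one term of the double sum is nonzero. In this additive form the expectation of a step
-- splits into hit probabilities.
open Classical in
lemma apply_step_sub {μ : Fin N → Measure (ℝ × (Fin d → ℝ))} {a b : ℝ}
    (hp : ∀ i, IsPointMeasure (μ i)) (hax : ∀ i, μ i (univ ×ˢ {ξ | onAxis ξ}ᶜ) = 0)
    (hs : IsSparse μ a b) (β : Fin N → ℝ → (Fin N → Fin d) → Vec d) (x : Fin N → Fin d)
    (g : (Fin N → Fin d) → ℝ) :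
    g (step β a b μ x) - g x = ∑ i, ∑ y,
      if IsHit β a b μ x i y then g (Function.update x i y) - g x else 0 := by
  by_cases hex : ∃ i y, IsHit β a b μ x i y
  · obtain ⟨i, y, hiy⟩ := hex
    have hstep : step β a b μ x = Function.update x i y := by
      funext k
      by_cases hk : k = i
      · subst hk
        have hex : ∃ y, IsHit β a b μ x k y := ⟨y, hiy⟩
        rw [step, dif_pos hex, Function.update_self]
        exact (IsHit.eq_of_isSparse hp hax hs hex.choose_spec hiy).2
      · have hex : ¬ ∃ y, IsHit β a b μ x k y := by
          rintro ⟨y', hy'⟩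
          exact hk (IsHit.eq_of_isSparse hp hax hs hy' hiy).1
        rw [step, dif_neg hex, Function.update_of_ne hk]
    rw [hstep, Finset.sum_eq_single i, Finset.sum_eq_single y, if_pos hiy]
    · intro y' _ hy'
      exact if_neg fun h => hy' (IsHit.eq_of_isSparse hp hax hs h hiy).2
    · simp
    · intro k _ hk
      exact Finset.sum_eq_zero fun y' _ =>
        if_neg fun h => hk (IsHit.eq_of_isSparse hp hax hs h hiy).1
    · simp
  · push Not at hex
    have hstep : step β a b μ x = x := by
      funext k
      rw [step, dif_neg (fun h => hex k h.choose h.choose_spec)]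
    rw [hstep, sub_self, Finset.sum_eq_zero]
    exact fun i _ => Finset.sum_eq_zero fun y _ => if_neg (hex i y)

lemma abs_generator_le {M G : ℝ} {β : Fin N → ℝ → (Fin N → Fin d) → Vec d}
    (hβ : IsRegularFeedback M β) {g : (Fin N → Fin d) → ℝ} (hg : ∀ x, |g x| ≤ G) (r : ℝ)
    (x : Fin N → Fin d) : |generator β g r x| ≤ N * (d * (M * (2 * G))) := by
  refine (Finset.abs_sum_le_sum_abs _ _).trans ?_
  calc ∑ i, |∑ y, β i r x y * (g (Function.update x i y) - g x)|
      ≤ ∑ i : Fin N, ∑ y : Fin d, M * (2 * G) := by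
        refine Finset.sum_le_sum fun i _ => (Finset.abs_sum_le_sum_abs _ _).trans
          (Finset.sum_le_sum fun y _ => ?_)
        rw [abs_mul, abs_of_nonneg (hβ.nonneg i r x y)]
        have h1 := abs_sub (g (Function.update x i y)) (g x)
        have h2 := hg (Function.update x i y)
        have h3 := hg x
        exact mul_le_mul (hβ.le i r x y) (by linarith) (abs_nonneg _)
          ((hβ.nonneg i r x y).trans (hβ.le i r x y))
    _ = N * (d * (M * (2 * G))) := by simp

lemma continuous_generator {M : ℝ} {β : Fin N → ℝ → (Fin N → Fin d) → Vec d}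
    (hβ : IsRegularFeedback M β) (g : (Fin N → Fin d) → ℝ) (x : Fin N → Fin d) :
    Continuous fun r => generator β g r x :=
  continuous_finsetSum _ fun i _ => continuous_finsetSum _ fun y _ =>
    (hβ.continuous i x y).mul continuous_const

end Generator

/-! ### Dynkin's formula. -/

section Forward

variable {d N : ℕ} {Ω : Type*} [MeasurableSpace Ω] {P : Measure Ω}
  {T M : ℝ} {m₀ : Vec d} {Z : Fin N → Ω → Fin d} {Nm : Fin N → Ω → Measure (ℝ × (Fin d → ℝ))}
  {β β' : Fin N → ℝ → (Fin N → Fin d) → Vec d} {X Y : Fin N → ℝ → Ω → Fin d}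

lemma measurableSet_isSparse (a b : ℝ) :
    MeasurableSet {μ : Fin N → Measure (ℝ × (Fin d → ℝ)) | IsSparse μ a b} := by
  have h : ∀ i, Measurable fun μ : Fin N → Measure (ℝ × (Fin d → ℝ)) => μ i (slab d a b) :=
    fun i => (Measure.measurable_coe (measurableSet_slab d a b)).comp (measurable_pi_apply i)
  have : {μ : Fin N → Measure (ℝ × (Fin d → ℝ)) | IsSparse μ a b} =
      (⋂ i, {μ | μ i (slab d a b) ≤ 1}) ∩ ⋂ i, ⋂ j, ⋂ (_ : i ≠ j),
        ({μ | μ i (slab d a b) = 0} ∪ {μ | μ j (slab d a b) = 0}) := by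
    ext μ; simp [IsSparse]
  rw [this]
  exact (MeasurableSet.iInter fun i => measurableSet_le (h i) measurable_const).inter
    (MeasurableSet.iInter fun i => MeasurableSet.iInter fun j => MeasurableSet.iInter fun _ =>
      (h i (measurableSet_singleton 0)).union (h j (measurableSet_singleton 0)))

lemma IsNoise.measurable_noise (hN : IsNoise P T M m₀ Z Nm) : Measurable fun ω i => Nm i ω :=
  measurable_pi_lambda _ fun i => (hN.poisson i).measurable

variable [IsProbabilityMeasure P]

/-- Markov property: a hit in `]a, b]` is an event of the noise after `a`, which is independent of
the state at `a`. -/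
lemma SolvesSDE.real_inter_isHit (hX : SolvesSDE P T Z Nm β X) (hN : IsNoise P T M m₀ Z Nm)
    (hM : 0 ≤ M) (hβ : IsRegularFeedback M β) {a : ℝ} (ha : a ∈ Icc 0 T) (b : ℝ)
    (x : Fin N → Fin d) (i : Fin N) (y : Fin d) :
    P.real ({ω | (fun i => X i a ω) = x} ∩ {ω | IsHit β a b (fun i => Nm i ω) x i y}) =
      P.real {ω | (fun i => X i a ω) = x} *
        P.real {ω | IsHit β a b (fun i => Nm i ω) x i y} := by
  have h := indepFun_real_inter_eq_mul
    ((SolvesSDE.indepFun_pair hN hM hβ hβ hX hX ha).comp measurable_fst measurable_id)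
    (measurableSet_singleton x) (measurableSet_isHit hβ a b x i y)
  have e : (id ∘ fun ω i => (Nm i ω).restrict (Ioi a ×ˢ univ)) ⁻¹'
      {μ | IsHit β a b μ x i y} = {ω | IsHit β a b (fun i => Nm i ω) x i y} := by
    ext ω
    simp only [mem_preimage, Function.comp_apply, id_eq, mem_ofPred_eq]
    rw [isHit_restrict_Ioi le_rfl]
  rw [e] at h
  exact h

/-- The number of accepted points is Poisson with the integrated rate as parameter. Since that
parameter is at most `M (b - a)`, the error is quadratic. -/
lemma IsNoise.abs_real_isHit_sub_le (hN : IsNoise P T M m₀ Z Nm) (hβ : IsRegularFeedback M β)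
    {a b : ℝ} (ha : 0 ≤ a) (hab : a ≤ b) (hb : b ≤ T) (x : Fin N → Fin d) (i : Fin N)
    (y : Fin d) :
    |P.real {ω | IsHit β a b (fun i => Nm i ω) x i y} - ∫ r in a..b, β i r x y| ≤
      M ^ 2 * (b - a) ^ 2 := by
  have hc : Continuous fun r => β i r x y := hβ.continuous i x y
  have h1 := (hN.poisson i).abs_real_ne_zero_sub_le
    (measurableSet_region a b hc.measurable y)
  rw [intensity_region ha hab hb hc (fun r => hβ.nonneg i r x y) (fun r => hβ.le i r x y)] at h1
  refine h1.trans ?_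
  have h2 : 0 ≤ ∫ r in a..b, β i r x y :=
    intervalIntegral.integral_nonneg hab fun r _ => hβ.nonneg i r x y
  have h3 : ∫ r in a..b, β i r x y ≤ M * (b - a) := by
    have := intervalIntegral.integral_mono_on hab (hc.intervalIntegrable _ _)
      (continuous_const.intervalIntegrable _ _) (g := fun _ => M) (fun r _ => hβ.le i r x y)
      (μ := volume)
    rw [intervalIntegral.integral_const, smul_eq_mul] at this
    linarith
  rw [← mul_pow]
  gcongr

open Classical in
/-- The expected increment of `g` over a short time interval. -/
lemma SolvesSDE.abs_increment_le (hX : SolvesSDE P T Z Nm β X) (hN : IsNoise P T M m₀ Z Nm)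
    (hM : 0 ≤ M) (hβ : IsRegularFeedback M β) {g : (Fin N → Fin d) → ℝ} {G : ℝ}
    (hg : ∀ x, |g x| ≤ G) {a b : ℝ} (ha : 0 ≤ a) (hab : a ≤ b) (hb : b ≤ T) :
    |∫ ω, g (fun i => X i b ω) ∂P - ∫ ω, g (fun i => X i a ω) ∂P -
        ∫ r in a..b, ∫ ω, generator β g r (fun i => X i a ω) ∂P| ≤
      ((2 * G + N * (d * (2 * G))) * ((N + (N : ℝ) ^ 2) * (d * M) ^ 2) +
        N * (d * (2 * G * M ^ 2))) * (b - a) ^ 2 := by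
  have haT : a ∈ Icc 0 T := ⟨ha, hab.trans hb⟩
  have hbT : b ∈ Icc 0 T := ⟨ha.trans hab, hb⟩
  have hma := hX.measurable_state haT
  have hmb := hX.measurable_state hbT
  -- Nonnegativity of `G` needs some state to exist, and the process provides one.
  by_cases hG' : IsEmpty (Fin N → Fin d)
  · exfalso
    have : Nonempty Ω := P.nonempty_of_neZero
    exact hG'.false fun i => X i a (Classical.arbitrary Ω)
  have hG : 0 ≤ G := by
    rw [not_isEmpty_iff] at hG'
    exact (abs_nonneg _).trans (hg (Classical.arbitrary _))
  let Δ : (Fin N → Fin d) → Fin N → Fin d → ℝ := fun x i y => g (Function.update x i y) - g x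
  have hΔ : ∀ x i y, |Δ x i y| ≤ 2 * G := fun x i y => by
    have := abs_sub (g (Function.update x i y)) (g x)
    have h2 := hg (Function.update x i y)
    have h3 := hg x
    simp only [Δ]; linarith
  -- The increment of `g` predicted by the hits. It is exact on sparse noise, and its expectation is
  -- the generator term up to `O((b - a)²)`.
  let F : Ω → ℝ := fun ω => ∑ i, ∑ y,
    if IsHit β a b (fun i => Nm i ω) (fun i => X i a ω) i y then Δ (fun i => X i a ω) i y else 0
  let A : (Fin N → Fin d) → Fin N → Fin d → Set Ω := fun x i y =>
    {ω | (fun i => X i a ω) = x} ∩ {ω | IsHit β a b (fun i => Nm i ω) x i y}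
  have hA : ∀ x i y, MeasurableSet (A x i y) := fun x i y =>
    (hma (measurableSet_singleton x)).inter
      (hN.measurable_noise (measurableSet_isHit hβ a b x i y))
  have hF : F = fun ω => ∑ x, ∑ i, ∑ y, (A x i y).indicator (fun _ => Δ x i y) ω := by
    funext ω
    rw [Finset.sum_eq_single (fun i => X i a ω)]
    · refine Finset.sum_congr rfl fun i _ => Finset.sum_congr rfl fun y _ => ?_
      simp only [A, indicator, mem_inter_iff, mem_ofPred_eq, true_and]
    · intro x _ hx
      refine Finset.sum_eq_zero fun i _ => Finset.sum_eq_zero fun y _ =>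
        indicator_of_notMem ?_ _
      exact fun h => hx h.1.symm
    · simp
  have hFi : Integrable F P := by
    rw [hF]
    exact integrable_finsetSum _ fun x _ => integrable_finsetSum _ fun i _ =>
      integrable_finsetSum _ fun y _ => (integrable_const _).indicator (hA x i y)
  have hFint : ∫ ω, F ω ∂P = ∑ x, ∑ i, ∑ y, P.real {ω | (fun i => X i a ω) = x} *
      (P.real {ω | IsHit β a b (fun i => Nm i ω) x i y} * Δ x i y) := by
    rw [hF, integral_finsetSum _ fun x _ => integrable_finsetSum _ fun i _ =>
      integrable_finsetSum _ fun y _ => (integrable_const _).indicator (hA x i y)]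
    refine Finset.sum_congr rfl fun x _ => ?_
    rw [integral_finsetSum _ fun i _ =>
      integrable_finsetSum _ fun y _ => (integrable_const _).indicator (hA x i y)]
    refine Finset.sum_congr rfl fun i _ => ?_
    rw [integral_finsetSum _ fun y _ => (integrable_const _).indicator (hA x i y)]
    refine Finset.sum_congr rfl fun y _ => ?_
    rw [integral_indicator_const _ (hA x i y), smul_eq_mul, ← mul_assoc,
      hX.real_inter_isHit hN hM hβ haT]
  have hgen : ∫ r in a..b, ∫ ω, generator β g r (fun i => X i a ω) ∂P =
      ∑ x, ∑ i, ∑ y, P.real {ω | (fun i => X i a ω) = x} *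
        ((∫ r in a..b, β i r x y) * Δ x i y) := by
    have e : ∀ r, ∫ ω, generator β g r (fun i => X i a ω) ∂P =
        ∑ x, ∑ i, ∑ y, P.real {ω | (fun i => X i a ω) = x} * (β i r x y * Δ x i y) := by
      intro r
      rw [integral_comp_fintype hma (generator β g r)]
      simp only [generator, Finset.mul_sum, Δ]
    simp_rw [e]
    have hi : ∀ x i y, Continuous fun r => P.real {ω | (fun i => X i a ω) = x} *
        (β i r x y * Δ x i y) := fun x i y =>
      continuous_const.mul ((hβ.continuous i x y).mul continuous_const)
    rw [intervalIntegral.integral_finsetSum fun x _ => (continuous_finsetSum _ fun i _ =>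
      continuous_finsetSum _ fun y _ => hi x i y).intervalIntegrable _ _]
    refine Finset.sum_congr rfl fun x _ => ?_
    rw [intervalIntegral.integral_finsetSum fun i _ =>
      (continuous_finsetSum _ fun y _ => hi x i y).intervalIntegrable _ _]
    refine Finset.sum_congr rfl fun i _ => ?_
    rw [intervalIntegral.integral_finsetSum fun y _ => (hi x i y).intervalIntegrable _ _]
    refine Finset.sum_congr rfl fun y _ => ?_
    rw [intervalIntegral.integral_const_mul, intervalIntegral.integral_mul_const]
  have hbad : MeasurableSet {ω | ¬ IsSparse (fun i => Nm i ω) a b} :=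
    (hN.measurable_noise (measurableSet_isSparse a b)).compl
  have hga := integrable_comp_fintype (P := P) hma g
  have hgb := integrable_comp_fintype (P := P) hmb g
  have h1 : |∫ ω, (g (fun i => X i b ω) - g (fun i => X i a ω) - F ω) ∂P| ≤
      (2 * G + N * (d * (2 * G))) * P.real {ω | ¬ IsSparse (fun i => Nm i ω) a b} := by
    have e : ∫ ω, {ω | ¬ IsSparse (fun i => Nm i ω) a b}.indicator
        (fun _ => 2 * G + N * (d * (2 * G))) ω ∂P =
        (2 * G + N * (d * (2 * G))) * P.real {ω | ¬ IsSparse (fun i => Nm i ω) a b} := by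
      rw [integral_indicator_const _ hbad, smul_eq_mul, mul_comm]
    rw [← e, ← Real.norm_eq_abs]
    refine norm_integral_le_of_norm_le ((integrable_const _).indicator hbad) ?_
    filter_upwards [hN.ae_isPath hX] with ω hω
    by_cases hsp : IsSparse (fun i => Nm i ω) a b
    · rw [indicator_of_notMem (by simpa using hsp)]
      have h2 := apply_step_sub hω.point hω.axis hsp β (fun i => X i a ω) g
      rw [← hω.eq_step ha hab hb hsp] at h2
      rw [h2]
      simp [F, Δ]
    · rw [indicator_of_mem hsp, Real.norm_eq_abs]
      have hFb : |F ω| ≤ N * (d * (2 * G)) := by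
        refine (Finset.abs_sum_le_sum_abs _ _).trans ?_
        calc _ ≤ ∑ i : Fin N, ∑ y : Fin d, 2 * G := by
              refine Finset.sum_le_sum fun i _ => (Finset.abs_sum_le_sum_abs _ _).trans
                (Finset.sum_le_sum fun y _ => ?_)
              split_ifs
              · exact hΔ _ _ _
              · simpa using hG
          _ = N * (d * (2 * G)) := by simp
      have h3 := abs_sub (g (fun i => X i b ω) - g (fun i => X i a ω)) (F ω)
      have h4 := abs_sub (g (fun i => X i b ω)) (g (fun i => X i a ω))
      have h5 := hg (fun i => X i b ω)
      have h6 := hg (fun i => X i a ω)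
      linarith
  rw [integral_sub (f := fun ω => g (fun i => X i b ω) - g (fun i => X i a ω)) (hgb.sub hga) hFi,
    integral_sub hgb hga] at h1
  have h2 : |∫ ω, F ω ∂P - ∫ r in a..b, ∫ ω, generator β g r (fun i => X i a ω) ∂P| ≤
      N * (d * (2 * G * M ^ 2)) * (b - a) ^ 2 := by
    rw [hFint, hgen, ← Finset.sum_sub_distrib]
    have hx : ∀ x, |(∑ i, ∑ y, P.real {ω | (fun i => X i a ω) = x} *
        (P.real {ω | IsHit β a b (fun i => Nm i ω) x i y} * Δ x i y)) -
        ∑ i, ∑ y, P.real {ω | (fun i => X i a ω) = x} * ((∫ r in a..b, β i r x y) * Δ x i y)| ≤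
        P.real {ω | (fun i => X i a ω) = x} * (N * (d * (2 * G * M ^ 2)) * (b - a) ^ 2) := by
      intro x
      rw [← Finset.sum_sub_distrib]
      calc _ ≤ ∑ i : Fin N, ∑ y : Fin d, P.real {ω | (fun i => X i a ω) = x} *
            (M ^ 2 * (b - a) ^ 2 * (2 * G)) := by
            refine (Finset.abs_sum_le_sum_abs _ _).trans (Finset.sum_le_sum fun i _ => ?_)
            rw [← Finset.sum_sub_distrib]
            refine (Finset.abs_sum_le_sum_abs _ _).trans (Finset.sum_le_sum fun y _ => ?_)
            rw [← mul_sub, ← sub_mul, abs_mul, abs_mul, abs_of_nonneg measureReal_nonneg]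
            have h7 := hN.abs_real_isHit_sub_le hβ ha hab hb x i y
            have h8 := hΔ x i y
            gcongr
        _ = _ := by
            simp only [Finset.sum_const, Finset.card_univ, Fintype.card_fin, nsmul_eq_mul]
            ring
    calc _ ≤ ∑ x, P.real {ω | (fun i => X i a ω) = x} *
          (N * (d * (2 * G * M ^ 2)) * (b - a) ^ 2) :=
          (Finset.abs_sum_le_sum_abs _ _).trans (Finset.sum_le_sum fun x _ => hx x)
      _ = _ := by
          rw [← integral_comp_fintype hma (fun _ => N * (d * (2 * G * M ^ 2)) * (b - a) ^ 2)]
          simp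
  have h3 := hN.real_not_isSparse_le hM ha hab hb
  have h4 : (2 * G + N * (d * (2 * G))) * P.real {ω | ¬ IsSparse (fun i => Nm i ω) a b} ≤
      (2 * G + N * (d * (2 * G))) * ((N + (N : ℝ) ^ 2) * (d * M) ^ 2 * (b - a) ^ 2) := by
    gcongr
  calc _ ≤ |∫ ω, g (fun i => X i b ω) ∂P - ∫ ω, g (fun i => X i a ω) ∂P - ∫ ω, F ω ∂P| +
        |∫ ω, F ω ∂P - ∫ r in a..b, ∫ ω, generator β g r (fun i => X i a ω) ∂P| := by
        refine le_trans (le_of_eq ?_) (abs_add_le _ _)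
        congr 1; ring
    _ ≤ _ := by linarith [h1, h2, h4]

/-- Dynkin's formula: the Kolmogorov forward equation in weak form. -/
theorem SolvesSDE.hasDerivWithinAt_integral (hX : SolvesSDE P T Z Nm β X)
    (hN : IsNoise P T M m₀ Z Nm) (hM : 0 ≤ M) (hβ : IsRegularFeedback M β)
    (g : (Fin N → Fin d) → ℝ) {t : ℝ} (ht : t ∈ Icc 0 T) :
    HasDerivWithinAt (fun s => ∫ ω, g (fun i => X i s ω) ∂P)
      (∫ ω, generator β g t (fun i => X i t ω) ∂P) (Icc 0 T) t := by
  obtain ⟨G, hG0, hG⟩ : ∃ G, 0 ≤ G ∧ ∀ x, |g x| ≤ G :=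
    ⟨∑ x, |g x|, Finset.sum_nonneg fun x _ => abs_nonneg _, fun x =>
      Finset.single_le_sum (f := fun x => |g x|) (fun _ _ => abs_nonneg _) (Finset.mem_univ x)⟩
  have hW : ∀ t ∈ Icc 0 T, Measurable fun ω i => X i t ω := fun t ht => hX.measurable_state ht
  have hL := fun a b ha hab hb => hX.real_state_ne_le (a := a) (b := b) hN hM ha hab hb
  have hcont : ContinuousOn (fun r => ∫ ω, generator β g r (fun i => X i r ω) ∂P) (Icc 0 T) :=
    continuousOn_integral_comp (W := fun r ω i => X i r ω) hW hL
      fun x => (continuous_generator hβ g x).continuousOn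
  refine hasDerivWithinAt_of_eq_integral (q := fun s => ∫ ω, g (fun i => X i s ω) ∂P) hcont
    (fun s hs => ?_) ht
  have hint : ∀ a b, 0 ≤ a → a ≤ b → b ≤ T → IntervalIntegrable
      (fun r => ∫ ω, generator β g r (fun i => X i r ω) ∂P) volume a b := by
    intro a b ha hab hb
    refine ContinuousOn.intervalIntegrable ?_
    rw [uIcc_of_le hab]
    exact hcont.mono (Icc_subset_Icc ha hb)
  -- The first constant is the one-step error with the state frozen at `a`; the second is the cost
  -- of unfreezing it inside the integral.
  have key := eq_of_forall_abs_sub_le_sq (T := T)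
    (Q := fun s => ∫ ω, g (fun i => X i s ω) ∂P -
      ∫ r in (0 : ℝ)..s, ∫ ω, generator β g r (fun i => X i r ω) ∂P)
    (C := ((2 * G + N * (d * (2 * G))) * ((N + (N : ℝ) ^ 2) * (d * M) ^ 2) +
        N * (d * (2 * G * M ^ 2))) + 2 * (N * (d * (M * (2 * G)))) * (N * (d * M)))
    (fun a b ha hab hb => ?_) le_rfl hs.1 hs.2
  · simp only [intervalIntegral.integral_same] at key
    linarith
  · have h1 := hX.abs_increment_le hN hM hβ hG ha hab hb
    have h2 := abs_integral_integral_comp_sub_le (P := P) (W := fun r ω i => X i r ω) hW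
      (L := N * (d * M)) (by positivity) hL (continuous_generator hβ g)
      (B := N * (d * (M * (2 * G)))) (by positivity) (abs_generator_le hβ hG) ha hab hb
    have h3 := intervalIntegral.integral_add_adjacent_intervals
      (hint 0 a le_rfl ha (hab.trans hb)) (hint a b ha hab hb)
    rw [abs_le] at h1 h2 ⊢
    constructor <;> nlinarith [h1.1, h1.2, h2.1, h2.2]

end Forward

/-! ### Separation of two solutions driven by the same noise. -/

section Coupling

variable {d N : ℕ}

/-- The total difference of the rates of player `i` under two feedbacks, in two states in which
player `i` occupies the same site. -/
def rateGap (β β' : Fin N → ℝ → (Fin N → Fin d) → Vec d) (i : Fin N) (r : ℝ)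
    (p : (Fin N → Fin d) × (Fin N → Fin d)) : ℝ :=
  if p.1 i = p.2 i then ∑ y, |β i r p.1 y - β' i r p.2 y| else 0

variable {Ω : Type*} [MeasurableSpace Ω] {P : Measure Ω} {T M : ℝ} {m₀ : Vec d}
  {Z : Fin N → Ω → Fin d} {Nm : Fin N → Ω → Measure (ℝ × (Fin d → ℝ))}
  {β β' : Fin N → ℝ → (Fin N → Fin d) → Vec d} {X Y : Fin N → ℝ → Ω → Fin d}

lemma continuous_rateGap (hβ : IsRegularFeedback M β) (hβ' : IsRegularFeedback M β') (i : Fin N)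
    (p : (Fin N → Fin d) × (Fin N → Fin d)) : Continuous fun r => rateGap β β' i r p := by
  unfold rateGap
  split_ifs
  · exact continuous_finsetSum _ fun y _ =>
      ((hβ.continuous i p.1 y).sub (hβ'.continuous i p.2 y)).abs
  · exact continuous_const

lemma rateGap_nonneg (i : Fin N) (r : ℝ) (p : (Fin N → Fin d) × (Fin N → Fin d)) :
    0 ≤ rateGap β β' i r p := by
  unfold rateGap
  split_ifs
  · exact Finset.sum_nonneg fun y _ => abs_nonneg _
  · exact le_rfl

lemma abs_rateGap_le (hM : 0 ≤ M) (hβ : IsRegularFeedback M β) (hβ' : IsRegularFeedback M β')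
    (i : Fin N) (r : ℝ) (p : (Fin N → Fin d) × (Fin N → Fin d)) :
    |rateGap β β' i r p| ≤ d * M := by
  rw [abs_of_nonneg (rateGap_nonneg i r p)]
  unfold rateGap
  split_ifs
  · calc ∑ y, |β i r p.1 y - β' i r p.2 y| ≤ ∑ y : Fin d, M := by
          refine Finset.sum_le_sum fun y _ => abs_sub_le_iff.2 ⟨?_, ?_⟩
          · linarith [hβ.le i r p.1 y, hβ'.nonneg i r p.2 y]
          · linarith [hβ'.le i r p.2 y, hβ.nonneg i r p.1 y]
      _ = d * M := by simp
  · positivity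

open Classical in
/-- If two paths driven by the same noise separate at player `i` while there is at most one point
of noise, this point is accepted by exactly one of the two. -/
lemma exists_symmDiff_ne_zero {z z' : Fin N → Fin d} {μ : Fin N → Measure (ℝ × (Fin d → ℝ))}
    {x x' : Fin N → ℝ → Fin d} (h : IsPath T z μ β x) (h' : IsPath T z' μ β' x') {a b r : ℝ}
    (ha : 0 ≤ a) (hr : r ∈ Ioc a b) (hb : b ≤ T) (hs : IsSparse μ a b) {i : Fin N}
    (heq : x i a = x' i a) (hne : x i r ≠ x' i r) :
    ∃ y, μ i (symmDiff (region a b (fun s => β i s (fun j => x j a) y) y)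
      (region a b (fun s => β' i s (fun j => x' j a) y) y)) ≠ 0 := by
  -- If no point lies in any of the symmetric differences, both feedbacks see the same hits up to
  -- time `r`, and the two steps agree at player `i`.
  by_contra! hcon
  have hsub : ∀ (g g' : ℝ → ℝ) (y : Fin d), region a r g y ⊆
      region a r g' y ∪ symmDiff (region a b g y) (region a b g' y) := by
    intro g g' y q hq
    by_cases hq' : q ∈ region a r g' y
    · exact Or.inl hq'
    · exact Or.inr (Or.inl ⟨⟨Ioc_subset_Ioc_right hr.2 hq.1, hq.2⟩, fun h => hq' ⟨hq.1, h.2⟩⟩)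
  have hhit : IsHit β a r μ (fun j => x j a) i = IsHit β' a r μ (fun j => x' j a) i := by
    funext y
    refine propext (not_iff_not.1 ⟨fun h0 => ?_, fun h0 => ?_⟩)
    · simp only [IsHit, ne_eq, not_not] at h0 ⊢
      refine measure_mono_null (hsub _ (fun s => β i s (fun j => x j a) y) y)
        (measure_union_null h0 ?_)
      rw [symmDiff_comm]; exact hcon y
    · simp only [IsHit, ne_eq, not_not] at h0 ⊢
      exact measure_mono_null (hsub _ (fun s => β' i s (fun j => x' j a) y) y)
        (measure_union_null h0 (hcon y))
  have e1 := congrFun (h.eq_step ha hr.1.le (hr.2.trans hb) (hs.mono le_rfl hr.2)) i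
  have e2 := congrFun (h'.eq_step ha hr.1.le (hr.2.trans hb) (hs.mono le_rfl hr.2)) i
  have hstep : ∀ (p q : Fin d → Prop) (u v : Fin d), p = q → u = v →
      (if h : ∃ y, p y then h.choose else u) = if h : ∃ y, q y then h.choose else v := by
    rintro p q u v rfl rfl; rfl
  refine hne ?_
  rw [e1, e2, step, step]
  exact hstep _ _ _ _ hhit heq

lemma SolvesSDE.measurable_pair (hY : SolvesSDE P T Z Nm β Y) (hX : SolvesSDE P T Z Nm β' X) {t : ℝ}
    (ht : t ∈ Icc 0 T) : Measurable fun ω => ((fun j => Y j t ω), (fun j => X j t ω)) :=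
  (hY.measurable_state ht).prodMk (hX.measurable_state ht)

variable [IsProbabilityMeasure P]

/-- Once the two states at `a` are fixed, the acceptance regions are deterministic and the noise
after `a` is independent of them; the intensity between the regions is the integrated difference of
the rates. -/
lemma SolvesSDE.real_inter_symmDiff (hN : IsNoise P T M m₀ Z Nm) (hM : 0 ≤ M)
    (hβ : IsRegularFeedback M β) (hβ' : IsRegularFeedback M β') (hY : SolvesSDE P T Z Nm β Y)
    (hX : SolvesSDE P T Z Nm β' X) {a b : ℝ} (ha : 0 ≤ a) (hab : a ≤ b) (hb : b ≤ T) (i : Fin N)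
    (p : (Fin N → Fin d) × (Fin N → Fin d)) (y : Fin d) :
    P.real ({ω | ((fun j => Y j a ω), (fun j => X j a ω)) = p} ∩
      {ω | Nm i ω (symmDiff (region a b (fun s => β i s p.1 y) y)
        (region a b (fun s => β' i s p.2 y) y)) ≠ 0}) ≤
      P.real {ω | ((fun j => Y j a ω), (fun j => X j a ω)) = p} *
        ∫ r in a..b, |β i r p.1 y - β' i r p.2 y| := by
  have hc : Continuous fun s => β i s p.1 y := hβ.continuous i p.1 y
  have hc' : Continuous fun s => β' i s p.2 y := hβ'.continuous i p.2 y
  have hm := (measurableSet_region a b hc.measurable y).symmDiff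
    (measurableSet_region a b hc'.measurable y)
  set D := symmDiff (region a b (fun s => β i s p.1 y) y)
        (region a b (fun s => β' i s p.2 y) y) with hD
  have hDsub : D ⊆ Ioi a ×ˢ univ := by
    rintro q (⟨hq, -⟩ | ⟨hq, -⟩) <;> exact ⟨hq.1.1, mem_univ _⟩
  have hmeas : MeasurableSet {μ : Fin N → Measure (ℝ × (Fin d → ℝ)) | μ i D ≠ 0} := by
    have : Measurable fun μ : Fin N → Measure (ℝ × (Fin d → ℝ)) => μ i D :=
      (Measure.measurable_coe hm).comp (measurable_pi_apply i)
    exact (this (measurableSet_singleton 0)).compl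
  have h := indepFun_real_inter_eq_mul
    (SolvesSDE.indepFun_pair hN hM hβ hβ' hY hX ⟨ha, hab.trans hb⟩)
    (measurableSet_singleton p) hmeas
  have e : (fun ω i => (Nm i ω).restrict (Ioi a ×ˢ univ)) ⁻¹'
      {μ : Fin N → Measure (ℝ × (Fin d → ℝ)) | μ i D ≠ 0} = {ω | Nm i ω D ≠ 0} := by
    ext ω
    simp only [mem_preimage, mem_ofPred_eq]
    rw [Measure.restrict_apply' (measurableSet_Ioi.prod MeasurableSet.univ),
      inter_eq_left.2 hDsub]
  rw [e] at h
  refine h.le.trans (mul_le_mul_of_nonneg_left ?_ measureReal_nonneg)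
  exact ((hN.poisson i).real_ne_zero_le hm).trans
    (intensity_symmDiff_region_le ha hab hb hc hc' y)

lemma SolvesSDE.real_separate_le (hN : IsNoise P T M m₀ Z Nm) (hM : 0 ≤ M)
    (hβ : IsRegularFeedback M β) (hβ' : IsRegularFeedback M β') (hY : SolvesSDE P T Z Nm β Y)
    (hX : SolvesSDE P T Z Nm β' X) {a b : ℝ} (ha : 0 ≤ a) (hab : a ≤ b) (hb : b ≤ T)
    (i : Fin N) :
    P.real {ω | Y i a ω = X i a ω ∧ ∃ r ∈ Ioc a b, Y i r ω ≠ X i r ω} ≤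
      (∫ r in a..b, ∫ ω, rateGap β β' i r ((fun j => Y j a ω), (fun j => X j a ω)) ∂P) +
        (N + (N : ℝ) ^ 2) * (d * M) ^ 2 * (b - a) ^ 2 := by
  classical
  have haT : a ∈ Icc 0 T := ⟨ha, hab.trans hb⟩
  have hmp : Measurable fun ω => ((fun j => Y j a ω), (fun j => X j a ω)) :=
    (hY.measurable_state haT).prodMk (hX.measurable_state haT)
  -- The event starts from agreement at player `i`, so only pairs of states that agree there count.
  -- This is why `rateGap` vanishes on the other pairs.
  let S : (Fin N → Fin d) × (Fin N → Fin d) → Fin d → Set Ω := fun p y =>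
    if p.1 i = p.2 i then {ω | ((fun j => Y j a ω), (fun j => X j a ω)) = p} ∩
      {ω | Nm i ω (symmDiff (region a b (fun s => β i s p.1 y) y)
        (region a b (fun s => β' i s p.2 y) y)) ≠ 0} else ∅
  have hsub : P.real {ω | Y i a ω = X i a ω ∧ ∃ r ∈ Ioc a b, Y i r ω ≠ X i r ω} ≤
      P.real ((⋃ p, ⋃ y, S p y) ∪ {ω | ¬ IsSparse (fun i => Nm i ω) a b}) := by
    rw [measureReal_def, measureReal_def]
    refine ENNReal.toReal_mono (measure_ne_top _ _) (measure_mono_ae ?_)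
    filter_upwards [hN.ae_isPath hX, hN.ae_isPath hY] with ω h1 h2 h3
    obtain ⟨heq, r, hr, hne⟩ := h3
    by_cases hs : IsSparse (fun i => Nm i ω) a b
    · obtain ⟨y, hy⟩ := exists_symmDiff_ne_zero h2 h1 ha hr hb hs heq hne
      refine Or.inl (mem_iUnion.2 ⟨((fun j => Y j a ω), (fun j => X j a ω)),
        mem_iUnion.2 ⟨y, ?_⟩⟩)
      simp only [S]
      rw [if_pos heq]
      exact ⟨rfl, hy⟩
    · exact Or.inr hs
  have hS : ∀ p y, P.real (S p y) ≤ P.real {ω | ((fun j => Y j a ω), (fun j => X j a ω)) = p} *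
      if p.1 i = p.2 i then ∫ r in a..b, |β i r p.1 y - β' i r p.2 y| else 0 := by
    intro p y
    by_cases hp : p.1 i = p.2 i
    · simp only [S, if_pos hp]
      exact SolvesSDE.real_inter_symmDiff hN hM hβ hβ' hY hX ha hab hb i p y
    · simp [S, if_neg hp]
  have hint : ∫ r in a..b, ∫ ω, rateGap β β' i r ((fun j => Y j a ω), (fun j => X j a ω)) ∂P =
      ∑ p, ∑ y, P.real {ω | ((fun j => Y j a ω), (fun j => X j a ω)) = p} *
        if p.1 i = p.2 i then ∫ r in a..b, |β i r p.1 y - β' i r p.2 y| else 0 := by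
    have e : ∀ r, ∫ ω, rateGap β β' i r ((fun j => Y j a ω), (fun j => X j a ω)) ∂P =
        ∑ p, P.real {ω | ((fun j => Y j a ω), (fun j => X j a ω)) = p} *
          rateGap β β' i r p := fun r => integral_comp_fintype hmp (rateGap β β' i r)
    simp_rw [e]
    have hc : ∀ p, Continuous fun r =>
        P.real {ω | ((fun j => Y j a ω), (fun j => X j a ω)) = p} * rateGap β β' i r p :=
      fun p => continuous_const.mul (continuous_rateGap hβ hβ' i p)
    rw [intervalIntegral.integral_finsetSum fun p _ => (hc p).intervalIntegrable _ _]
    refine Finset.sum_congr rfl fun p _ => ?_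
    rw [intervalIntegral.integral_const_mul, ← Finset.mul_sum]
    congr 1
    by_cases hp : p.1 i = p.2 i
    · simp only [rateGap, if_pos hp]
      have hc' : ∀ y, Continuous fun r => |β i r p.1 y - β' i r p.2 y| := fun y =>
        ((hβ.continuous i p.1 y).sub (hβ'.continuous i p.2 y)).abs
      rw [intervalIntegral.integral_finsetSum fun y _ => (hc' y).intervalIntegrable _ _]
    · simp [rateGap, if_neg hp]
  rw [hint]
  refine hsub.trans ((measureReal_union_le _ _).trans (add_le_add ?_
    (hN.real_not_isSparse_le hM ha hab hb)))
  exact (measureReal_iUnion_fintype_le _).trans (Finset.sum_le_sum fun p _ =>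
    (measureReal_iUnion_fintype_le _).trans (Finset.sum_le_sum fun y _ => hS p y))

lemma SolvesSDE.real_pair_ne_le (hN : IsNoise P T M m₀ Z Nm) (hM : 0 ≤ M)
    (hY : SolvesSDE P T Z Nm β Y) (hX : SolvesSDE P T Z Nm β' X) {a b : ℝ} (ha : 0 ≤ a)
    (hab : a ≤ b) (hb : b ≤ T) :
    P.real {ω | (((fun j => Y j b ω), (fun j => X j b ω)) :
      (Fin N → Fin d) × (Fin N → Fin d)) ≠ ((fun j => Y j a ω), (fun j => X j a ω))} ≤
      2 * (N * (d * M)) * (b - a) := by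
  have hs : {ω | (((fun j => Y j b ω), (fun j => X j b ω)) :
      (Fin N → Fin d) × (Fin N → Fin d)) ≠ ((fun j => Y j a ω), (fun j => X j a ω))} ⊆
      {ω | (fun j => Y j b ω) ≠ fun j => Y j a ω} ∪
        {ω | (fun j => X j b ω) ≠ fun j => X j a ω} := by
    intro ω hω
    by_contra hcon
    simp only [mem_union, mem_ofPred_eq, not_or, ne_eq, not_not] at hcon
    exact hω (Prod.ext hcon.1 hcon.2)
  refine (measureReal_mono hs).trans ((measureReal_union_le _ _).trans ?_)
  linarith [hY.real_state_ne_le hN hM ha hab hb, hX.real_state_ne_le hN hM ha hab hb]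

lemma SolvesSDE.continuousOn_integral_pair (hN : IsNoise P T M m₀ Z Nm) (hM : 0 ≤ M)
    (hY : SolvesSDE P T Z Nm β Y) (hX : SolvesSDE P T Z Nm β' X)
    {φ : ℝ → (Fin N → Fin d) × (Fin N → Fin d) → ℝ}
    (hφ : ∀ p, ContinuousOn (fun r => φ r p) (Icc 0 T)) :
    ContinuousOn (fun r => ∫ ω, φ r ((fun j => Y j r ω), (fun j => X j r ω)) ∂P) (Icc 0 T) :=
  continuousOn_integral_comp (W := fun r ω => ((fun j => Y j r ω), (fun j => X j r ω)))
    (fun _ hr => hY.measurable_pair hX hr)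
    (fun _ _ ha hab hb => SolvesSDE.real_pair_ne_le hN hM hY hX ha hab hb) hφ

/-- Two solutions driven by the same noise separate at most at the rate given by the difference of
their feedbacks. -/
theorem SolvesSDE.real_exists_ne_le (hN : IsNoise P T M m₀ Z Nm) (hM : 0 ≤ M)
    (hβ : IsRegularFeedback M β) (hβ' : IsRegularFeedback M β') (hY : SolvesSDE P T Z Nm β Y)
    (hX : SolvesSDE P T Z Nm β' X) (i : Fin N) {t : ℝ} (ht : t ∈ Icc 0 T) :
    P.real {ω | ∃ r ∈ Icc 0 t, Y i r ω ≠ X i r ω} ≤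
      ∫ r in (0 : ℝ)..t, ∫ ω, rateGap β β' i r ((fun j => Y j r ω), (fun j => X j r ω)) ∂P := by
  have hW : ∀ r ∈ Icc 0 T, Measurable fun ω => ((fun j => Y j r ω), (fun j => X j r ω)) :=
    fun r hr => hY.measurable_pair hX hr
  have hL : ∀ a b, 0 ≤ a → a ≤ b → b ≤ T →
      P.real {ω | (((fun j => Y j b ω), (fun j => X j b ω)) :
        (Fin N → Fin d) × (Fin N → Fin d)) ≠ ((fun j => Y j a ω), (fun j => X j a ω))} ≤
        2 * (N * (d * M)) * (b - a) := fun _ _ ha hab hb =>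
    SolvesSDE.real_pair_ne_le hN hM hY hX ha hab hb
  have hcont := SolvesSDE.continuousOn_integral_pair hN hM hY hX
    fun p => (continuous_rateGap hβ hβ' i p).continuousOn
  have hint : ∀ a b, 0 ≤ a → a ≤ b → b ≤ T → IntervalIntegrable
      (fun r => ∫ ω, rateGap β β' i r ((fun j => Y j r ω), (fun j => X j r ω)) ∂P)
      volume a b := by
    intro a b ha hab hb
    refine ContinuousOn.intervalIntegrable ?_
    rw [uIcc_of_le hab]
    exact hcont.mono (Icc_subset_Icc ha hb)
  -- The event is an uncountable union over times; measurability is not needed for it, only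
  -- monotonicity and subadditivity of the measure. The increments of `Q` are bounded from above
  -- only, so `Q` is nonincreasing.
  have key := le_of_forall_sub_le_sq (T := T)
    (Q := fun s => P.real {ω | ∃ r ∈ Icc 0 s, Y i r ω ≠ X i r ω} -
      ∫ r in (0 : ℝ)..s, ∫ ω, rateGap β β' i r ((fun j => Y j r ω), (fun j => X j r ω)) ∂P)
    (C := (N + (N : ℝ) ^ 2) * (d * M) ^ 2 + 2 * (d * M) * (2 * (N * (d * M))))
    (fun a b ha hab hb => ?_) le_rfl ht.1 ht.2
  · have h0 : P.real {ω | ∃ r ∈ Icc (0 : ℝ) 0, Y i r ω ≠ X i r ω} = 0 := by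
      rw [measureReal_eq_zero_iff, ← nonpos_iff_eq_zero]
      refine (measure_mono_ae (t := ∅) ?_).trans_eq measure_empty
      filter_upwards [hN.ae_isPath hX, hN.ae_isPath hY] with ω h1 h2 h3
      obtain ⟨r, hr, hne⟩ := h3
      rw [Icc_self, mem_singleton_iff] at hr
      subst hr
      exact hne ((h2.zero (ht.1.trans ht.2) i).trans (h1.zero (ht.1.trans ht.2) i).symm)
    simp only [intervalIntegral.integral_same, h0] at key
    linarith
  · have h1 := SolvesSDE.real_separate_le hN hM hβ hβ' hY hX ha hab hb i
    have h2 := abs_integral_integral_comp_sub_le (P := P)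
      (W := fun r ω => ((fun j => Y j r ω), (fun j => X j r ω))) hW
      (L := 2 * (N * (d * M))) (by positivity) hL (continuous_rateGap hβ hβ' i)
      (B := d * M) (by positivity) (abs_rateGap_le hM hβ hβ' i) ha hab hb
    have h3 := intervalIntegral.integral_add_adjacent_intervals
      (hint 0 a le_rfl ha (hab.trans hb)) (hint a b ha hab hb)
    have h4 : P.real {ω | ∃ r ∈ Icc 0 b, Y i r ω ≠ X i r ω} ≤
        P.real {ω | ∃ r ∈ Icc 0 a, Y i r ω ≠ X i r ω} +
        P.real {ω | Y i a ω = X i a ω ∧ ∃ r ∈ Ioc a b, Y i r ω ≠ X i r ω} := by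
      refine (measureReal_mono ?_).trans (measureReal_union_le _ _)
      rintro ω ⟨r, hr, hne⟩
      by_cases hω : ∃ r ∈ Icc 0 a, Y i r ω ≠ X i r ω
      · exact Or.inl hω
      · push Not at hω
        refine Or.inr ⟨hω a ⟨ha, le_rfl⟩, r, ⟨?_, hr.2⟩, hne⟩
        by_contra! hra
        exact hne (hω r ⟨hr.1, hra⟩)
    rw [abs_le] at h2
    nlinarith [h2.1, h2.2]

end Coupling

/-! ### Changing feedbacks outside the horizon. -/

section Feedback

variable {d N : ℕ} {Ω : Type*} [MeasurableSpace Ω] {P : Measure Ω} {T M : ℝ} {m₀ : Vec d}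
  {Z : Fin N → Ω → Fin d} {Nm : Fin N → Ω → Measure (ℝ × (Fin d → ℝ))}
  {β β' : Fin N → ℝ → (Fin N → Fin d) → Vec d} {X : Fin N → ℝ → Ω → Fin d}

lemma SolvesSDE.congr (hX : SolvesSDE P T Z Nm β X)
    (h : ∀ i, ∀ t ∈ Icc 0 T, ∀ x, β i t x = β' i t x) : SolvesSDE P T Z Nm β' X where
  measurable := hX.measurable
  cadlag := hX.cadlag
  eqn := by
    filter_upwards [hX.eqn] with ω hω i t ht
    rw [hω i t ht]
    congr 1
    refine setIntegral_congr_fun (measurableSet_Ioc.prod MeasurableSet.univ) fun q hq => ?_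
    have hq1 : q.1 ∈ Icc 0 T := ⟨hq.1.1.le, hq.1.2.trans ht.2⟩
    simp only [h i q.1 hq1]

/-- The feedback stopped outside of the time interval `[0,T]`. -/
def clampFeedback (T : ℝ) (β : Fin N → ℝ → (Fin N → Fin d) → Vec d) :
    Fin N → ℝ → (Fin N → Fin d) → Vec d := fun i t => β i (max 0 (min t T))

lemma clampFeedback_eq {t : ℝ} (ht : t ∈ Icc 0 T) (i : Fin N) (x : Fin N → Fin d) :
    clampFeedback T β i t x = β i t x := by
  rw [clampFeedback, min_eq_left ht.2, max_eq_right ht.1]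

lemma isRegularFeedback_clampFeedback (hT : 0 ≤ T)
    (hc : ∀ i x y, ContinuousOn (fun t => β i t x y) (Icc 0 T))
    (h0 : ∀ i, ∀ t ∈ Icc 0 T, ∀ x y, 0 ≤ β i t x y)
    (hM : ∀ i, ∀ t ∈ Icc 0 T, ∀ x y, β i t x y ≤ M) :
    IsRegularFeedback M (clampFeedback T β) := by
  have hmem : ∀ t : ℝ, max 0 (min t T) ∈ Icc 0 T := fun t =>
    ⟨le_max_left _ _, max_le hT (min_le_right _ _)⟩
  exact ⟨fun i x y => (hc i x y).comp_continuous (by fun_prop) hmem,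
    fun i t x y => h0 i _ (hmem t) x y, fun i t x y => hM i _ (hmem t) x y⟩

lemma SolvesSDE.clamp (hX : SolvesSDE P T Z Nm β X) :
    SolvesSDE P T Z Nm (clampFeedback T β) X :=
  hX.congr fun i _ ht x => (clampFeedback_eq ht i x).symm

end Feedback

/-! ### Decoupled players are i.i.d. -/

section Decoupled

variable {d N : ℕ} {Ω : Type*} [MeasurableSpace Ω] {P : Measure Ω}
  {T M : ℝ} {m₀ : Vec d}
  {Z : Fin N → Ω → Fin d} {Nm : Fin N → Ω → Measure (ℝ × (Fin d → ℝ))}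
  {X : Fin N → ℝ → Ω → Fin d}

/-- When the rates ignore the other players, each component is a one-player system, and one
functional of the noise serves all of them. -/
lemma SolvesSDE.single {γ : ℝ → Fin d → Vec d}
    (hX : SolvesSDE P T Z Nm (fun i t x => γ t (x i)) X) (i : Fin N) :
    SolvesSDE P T (fun _ : Fin 1 => Z i) (fun _ => Nm i) (fun j t x => γ t (x j))
      (fun _ => X i) where
  measurable _ := hX.measurable i
  cadlag := by filter_upwards [hX.cadlag] with ω hω _ using hω i
  eqn := by filter_upwards [hX.eqn] with ω hω _ using hω i

variable [IsProbabilityMeasure P]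

lemma IsNoise.single (hN : IsNoise P T M m₀ Z Nm) (i : Fin N) :
    IsNoise P T M m₀ (fun _ : Fin 1 => Z i) (fun _ => Nm i) where
  poisson _ := hN.poisson i
  indep_poisson := iIndepFun.of_subsingleton
  measurable_init _ := hN.measurable_init i
  law_init _ := hN.law_init i
  indep_init := iIndepFun.of_subsingleton
  indep := hN.indep.comp (φ := fun z (_ : Fin 1) => z i) (ψ := fun μ (_ : Fin 1) => μ i)
    (measurable_pi_lambda _ fun _ => measurable_pi_apply i)
    (measurable_pi_lambda _ fun _ => measurable_pi_apply i)

/-- The joint law is the product of the laws of all initial states and of all Poisson measures;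
transposing a pair of vectors into a vector of pairs turns it into a product over players. -/
lemma IsNoise.iIndepFun_pair (hN : IsNoise P T M m₀ Z Nm) :
    iIndepFun (fun i ω => (Z i ω, Nm i ω)) P := by
  have hZ := hN.measurable_init
  have hNm : ∀ i, Measurable (Nm i) := fun i => (hN.poisson i).measurable
  have hp : ∀ i, Measurable fun ω => (Z i ω, Nm i ω) := fun i => (hZ i).prodMk (hNm i)
  have : ∀ i, IsProbabilityMeasure (P.map (Z i)) := fun i =>
    Measure.isProbabilityMeasure_map (hZ i).aemeasurable
  have : ∀ i, IsProbabilityMeasure (P.map (Nm i)) := fun i =>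
    Measure.isProbabilityMeasure_map (hNm i).aemeasurable
  have hZN : ∀ i, P.map (fun ω => (Z i ω, Nm i ω)) = (P.map (Z i)).prod (P.map (Nm i)) :=
    fun i => (indepFun_iff_map_prod_eq_prod_map_map (hZ i).aemeasurable
      (hNm i).aemeasurable).1 (hN.indep.comp (measurable_pi_apply i) (measurable_pi_apply i))
  rw [iIndepFun_iff_map_fun_eq_pi_map fun i => (hp i).aemeasurable]
  simp_rw [hZN]
  have hmp := measurePreserving_arrowProdEquivProdArrow (Fin d) (Measure (ℝ × (Fin d → ℝ))) (Fin N)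
    (fun i => P.map (Z i)) (fun i => P.map (Nm i))
  rw [← (hmp.symm _).map_eq, ← hN.indep_init.map_fun_eq_pi_map fun i => (hZ i).aemeasurable,
    ← hN.indep_poisson.map_fun_eq_pi_map fun i => (hNm i).aemeasurable,
    ← (indepFun_iff_map_prod_eq_prod_map_map (measurable_pi_lambda _ hZ).aemeasurable
      (measurable_pi_lambda _ hNm).aemeasurable).1 hN.indep,
    Measure.map_map (MeasurableEquiv.measurable _)
      ((measurable_pi_lambda _ hZ).prodMk (measurable_pi_lambda _ hNm))]
  rfl

lemma map_eq_of_lawVec_eq {X X' : Ω → Fin d} (hX : Measurable X) (hX' : Measurable X')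
    (h : lawVec P X = lawVec P X') : P.map X = P.map X' := by
  refine Measure.ext_of_singleton fun x => ?_
  rw [Measure.map_apply hX (measurableSet_singleton x),
    Measure.map_apply hX' (measurableSet_singleton x)]
  have := congrArg (fun v : Vec d => v x) h
  exact (measureReal_eq_measureReal_iff).1 this

lemma IsNoise.identDistrib_pair (hN : IsNoise P T M m₀ Z Nm) (i j : Fin N) :
    IdentDistrib (fun ω => (Z i ω, Nm i ω)) (fun ω => (Z j ω, Nm j ω)) P P := by
  have h1 : IdentDistrib (Z i) (Z j) P P :=
    ⟨(hN.measurable_init i).aemeasurable, (hN.measurable_init j).aemeasurable,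
      map_eq_of_lawVec_eq (hN.measurable_init i) (hN.measurable_init j)
        ((hN.law_init i).trans (hN.law_init j).symm)⟩
  exact h1.prodMk ((hN.poisson i).identDistrib (hN.poisson j))
    (hN.indep.comp (measurable_pi_apply i) (measurable_pi_apply i))
    (hN.indep.comp (measurable_pi_apply j) (measurable_pi_apply j))

/-- A decoupled solution is a functional, the same for all players, of the noise of the
player. -/
lemma exists_single_functional (hM : 0 ≤ M) (hN : IsNoise P T M m₀ Z Nm)
    {γ : ℝ → Fin d → Vec d}
    (hγ : IsRegularFeedback M (fun (i : Fin 1) t (x : Fin 1 → Fin d) => γ t (x i)))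
    (hX : SolvesSDE P T Z Nm (fun i t x => γ t (x i)) X) :
    ∃ Ψ : Fin d × Measure (ℝ × (Fin d → ℝ)) → Icc 0 T → Fin d, Measurable Ψ ∧
      ∀ i (t : Icc 0 T), (fun ω => X i t ω) =ᵐ[P] fun ω => Ψ (Z i ω, Nm i ω) t := by
  choose Φ hΦ h using fun t : Icc 0 T => exists_adapted_functional hM hγ t.2
  refine ⟨fun p t => Φ t (fun _ => p.1, fun _ => p.2.restrict (Iic (t : ℝ) ×ˢ univ)) 0, ?_, ?_⟩
  · refine measurable_pi_lambda _ fun t => (measurable_pi_apply 0).comp ((hΦ t).comp ?_)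
    exact (measurable_pi_lambda _ fun _ => measurable_fst).prodMk
      (measurable_pi_lambda _ fun _ => (measurable_restrict_measure
        (measurableSet_Iic.prod MeasurableSet.univ)).comp measurable_snd)
  · intro i t
    filter_upwards [h t P m₀ _ _ _ (hN.single i) (hX.single i)] with ω hω
    exact congrFun hω 0

/-- Independence passes from the noise of the players to one functional of it. Almost sure equality
at each single time suffices, because the path σ-algebra is generated by the coordinates. -/
theorem SolvesSDE.iIndepFun_path (hM : 0 ≤ M) (hN : IsNoise P T M m₀ Z Nm)
    {γ : ℝ → Fin d → Vec d}
    (hγ : IsRegularFeedback M (fun (i : Fin 1) t (x : Fin 1 → Fin d) => γ t (x i)))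
    (hX : SolvesSDE P T Z Nm (fun i t x => γ t (x i)) X) :
    iIndepFun (fun i ω (t : Icc 0 T) => X i t ω) P := by
  obtain ⟨Ψ, hΨ, h⟩ := exists_single_functional hM hN hγ hX
  exact iIndepFun.process_congr (X := fun i t ω => Ψ (Z i ω, Nm i ω) t)
    (hN.iIndepFun_pair.comp (fun _ => Ψ) fun _ => hΨ) fun i t => (h i t).symm

theorem SolvesSDE.identDistrib_path (hM : 0 ≤ M) (hN : IsNoise P T M m₀ Z Nm)
    {γ : ℝ → Fin d → Vec d}
    (hγ : IsRegularFeedback M (fun (i : Fin 1) t (x : Fin 1 → Fin d) => γ t (x i)))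
    (hX : SolvesSDE P T Z Nm (fun i t x => γ t (x i)) X) (i j : Fin N) :
    IdentDistrib (fun ω (t : Icc 0 T) => X i t ω) (fun ω (t : Icc 0 T) => X j t ω) P P := by
  obtain ⟨Ψ, hΨ, h⟩ := exists_single_functional hM hN hγ hX
  have hm : ∀ k, AEMeasurable (fun ω (t : Icc 0 T) => X k t ω) P := fun k =>
    (measurable_pi_lambda _ fun t : Icc 0 T => hX.measurable k t t.2).aemeasurable
  have hpair : ∀ k, Measurable fun ω => (Z k ω, Nm k ω) := fun k =>
    (hN.measurable_init k).prodMk (hN.poisson k).measurable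
  have hm' : ∀ k, AEMeasurable (fun ω (t : Icc 0 T) => Ψ (Z k ω, Nm k ω) t) P := fun k =>
    (hΨ.comp (hpair k)).aemeasurable
  refine ⟨hm i, hm j, ?_⟩
  rw [map_eq_of_forall_ae_eq (X := fun (t : Icc 0 T) ω => X i t ω) (hm i) (hm' i) (h i),
    map_eq_of_forall_ae_eq (X := fun (t : Icc 0 T) ω => X j t ω) (hm j) (hm' j) (h j)]
  exact ((hN.identDistrib_pair i j).comp hΨ).map_eq

end Decoupled

/-! ### The Kolmogorov equation for the law of a player. -/

section Law

variable {d N : ℕ} {Ω : Type*} [MeasurableSpace Ω] {P : Measure Ω} [IsProbabilityMeasure P]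
  {T M : ℝ} {m₀ : Vec d}
  {Z : Fin N → Ω → Fin d} {Nm : Fin N → Ω → Measure (ℝ × (Fin d → ℝ))}
  {X : Fin N → ℝ → Ω → Fin d}

lemma lawVec_mem_simplex {X : Ω → Fin d} (hX : Measurable X) : lawVec P X ∈ simplex d := by
  refine ⟨fun x => measureReal_nonneg, ?_⟩
  have := integral_comp_fintype (P := P) hX (fun _ => (1 : ℝ))
  simpa [lawVec] using this.symm

lemma SolvesSDE.continuousOn_lawVec {β : Fin N → ℝ → (Fin N → Fin d) → Vec d}
    (hX : SolvesSDE P T Z Nm β X) (hN : IsNoise P T M m₀ Z Nm) (hM : 0 ≤ M) (i : Fin N) :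
    ContinuousOn (fun t => lawVec P (X i t)) (Icc 0 T) := by
  have h : ∀ x, ContinuousOn (fun t => lawVec P (X i t) x) (Icc 0 T) := fun x =>
    continuousOn_real_eq (W := fun t ω => X i t ω) (L := d * M) (hX.measurable i)
      (fun a b ha hab hb => hX.real_ne_le hN hM i ha hab hb) x
  exact (PiLp.continuous_toLp 2 _).comp_continuousOn (continuousOn_pi.2 h)

/-- The drift of the Kolmogorov equation with transition rates `γ`. -/
def kolmogorovDrift (γ : Fin d → Vec d) (m : Vec d) (z : Fin d) : ℝ :=
  ∑ y, m y * γ y z - m z * ∑ y, γ z y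

lemma kolmogorovDrift_eq_erase (γ : Fin d → Vec d) (m : Vec d) (z : Fin d) :
    kolmogorovDrift γ m z = ∑ y ∈ Finset.univ.erase z, m y * γ y z -
      m z * ∑ y ∈ Finset.univ.erase z, γ z y := by
  rw [kolmogorovDrift, ← Finset.sum_erase_add _ _ (Finset.mem_univ z),
    ← Finset.sum_erase_add _ (fun y => γ z y) (Finset.mem_univ z)]
  ring

/-- The law of a player with decoupled dynamics solves the Kolmogorov equation. -/
theorem SolvesSDE.hasDerivWithinAt_lawVec (hM : 0 ≤ M) (hN : IsNoise P T M m₀ Z Nm)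
    {γ : Fin N → ℝ → Fin d → Vec d}
    (hγ : IsRegularFeedback M (fun i t (x : Fin N → Fin d) => γ i t (x i)))
    (hX : SolvesSDE P T Z Nm (fun i t x => γ i t (x i)) X) (i : Fin N) (z : Fin d) {t : ℝ}
    (ht : t ∈ Icc 0 T) :
    HasDerivWithinAt (fun s => lawVec P (X i s) z)
      (kolmogorovDrift (γ i t) (lawVec P (X i t)) z) (Icc 0 T) t := by
  classical
  have h := hX.hasDerivWithinAt_integral hN hM hγ (fun x => if x i = z then 1 else 0) ht
  have e1 : ∀ s ∈ Icc 0 T, lawVec P (X i s) z =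
      ∫ ω, (fun x : Fin N → Fin d => if x i = z then (1 : ℝ) else 0) (fun i => X i s ω) ∂P := by
    intro s hs
    have := integral_comp_fintype (P := P) (hX.measurable i s hs)
      (fun x => if x = z then (1 : ℝ) else 0)
    simp only [this]
    simp [lawVec]
  have e2 : ∫ ω, generator (fun i t (x : Fin N → Fin d) => γ i t (x i))
      (fun x => if x i = z then 1 else 0) t (fun i => X i t ω) ∂P =
      kolmogorovDrift (γ i t) (lawVec P (X i t)) z := by
    have hg : ∀ x : Fin N → Fin d, generator (fun i t (x : Fin N → Fin d) => γ i t (x i))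
        (fun x => if x i = z then 1 else 0) t x =
        γ i t (x i) z - if x i = z then ∑ y, γ i t z y else 0 := by
      intro x
      rw [generator, Finset.sum_eq_single i]
      · simp only [Function.update_self, mul_sub, Finset.sum_sub_distrib, mul_ite, mul_one,
          mul_zero, Finset.sum_ite_eq', Finset.mem_univ, if_true]
        congr 1
        split_ifs with hx
        · rw [hx]
        · simp
      · intro k _ hk
        refine Finset.sum_eq_zero fun y _ => ?_
        rw [Function.update_of_ne hk.symm, sub_self, mul_zero]
      · simp
    simp_rw [hg]
    have := integral_comp_fintype (P := P) (hX.measurable i t ht)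
      (fun x => γ i t x z - if x = z then ∑ y, γ i t z y else 0)
    rw [this]
    simp only [mul_sub, Finset.sum_sub_distrib, kolmogorovDrift, lawVec, mul_ite, mul_zero,
      Finset.sum_ite_eq', Finset.mem_univ, if_true]
  rw [e2] at h
  exact h.congr e1 (e1 t ht)

end Law

/-! ### A backward maximum principle. -/

section MaximumPrinciple

/-- A function which increases to the right of `t` cannot have `t` as a right maximum. -/
lemma nonpos_of_hasDerivWithinAt_of_le {h : ℝ → ℝ} {h' t T : ℝ} (ht : t ∈ Ico 0 T)
    (hd : HasDerivWithinAt h h' (Icc 0 T) t) (hmax : ∀ s ∈ Icc t T, h s ≤ h t) : h' ≤ 0 := by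
  have hd' : HasDerivWithinAt h h' (Ioc t T) t := hd.mono fun s hs => ⟨ht.1.trans hs.1.le, hs.2⟩
  rw [hasDerivWithinAt_iff_tendsto_slope' (fun h => lt_irrefl _ h.1)] at hd'
  have : NeBot (𝓝[Ioc t T] t) := by
    rw [nhdsWithin_Ioc_eq_nhdsGT ht.2]; infer_instance
  refine le_of_tendsto hd' ?_
  filter_upwards [self_mem_nhdsWithin] with s hs
  rw [slope_def_field]
  exact div_nonpos_of_nonpos_of_nonneg (by linarith [hmax s ⟨hs.1.le, hs.2⟩])
    (by linarith [hs.1])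

/-- The maximum principle on a compact set (with finitely many components). -/
theorem le_of_deriv_ge_at_max {ι E : Type*} [Finite ι] [TopologicalSpace E] {S : Set E}
    (hS : IsCompact S) {T c c₀ : ℝ} {f : ℝ → ι → E → ℝ}
    (hf : ∀ i, ContinuousOn (fun q : ℝ × E => f q.1 i q.2) (Icc 0 T ×ˢ S))
    (hd : ∀ t ∈ Ico 0 T, ∀ i, ∀ s ∈ S, (∀ j, ∀ s' ∈ S, f t j s' ≤ f t i s) →
      ∃ f', HasDerivWithinAt (fun r => f r i s) f' (Icc 0 T) t ∧ -c ≤ f')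
    (hT : ∀ i, ∀ s ∈ S, f T i s ≤ c₀) :
    ∀ t ∈ Icc 0 T, ∀ i, ∀ s ∈ S, f t i s ≤ c₀ + c * (T - t) := by
  intro t ht i s hs
  refine le_of_forall_pos_le_add fun ε' hε' => ?_
  -- Chosen so that `ε (T - t) ≤ ε'`; the `+ 1` keeps the denominator positive at `t = T`.
  set ε := ε' / (T - t + 1) with hε
  have hTt : 0 < T - t + 1 := by linarith [ht.2]
  have hεpos : 0 < ε := by positivity
  -- The slope `c + ε` excludes a maximum before `T`: there the time derivative would be at least `ε
  -- > 0`, while a maximum from the right makes it nonpositive.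
  let g : ι → ℝ × E → ℝ := fun i q => f q.1 i q.2 - (c + ε) * (T - q.1)
  have hg : ∀ i, ContinuousOn (g i) (Icc 0 T ×ˢ S) := fun i => (hf i).sub (by fun_prop)
  have hne : (Icc 0 T ×ˢ S).Nonempty := ⟨(t, s), ht, hs⟩
  choose q hq hqmax using fun i => (isCompact_Icc.prod hS).exists_isMaxOn hne (hg i)
  have : Nonempty ι := ⟨i⟩
  obtain ⟨j, hj⟩ := Finite.exists_max fun i => g i (q i)
  have hall : ∀ i, ∀ r ∈ Icc 0 T, ∀ s ∈ S, g i (r, s) ≤ g j (q j) := fun i r hr s hs =>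
    (hqmax i (show (r, s) ∈ Icc 0 T ×ˢ S from ⟨hr, hs⟩)).trans (hj i)
  have hle : g j (q j) ≤ c₀ := by
    rcases eq_or_lt_of_le (hq j).1.2 with hT' | hT'
    · simp only [g]
      rw [hT']
      linarith [hT j (q j).2 (hq j).2]
    · exfalso
      have hmem : (q j).1 ∈ Ico 0 T := ⟨(hq j).1.1, hT'⟩
      obtain ⟨f', hf', hcf⟩ := hd (q j).1 hmem j (q j).2 (hq j).2 fun k s' hs' => by
        have := hall k (q j).1 (hq j).1 s' hs'
        simp only [g] at this
        linarith
      have hder : HasDerivWithinAt (fun r => g j (r, (q j).2)) (f' - (c + ε) * (0 - 1))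
          (Icc 0 T) (q j).1 :=
        hf'.sub ((((hasDerivWithinAt_id _ _).const_sub T).congr_deriv (by simp)).const_mul _)
      have := nonpos_of_hasDerivWithinAt_of_le hmem hder fun r hr =>
        hall j r ⟨hmem.1.trans hr.1, hr.2⟩ _ (hq j).2
      linarith
  have h1 := (hall i t ht s hs).trans hle
  simp only [g] at h1
  have h2 : ε * (T - t) ≤ ε' := by
    rw [hε, div_mul_eq_mul_div, div_le_iff₀ hTt]
    nlinarith
  linarith

end MaximumPrinciple

/-! ### The simplex and transfers of mass. -/

section Simplex

variable {d : ℕ}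

lemma inner_eq_sum (a p : Vec d) : inner ℝ a p = ∑ y, a y * p y := by
  simp [PiLp.inner_apply, mul_comm]

lemma inner_dirac (a : Vec d) (y : Fin d) : inner ℝ a (dirac y) = a y := by
  simp [dirac, EuclideanSpace.inner_single_right]

lemma norm_dirac (y : Fin d) : ‖(dirac y : Vec d)‖ = 1 := by simp [dirac]

lemma norm_dirac_sub_le (y z : Fin d) : ‖(dirac z - dirac y : Vec d)‖ ≤ 2 := by
  refine (norm_sub_le _ _).trans ?_
  rw [norm_dirac, norm_dirac]; norm_num

lemma dirac_apply (y z : Fin d) : (dirac y : Vec d) z = if z = y then 1 else 0 := by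
  simp [dirac]

lemma dirac_mem_simplex (y : Fin d) : (dirac y : Vec d) ∈ simplex d := by
  refine ⟨fun x => ?_, ?_⟩
  · rw [dirac_apply]; split_ifs <;> norm_num
  · simp [dirac_apply]

lemma abs_apply_le_norm (v : Vec d) (y : Fin d) : |v y| ≤ ‖v‖ := by
  rw [← Real.norm_eq_abs]; exact PiLp.norm_apply_le v y

lemma norm_le_sum_abs (v : Vec d) : ‖v‖ ≤ ∑ y, |v y| := by
  have h : v = ∑ y, v y • (dirac y : Vec d) := by
    ext z
    simp [dirac_apply]
  calc ‖v‖ = ‖∑ y, v y • (dirac y : Vec d)‖ := by rw [← h]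
    _ ≤ ∑ y, ‖v y • (dirac y : Vec d)‖ := norm_sum_le _ _
    _ = ∑ y, |v y| := by simp [norm_smul, norm_dirac]

lemma sum_abs_le (v : Vec d) : ∑ y, |v y| ≤ d * ‖v‖ :=
  (Finset.sum_le_sum fun y _ => abs_apply_le_norm v y).trans (by simp)

lemma norm_le_one_of_mem_simplex {m : Vec d} (hm : m ∈ simplex d) : ‖m‖ ≤ 1 := by
  refine (norm_le_sum_abs m).trans_eq ?_
  rw [← hm.2]
  exact Finset.sum_congr rfl fun y _ => abs_of_nonneg (hm.1 y)

lemma norm_sub_le_two {m m' : Vec d} (hm : m ∈ simplex d) (hm' : m' ∈ simplex d) :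
    ‖m' - m‖ ≤ 2 := by
  linarith [norm_sub_le m' m, norm_le_one_of_mem_simplex hm, norm_le_one_of_mem_simplex hm']

lemma isCompact_simplex (d : ℕ) : IsCompact (simplex d) := by
  refine Metric.isCompact_of_isClosed_isBounded ?_ ?_
  · have : simplex d = (⋂ x, {m : Vec d | 0 ≤ m x}) ∩ {m | ∑ x, m x = 1} := by
      ext m; simp [simplex]
    rw [this]
    refine (isClosed_iInter fun x => isClosed_le continuous_const (by fun_prop)).inter
      (isClosed_eq (by fun_prop) continuous_const)
  · exact (Metric.isBounded_closedBall (x := (0 : Vec d)) (r := 1)).subset fun m hm => by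
      simpa using norm_le_one_of_mem_simplex hm

lemma exists_pos_of_mem_simplex {m : Vec d} (hm : m ∈ simplex d) : ∃ p, 0 < m p := by
  by_contra! h
  have : ∑ x, m x ≤ 0 := Finset.sum_nonpos fun x _ => h x
  rw [hm.2] at this
  linarith

lemma move_apply (m : Vec d) (c : ℝ) (y z w : Fin d) :
    (m + c • (dirac z - dirac y)) w =
      m w + c * ((if w = z then 1 else 0) - if w = y then 1 else 0) := by
  simp [dirac_apply]

lemma sum_move (m : Vec d) (c : ℝ) (y z : Fin d) :
    ∑ w, (m + c • (dirac z - dirac y)) w = ∑ w, m w := by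
  simp only [move_apply, Finset.sum_add_distrib, ← Finset.mul_sum, Finset.sum_sub_distrib]
  simp

lemma move_mem_simplex {m : Vec d} (hm : m ∈ simplex d) {c : ℝ} {y : Fin d} (h0 : 0 ≤ c)
    (hc : c ≤ m y) (z : Fin d) : m + c • (dirac z - dirac y) ∈ simplex d := by
  refine ⟨fun w => ?_, (sum_move m c y z).trans hm.2⟩
  rw [move_apply]
  have := hm.1 w
  by_cases h1 : w = y
  · subst h1
    split_ifs <;> simp <;> nlinarith
  · split_ifs <;> simp <;> nlinarith

end Simplex

/-! ### Second order calculus on the simplex. -/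

section SimplexCalculus

variable {d : ℕ} {φ : Vec d → ℝ} {D : Vec d → Fin d → Vec d} {Λ : ℝ≥0}

/-- The definition gives a derivative at the start of a transfer only. Shifting the base point along
the segment makes it a right derivative at every `s < c`, as the mean value inequality requires. -/
lemma IsC1Deriv.hasDerivWithinAt_Ici (h : Game.IsC1Deriv φ D) {m : Vec d} {c : ℝ} {y z : Fin d}
    (hm : m ∈ simplex d) (hc : c ≤ m y) {s : ℝ} (hs : s ∈ Ico 0 c) :
    HasDerivWithinAt (fun r => φ (m + r • (dirac z - dirac y)))
      (D (m + s • (dirac z - dirac y)) y z) (Ici s) s := by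
  have hms := move_mem_simplex hm hs.1 (hs.2.le.trans hc) z
  have h1 := h.1 _ hms y z
  have h2 : HasDerivWithinAt (fun r : ℝ => φ (m + s • (dirac z - dirac y) +
      r • (dirac z - dirac y))) (D (m + s • (dirac z - dirac y)) y z) (Ici 0) 0 := by
    refine h1.mono_of_mem_nhdsWithin ?_
    filter_upwards [Icc_mem_nhdsGE (sub_pos.2 hs.2)] with r hr
    refine ⟨hr.1, ?_⟩
    rw [add_assoc, ← add_smul]
    exact move_mem_simplex hm (add_nonneg hs.1 hr.1) (by linarith [hr.2]) z
  have h3 : HasDerivWithinAt (fun r : ℝ => r - s) 1 (Ici s) s :=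
    (hasDerivWithinAt_id _ _).sub_const _
  have h2' : HasDerivWithinAt (fun r : ℝ => φ (m + s • (dirac z - dirac y) +
      r • (dirac z - dirac y))) (D (m + s • (dirac z - dirac y)) y z) (Ici 0) (s - s) := by
    rwa [sub_self]
  have h4 := HasDerivWithinAt.comp (h := fun r : ℝ => r - s) s h2' h3 (fun r (hr : s ≤ r) => show 0 ≤ r - s from sub_nonneg.2 hr)
  rw [mul_one] at h4
  refine h4.congr_of_mem (fun r _ => ?_) self_mem_Ici
  simp only [Function.comp_apply]
  rw [add_assoc, ← add_smul, add_sub_cancel]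

lemma IsC1Deriv.self_eq_zero (h : Game.IsC1Deriv φ D) {m : Vec d} (hm : m ∈ simplex d)
    (y : Fin d) : D m y y = 0 := by
  have h1 := h.1 m hm y y
  have e : {s : ℝ | 0 ≤ s ∧ m + s • (dirac y - dirac y) ∈ simplex d} = Ici 0 := by
    ext s; simp [hm]
  rw [e] at h1
  have h2 : HasDerivWithinAt (fun s : ℝ => φ (m + s • (dirac y - dirac y))) 0 (Ici 0) 0 := by
    simpa using hasDerivWithinAt_const (0 : ℝ) (Ici (0 : ℝ)) (φ m)
  exact (uniqueDiffWithinAt_Ici 0).eq_deriv _ h1 h2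

/-- Second order estimate for a transfer of mass. -/
lemma IsC1Deriv.abs_move_sub_le (h : Game.IsC1Deriv φ D) (hφ : ContinuousOn φ (simplex d))
    (hL : ∀ y, LipschitzOnWith Λ (fun m => D m y) (simplex d)) {m : Vec d} (hm : m ∈ simplex d)
    {c : ℝ} {y : Fin d} (h0 : 0 ≤ c) (hc : c ≤ m y) (z : Fin d) :
    |φ (m + c • (dirac z - dirac y)) - φ m - c * D m y z| ≤ 2 * Λ * c ^ 2 := by
  have hder : ∀ s ∈ Ico 0 c, HasDerivWithinAt
      (fun r => φ (m + r • (dirac z - dirac y)) - r * D m y z)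
      (D (m + s • (dirac z - dirac y)) y z - D m y z) (Ici s) s := fun s hs => by
    have := (IsC1Deriv.hasDerivWithinAt_Ici h hm hc hs (z := z)).fun_sub
      ((hasDerivWithinAt_id s (Ici s)).mul_const (D m y z))
    simpa using this
  have hcont : ContinuousOn (fun r => φ (m + r • (dirac z - dirac y)) - r * D m y z)
      (Icc 0 c) := by
    refine ContinuousOn.sub (hφ.comp (by fun_prop) fun r hr => ?_) (by fun_prop)
    exact move_mem_simplex hm hr.1 (hr.2.trans hc) z
  have hb : ∀ s ∈ Ico 0 c, ‖D (m + s • (dirac z - dirac y)) y z - D m y z‖ ≤ 2 * Λ * c := by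
    intro s hs
    have h1 := (hL y).dist_le_mul _ (move_mem_simplex hm hs.1 (hs.2.le.trans hc) z) _ hm
    rw [dist_eq_norm, dist_eq_norm, add_sub_cancel_left, norm_smul, Real.norm_eq_abs,
      abs_of_nonneg hs.1] at h1
    have h2 := abs_apply_le_norm (D (m + s • (dirac z - dirac y)) y - D m y) z
    rw [PiLp.sub_apply] at h2
    rw [Real.norm_eq_abs]
    refine h2.trans (h1.trans ?_)
    have h3 : s * ‖(dirac z - dirac y : Vec d)‖ ≤ c * 2 :=
      mul_le_mul hs.2.le (norm_dirac_sub_le y z) (norm_nonneg _) h0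
    calc (Λ : ℝ) * (s * ‖(dirac z - dirac y : Vec d)‖) ≤ Λ * (c * 2) := by gcongr
      _ = 2 * Λ * c := by ring
  have := norm_image_sub_le_of_norm_deriv_right_le_segment hcont hder hb c ⟨h0, le_rfl⟩
  rw [Real.norm_eq_abs] at this
  simp only [zero_smul, add_zero, zero_mul, sub_zero] at this
  calc _ = |φ (m + c • (dirac z - dirac y)) - c * D m y z - φ m| := by congr 1; ring
    _ ≤ 2 * Λ * c * c := this
    _ = 2 * Λ * c ^ 2 := by ring

/-- For `c < 0` the positive transfer starts at the end point and leads back to `m`; changing the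
base point of the derivative costs another `2 Λ c²`. -/
lemma IsC1Deriv.abs_signed_move_sub_le (h : Game.IsC1Deriv φ D)
    (hφ : ContinuousOn φ (simplex d))
    (hL : ∀ y, LipschitzOnWith Λ (fun m => D m y) (simplex d)) {m : Vec d} (hm : m ∈ simplex d)
    {c : ℝ} {p z : Fin d} (hpz : p ≠ z) (hc : m + c • (dirac z - dirac p) ∈ simplex d) :
    |φ (m + c • (dirac z - dirac p)) - φ m - c * D m p z| ≤ 4 * Λ * c ^ 2 := by
  have hΛ : (0 : ℝ) ≤ Λ := Λ.2
  rcases le_total 0 c with h0 | h0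
  · have hcp : c ≤ m p := by
      have := hc.1 p
      rw [move_apply, if_neg hpz, if_pos rfl] at this
      linarith
    have := IsC1Deriv.abs_move_sub_le h hφ hL hm h0 hcp z
    nlinarith [sq_nonneg c]
  · set m1 := m + c • (dirac z - dirac p) with hm1
    have hcp : -c ≤ m1 p := by
      have := hm.1 p
      rw [hm1, move_apply, if_neg hpz, if_pos rfl]
      linarith
    have h1 := IsC1Deriv.abs_move_sub_le h hφ hL hc (by linarith : 0 ≤ -c) hcp z
    have e : m1 + (-c) • (dirac z - dirac p) = m := by rw [hm1, neg_smul]; abel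
    rw [e] at h1
    have h2 := (hL p).dist_le_mul _ hc _ hm
    have h3 := abs_apply_le_norm (D m1 p - D m p) z
    rw [dist_eq_norm, dist_eq_norm, hm1, add_sub_cancel_left, ← hm1, norm_smul, Real.norm_eq_abs,
      abs_of_nonpos h0] at h2
    have h4 : |D m1 p z - D m p z| ≤ Λ * (-c * 2) := by
      rw [PiLp.sub_apply] at h3
      refine h3.trans (h2.trans ?_)
      have := norm_dirac_sub_le p z
      gcongr
      linarith
    have h5 : |c * (D m1 p z - D m p z)| ≤ 2 * Λ * c ^ 2 := by
      rw [abs_mul, abs_of_nonpos h0]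
      calc -c * |D m1 p z - D m p z| ≤ -c * (Λ * (-c * 2)) := by
            apply mul_le_mul_of_nonneg_left h4; linarith
        _ = 2 * Λ * c ^ 2 := by ring
    rw [abs_le] at h1 h5 ⊢
    constructor <;> nlinarith [h1.1, h1.2, h5.1, h5.2]

/-- The constant of the second order expansion, for transfers involving `k` coordinates. -/
def quadConst (Λ : ℝ) : ℕ → ℝ
  | 0 => 0
  | k + 1 => 9 * quadConst Λ k + 10 * Λ

lemma quadConst_nonneg {Λ : ℝ} (hΛ : 0 ≤ Λ) (k : ℕ) : 0 ≤ quadConst Λ k := by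
  induction k with
  | zero => exact le_rfl
  | succ k ih => rw [quadConst]; positivity

/-- Induction on the number of coordinates other than `p` that may change. One of them is corrected
by an exchange of mass with `p`, and the Lipschitz bound pays for the new base point of the
derivative. -/
lemma IsC1Deriv.abs_expansion_le_card (h : Game.IsC1Deriv φ D) (hφ : ContinuousOn φ (simplex d))
    (hL : ∀ y, LipschitzOnWith Λ (fun m => D m y) (simplex d)) (p : Fin d) (k : ℕ) :
    ∀ (s : Finset (Fin d)), s.card = k → p ∉ s → ∀ m ∈ simplex d, ∀ m' ∈ simplex d,
      (∀ w, w ∉ s → w ≠ p → m' w = m w) →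
      |φ m' - φ m - inner ℝ (D m p) (m' - m)| ≤ quadConst Λ k * ‖m' - m‖ ^ 2 := by
  have hΛ : (0 : ℝ) ≤ Λ := Λ.2
  induction k with
  | zero =>
    intro s hs _ m hm m' hm' hag
    rw [Finset.card_eq_zero] at hs
    subst hs
    have h1 : m' = m := by
      have hne : ∀ w, w ≠ p → m' w = m w := fun w hw => hag w (by simp) hw
      have hp : m' p = m p := by
        have e := hm'.2.trans hm.2.symm
        rw [← Finset.sum_erase_add _ _ (Finset.mem_univ p),
          ← Finset.sum_erase_add _ _ (Finset.mem_univ p),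
          Finset.sum_congr rfl fun w hw => hne w (Finset.ne_of_mem_erase hw)] at e
        linarith
      ext w
      by_cases hw : w = p
      · rw [hw, hp]
      · exact hne w hw
    subst h1
    simp [quadConst]
  | succ k ih =>
    intro s hs hps m hm m' hm' hag
    -- The intermediate point must stay in the simplex. A coordinate that loses mass can always give
    -- it to `p`. If none loses, `p` alone pays for all gains, so it can afford each single one.
    obtain ⟨z, hz, hmem⟩ : ∃ z ∈ s, m + (m' z - m z) • (dirac z - dirac p) ∈ simplex d := by
      by_cases hneg : ∃ z ∈ s, m' z < m z
      · obtain ⟨z, hz, hlt⟩ := hneg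
        refine ⟨z, hz, ?_⟩
        have e : m + (m' z - m z) • (dirac z - dirac p) =
            m + (m z - m' z) • (dirac p - dirac z) := by
          rw [← neg_sub (dirac p : Vec d), smul_neg, ← neg_smul, neg_sub]
        rw [e]
        exact move_mem_simplex hm (by linarith) (by linarith [hm'.1 z]) p
      · push Not at hneg
        obtain ⟨z, hz⟩ : s.Nonempty := by rw [← Finset.card_pos]; omega
        refine ⟨z, hz, move_mem_simplex hm (by linarith [hneg z hz]) ?_ z⟩
        have hsum : ∑ w, (m' w - m w) = 0 := by
          rw [Finset.sum_sub_distrib, hm.2, hm'.2, sub_self]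
        rw [← Finset.sum_erase_add _ _ (Finset.mem_univ p)] at hsum
        have hge : m' z - m z ≤ ∑ w ∈ Finset.univ.erase p, (m' w - m w) := by
          refine Finset.single_le_sum (f := fun w => m' w - m w) (fun w hw => ?_)
            (Finset.mem_erase.2 ⟨fun e => hps (e ▸ hz), Finset.mem_univ _⟩)
          by_cases hws : w ∈ s
          · linarith [hneg w hws]
          · rw [hag w hws (Finset.ne_of_mem_erase hw)]; simp
        linarith [hm'.1 p]
    have hpz : p ≠ z := fun e => hps (e ▸ hz)
    set c := m' z - m z with hc
    set m1 := m + c • (dirac z - dirac p) with hm1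
    have h1 := IsC1Deriv.abs_signed_move_sub_le h hφ hL hm hpz hmem
    have h2 := ih (s.erase z) (by rw [Finset.card_erase_of_mem hz, hs]; rfl)
      (fun hp => hps (Finset.mem_of_mem_erase hp)) m1 hmem m' hm' (by
        intro w hw hwp
        rw [hm1, move_apply, if_neg hwp]
        by_cases hwz : w = z
        · subst hwz; rw [if_pos rfl, hc]; ring
        · rw [if_neg hwz, hag w (fun hws => hw (Finset.mem_erase.2 ⟨hwz, hws⟩)) hwp]; ring)
    rw [← hm1] at h1
    set R := ‖m' - m‖ with hR
    have hR0 : 0 ≤ R := norm_nonneg _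
    have hcR : |c| ≤ R := by
      have := abs_apply_le_norm (m' - m) z
      rwa [PiLp.sub_apply] at this
    have hmm1 : ‖m1 - m‖ ≤ 2 * |c| := by
      rw [hm1, add_sub_cancel_left, norm_smul, Real.norm_eq_abs, mul_comm]
      gcongr
      exact norm_dirac_sub_le p z
    -- The square of this `3` is the factor `9` in `quadConst`; the `10` there is `4` from the
    -- signed move plus `6` from the change of base point.
    have hm'1 : ‖m' - m1‖ ≤ 3 * R := by
      have := norm_sub_le (m' - m) (m1 - m)
      rw [sub_sub_sub_cancel_right] at this
      linarith
    have h3 : |inner ℝ (D m1 p - D m p) (m' - m1)| ≤ 6 * Λ * R ^ 2 := by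
      refine (abs_real_inner_le_norm _ _).trans ?_
      have h4 := (hL p).dist_le_mul _ hmem _ hm
      rw [dist_eq_norm, dist_eq_norm] at h4
      calc ‖D m1 p - D m p‖ * ‖m' - m1‖ ≤ (Λ * (2 * R)) * (3 * R) := by
            refine mul_le_mul (h4.trans ?_) hm'1 (norm_nonneg _) (by positivity)
            gcongr; linarith
        _ = 6 * Λ * R ^ 2 := by ring
    have e : φ m' - φ m - inner ℝ (D m p) (m' - m) =
        (φ m' - φ m1 - inner ℝ (D m1 p) (m' - m1)) + (φ m1 - φ m - c * D m p z) +
          inner ℝ (D m1 p - D m p) (m' - m1) := by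
      have e1 : m' - m = (m' - m1) + c • (dirac z - dirac p) := by rw [hm1]; abel
      rw [e1, inner_add_right, inner_smul_right, inner_sub_right (D m p) (dirac z) (dirac p),
        inner_dirac, inner_dirac, IsC1Deriv.self_eq_zero h hm, inner_sub_left]
      ring
    have h5 : quadConst Λ k * ‖m' - m1‖ ^ 2 ≤ quadConst Λ k * (3 * R) ^ 2 := by
      have := quadConst_nonneg hΛ k
      gcongr
    have h6 : 4 * Λ * c ^ 2 ≤ 4 * Λ * R ^ 2 := by
      rw [← sq_abs c]; gcongr
    rw [e]
    calc _ ≤ quadConst Λ k * (3 * R) ^ 2 + 4 * Λ * R ^ 2 + 6 * Λ * R ^ 2 :=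
          (abs_add_le _ _).trans (add_le_add ((abs_add_le _ _).trans
            (add_le_add (h2.trans h5) (h1.trans h6))) h3)
      _ = quadConst Λ (k + 1) * R ^ 2 := by rw [quadConst]; ring

/-- Second order expansion of a `C^{1,1}` function on the simplex. -/
theorem IsC1Deriv.abs_expansion_le (h : Game.IsC1Deriv φ D) (hφ : ContinuousOn φ (simplex d))
    (hL : ∀ y, LipschitzOnWith Λ (fun m => D m y) (simplex d)) {m m' : Vec d}
    (hm : m ∈ simplex d) (hm' : m' ∈ simplex d) (p : Fin d) :
    |φ m' - φ m - inner ℝ (D m p) (m' - m)| ≤ quadConst Λ (d - 1) * ‖m' - m‖ ^ 2 :=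
  IsC1Deriv.abs_expansion_le_card h hφ hL p (d - 1) (Finset.univ.erase p) (by simp) (by simp)
    m hm m' hm' fun w hw hwp => absurd (Finset.mem_erase.2 ⟨hwp, Finset.mem_univ w⟩) hw

lemma eq_zero_of_abs_mul_le_sq {a ε C : ℝ} (hε : 0 < ε)
    (h : ∀ c ∈ Ioc 0 ε, |c * a| ≤ C * c ^ 2) : a = 0 := by
  have h1 : ∀ c ∈ Ioc 0 ε, |a| ≤ C * c := fun c hc => by
    have := h c hc
    rw [abs_mul, abs_of_pos hc.1, sq, ← mul_assoc, mul_comm C c, mul_assoc] at this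
    exact le_of_mul_le_mul_left this hc.1
  have hlim : Tendsto (fun c => C * c) (𝓝[>] 0) (𝓝 (C * 0)) :=
    (continuous_const.mul continuous_id).continuousAt.continuousWithinAt
  rw [mul_zero] at hlim
  have := ge_of_tendsto hlim (by
    filter_upwards [Ioc_mem_nhdsGT hε] with c hc using h1 c hc)
  exact abs_nonpos_iff.1 this

/-- Change of the reference point in the derivative with respect to the measure. -/
theorem IsC1Deriv.eq_sub (h : Game.IsC1Deriv φ D) (hφ : ContinuousOn φ (simplex d))
    (hL : ∀ y, LipschitzOnWith Λ (fun m => D m y) (simplex d)) {m : Vec d}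
    (hm : m ∈ simplex d) {y : Fin d} (hy : 0 < m y) (p z : Fin d) :
    D m y z = D m p z - D m p y := by
  have hΛ : (0 : ℝ) ≤ Λ := Λ.2
  -- The transfer from `y` to `z` is expanded directly and through the reference `p`. The two first
  -- order terms differ by `O(c²)` for all small `c > 0`, which are admissible because `m y > 0`.
  refine sub_eq_zero.1 (eq_zero_of_abs_mul_le_sq hy (C := 2 * Λ + quadConst Λ (d - 1) * 4)
    fun c hc => ?_)
  have hmem := move_mem_simplex hm hc.1.le hc.2 z
  have h1 := IsC1Deriv.abs_move_sub_le h hφ hL hm hc.1.le hc.2 z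
  have h2 := IsC1Deriv.abs_expansion_le h hφ hL hm hmem p
  rw [add_sub_cancel_left, inner_smul_right, inner_sub_right, inner_dirac, inner_dirac,
    norm_smul, Real.norm_eq_abs, abs_of_pos hc.1] at h2
  have h3 : quadConst Λ (d - 1) * (c * ‖(dirac z - dirac y : Vec d)‖) ^ 2 ≤
      quadConst Λ (d - 1) * (c * 2) ^ 2 := by
    have := quadConst_nonneg hΛ (d - 1)
    have := norm_dirac_sub_le y z
    have := hc.1.le
    gcongr
  have h4 := h2.trans h3
  rw [abs_le] at h1 h4 ⊢
  constructor <;> nlinarith [h1.1, h1.2, h4.1, h4.2]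

end SimplexCalculus

variable {d : ℕ}

/-! ### The Hamiltonian and its signs. -/

section Hamiltonian

variable {𝒢 : Game d}

lemma Game.Standing.isOptimal (h : 𝒢.Standing) (x : Fin d) (p : Vec d) :
    𝒢.IsOptimal x p (𝒢.optControl x p) := by
  have hex : ∃ a, 𝒢.IsOptimal x p a := (h.unique_max x p).exists
  rw [Game.optControl, dif_pos hex]
  exact hex.choose_spec

lemma Game.Standing.le_optControl (h : 𝒢.Standing) (x : Fin d) (p : Vec d) (y : Fin d) :
    𝒢.κ ≤ 𝒢.optControl x p y := ((h.isOptimal x p).1 y).1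

lemma Game.Standing.optControl_le (h : 𝒢.Standing) (x : Fin d) (p : Vec d) (y : Fin d) :
    𝒢.optControl x p y ≤ 𝒢.M := ((h.isOptimal x p).1 y).2

lemma Game.Standing.optControl_nonneg (h : 𝒢.Standing) (x : Fin d) (p : Vec d) (y : Fin d) :
    0 ≤ 𝒢.optControl x p y := h.κ_pos.le.trans (h.le_optControl x p y)

lemma Game.Standing.M_pos (h : 𝒢.Standing) : 0 < 𝒢.M := h.κ_pos.trans_le h.κ_le_M

lemma Game.Standing.hamiltonian_eq (h : 𝒢.Standing) (x : Fin d) (p : Vec d) :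
    𝒢.hamiltonian x p = - inner ℝ (𝒢.optControl x p) p - 𝒢.L x (𝒢.optControl x p) :=
  IsGreatest.csSup_eq ⟨⟨_, (h.isOptimal x p).1, rfl⟩, by
    rintro _ ⟨b, hb, rfl⟩
    exact (h.isOptimal x p).2 b hb⟩

lemma inner_nonpos_of_nonpos {a p : Vec d} (ha : ∀ y, 0 ≤ a y) (hp : ∀ y, p y ≤ 0) :
    inner ℝ a p ≤ 0 := by
  rw [inner_eq_sum]
  exact Finset.sum_nonpos fun y _ => mul_nonpos_of_nonneg_of_nonpos (ha y) (hp y)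

lemma inner_nonneg_of_nonneg {a p : Vec d} (ha : ∀ y, 0 ≤ a y) (hp : ∀ y, 0 ≤ p y) :
    0 ≤ inner ℝ a p := by
  rw [inner_eq_sum]
  exact Finset.sum_nonneg fun y _ => mul_nonneg (ha y) (hp y)

/-- Controls have nonnegative coordinates, so nonpositive differences contribute `-a·p ≥ 0`. This is
the situation at a spatial maximum. -/
lemma Game.Standing.neg_le_hamiltonian (h : 𝒢.Standing) {cL : ℝ}
    (hcL : ∀ x, ∀ a ∈ 𝒢.controls, |𝒢.L x a| ≤ cL) (x : Fin d) {p : Vec d} (hp : ∀ y, p y ≤ 0) :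
    -cL ≤ 𝒢.hamiltonian x p := by
  have h1 := h.hamiltonian_eq x p
  have h2 := inner_nonpos_of_nonpos (h.optControl_nonneg x p) hp
  have h3 := (_root_.abs_le.1 (hcL x _ (h.isOptimal x p).1)).2
  linarith

lemma Game.Standing.hamiltonian_le (h : 𝒢.Standing) {cL : ℝ}
    (hcL : ∀ x, ∀ a ∈ 𝒢.controls, |𝒢.L x a| ≤ cL) (x : Fin d) {p : Vec d} (hp : ∀ y, 0 ≤ p y) :
    𝒢.hamiltonian x p ≤ cL := by
  have h1 := h.hamiltonian_eq x p
  have h2 := inner_nonneg_of_nonneg (h.optControl_nonneg x p) hp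
  have h3 := (_root_.abs_le.1 (hcL x _ (h.isOptimal x p).1)).1
  linarith

end Hamiltonian

/-! ### Finite differences and empirical measures. -/

section Differences

variable {N : ℕ}

@[simp] lemma diff_apply (g : Fin d → ℝ) (x y : Fin d) : diff g x y = g y - g x := rfl

@[simp] lemma diffAt_apply (j : Fin N) (g : (Fin N → Fin d) → ℝ) (x : Fin N → Fin d)
    (y : Fin d) : diffAt j g x y = g (Function.update x j y) - g x := rfl

lemma norm_le_sqrt_mul {a : Vec d} {c : ℝ} (hc : 0 ≤ c) (h : ∀ y, |a y| ≤ c) :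
    ‖a‖ ≤ √(d : ℝ) * c := by
  rw [EuclideanSpace.norm_eq]
  refine Real.sqrt_le_iff.2 ⟨by positivity, ?_⟩
  rw [mul_pow, Real.sq_sqrt (by positivity)]
  calc ∑ i, ‖a i‖ ^ 2 ≤ ∑ _i : Fin d, c ^ 2 := by
        gcongr with i; exact h i
    _ = d * c ^ 2 := by simp

lemma norm_diff_le {g : Fin d → ℝ} {B : ℝ} (hg : ∀ y, |g y| ≤ B) (x : Fin d) :
    ‖diff g x‖ ≤ 2 * √(d : ℝ) * B := by
  have hB : 0 ≤ B := (abs_nonneg _).trans (hg x)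
  refine (norm_le_sqrt_mul (c := 2 * B) (by positivity) fun y => ?_).trans_eq (by ring)
  rw [diff_apply]
  linarith [abs_sub (g y) (g x), hg y, hg x]

lemma norm_diffAt_le {g : (Fin N → Fin d) → ℝ} {B : ℝ} (hg : ∀ y, |g y| ≤ B) (j : Fin N)
    (x : Fin N → Fin d) : ‖diffAt j g x‖ ≤ 2 * √(d : ℝ) * B := by
  have hB : 0 ≤ B := (abs_nonneg _).trans (hg x)
  refine (norm_le_sqrt_mul (c := 2 * B) (by positivity) fun y => ?_).trans_eq (by ring)
  rw [diffAt_apply]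
  linarith [abs_sub (g (Function.update x j y)) (g x), hg (Function.update x j y), hg x]

lemma norm_diff_sub_le {g g' : Fin d → ℝ} {ε : ℝ} (h : ∀ y, |g y - g' y| ≤ ε) (x : Fin d) :
    ‖diff g x - diff g' x‖ ≤ 2 * √(d : ℝ) * ε := by
  have e : diff g x - diff g' x = diff (fun y => g y - g' y) x := by
    ext y; simp only [PiLp.sub_apply, diff_apply]; ring
  rw [e]
  exact norm_diff_le h x

lemma empiricalOther_mem_simplex {i : Fin N} (hN : 2 ≤ N) (x : Fin N → Fin d) :
    empiricalOther i x ∈ simplex d := by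
  have hN' : (0 : ℝ) < (N : ℝ) - 1 := by
    have : (2 : ℝ) ≤ N := by exact_mod_cast hN
    linarith
  have hz : ∀ z, empiricalOther i x z =
      1 / ((N : ℝ) - 1) * ∑ j ∈ Finset.univ.erase i, dirac (x j) z := fun z => by
    simp [empiricalOther]
  refine ⟨fun z => ?_, ?_⟩
  · rw [hz]
    exact mul_nonneg (by positivity) (Finset.sum_nonneg fun j _ => (dirac_mem_simplex (x j)).1 z)
  · simp only [hz]
    rw [← Finset.mul_sum, Finset.sum_comm]
    simp only [(dirac_mem_simplex _).2]
    rw [Finset.sum_const, Finset.card_erase_of_mem (Finset.mem_univ i), Finset.card_univ,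
      Fintype.card_fin, nsmul_eq_mul, Nat.cast_sub (by lia), mul_one, Nat.cast_one,
      one_div_mul_cancel hN'.ne']

end Differences

/-! ### A priori bounds by the maximum principle. -/

section Bounds

variable {𝒢 : Game d} {cL cF cG : ℝ}

/-- Uniform bounds on the costs. -/
structure Game.CostBound (𝒢 : Game d) (cL cF cG : ℝ) : Prop where
  L_le : ∀ x, ∀ a ∈ 𝒢.controls, |𝒢.L x a| ≤ cL
  F_le : ∀ x, ∀ m ∈ simplex d, |𝒢.F x m| ≤ cF
  G_le : ∀ x, ∀ m ∈ simplex d, |𝒢.G x m| ≤ cG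

lemma Game.CostBound.nonneg (hc : 𝒢.CostBound cL cF cG) (h : 𝒢.Standing) (x : Fin d) :
    0 ≤ cL + cF :=
  add_nonneg ((abs_nonneg _).trans (hc.L_le x _ (h.isOptimal x 0).1))
    ((abs_nonneg _).trans (hc.F_le x _ (dirac_mem_simplex x)))

lemma le_bound_of_le {T c c₀ t : ℝ} (hc : 0 ≤ c) (ht : t ∈ Icc 0 T) {a : ℝ}
    (h : a ≤ c₀ + c * (T - t)) : a ≤ T * c + c₀ := by
  nlinarith [mul_nonneg hc ht.1]

/-- At a maximum over states all differences are nonpositive, so the transport terms have a sign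
whatever the other controls are, and the time derivative is at least `-(cL + cF)`. Minima are
symmetric. The bound keeps `Δ^i v^{N,i}` in the ball of (H1). -/
lemma Game.IsHJBSolution.abs_le (h : 𝒢.Standing) (hc : 𝒢.CostBound cL cF cG) {N : ℕ}
    (hN : 2 ≤ N) {v : Fin N → ℝ → (Fin N → Fin d) → ℝ} (hv : 𝒢.IsHJBSolution v) (i : Fin N)
    {t : ℝ} (ht : t ∈ Icc 0 𝒢.T) (x : Fin N → Fin d) :
    |v i t x| ≤ 𝒢.T * (cL + cF) + cG := by
  have hc0 := hc.nonneg h (x i)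
  have hcont : ∀ x, ContinuousOn (fun q : ℝ × Unit => v i q.1 x) (Icc 0 𝒢.T ×ˢ univ) := fun x =>
    ContinuousOn.comp (g := fun t => v i t x) (t := Icc 0 𝒢.T)
      (fun t ht => ((hv i x).1 t ht).continuousWithinAt) continuousOn_fst fun q hq => hq.1
  have hF := fun x => _root_.abs_le.1 (hc.F_le (x i) _ (empiricalOther_mem_simplex (i := i) hN x))
  have hG := fun x => _root_.abs_le.1 (hc.G_le (x i) _ (empiricalOther_mem_simplex (i := i) hN x))
  have hup := le_of_deriv_ge_at_max (ι := Fin N → Fin d) (S := (univ : Set Unit)) isCompact_univ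
    (c := cL + cF) (c₀ := cG) (f := fun t x _ => v i t x) hcont
    (fun t ht x _ _ hmax => ⟨_, (hv i x).1 t ⟨ht.1, ht.2.le⟩, by
      have hp : ∀ j y, diffAt j (v i t) x y ≤ 0 := fun j y => by
        rw [diffAt_apply]; linarith [hmax (Function.update x j y) () trivial]
      have h1 := h.neg_le_hamiltonian hc.L_le (x i) (hp i)
      have h2 : ∑ j ∈ Finset.univ.erase i,
          inner ℝ (𝒢.optControl (x j) (diffAt j (v j t) x)) (diffAt j (v i t) x) ≤ 0 :=
        Finset.sum_nonpos fun j _ => inner_nonpos_of_nonpos (h.optControl_nonneg _ _) (hp j)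
      linarith [(hF x).2]⟩)
    (fun x _ _ => by rw [(hv i x).2]; exact (hG x).2) t ht x () trivial
  have hlow := le_of_deriv_ge_at_max (ι := Fin N → Fin d) (S := (univ : Set Unit)) isCompact_univ
    (c := cL + cF) (c₀ := cG) (f := fun t x _ => -v i t x) (fun x => (hcont x).neg)
    (fun t ht x _ _ hmax => ⟨_, ((hv i x).1 t ⟨ht.1, ht.2.le⟩).fun_neg, by
      have hp : ∀ j y, 0 ≤ diffAt j (v i t) x y := fun j y => by
        rw [diffAt_apply]; linarith [hmax (Function.update x j y) () trivial]
      have h1 := h.hamiltonian_le hc.L_le (x i) (hp i)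
      have h2 : 0 ≤ ∑ j ∈ Finset.univ.erase i,
          inner ℝ (𝒢.optControl (x j) (diffAt j (v j t) x)) (diffAt j (v i t) x) :=
        Finset.sum_nonneg fun j _ => inner_nonneg_of_nonneg (h.optControl_nonneg _ _) (hp j)
      linarith [(hF x).1]⟩)
    (fun x _ _ => by rw [(hv i x).2]; linarith [(hG x).1]) t ht x () trivial
  exact _root_.abs_le'.2 ⟨le_bound_of_le hc0 ht hup, le_bound_of_le hc0 ht hlow⟩

lemma Game.IsMFGSolution.abs_le (h : 𝒢.Standing) (hc : 𝒢.CostBound cL cF cG) {m₀ : Vec d}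
    {u : ℝ → Fin d → ℝ} {m : ℝ → Vec d} (hu : 𝒢.IsMFGSolution m₀ u m)
    {t : ℝ} (ht : t ∈ Icc 0 𝒢.T) (x : Fin d) : |u t x| ≤ 𝒢.T * (cL + cF) + cG := by
  have hc0 := hc.nonneg h x
  have hcont : ∀ x, ContinuousOn (fun q : ℝ × Unit => u q.1 x) (Icc 0 𝒢.T ×ˢ univ) := fun x =>
    ContinuousOn.comp (g := fun t => u t x) (t := Icc 0 𝒢.T)
      (fun t ht => (hu.2.1 t ht x).continuousWithinAt) continuousOn_fst fun q hq => hq.1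
  have hF := fun t ht x => _root_.abs_le.1 (hc.F_le x (m t) (hu.1 t ht))
  have hG := fun x => _root_.abs_le.1 (hc.G_le x (m 𝒢.T) (hu.1 _ ⟨h.T_pos.le, le_rfl⟩))
  have hup := le_of_deriv_ge_at_max (S := (univ : Set Unit)) isCompact_univ
    (c := cL + cF) (c₀ := cG) (f := fun t x _ => u t x) hcont
    (fun t ht x _ _ hmax => ⟨_, hu.2.1 t ⟨ht.1, ht.2.le⟩ x, by
      have h1 := h.neg_le_hamiltonian hc.L_le x (p := diff (u t) x) fun y => by
        rw [diff_apply]; linarith [hmax y () trivial]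
      linarith [(hF t ⟨ht.1, ht.2.le⟩ x).2]⟩)
    (fun x _ _ => by rw [hu.2.2.2.1]; exact (hG x).2) t ht x () trivial
  have hlow := le_of_deriv_ge_at_max (S := (univ : Set Unit)) isCompact_univ
    (c := cL + cF) (c₀ := cG) (f := fun t x _ => -u t x) (fun x => (hcont x).neg)
    (fun t ht x _ _ hmax => ⟨_, (hu.2.1 t ⟨ht.1, ht.2.le⟩ x).fun_neg, by
      have h1 := h.hamiltonian_le hc.L_le x (p := diff (u t) x) fun y => by
        rw [diff_apply]; linarith [hmax y () trivial]
      linarith [(hF t ⟨ht.1, ht.2.le⟩ x).1]⟩)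
    (fun x _ _ => by rw [hu.2.2.2.1]; linarith [(hG x).1]) t ht x () trivial
  exact _root_.abs_le'.2 ⟨le_bound_of_le hc0 ht hup, le_bound_of_le hc0 ht hlow⟩

/-- A small transfer out of `y` is admissible because `m y > 0`, and at a maximum it cannot increase
`φ`. -/
lemma IsC1Deriv.nonpos_of_max {φ : Vec d → ℝ} {D : Vec d → Fin d → Vec d}
    (hD : Game.IsC1Deriv φ D) {m : Vec d} (hm : m ∈ simplex d)
    (hmax : ∀ m' ∈ simplex d, φ m' ≤ φ m) {y : Fin d} (hy : 0 < m y) (z : Fin d) :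
    D m y z ≤ 0 := by
  have h0 := IsC1Deriv.hasDerivWithinAt_Ici hD hm le_rfl (y := y) (z := z) (s := 0)
    ⟨le_rfl, hy⟩
  rw [zero_smul, add_zero] at h0
  have h1 := h0.mono (s := Icc 0 (m y)) fun s hs => hs.1
  refine nonpos_of_hasDerivWithinAt_of_le ⟨le_rfl, hy⟩ h1 fun s hs => ?_
  rw [zero_smul, add_zero]
  exact hmax _ (move_mem_simplex hm hs.1 hs.2 z)

lemma IsC1Deriv.neg {φ : Vec d → ℝ} {D : Vec d → Fin d → Vec d} (hD : Game.IsC1Deriv φ D) :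
    Game.IsC1Deriv (fun m => -φ m) (fun m y => -D m y) :=
  ⟨fun m hm y z => (hD.1 m hm y z).fun_neg, fun y => (hD.2 y).neg⟩

/-- The functions `Ut` and `D` are the derivatives of the regular solution `U`, with `D` Lipschitz
with constant `Λ` in the measure. -/
structure Game.IsRegularWith (𝒢 : Game d) (U : ℝ → Fin d → Vec d → ℝ)
    (Ut : ℝ → Fin d → Vec d → ℝ) (D : ℝ → Fin d → Vec d → Fin d → Vec d) (Λ : ℝ≥0) : Prop where
  cont : ∀ x, ContinuousOn (fun q : ℝ × Vec d => U q.1 x q.2) (Icc 0 𝒢.T ×ˢ simplex d)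
  deriv : ∀ x, ∀ m ∈ simplex d, ∀ t ∈ Icc 0 𝒢.T,
    HasDerivWithinAt (fun s => U s x m) (Ut t x m) (Icc 0 𝒢.T) t
  deriv_cont : ∀ x, ∀ m ∈ simplex d, ContinuousOn (fun t => Ut t x m) (Icc 0 𝒢.T)
  c1 : ∀ t ∈ Icc 0 𝒢.T, ∀ x, Game.IsC1Deriv (U t x) (D t x)
  eqn : ∀ t ∈ Icc 0 𝒢.T, ∀ x, ∀ m ∈ simplex d,
    Ut t x m = 𝒢.hamiltonian x (diff (fun y => U t y m) x)
      - ∑ y, m y * inner ℝ (D t x m y) (𝒢.optControl y (diff (fun z => U t z m) y)) - 𝒢.F x m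
  terminal : ∀ x, ∀ m ∈ simplex d, U 𝒢.T x m = 𝒢.G x m
  lip : ∀ t ∈ Icc 0 𝒢.T, ∀ x y, LipschitzOnWith Λ (fun m => D t x m y) (simplex d)

lemma Game.IsRegularSolution.exists_regularWith {U : ℝ → Fin d → Vec d → ℝ}
    (hU : 𝒢.IsRegularSolution U) : ∃ Ut D Λ, 𝒢.IsRegularWith U Ut D Λ := by
  obtain ⟨Ut, D, h1, h2, h3, h4, h5, Λ, h6⟩ := hU
  exact ⟨Ut, D, Λ, h1, fun x m hm => (h2 x m hm).1, fun x m hm => (h2 x m hm).2, h3,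
    fun t ht x m hm => by linarith [h4 t ht x m hm], h5, h6⟩

variable {U Ut : ℝ → Fin d → Vec d → ℝ} {D : ℝ → Fin d → Vec d → Fin d → Vec d} {Λ : ℝ≥0}

/-- At a maximum over states and measures the integral term has a sign: where `m y > 0` the
derivative is nonpositive in all directions, and where `m y = 0` the weight removes it. -/
lemma Game.IsRegularWith.abs_le (h : 𝒢.Standing) (hc : 𝒢.CostBound cL cF cG)
    (hU : 𝒢.IsRegularWith U Ut D Λ) {t : ℝ} (ht : t ∈ Icc 0 𝒢.T) (x : Fin d) {m : Vec d}
    (hm : m ∈ simplex d) : |U t x m| ≤ 𝒢.T * (cL + cF) + cG := by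
  have hc0 := hc.nonneg h x
  have hF := fun x m hm => _root_.abs_le.1 (hc.F_le x m hm)
  have hG := fun x m hm => _root_.abs_le.1 (hc.G_le x m hm)
  have hup := le_of_deriv_ge_at_max (isCompact_simplex d) (c := cL + cF) (c₀ := cG) (f := U)
    hU.cont
    (fun t ht x m hm hmax => ⟨_, hU.deriv x m hm t ⟨ht.1, ht.2.le⟩, by
      rw [hU.eqn t ⟨ht.1, ht.2.le⟩ x m hm]
      have h1 := h.neg_le_hamiltonian hc.L_le x (p := diff (fun y => U t y m) x) fun y => by
        rw [diff_apply]; linarith [hmax y m hm]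
      have h2 : ∑ y, m y * inner ℝ (D t x m y) (𝒢.optControl y (diff (fun z => U t z m) y)) ≤ 0 :=
        Finset.sum_nonpos fun y _ => by
          rcases (hm.1 y).eq_or_lt with h0 | h0
          · rw [← h0, zero_mul]
          · refine mul_nonpos_of_nonneg_of_nonpos h0.le ?_
            rw [real_inner_comm]
            exact inner_nonpos_of_nonpos (h.optControl_nonneg _ _) fun z =>
              IsC1Deriv.nonpos_of_max (hU.c1 t ⟨ht.1, ht.2.le⟩ x) hm (hmax x) h0 z
      linarith [(hF x m hm).2]⟩)
    (fun x m hm => by rw [hU.terminal x m hm]; exact (hG x m hm).2) t ht x m hm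
  have hlow := le_of_deriv_ge_at_max (isCompact_simplex d) (c := cL + cF) (c₀ := cG)
    (f := fun t x m => -U t x m) (fun x => (hU.cont x).neg)
    (fun t ht x m hm hmax => ⟨_, (hU.deriv x m hm t ⟨ht.1, ht.2.le⟩).fun_neg, by
      rw [hU.eqn t ⟨ht.1, ht.2.le⟩ x m hm]
      have h1 := h.hamiltonian_le hc.L_le x (p := diff (fun y => U t y m) x) fun y => by
        rw [diff_apply]; linarith [hmax y m hm]
      have h2 : 0 ≤ ∑ y, m y * inner ℝ (D t x m y) (𝒢.optControl y (diff (fun z => U t z m) y)) :=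
        Finset.sum_nonneg fun y _ => by
          rcases (hm.1 y).eq_or_lt with h0 | h0
          · rw [← h0, zero_mul]
          · refine mul_nonneg h0.le ?_
            rw [real_inner_comm]
            refine inner_nonneg_of_nonneg (h.optControl_nonneg _ _) fun z => ?_
            have := IsC1Deriv.nonpos_of_max (IsC1Deriv.neg (hU.c1 t ⟨ht.1, ht.2.le⟩ x)) hm
              (hmax x) h0 z
            rw [PiLp.neg_apply] at this
            linarith
      linarith [(hF x m hm).1]⟩)
    (fun x m hm => by rw [hU.terminal x m hm]; linarith [(hG x m hm).1]) t ht x m hm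
  exact _root_.abs_le'.2 ⟨le_bound_of_le hc0 ht hup, le_bound_of_le hc0 ht hlow⟩

end Bounds

/-! ### Uniform constants for the game and the master equation. -/

variable {d : ℕ} {𝒢 : Game d} {U Ut : ℝ → Fin d → Vec d → ℝ}
  {D : ℝ → Fin d → Vec d → Fin d → Vec d} {K R : ℝ}

/-- The quantitative consequences of the assumptions on the game and on the regular solution `U`
of the master equation, with a common constant `R`. -/
structure Game.Estimates (𝒢 : Game d) (U Ut : ℝ → Fin d → Vec d → ℝ)
    (D : ℝ → Fin d → Vec d → Fin d → Vec d) (K R : ℝ) : Prop where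
  standing : 𝒢.Standing
  regular : ∃ Λ, 𝒢.IsRegularWith U Ut D Λ
  one_le : 1 ≤ R
  sqrt_le : 2 * √(d : ℝ) ≤ R
  card_le : (d : ℝ) ≤ R
  M_le : 𝒢.M ≤ R
  hamiltonian_lip : ∀ x p q, ‖p‖ ≤ K → ‖q‖ ≤ K →
    |𝒢.hamiltonian x p - 𝒢.hamiltonian x q| ≤ R * ‖p - q‖
  optControl_lip : ∀ x p q, ‖p‖ ≤ K → ‖q‖ ≤ K →
    ‖𝒢.optControl x p - 𝒢.optControl x q‖ ≤ R * ‖p - q‖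
  norm_optControl : ∀ x p, ‖𝒢.optControl x p‖ ≤ R
  norm_diff : ∀ t ∈ Icc 0 𝒢.T, ∀ m ∈ simplex d, ∀ x, ‖diff (fun y => U t y m) x‖ ≤ K
  norm_D : ∀ t ∈ Icc 0 𝒢.T, ∀ m ∈ simplex d, ∀ x y, ‖D t x m y‖ ≤ R
  D_lip : ∀ t ∈ Icc 0 𝒢.T, ∀ m ∈ simplex d, ∀ m' ∈ simplex d, ∀ x y,
    ‖D t x m y - D t x m' y‖ ≤ R * ‖m - m'‖
  U_lip : ∀ t ∈ Icc 0 𝒢.T, ∀ m ∈ simplex d, ∀ m' ∈ simplex d, ∀ x,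
    |U t x m - U t x m'| ≤ R * ‖m - m'‖
  expansion : ∀ t ∈ Icc 0 𝒢.T, ∀ m ∈ simplex d, ∀ m' ∈ simplex d, ∀ x p,
    |U t x m' - U t x m - inner ℝ (D t x m p) (m' - m)| ≤ R * ‖m' - m‖ ^ 2
  move : ∀ t ∈ Icc 0 𝒢.T, ∀ m ∈ simplex d, ∀ x y z, ∀ c ∈ Icc 0 (m y),
    |U t x (m + c • (dirac z - dirac y)) - U t x m - c * D t x m y z| ≤ R * c ^ 2

lemma Game.IsRegularWith.continuousOn {Λ : ℝ≥0} (h : 𝒢.IsRegularWith U Ut D Λ) {t : ℝ}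
    (ht : t ∈ Icc 0 𝒢.T) (x : Fin d) : ContinuousOn (U t x) (simplex d) :=
  (h.cont x).comp (f := fun m => (t, m)) (by fun_prop) fun m hm => ⟨ht, hm⟩

lemma norm_le_of_abs_move_le {φ : Vec d → ℝ} {D : Vec d → Fin d → Vec d} {Λ : ℝ≥0} {B : ℝ}
    (h : Game.IsC1Deriv φ D) (hφ : ContinuousOn φ (simplex d))
    (hL : ∀ y, LipschitzOnWith Λ (fun m => D m y) (simplex d))
    (hB : ∀ m ∈ simplex d, |φ m| ≤ B) {m : Vec d} (hm : m ∈ simplex d) (y : Fin d) :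
    ‖D m y‖ ≤ √(d : ℝ) * (2 * B * d + 2 * Λ) + 2 * Λ := by
  have hB0 : 0 ≤ B := (abs_nonneg _).trans (hB m hm)
  have hd : 0 < (d : ℝ) := by
    have : 0 < d := y.pos
    exact_mod_cast this
  have hd1 : 1 ≤ (d : ℝ) := by
    have : 1 ≤ d := y.pos
    exact_mod_cast this
  -- The uniform measure has mass `1 / d` at every site, so a transfer of fixed size bounds the
  -- derivative there. Lipschitz continuity carries the bound over the simplex, whose points are at
  -- distance at most `2`.
  let μ : Vec d := WithLp.toLp 2 fun _ => 1 / (d : ℝ)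
  have hμ : μ ∈ simplex d := ⟨fun x => by simp [μ], by simp [μ, hd.ne']⟩
  have h1 : ‖D μ y‖ ≤ √(d : ℝ) * (2 * B * d + 2 * Λ) := by
    refine norm_le_sqrt_mul (by positivity) fun z => ?_
    have h2 := IsC1Deriv.abs_move_sub_le h hφ hL hμ (c := 1 / d) (y := y) (by positivity) le_rfl z
    have h3 := hB _ (move_mem_simplex hμ (c := 1 / d) (y := y) (by positivity) le_rfl z)
    have h4 : |1 / (d : ℝ) * D μ y z| ≤ 2 * B + 2 * Λ * (1 / d) ^ 2 := by
      have h5 := _root_.abs_le.1 h2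
      have h6 := _root_.abs_le.1 h3
      have h7 := _root_.abs_le.1 (hB μ hμ)
      rw [_root_.abs_le]
      constructor <;> linarith
    rw [abs_mul, abs_of_pos (by positivity : 0 < 1 / (d : ℝ)), one_div_mul_eq_div,
      div_le_iff₀ hd] at h4
    calc |D μ y z| ≤ 2 * B * d + 2 * Λ * (1 / d) := h4.trans_eq (by field_simp)
      _ ≤ 2 * B * d + 2 * Λ * 1 := by
        gcongr
        rw [div_le_one hd]; exact hd1
      _ = _ := by ring
  have h2 := (hL y).dist_le_mul _ hm _ hμ
  rw [dist_eq_norm, dist_eq_norm] at h2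
  have h3 : (Λ : ℝ) * ‖m - μ‖ ≤ Λ * 2 := by
    gcongr; exact norm_sub_le_two hμ hm
  have h4 := norm_add_le (D μ y) (D m y - D μ y)
  rw [add_sub_cancel] at h4
  linarith

/-- All constants are dominated by one sum `R`. The radius is the a priori bound on finite
differences, which does not exceed the radius `K'` of (H1). -/
theorem Game.exists_estimates [NeZero d] {cL cF cG K' : ℝ} (h : 𝒢.Standing)
    (hc : 𝒢.CostBound cL cF cG) (hK : 2 * √(d : ℝ) * (𝒢.T * (cL + cF) + cG) ≤ K')
    (hH1 : 𝒢.H1 K') (hU : 𝒢.IsRegularSolution U) :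
    ∃ Ut D R, 𝒢.Estimates U Ut D (2 * √(d : ℝ) * (𝒢.T * (cL + cF) + cG)) R := by
  obtain ⟨Ut, D, Λ, hreg⟩ := hU.exists_regularWith
  obtain ⟨Λ', hΛ'⟩ := hH1
  set B := 𝒢.T * (cL + cF) + cG with hB
  have hUB : ∀ t ∈ Icc 0 𝒢.T, ∀ x, ∀ m ∈ simplex d, |U t x m| ≤ B := fun t ht x m hm =>
    hreg.abs_le h hc ht x hm
  have hB0 : 0 ≤ B := (abs_nonneg _).trans
    (hUB 𝒢.T ⟨h.T_pos.le, le_rfl⟩ 0 _ (dirac_mem_simplex 0))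
  have hΛ0 : (0 : ℝ) ≤ Λ := Λ.2
  have hΛ'0 : (0 : ℝ) ≤ Λ' := Λ'.2
  set CD := √(d : ℝ) * (2 * B * d + 2 * Λ) + 2 * Λ with hCD
  have hCD0 : 0 ≤ CD := by positivity
  have hQ := quadConst_nonneg hΛ0 (d - 1)
  have hM := h.M_pos
  set Q := quadConst Λ (d - 1)
  set R := 1 + 2 * √(d : ℝ) + d + 𝒢.M + Λ' + √(d : ℝ) * 𝒢.M + CD + 2 * Λ + 2 * Q with hR
  have h0 : 0 ≤ √(d : ℝ) := Real.sqrt_nonneg _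
  have h1 : (0 : ℝ) ≤ d := by positivity
  have h2 : 0 ≤ √(d : ℝ) * 𝒢.M := by positivity
  have hball : ∀ p : Vec d, ‖p‖ ≤ 2 * √(d : ℝ) * B → p ∈ Metric.closedBall (0 : Vec d) K' :=
    fun p hp => mem_closedBall_zero_iff.2 (hp.trans hK)
  have hcont := fun {t} ht x => hreg.continuousOn (t := t) ht x
  have hDn : ∀ t ∈ Icc 0 𝒢.T, ∀ m ∈ simplex d, ∀ x y, ‖D t x m y‖ ≤ CD := fun t ht m hm x y =>
    norm_le_of_abs_move_le (hreg.c1 t ht x) (hcont ht x) (hreg.lip t ht x) (hUB t ht x) hm y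
  have hexp := fun t ht m hm m' hm' x p => IsC1Deriv.abs_expansion_le (hreg.c1 t ht x)
    (hcont ht x) (hreg.lip t ht x) (m := m) hm (m' := m') hm' p
  refine ⟨Ut, D, R, h, ⟨Λ, hreg⟩, by linarith, by linarith, by linarith, by linarith,
    fun x p q hp hq => ?_, fun x p q hp hq => ?_, fun x p => ?_,
    fun t ht m hm x => norm_diff_le (fun y => hUB t ht y m hm) x,
    fun t ht m hm x y => (hDn t ht m hm x y).trans (by linarith), fun t ht m hm m' hm' x y => ?_,
    fun t ht m hm m' hm' x => ?_, fun t ht m hm m' hm' x p => ?_,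
    fun t ht m hm x y z c hcm => ?_⟩
  · have := (hΛ' x).1.dist_le_mul _ (hball p hp) _ (hball q hq)
    rw [Real.dist_eq, dist_eq_norm] at this
    exact this.trans (mul_le_mul_of_nonneg_right (by linarith) (norm_nonneg _))
  · have := (hΛ' x).2.dist_le_mul _ (hball p hp) _ (hball q hq)
    rw [dist_eq_norm, dist_eq_norm] at this
    exact this.trans (mul_le_mul_of_nonneg_right (by linarith) (norm_nonneg _))
  · refine (norm_le_sqrt_mul hM.le fun y => ?_).trans (by linarith : √(d : ℝ) * 𝒢.M ≤ R)
    rw [abs_of_nonneg (h.optControl_nonneg x p y)]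
    exact h.optControl_le x p y
  · have := (hreg.lip t ht x y).dist_le_mul _ hm _ hm'
    rw [dist_eq_norm, dist_eq_norm] at this
    exact this.trans (mul_le_mul_of_nonneg_right (by linarith) (norm_nonneg _))
  · have h3 := hexp t ht m' hm' m hm x x
    have h4 := abs_real_inner_le_norm (D t x m' x) (m - m')
    have h5 : ‖D t x m' x‖ * ‖m - m'‖ ≤ CD * ‖m - m'‖ := by
      gcongr; exact hDn t ht m' hm' x x
    have h6 := norm_sub_le_two hm' hm
    have h7 : Q * ‖m - m'‖ ^ 2 ≤ 2 * Q * ‖m - m'‖ := by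
      nlinarith [mul_nonneg hQ (norm_nonneg (m - m'))]
    have h8 := abs_add_le (U t x m - U t x m' - inner ℝ (D t x m' x) (m - m'))
      (inner ℝ (D t x m' x) (m - m'))
    rw [sub_add_cancel] at h8
    have h9 : (CD + 2 * Q) * ‖m - m'‖ ≤ R * ‖m - m'‖ :=
      mul_le_mul_of_nonneg_right (by linarith) (norm_nonneg _)
    linarith
  · exact (hexp t ht m hm m' hm' x p).trans (mul_le_mul_of_nonneg_right (by linarith) (by positivity))
  · exact (IsC1Deriv.abs_move_sub_le (hreg.c1 t ht x) (hcont ht x) (hreg.lip t ht x) hm hcm.1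
      hcm.2 z).trans (mul_le_mul_of_nonneg_right (by linarith) (by positivity))

/-! ### The chain rule for `U` along flows of measures. -/

namespace Game.Estimates

lemma nonneg (h : 𝒢.Estimates U Ut D K R) : 0 ≤ R := zero_le_one.trans h.one_le

lemma continuousOn_time (h : 𝒢.Estimates U Ut D K R) {m : Vec d} (hm : m ∈ simplex d)
    (x : Fin d) : ContinuousOn (fun t => U t x m) (Icc 0 𝒢.T) := by
  obtain ⟨Λ, hr⟩ := h.regular
  exact (hr.cont x).comp (f := fun t => (t, m)) (by fun_prop) fun t ht => ⟨ht, hm⟩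

/-- Regularity gives no continuity of `D^m U` in time directly. It holds because the difference
quotients in the measure are continuous in time and converge uniformly, with error `R c`. -/
lemma continuousOn_D_time (h : 𝒢.Estimates U Ut D K R) {m : Vec d} (hm : m ∈ simplex d)
    (x : Fin d) {p : Fin d} (hp : 0 < m p) :
    ContinuousOn (fun t => D t x m p) (Icc 0 𝒢.T) := by
  have hR : 0 < R := zero_lt_one.trans_le h.one_le
  have key : ∀ z, ContinuousOn (fun t => D t x m p z) (Icc 0 𝒢.T) := by
    intro z
    refine continuousOn_of_uniform_approx_of_continuousOn fun u hu => ?_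
    obtain ⟨ε, hε, hεu⟩ := Metric.mem_uniformity_dist.1 hu
    -- Admissible as a transfer out of `p`, and small enough for the error `R c` to be below `ε`.
    set c := min (m p) (ε / (2 * R)) with hc
    have hc0 : 0 < c := lt_min hp (by positivity)
    refine ⟨fun t => (U t x (m + c • (dirac z - dirac p)) - U t x m) / c,
      ((h.continuousOn_time (move_mem_simplex hm hc0.le (min_le_left _ _) z) x).sub
        (h.continuousOn_time hm x)).div_const c, fun t ht => hεu ?_⟩
    have h1 := h.move t ht m hm x p z c ⟨hc0.le, min_le_left _ _⟩
    rw [dist_comm, Real.dist_eq]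
    have e : (U t x (m + c • (dirac z - dirac p)) - U t x m) / c - D t x m p z =
        (U t x (m + c • (dirac z - dirac p)) - U t x m - c * D t x m p z) / c := by
      field_simp
    rw [e, abs_div, abs_of_pos hc0, div_lt_iff₀ hc0]
    have h2 : c ≤ ε / (2 * R) := min_le_right _ _
    rw [le_div_iff₀ (by positivity)] at h2
    nlinarith
  exact (PiLp.continuous_toLp 2 _).comp_continuousOn (continuousOn_pi.2 key)

/-- The chain rule for `U` along a differentiable curve of probability vectors. -/
theorem hasDerivWithinAt_along (h : 𝒢.Estimates U Ut D K R) {m : ℝ → Vec d}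
    (hm : ∀ t ∈ Icc 0 𝒢.T, m t ∈ simplex d) {t : ℝ} (ht : t ∈ Icc 0 𝒢.T) {m' : Vec d}
    (hd : HasDerivWithinAt m m' (Icc 0 𝒢.T) t) (x : Fin d) {p : Fin d} (hp : 0 < m t p) :
    HasDerivWithinAt (fun s => U s x (m s)) (Ut t x (m t) + inner ℝ (D t x (m t) p) m')
      (Icc 0 𝒢.T) t := by
  obtain ⟨Λ, hr⟩ := h.regular
  have h1 := hr.deriv x (m t) (hm t ht) t ht
  -- The measure is varied at the moving time `s`, so the expansion involves `D s`; its continuity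
  -- in time recovers the derivative at `t`.
  have h2 : HasDerivWithinAt (fun s => U s x (m s) - U s x (m t)) (inner ℝ (D t x (m t) p) m')
      (Icc 0 𝒢.T) t := by
    rw [hasDerivWithinAt_iff_tendsto_slope] at hd ⊢
    have hms : Tendsto m (𝓝[Icc 0 𝒢.T \ {t}] t) (𝓝 (m t)) := by
      have := hasDerivWithinAt_iff_tendsto_slope.2 hd
      exact this.continuousWithinAt.mono_left (nhdsWithin_mono _ sdiff_subset)
    have hDs : Tendsto (fun s => D s x (m t) p) (𝓝[Icc 0 𝒢.T \ {t}] t) (𝓝 (D t x (m t) p)) :=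
      (h.continuousOn_D_time (hm t ht) x hp t ht).mono_left (nhdsWithin_mono _ sdiff_subset)
    have h3 : Tendsto (fun s => inner ℝ (D s x (m t) p) (slope m t s)) (𝓝[Icc 0 𝒢.T \ {t}] t)
        (𝓝 (inner ℝ (D t x (m t) p) m')) := hDs.inner hd
    have h4 : Tendsto (fun s => R * (‖slope m t s‖ * ‖m s - m t‖)) (𝓝[Icc 0 𝒢.T \ {t}] t)
        (𝓝 0) := by
      have : Tendsto (fun s => R * (‖slope m t s‖ * ‖m s - m t‖)) (𝓝[Icc 0 𝒢.T \ {t}] t)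
          (𝓝 (R * (‖m'‖ * ‖m t - m t‖))) :=
        (hd.norm.mul (hms.sub_const _).norm).const_mul R
      simpa using this
    have h5 := squeeze_zero_norm' (f := fun s => slope (fun s => U s x (m s) - U s x (m t)) t s
      - inner ℝ (D s x (m t) p) (slope m t s)) ?_ h4
    · simpa using h5.add h3
    · filter_upwards [self_mem_nhdsWithin] with s hs
      have h6 := h.expansion s hs.1 (m t) (hm t ht) (m s) (hm s hs.1) x p
      have hst : 0 < |s - t| := abs_pos.2 (sub_ne_zero.2 hs.2)
      have e : slope (fun s => U s x (m s) - U s x (m t)) t s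
          - inner ℝ (D s x (m t) p) (slope m t s) = (s - t)⁻¹ *
          (U s x (m s) - U s x (m t) - inner ℝ (D s x (m t) p) (m s - m t)) := by
        simp only [slope, vsub_eq_sub, sub_self, sub_zero, smul_eq_mul, inner_smul_right]
        ring
      have e2 : ‖slope m t s‖ = |s - t|⁻¹ * ‖m s - m t‖ := by
        rw [slope, vsub_eq_sub, norm_smul, norm_inv, Real.norm_eq_abs]
      rw [e, e2, norm_mul, norm_inv, Real.norm_eq_abs, Real.norm_eq_abs]
      calc _ ≤ |s - t|⁻¹ * (R * ‖m s - m t‖ ^ 2) := by gcongr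
        _ = _ := by ring
  refine (h1.add h2).congr_of_mem (fun s _ => ?_) ht
  simp

/-- Since `D(m,y)_z = D(m,p)_z - D(m,p)_y` for `m y > 0`, regrouping the sums turns the derivative
along the drift into the integral term of the master equation. -/
lemma inner_kolmogorovDrift (h : 𝒢.Estimates U Ut D K R) {t : ℝ} (ht : t ∈ Icc 0 𝒢.T)
    (x : Fin d) {m : Vec d} (hm : m ∈ simplex d) (p : Fin d) (γ : Fin d → Vec d) :
    inner ℝ (D t x m p) (WithLp.toLp 2 (kolmogorovDrift γ m)) =
      ∑ y, m y * inner ℝ (D t x m y) (γ y) := by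
  obtain ⟨Λ, hr⟩ := h.regular
  have h1 : ∀ y, m y * inner ℝ (D t x m y) (γ y) =
      m y * ∑ z, (D t x m p z - D t x m p y) * γ y z := fun y => by
    rcases (hm.1 y).eq_or_lt with h0 | h0
    · rw [← h0, zero_mul, zero_mul]
    · rw [inner_eq_sum]
      congr 1
      refine Finset.sum_congr rfl fun z _ => ?_
      rw [IsC1Deriv.eq_sub (hr.c1 t ht x) (hr.continuousOn ht x) (hr.lip t ht x) hm h0 p z]
  rw [inner_eq_sum, Finset.sum_congr rfl fun y _ => h1 y]
  simp only [kolmogorovDrift, mul_sub, sub_mul, Finset.sum_sub_distrib, Finset.mul_sum]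
  congr 1
  · rw [Finset.sum_comm]
    exact Finset.sum_congr rfl fun y _ => Finset.sum_congr rfl fun z _ => by ring
  · exact Finset.sum_congr rfl fun y _ => Finset.sum_congr rfl fun z _ => by ring

/-- The value function `U` along a Kolmogorov flow with rates `γ`. -/
lemma hasDerivWithinAt_flow (h : 𝒢.Estimates U Ut D K R) {m : ℝ → Vec d}
    (hm : ∀ t ∈ Icc 0 𝒢.T, m t ∈ simplex d) {t : ℝ} (ht : t ∈ Icc 0 𝒢.T) {γ : Fin d → Vec d}
    (hd : HasDerivWithinAt m (WithLp.toLp 2 (kolmogorovDrift γ (m t))) (Icc 0 𝒢.T) t)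
    (x : Fin d) :
    HasDerivWithinAt (fun s => U s x (m s))
      (𝒢.hamiltonian x (diff (fun y => U t y (m t)) x) - 𝒢.F x (m t) +
        ∑ y, m t y * inner ℝ (D t x (m t) y)
          (γ y - 𝒢.optControl y (diff (fun z => U t z (m t)) y))) (Icc 0 𝒢.T) t := by
  obtain ⟨Λ, hr⟩ := h.regular
  obtain ⟨p, hp⟩ := exists_pos_of_mem_simplex (hm t ht)
  refine (h.hasDerivWithinAt_along hm ht hd x hp).congr_deriv ?_
  rw [h.inner_kolmogorovDrift ht x (hm t ht), hr.eqn t ht x _ (hm t ht)]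
  simp only [inner_sub_right, mul_sub, Finset.sum_sub_distrib]
  ring

end Game.Estimates

/-! ### Forward and backward Gronwall uniqueness. -/

section Gronwall

variable {E : Type*} [NormedAddCommGroup E] [NormedSpace ℝ E] {f f' : ℝ → E} {T C : ℝ}

lemma eq_zero_of_norm_deriv_le_of_left
    (hf : ∀ t ∈ Icc 0 T, HasDerivWithinAt f (f' t) (Icc 0 T) t) (h0 : f 0 = 0)
    (hb : ∀ t ∈ Icc 0 T, ‖f' t‖ ≤ C * ‖f t‖) : ∀ t ∈ Icc 0 T, f t = 0 :=
  eq_zero_of_abs_deriv_le_mul_abs_self_of_eq_zero_right (f' := f')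
    (fun t ht => (hf t ht).continuousWithinAt)
    (fun t ht => (hf t ⟨ht.1, ht.2.le⟩).mono_of_mem_nhdsWithin
      (mem_of_superset (Icc_mem_nhdsGE ht.2) (Icc_subset_Icc_left ht.1)))
    h0 fun t ht => hb t ⟨ht.1, ht.2.le⟩

lemma eq_zero_of_norm_deriv_le_of_right
    (hf : ∀ t ∈ Icc 0 T, HasDerivWithinAt f (f' t) (Icc 0 T) t) (hT : f T = 0)
    (hb : ∀ t ∈ Icc 0 T, ‖f' t‖ ≤ C * ‖f t‖) : ∀ t ∈ Icc 0 T, f t = 0 := by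
  have hm : ∀ t ∈ Icc 0 T, T - t ∈ Icc 0 T := fun t ht =>
    ⟨by linarith [ht.2], by linarith [ht.1]⟩
  have h := eq_zero_of_norm_deriv_le_of_left (f := fun t => f (T - t)) (T := T) (C := C)
    (f' := fun t => -f' (T - t)) (fun t ht => ?_) (by simpa using hT) fun t ht => by
      rw [norm_neg]; exact hb _ (hm t ht)
  · intro t ht
    simpa using h _ (hm t ht)
  · have h1 : HasDerivWithinAt (fun t : ℝ => T - t) (-1) (Icc 0 T) t :=
      (hasDerivWithinAt_id t _).const_sub T
    have := HasDerivWithinAt.scomp (h := fun t : ℝ => T - t) t (hf _ (hm t ht)) h1 hm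
    simpa [Function.comp_def] using this

end Gronwall

/-! ### The limit flow and the mean field game system. -/

variable {d : ℕ} {𝒢 : Game d} {U Ut : ℝ → Fin d → Vec d → ℝ}
  {D : ℝ → Fin d → Vec d → Fin d → Vec d} {K R : ℝ}

lemma hasDerivWithinAt_toLp {m : ℝ → Vec d} {m' : Fin d → ℝ} {s : Set ℝ} {t : ℝ}
    (h : ∀ z, HasDerivWithinAt (fun s => m s z) (m' z) s t) :
    HasDerivWithinAt m (WithLp.toLp 2 m') s t := by
  have h1 : HasDerivWithinAt (fun s => WithLp.ofLp (m s)) m' s t := hasDerivWithinAt_pi.2 h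
  exact (PiLp.continuousLinearEquiv 2 ℝ fun _ : Fin d => ℝ).symm.hasFDerivAt.comp_hasDerivWithinAt
    t h1

/-- The transition rates `α*(y, Δ^y U(t,y,m))`. -/
noncomputable def Game.optimalRate (𝒢 : Game d) (U : ℝ → Fin d → Vec d → ℝ) (t : ℝ) (m : Vec d) (y : Fin d) :
    Vec d := 𝒢.optControl y (diff (fun z => U t z m) y)

/-- The flow of probability vectors driven by the rates `α*(y, Δ^y U(t,y,μ(t)))`. -/
structure Game.IsLimitFlow (𝒢 : Game d) (U : ℝ → Fin d → Vec d → ℝ) (μ : ℝ → Vec d) : Prop where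
  mem : ∀ t ∈ Icc 0 𝒢.T, μ t ∈ simplex d
  deriv : ∀ t ∈ Icc 0 𝒢.T, HasDerivWithinAt μ
    (WithLp.toLp 2 (kolmogorovDrift (𝒢.optimalRate U t (μ t)) (μ t))) (Icc 0 𝒢.T) t

lemma Game.IsLimitFlow.continuousOn {μ : ℝ → Vec d} (h : 𝒢.IsLimitFlow U μ) :
    ContinuousOn μ (Icc 0 𝒢.T) := fun t ht => (h.deriv t ht).continuousWithinAt

lemma norm_kolmogorovDrift_sub_le {γ γ' : Fin d → Vec d} {m m' : Vec d} {M ε : ℝ}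
    (hm : m ∈ simplex d) (hM : 0 ≤ M) (hγ : ∀ y z, |γ' y z| ≤ M)
    (hε : ∀ y, ‖γ y - γ' y‖ ≤ ε) :
    ‖(WithLp.toLp 2 (kolmogorovDrift γ m) - WithLp.toLp 2 (kolmogorovDrift γ' m') : Vec d)‖ ≤
      √(d : ℝ) * (2 * d * (ε + M * ‖m - m'‖)) := by
  have hm1 : ∀ y, m y ≤ 1 := fun y => by
    rw [← hm.2]; exact Finset.single_le_sum (fun z _ => hm.1 z) (Finset.mem_univ y)
  rcases isEmpty_or_nonempty (Fin d) with hd | ⟨⟨y₀⟩⟩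
  · rw [show (WithLp.toLp 2 (kolmogorovDrift γ m) - WithLp.toLp 2 (kolmogorovDrift γ' m') : Vec d)
      = 0 from Subsingleton.elim _ _, norm_zero]
    have : d = 0 := by
      rcases Nat.eq_zero_or_pos d with h | h
      · exact h
      · exact (hd.false ⟨0, h⟩).elim
    simp [this]
  have hε0 : 0 ≤ ε := (norm_nonneg _).trans (hε y₀)
  have key : ∀ y y' z, |m y * γ y' z - m' y * γ' y' z| ≤ ε + M * ‖m - m'‖ := fun y y' z => by
    have e : m y * γ y' z - m' y * γ' y' z =
        m y * (γ y' - γ' y') z + (m - m') y * γ' y' z := by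
      simp only [PiLp.sub_apply]; ring
    rw [e]
    refine (abs_add_le _ _).trans (add_le_add ?_ ?_)
    · rw [abs_mul, abs_of_nonneg (hm.1 y)]
      have := (abs_apply_le_norm (γ y' - γ' y') z).trans (hε y')
      calc m y * |(γ y' - γ' y') z| ≤ 1 * ε := mul_le_mul (hm1 y) this (abs_nonneg _) zero_le_one
        _ = ε := one_mul _
    · rw [abs_mul, mul_comm M]
      exact mul_le_mul (abs_apply_le_norm _ _) (hγ _ _) (abs_nonneg _) (norm_nonneg _)
  refine norm_le_sqrt_mul (by positivity) fun z => ?_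
  have e : (WithLp.toLp 2 (kolmogorovDrift γ m) - WithLp.toLp 2 (kolmogorovDrift γ' m') : Vec d) z =
      ∑ y, (m y * γ y z - m' y * γ' y z) - ∑ y, (m z * γ z y - m' z * γ' z y) := by
    simp only [PiLp.sub_apply, kolmogorovDrift, Finset.sum_sub_distrib, Finset.mul_sum]
    ring
  have hs : ∀ g : Fin d → ℝ, (∀ y, |g y| ≤ ε + M * ‖m - m'‖) →
      |∑ y, g y| ≤ d * (ε + M * ‖m - m'‖) := fun g hg =>
    (Finset.abs_sum_le_sum_abs _ _).trans ((Finset.sum_le_sum fun y _ => hg y).trans_eq (by simp; ring))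
  rw [e]
  refine (abs_sub _ _).trans ((add_le_add (hs _ fun y => key y y z)
    (hs _ fun y => key z z y)).trans_eq (by ring))

namespace Game.Estimates

lemma norm_optimalRate_sub_le (h : 𝒢.Estimates U Ut D K R) {t : ℝ} (ht : t ∈ Icc 0 𝒢.T)
    {m m' : Vec d} (hm : m ∈ simplex d) (hm' : m' ∈ simplex d) (y : Fin d) :
    ‖𝒢.optimalRate U t m y - 𝒢.optimalRate U t m' y‖ ≤ R ^ 3 * ‖m - m'‖ := by
  have hR := h.nonneg
  have h1 : ‖diff (fun z => U t z m) y - diff (fun z => U t z m') y‖ ≤ R * (R * ‖m - m'‖) :=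
    (norm_diff_sub_le (fun z => h.U_lip t ht m hm m' hm' z) y).trans
      (mul_le_mul_of_nonneg_right h.sqrt_le (by positivity))
  calc _ ≤ R * ‖diff (fun z => U t z m) y - diff (fun z => U t z m') y‖ :=
        h.optControl_lip y _ _ (h.norm_diff t ht m hm y) (h.norm_diff t ht m' hm' y)
    _ ≤ R * (R * (R * ‖m - m'‖)) := by gcongr
    _ = _ := by ring

lemma continuousOn_optControl (h : 𝒢.Estimates U Ut D K R) (y : Fin d) :
    ContinuousOn (𝒢.optControl y) (Metric.closedBall 0 K) :=
  (LipschitzOnWith.of_dist_le_mul (K := R.toNNReal) fun p hp q hq => by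
    rw [dist_eq_norm, dist_eq_norm, Real.coe_toNNReal _ h.nonneg]
    exact h.optControl_lip y p q (mem_closedBall_zero_iff.1 hp)
      (mem_closedBall_zero_iff.1 hq)).continuousOn

lemma continuousOn_optimalRate (h : 𝒢.Estimates U Ut D K R) {μ : ℝ → Vec d}
    (hμ : ∀ t ∈ Icc 0 𝒢.T, μ t ∈ simplex d) (hc : ContinuousOn μ (Icc 0 𝒢.T)) (y : Fin d) :
    ContinuousOn (fun t => 𝒢.optimalRate U t (μ t) y) (Icc 0 𝒢.T) := by
  obtain ⟨Λ, hr⟩ := h.regular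
  have h1 : ∀ z, ContinuousOn (fun t => U t z (μ t)) (Icc 0 𝒢.T) := fun z =>
    (hr.cont z).comp (f := fun t => (t, μ t)) (continuousOn_id.prodMk hc) fun t ht => ⟨ht, hμ t ht⟩
  have h2 : ContinuousOn (fun t => diff (fun z => U t z (μ t)) y) (Icc 0 𝒢.T) :=
    (PiLp.continuous_toLp 2 _).comp_continuousOn
      (continuousOn_pi.2 fun z => (h1 z).sub (h1 y))
  exact (h.continuousOn_optControl y).comp h2 fun t ht => mem_closedBall_zero_iff.2 (h.norm_diff t ht _ (hμ t ht) y)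

/-- The drift is Lipschitz in the measure, because `U` is Lipschitz in `m` and `α*` is Lipschitz on
the ball containing the differences; Gronwall applies. -/
theorem limitFlow_unique (h : 𝒢.Estimates U Ut D K R) {μ μ' : ℝ → Vec d}
    (hμ : 𝒢.IsLimitFlow U μ) (hμ' : 𝒢.IsLimitFlow U μ') (h0 : μ 0 = μ' 0) :
    ∀ t ∈ Icc 0 𝒢.T, μ t = μ' t := by
  have hM := h.standing.M_pos
  have key := eq_zero_of_norm_deriv_le_of_left (f := fun t => μ t - μ' t)
    (C := √(d : ℝ) * (2 * d * (R ^ 3 + 𝒢.M)))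
    (fun t ht => (hμ.deriv t ht).fun_sub (hμ'.deriv t ht)) (sub_eq_zero.2 h0) fun t ht => ?_
  · exact fun t ht => sub_eq_zero.1 (key t ht)
  · refine (norm_kolmogorovDrift_sub_le (hμ.mem t ht) hM.le (fun y z => ?_)
      fun y => h.norm_optimalRate_sub_le ht (hμ.mem t ht) (hμ'.mem t ht) y).trans_eq (by ring)
    rw [Game.optimalRate, abs_of_nonneg (h.standing.optControl_nonneg _ _ _)]
    exact h.standing.optControl_le _ _ _

/-- Along the flow of a mean field game solution, `U` coincides with the value function. -/
theorem eq_value (h : 𝒢.Estimates U Ut D K R) {m₀ : Vec d} {u : ℝ → Fin d → ℝ} {m : ℝ → Vec d}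
    (hu : 𝒢.IsMFGSolution m₀ u m) (hK : ∀ t ∈ Icc 0 𝒢.T, ∀ x, ‖diff (u t) x‖ ≤ K) :
    ∀ t ∈ Icc 0 𝒢.T, ∀ x, U t x (m t) = u t x := by
  obtain ⟨Λ, hr⟩ := h.regular
  have hR := h.nonneg
  obtain ⟨hmem, hud, hmd, huT, -⟩ := hu
  have hdm : ∀ t ∈ Icc 0 𝒢.T, HasDerivWithinAt m (WithLp.toLp 2
      (kolmogorovDrift (fun y => 𝒢.optControl y (diff (u t) y)) (m t))) (Icc 0 𝒢.T) t :=
    fun t ht => hasDerivWithinAt_toLp fun z => by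
      rw [kolmogorovDrift_eq_erase]; exact hmd t ht z
  -- The difference vanishes at `T`. In its derivative, `H` contributes `R²` times its norm, and the
  -- discrepancy of the rates tested against `D^m U` contributes `R³` times it.
  have key := eq_zero_of_norm_deriv_le_of_right (f := fun t x => U t x (m t) - u t x)
    (C := R ^ 2 + R ^ 3)
    (fun t ht => hasDerivWithinAt_pi.2 fun x =>
      (h.hasDerivWithinAt_flow hmem ht (hdm t ht) x).fun_sub (hud t ht x)) ?_ fun t ht => ?_
  · exact fun t ht x => sub_eq_zero.1 (congrFun (key t ht) x)
  · ext x
    simp only [Pi.zero_apply]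
    rw [huT, hr.terminal x _ (hmem _ ⟨h.standing.T_pos.le, le_rfl⟩), sub_self]
  · set n := ‖fun x => U t x (m t) - u t x‖ with hn
    have hn0 : 0 ≤ n := norm_nonneg _
    refine (pi_norm_le_iff_of_nonneg (by positivity)).2 fun x => ?_
    have h1 : ∀ y, ‖diff (fun z => U t z (m t)) y - diff (u t) y‖ ≤ R * n := fun y =>
      (norm_diff_sub_le (fun z => norm_le_pi_norm (fun x => U t x (m t) - u t x) z) y).trans
        (mul_le_mul_of_nonneg_right h.sqrt_le hn0)
    have hKU := h.norm_diff t ht (m t) (hmem t ht)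
    have h2 := h.hamiltonian_lip x _ _ (hKU x) (hK t ht x)
    have h3 : |∑ y, m t y * inner ℝ (D t x (m t) y) (𝒢.optControl y (diff (u t) y) -
        𝒢.optControl y (diff (fun z => U t z (m t)) y))| ≤ R ^ 3 * n := by
      calc _ ≤ ∑ y, m t y * (R ^ 3 * n) := by
            refine (Finset.abs_sum_le_sum_abs _ _).trans (Finset.sum_le_sum fun y _ => ?_)
            rw [abs_mul, abs_of_nonneg ((hmem t ht).1 y)]
            refine mul_le_mul_of_nonneg_left ?_ ((hmem t ht).1 y)
            have h4 := h.optControl_lip y _ _ (hK t ht y) (hKU y)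
            rw [norm_sub_rev] at h4
            calc _ ≤ _ := abs_real_inner_le_norm _ _
              _ ≤ R * (R * (R * n)) := by
                rw [norm_sub_rev]
                refine mul_le_mul (h.norm_D t ht _ (hmem t ht) x y) (h4.trans ?_)
                  (norm_nonneg _) hR
                gcongr
                rw [norm_sub_rev]; exact h1 y
              _ = R ^ 3 * n := by ring
        _ = R ^ 3 * n := by rw [← Finset.sum_mul, (hmem t ht).2, one_mul]
    rw [Real.norm_eq_abs]
    have h5 : R * ‖diff (fun z => U t z (m t)) x - diff (u t) x‖ ≤ R * (R * n) := by
      gcongr; exact h1 x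
    have h6 := _root_.abs_le.1 h2
    have h7 := _root_.abs_le.1 h3
    rw [_root_.abs_le]
    constructor <;> nlinarith

lemma isLimitFlow_of_isMFGSolution (h : 𝒢.Estimates U Ut D K R) {m₀ : Vec d}
    {u : ℝ → Fin d → ℝ} {m : ℝ → Vec d} (hu : 𝒢.IsMFGSolution m₀ u m)
    (hK : ∀ t ∈ Icc 0 𝒢.T, ∀ x, ‖diff (u t) x‖ ≤ K) : 𝒢.IsLimitFlow U m where
  mem := hu.1
  deriv t ht := hasDerivWithinAt_toLp fun z => by
    rw [kolmogorovDrift_eq_erase]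
    have e : ∀ y, 𝒢.optimalRate U t (m t) y = 𝒢.optControl y (diff (u t) y) := fun y => by
      rw [Game.optimalRate]
      congr 2
      exact funext fun z => h.eq_value hu hK t ht z
    simp only [e]
    exact hu.2.2.1 t ht z

end Game.Estimates

/-! ### The common law of the limit processes. -/

section Limit

variable {N : ℕ} {Ω : Type*} [MeasurableSpace Ω] {P : Measure Ω}
  {m₀ : Vec d} {Z : Fin N → Ω → Fin d} {Nm : Fin N → Ω → Measure (ℝ × (Fin d → ℝ))}
  {X : Fin N → ℝ → Ω → Fin d}

lemma SolvesSDE.lawVec_zero {T M : ℝ} {β : Fin N → ℝ → (Fin N → Fin d) → Vec d} (hT : 0 ≤ T)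
    (hN : IsNoise P T M m₀ Z Nm) (hX : SolvesSDE P T Z Nm β X) (i : Fin N) :
    lawVec P (X i 0) = m₀ := by
  rw [← hN.law_init i]
  have : X i 0 =ᵐ[P] Z i := by
    filter_upwards [hX.eqn] with ω hω
    have := hω i 0 ⟨le_rfl, hT⟩
    simp only [Ioc_self, empty_prod, Measure.restrict_empty, integral_zero_measure, add_zero,
      Nat.cast_inj] at this
    exact Fin.ext this
  ext x
  refine measureReal_congr ?_
  filter_upwards [this] with ω hω
  exact congrArg (fun y => y = x) hω

/-- The rates of the limit processes, extended continuously to all times. -/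
noncomputable def Game.limitRate (𝒢 : Game d) (U : ℝ → Fin d → Vec d → ℝ) (μ : ℝ → Vec d) (t : ℝ) (y : Fin d) :
    Vec d := 𝒢.optimalRate U (max 0 (min t 𝒢.T)) (μ (max 0 (min t 𝒢.T))) y

lemma Game.limitRate_eq {μ : ℝ → Vec d} {t : ℝ} (ht : t ∈ Icc 0 𝒢.T) (y : Fin d) :
    𝒢.limitRate U μ t y = 𝒢.optimalRate U t (μ t) y := by
  rw [limitRate, min_eq_left ht.2, max_eq_right ht.1]

lemma Game.Estimates.isRegularFeedback_limitRate (h : 𝒢.Estimates U Ut D K R) {μ : ℝ → Vec d}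
    (hμ : 𝒢.IsLimitFlow U μ) (n : ℕ) :
    IsRegularFeedback 𝒢.M (fun (i : Fin n) t (x : Fin n → Fin d) => 𝒢.limitRate U μ t (x i)) :=
  isRegularFeedback_clampFeedback (M := 𝒢.M)
    (β := fun (i : Fin n) t (x : Fin n → Fin d) => 𝒢.optimalRate U t (μ t) (x i))
    h.standing.T_pos.le
    (fun i x y => (EuclideanSpace.proj (𝕜 := ℝ) y).continuous.comp_continuousOn
      (h.continuousOn_optimalRate hμ.mem hμ.continuousOn (x i)))
    (fun _ _ _ _ _ => h.standing.optControl_nonneg _ _ _)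
    (fun _ _ _ _ _ => h.standing.optControl_le _ _ _)

lemma Game.solvesSDE_limitRate {μ : ℝ → Vec d}
    (hX : SolvesSDE P 𝒢.T Z Nm (𝒢.limitFeedback U (fun i t => lawVec P (X i t))) X)
    (hμ : ∀ i, ∀ t ∈ Icc 0 𝒢.T, lawVec P (X i t) = μ t) :
    SolvesSDE P 𝒢.T Z Nm (fun i t x => 𝒢.limitRate U μ t (x i)) X :=
  hX.congr fun i t ht x => by
    rw [limitRate_eq ht, limitFeedback, hμ i t ht, optimalRate]

variable [IsProbabilityMeasure P]

/-- The Kolmogorov equation with rates evaluated along the law itself is the equation of the limit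
flow. Continuity of the law in time makes the feedback regular, as Dynkin's formula requires. -/
lemma Game.Estimates.isLimitFlow_lawVec (h : 𝒢.Estimates U Ut D K R)
    (hN : IsNoise P 𝒢.T 𝒢.M m₀ Z Nm)
    (hX : SolvesSDE P 𝒢.T Z Nm (𝒢.limitFeedback U (fun i t => lawVec P (X i t))) X) (i : Fin N) :
    𝒢.IsLimitFlow U (fun t => lawVec P (X i t)) := by
  have hT := h.standing.T_pos.le
  have hM := h.standing.M_pos.le
  have hmem : ∀ i, ∀ t ∈ Icc 0 𝒢.T, lawVec P (X i t) ∈ simplex d := fun i t ht =>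
    lawVec_mem_simplex (hX.measurable i t ht)
  have hreg := isRegularFeedback_clampFeedback (M := 𝒢.M)
    (β := 𝒢.limitFeedback U (fun i t => lawVec P (X i t))) hT
    (fun i x y => (EuclideanSpace.proj (𝕜 := ℝ) y).continuous.comp_continuousOn
      (h.continuousOn_optimalRate (hmem i) (hX.continuousOn_lawVec hN hM i) (x i)))
    (fun _ _ _ _ _ => h.standing.optControl_nonneg _ _ _)
    (fun _ _ _ _ _ => h.standing.optControl_le _ _ _)
  refine ⟨hmem i, fun t ht => hasDerivWithinAt_toLp fun z => ?_⟩
  have := SolvesSDE.hasDerivWithinAt_lawVec (γ := fun i t y =>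
    𝒢.optimalRate U (max 0 (min t 𝒢.T)) (lawVec P (X i (max 0 (min t 𝒢.T)))) y) hM hN hreg
    hX.clamp i z ht
  simpa only [min_eq_left ht.2, max_eq_right ht.1] using this

/-- The limit processes follow the unique flow started at `m₀`. -/
lemma Game.Estimates.exists_limitFlow (h : 𝒢.Estimates U Ut D K R) (hNpos : 0 < N)
    (hN : IsNoise P 𝒢.T 𝒢.M m₀ Z Nm)
    (hX : SolvesSDE P 𝒢.T Z Nm (𝒢.limitFeedback U (fun i t => lawVec P (X i t))) X) :
    ∃ μ, 𝒢.IsLimitFlow U μ ∧ μ 0 = m₀ ∧ ∀ i, ∀ t ∈ Icc 0 𝒢.T, lawVec P (X i t) = μ t :=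
  ⟨_, h.isLimitFlow_lawVec hN hX ⟨0, hNpos⟩, hX.lawVec_zero h.standing.T_pos.le hN _,
    fun i t ht => h.limitFlow_unique (h.isLimitFlow_lawVec hN hX i)
      (h.isLimitFlow_lawVec hN hX ⟨0, hNpos⟩)
      ((hX.lawVec_zero h.standing.T_pos.le hN _).trans
        (hX.lawVec_zero h.standing.T_pos.le hN _).symm) t ht⟩

end Limit

variable {d N : ℕ}

/-! ### Empirical measures of the other players. -/

section Empirical

lemma cast_sub_one_pos (hN : 2 ≤ N) : (0 : ℝ) < (N : ℝ) - 1 := by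
  have : (2 : ℝ) ≤ N := by exact_mod_cast hN
  linarith

lemma empiricalOther_apply (i : Fin N) (x : Fin N → Fin d) (z : Fin d) :
    empiricalOther i x z = 1 / ((N : ℝ) - 1) * ∑ j ∈ Finset.univ.erase i, dirac (x j) z := by
  simp [empiricalOther]

lemma empiricalOther_update_self (i : Fin N) (x : Fin N → Fin d) (y : Fin d) :
    empiricalOther i (Function.update x i y) = empiricalOther i x := by
  rw [empiricalOther, empiricalOther]
  congr 1
  exact Finset.sum_congr rfl fun j hj => by rw [Function.update_of_ne (Finset.ne_of_mem_erase hj)]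

lemma empiricalOther_update {i j : Fin N} (hj : j ≠ i) (x : Fin N → Fin d) (y : Fin d) :
    empiricalOther i (Function.update x j y) =
      empiricalOther i x + (1 / ((N : ℝ) - 1)) • (dirac y - dirac (x j)) := by
  have hmem : j ∈ Finset.univ.erase i := Finset.mem_erase.2 ⟨hj, Finset.mem_univ j⟩
  rw [empiricalOther, empiricalOther, ← smul_add, ← Finset.sum_erase_add _ _ hmem,
    ← Finset.sum_erase_add (Finset.univ.erase i) (fun k => (dirac (x k) : Vec d)) hmem,
    Function.update_self, add_assoc, add_sub_cancel]
  congr 2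
  exact Finset.sum_congr rfl fun k hk => by rw [Function.update_of_ne (Finset.ne_of_mem_erase hk)]

/-- Player `j` itself sits at `x j`, so moving it is an admissible transfer of mass `1 / (N - 1)`.
-/
lemma le_empiricalOther_apply (hN : 2 ≤ N) {i j : Fin N} (hj : j ≠ i) (x : Fin N → Fin d) :
    1 / ((N : ℝ) - 1) ≤ empiricalOther i x (x j) := by
  have hN1 := cast_sub_one_pos hN
  rw [empiricalOther_apply]
  refine le_mul_of_one_le_right (by positivity) ?_
  have h1 : dirac (x j) (x j) ≤ ∑ k ∈ Finset.univ.erase i, dirac (x k) (x j) :=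
    Finset.single_le_sum (f := fun k => dirac (x k) (x j))
      (fun k _ => (dirac_mem_simplex (x k)).1 (x j))
      (Finset.mem_erase.2 ⟨hj, Finset.mem_univ j⟩)
  rwa [dirac_apply, if_pos rfl] at h1

lemma sum_empiricalOther_mul (i : Fin N) (x : Fin N → Fin d) (g : Fin d → ℝ) :
    ∑ y, empiricalOther i x y * g y =
      1 / ((N : ℝ) - 1) * ∑ j ∈ Finset.univ.erase i, g (x j) := by
  simp only [empiricalOther_apply, mul_assoc, Finset.sum_mul]
  rw [← Finset.mul_sum, Finset.sum_comm]
  simp [dirac_apply]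

lemma norm_empiricalOther_sub_le (hN : 2 ≤ N) (i j : Fin N) (x : Fin N → Fin d) :
    ‖empiricalOther i x - empiricalOther j x‖ ≤ 2 * (1 / ((N : ℝ) - 1)) := by
  have hN1 := cast_sub_one_pos hN
  have e : empiricalOther i x - empiricalOther j x =
      (1 / ((N : ℝ) - 1)) • (dirac (x j) - dirac (x i)) := by
    rw [empiricalOther, empiricalOther, ← smul_sub, Finset.sum_erase_eq_sub (Finset.mem_univ i),
      Finset.sum_erase_eq_sub (Finset.mem_univ j), sub_sub_sub_cancel_left]
  rw [e, norm_smul, Real.norm_of_nonneg (by positivity), mul_comm]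
  gcongr
  exact norm_dirac_sub_le _ _

lemma card_erase_mul (hN : 2 ≤ N) (i : Fin N) (a : ℝ) :
    ∑ _j ∈ Finset.univ.erase i, 1 / ((N : ℝ) - 1) * a = a := by
  rw [Finset.sum_const, Finset.card_erase_of_mem (Finset.mem_univ i), Finset.card_univ,
    Fintype.card_fin, nsmul_eq_mul, Nat.cast_sub (by lia), Nat.cast_one, ← mul_assoc,
    mul_one_div_cancel (cast_sub_one_pos hN).ne', one_mul]

/-- Each `a j` occurs once for every `i ≠ j`. This closes estimates summed over players without any
appeal to exchangeability. -/
lemma sum_sum_erase (hN : 2 ≤ N) (a : Fin N → ℝ) :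
    ∑ i, 1 / ((N : ℝ) - 1) * ∑ j ∈ Finset.univ.erase i, a j = ∑ i, a i := by
  have h := fun j => card_erase_mul hN j (a j)
  simp only [Finset.mul_sum]
  rw [Finset.sum_congr rfl fun j _ => (h j).symm]
  exact Finset.sum_comm' fun i j => by simp [ne_comm]

end Empirical

/-! ### `U` at the empirical measure as an approximate Nash solution. -/

/-- The value `U(t, x_i, m^{N,i}_x)` of the `i`-th player according to the master equation. -/
noncomputable def symmetricValue (U : ℝ → Fin d → Vec d → ℝ) (i : Fin N) (t : ℝ) (x : Fin N → Fin d) : ℝ :=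
  U t (x i) (empiricalOther i x)

variable {𝒢 : Game d} {U Ut : ℝ → Fin d → Vec d → ℝ}
  {D : ℝ → Fin d → Vec d → Fin d → Vec d} {K R : ℝ}

lemma diffAt_symmetricValue_self (i : Fin N) (t : ℝ) (x : Fin N → Fin d) :
    diffAt i (symmetricValue U i t) x = diff (fun y => U t y (empiricalOther i x)) (x i) := by
  ext y
  simp [symmetricValue, empiricalOther_update_self]

namespace Game.Estimates

lemma norm_diffAt_symmetricValue_self (h : 𝒢.Estimates U Ut D K R) (hN : 2 ≤ N) (i : Fin N)
    {t : ℝ} (ht : t ∈ Icc 0 𝒢.T) (x : Fin N → Fin d) :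
    ‖diffAt i (symmetricValue U i t) x‖ ≤ K := by
  rw [diffAt_symmetricValue_self]
  exact h.norm_diff t ht _ (empiricalOther_mem_simplex hN x) _

/-- A move of player `j` is a transfer of mass `1 / (N - 1)`, to which the second order estimate for
`U` applies coordinatewise. -/
lemma norm_diffAt_symmetricValue_sub (h : 𝒢.Estimates U Ut D K R) (hN : 2 ≤ N) {i j : Fin N}
    (hj : j ≠ i) {t : ℝ} (ht : t ∈ Icc 0 𝒢.T) (x : Fin N → Fin d) :
    ‖diffAt j (symmetricValue U i t) x -
      (1 / ((N : ℝ) - 1)) • D t (x i) (empiricalOther i x) (x j)‖ ≤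
      R ^ 2 * (1 / ((N : ℝ) - 1)) ^ 2 := by
  have hN1 := cast_sub_one_pos hN
  have hR := h.nonneg
  have h1 : √(d : ℝ) ≤ R := by linarith [h.sqrt_le, Real.sqrt_nonneg (d : ℝ)]
  refine (norm_le_sqrt_mul (c := R * (1 / ((N : ℝ) - 1)) ^ 2) (by positivity) fun y => ?_).trans ?_
  · rw [PiLp.sub_apply, PiLp.smul_apply, diffAt_apply, symmetricValue, symmetricValue,
      empiricalOther_update hj, Function.update_of_ne hj.symm, smul_eq_mul]
    exact h.move t ht _ (empiricalOther_mem_simplex hN x) (x i) (x j) y _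
      ⟨by positivity, le_empiricalOther_apply hN hj x⟩
  · calc _ ≤ R * (R * (1 / ((N : ℝ) - 1)) ^ 2) := by gcongr
      _ = _ := by ring

lemma norm_diffAt_symmetricValue (h : 𝒢.Estimates U Ut D K R) (hN : 2 ≤ N) {i j : Fin N}
    (hj : j ≠ i) {t : ℝ} (ht : t ∈ Icc 0 𝒢.T) (x : Fin N → Fin d) :
    ‖diffAt j (symmetricValue U i t) x‖ ≤ 2 * R ^ 2 * (1 / ((N : ℝ) - 1)) := by
  have hN1 := cast_sub_one_pos hN
  have hR := h.one_le
  have h1 := h.norm_diffAt_symmetricValue_sub hN hj ht x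
  have h2 := norm_add_le (diffAt j (symmetricValue U i t) x -
      (1 / ((N : ℝ) - 1)) • D t (x i) (empiricalOther i x) (x j))
      ((1 / ((N : ℝ) - 1)) • D t (x i) (empiricalOther i x) (x j))
  rw [sub_add_cancel, norm_smul, Real.norm_of_nonneg (by positivity : 0 ≤ 1 / ((N : ℝ) - 1))] at h2
  have h3 := h.norm_D t ht _ (empiricalOther_mem_simplex (i := i) hN x) (x i) (x j)
  set c := 1 / ((N : ℝ) - 1) with hc
  have hc0 : 0 ≤ c := by positivity
  have hc1 : c ≤ 1 := by
    rw [hc, div_le_one hN1]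
    have : (2 : ℝ) ≤ N := by exact_mod_cast hN
    linarith
  have h4 : c * ‖D t (x i) (empiricalOther i x) (x j)‖ ≤ c * R := by gcongr
  have h5 : R ^ 2 * c ^ 2 ≤ R ^ 2 * c := by
    gcongr
    nlinarith
  have h6 : c * R ≤ R ^ 2 * c := by nlinarith [mul_nonneg hc0 h.nonneg]
  linarith

/-- The functions `U(t, x_i, m^{N,i}_x)` almost solve the Hamilton-Jacobi-Bellman system. -/
lemma abs_residual_le (h : 𝒢.Estimates U Ut D K R) (hN : 2 ≤ N) (i : Fin N)
    {t : ℝ} (ht : t ∈ Icc 0 𝒢.T) (x : Fin N → Fin d) :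
    |Ut t (x i) (empiricalOther i x) - (𝒢.hamiltonian (x i) (diffAt i (symmetricValue U i t) x)
      - ∑ j ∈ Finset.univ.erase i, inner ℝ
          (𝒢.optControl (x j) (diffAt j (symmetricValue U j t) x))
          (diffAt j (symmetricValue U i t) x)
      - 𝒢.F (x i) (empiricalOther i x))| ≤ 3 * R ^ 4 * (1 / ((N : ℝ) - 1)) := by
  obtain ⟨Λ, hr⟩ := h.regular
  have hN1 := cast_sub_one_pos hN
  have hR := h.one_le
  have hm := fun j => empiricalOther_mem_simplex (i := j) hN x
  rw [hr.eqn t ht (x i) _ (hm i), sum_empiricalOther_mul, diffAt_symmetricValue_self]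
  set c := 1 / ((N : ℝ) - 1) with hc
  have hc0 : 0 ≤ c := by positivity
  set m := empiricalOther i x with hmdef
  have e : ∀ H F S S' : ℝ, H - S - F - (H - S' - F) = S' - S := fun _ _ _ _ => by ring
  rw [e, Finset.mul_sum, ← Finset.sum_sub_distrib]
  -- Each of the `N - 1` terms carries two errors of order `c²`: the expansion of `Δ^j`, and the
  -- replacement of the measure seen by player `j` by the one seen by player `i`, at distance at
  -- most `2 c`.
  have key : ∀ j ∈ Finset.univ.erase i,
      |inner ℝ (𝒢.optControl (x j) (diffAt j (symmetricValue U j t) x))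
          (diffAt j (symmetricValue U i t) x) -
        c * inner ℝ (D t (x i) m (x j)) (𝒢.optControl (x j) (diff (fun z => U t z m) (x j)))| ≤
      c * (3 * R ^ 4 * c) := by
    intro j hj
    rw [diffAt_symmetricValue_self]
    set α := 𝒢.optControl (x j) (diff (fun y => U t y (empiricalOther j x)) (x j)) with hα
    set α' := 𝒢.optControl (x j) (diff (fun z => U t z m) (x j)) with hα'
    set δ := diffAt j (symmetricValue U i t) x with hδ
    set D' := D t (x i) m (x j) with hD'
    have h1 : ‖δ - c • D'‖ ≤ R ^ 2 * c ^ 2 :=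
      h.norm_diffAt_symmetricValue_sub hN (Finset.ne_of_mem_erase hj) ht x
    have h2 : ‖α - α'‖ ≤ R ^ 3 * (2 * c) :=
      (h.norm_optimalRate_sub_le ht (hm j) (hm i) (x j)).trans (by
        have := norm_empiricalOther_sub_le hN j i x
        have hR0 := h.nonneg
        gcongr)
    have e1 : inner ℝ α δ - c * inner ℝ D' α' = inner ℝ α (δ - c • D') +
        c * inner ℝ D' (α - α') := by
      rw [inner_sub_right, inner_sub_right, inner_smul_right, real_inner_comm α D']; ring
    have h3 : |inner ℝ α (δ - c • D')| ≤ R * (R ^ 2 * c ^ 2) :=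
      (abs_real_inner_le_norm _ _).trans (mul_le_mul (h.norm_optControl _ _) h1 (norm_nonneg _)
        h.nonneg)
    have h4 : |inner ℝ D' (α - α')| ≤ R * (R ^ 3 * (2 * c)) :=
      (abs_real_inner_le_norm _ _).trans (mul_le_mul (h.norm_D t ht m (hm i) _ _) h2
        (norm_nonneg _) h.nonneg)
    have h5 : R ^ 3 ≤ R ^ 4 := pow_le_pow_right₀ hR (by norm_num)
    rw [e1]
    calc _ ≤ |inner ℝ α (δ - c • D')| + c * |inner ℝ D' (α - α')| := by
          refine (abs_add_le _ _).trans ?_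
          rw [abs_mul, abs_of_nonneg hc0]
      _ ≤ R * (R ^ 2 * c ^ 2) + c * (R * (R ^ 3 * (2 * c))) := by gcongr
      _ = (R ^ 3 + 2 * R ^ 4) * c ^ 2 := by ring
      _ ≤ (R ^ 4 + 2 * R ^ 4) * c ^ 2 := by gcongr
      _ = _ := by ring
  refine (Finset.abs_sum_le_sum_abs _ _).trans ((Finset.sum_le_sum key).trans_eq ?_)
  exact card_erase_mul hN i _

end Game.Estimates

/-! ### The energy inequality. -/

/-- The generator acting on a square. -/
lemma generator_sq (β : Fin N → ℝ → (Fin N → Fin d) → Vec d) (w : (Fin N → Fin d) → ℝ) (t : ℝ)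
    (x : Fin N → Fin d) : generator β (fun x => w x ^ 2) t x =
      2 * w x * ∑ j, inner ℝ (β j t x) (diffAt j w x) +
        ∑ j, ∑ y, β j t x y * (diffAt j w x y) ^ 2 := by
  simp only [generator, inner_eq_sum, Finset.mul_sum, ← Finset.sum_add_distrib]
  refine Finset.sum_congr rfl fun j _ => Finset.sum_congr rfl fun y _ => ?_
  rw [diffAt_apply]; ring

lemma norm_sq_eq_sum (v : Vec d) : ‖v‖ ^ 2 = ∑ y, v y ^ 2 := by
  rw [EuclideanSpace.norm_eq, Real.sq_sqrt (by positivity)]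
  simp

lemma diffAt_sub (j : Fin N) (f g : (Fin N → Fin d) → ℝ) (x : Fin N → Fin d) :
    diffAt j (fun x => f x - g x) x = diffAt j f x - diffAt j g x := by
  ext y; simp only [diffAt_apply, PiLp.sub_apply]; ring

/-- The constant in the energy estimate. -/
noncomputable def energyConst (κ R : ℝ) : ℝ := 16 * R ^ 2 / κ + 16 * R ^ 6 / κ + 1

/-- Young's inequality gives up `κ/4` of the coercive term `κ a²` and charges `κ/4` to the average
`S` over the other players. The gap between `3κ/4` and `κ/4` is what closes the system over players.
-/
lemma energy_algebra {κ R c w a b S g s : ℝ} (hκ : 0 < κ)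
    (hg : |g| ≤ 2 * R * a + 2 * R ^ 3 * b + 3 * R ^ 4 * c) (hb : b ^ 2 ≤ S)
    (hs : κ * a ^ 2 ≤ s) :
    3 * κ / 4 * a ^ 2 - κ / 4 * S - energyConst κ R * w ^ 2 - 9 * R ^ 8 * c ^ 2 ≤
      2 * w * g + s := by
  have h1 : -(2 * |w| * |g|) ≤ 2 * w * g := by
    have := neg_abs_le (2 * w * g)
    rwa [abs_mul, abs_mul, abs_two] at this
  have h2 : 2 * |w| * |g| ≤ 2 * |w| * (2 * R * a + 2 * R ^ 3 * b + 3 * R ^ 4 * c) := by gcongr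
  have hw : w ^ 2 = |w| ^ 2 := (sq_abs w).symm
  have h3 : 2 * |w| * (2 * R * a) ≤ κ / 4 * a ^ 2 + 16 * R ^ 2 / κ * |w| ^ 2 := by
    have : 0 ≤ κ / 4 * (a - 8 * R / κ * |w|) ^ 2 := by positivity
    have e : κ / 4 * (a - 8 * R / κ * |w|) ^ 2 =
        κ / 4 * a ^ 2 - 2 * |w| * (2 * R * a) + 16 * R ^ 2 / κ * |w| ^ 2 := by
      field_simp; ring
    linarith
  have h4 : 2 * |w| * (2 * R ^ 3 * b) ≤ κ / 4 * b ^ 2 + 16 * R ^ 6 / κ * |w| ^ 2 := by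
    have : 0 ≤ κ / 4 * (b - 8 * R ^ 3 / κ * |w|) ^ 2 := by positivity
    have e : κ / 4 * (b - 8 * R ^ 3 / κ * |w|) ^ 2 =
        κ / 4 * b ^ 2 - 2 * |w| * (2 * R ^ 3 * b) + 16 * R ^ 6 / κ * |w| ^ 2 := by
      field_simp; ring
    linarith
  have h5 : 2 * |w| * (3 * R ^ 4 * c) ≤ |w| ^ 2 + 9 * R ^ 8 * c ^ 2 := by
    nlinarith [sq_nonneg (|w| - 3 * R ^ 4 * c)]
  have h6 : κ / 4 * b ^ 2 ≤ κ / 4 * S := by gcongr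
  rw [energyConst, hw]
  nlinarith

/-- The error `U(t, x_i, m^{N,i}_x) - v^{N,i}(t,x)`. -/
noncomputable def valueError (U : ℝ → Fin d → Vec d → ℝ) (v : Fin N → ℝ → (Fin N → Fin d) → ℝ) (i : Fin N)
    (t : ℝ) (x : Fin N → Fin d) : ℝ := symmetricValue U i t x - v i t x

/-- The generator of the Nash dynamics contains the transport of the equation for `v^{N,i}`. There
remain the residual, Lipschitz differences of `H` and `α*`, and the transport by player `i` itself.
The quadratic part is coercive because the rates are at least `κ`. -/
theorem Game.Estimates.energy_le (h : 𝒢.Estimates U Ut D K R) (hN : 2 ≤ N)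
    {v : Fin N → ℝ → (Fin N → Fin d) → ℝ} (hv : 𝒢.IsHJBSolution v)
    (hvK : ∀ i, ∀ t ∈ Icc 0 𝒢.T, ∀ x, ‖diffAt i (v i t) x‖ ≤ K) (i : Fin N) {t : ℝ}
    (ht : t ∈ Icc 0 𝒢.T) (x : Fin N → Fin d) :
    ∃ φ', HasDerivWithinAt (fun s => valueError U v i s x ^ 2) φ' (Icc 0 𝒢.T) t ∧
      3 * 𝒢.κ / 4 * ‖diffAt i (valueError U v i t) x‖ ^ 2
        - 𝒢.κ / 4 * (1 / ((N : ℝ) - 1) *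
          ∑ j ∈ Finset.univ.erase i, ‖diffAt j (valueError U v j t) x‖ ^ 2)
        - energyConst 𝒢.κ R * valueError U v i t x ^ 2
        - 9 * R ^ 8 * (1 / ((N : ℝ) - 1)) ^ 2 ≤
      φ' + generator (𝒢.nashFeedback v) (fun x => valueError U v i t x ^ 2) t x := by
  obtain ⟨Λ, hr⟩ := h.regular
  have hN1 := cast_sub_one_pos hN
  have hR := h.one_le
  have hR0 := h.nonneg
  have hκ := h.standing.κ_pos
  have hm := fun j => empiricalOther_mem_simplex (i := j) hN x
  have hres := h.abs_residual_le hN i ht x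
  have hsmall := fun j (hj : j ∈ Finset.univ.erase i) =>
    h.norm_diffAt_symmetricValue hN (Finset.ne_of_mem_erase hj) ht x
  have hgen := generator_sq (𝒢.nashFeedback v) (valueError U v i t) t x
  have hdiff : ∀ j k, diffAt j (valueError U v k t) x =
      diffAt j (symmetricValue U k t) x - diffAt j (v k t) x := fun j k => diffAt_sub j _ _ x
  set c := 1 / ((N : ℝ) - 1) with hc
  have hc0 : 0 ≤ c := by positivity
  set a : Fin N → ℝ := fun j => ‖diffAt j (valueError U v j t) x‖ with ha
  have hα : ∀ j, ‖𝒢.optControl (x j) (diffAt j (symmetricValue U j t) x) -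
      𝒢.optControl (x j) (diffAt j (v j t) x)‖ ≤ R * a j := fun j => by
    rw [ha]
    simp only [hdiff]
    exact h.optControl_lip _ _ _ (h.norm_diffAt_symmetricValue_self hN j ht x) (hvK j t ht x)
  have hH : |𝒢.hamiltonian (x i) (diffAt i (symmetricValue U i t) x) -
      𝒢.hamiltonian (x i) (diffAt i (v i t) x)| ≤ R * a i := by
    rw [ha]
    simp only [hdiff]
    exact h.hamiltonian_lip _ _ _ (h.norm_diffAt_symmetricValue_self hN i ht x) (hvK i t ht x)
  have hd := ((hr.deriv (x i) _ (hm i) t ht).fun_sub ((hv i x).1 t ht)).fun_pow 2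
  refine ⟨_, hd, ?_⟩
  rw [hgen, ← Finset.sum_erase_add _ _ (Finset.mem_univ i)]
  set r := Ut t (x i) (empiricalOther i x) - (𝒢.hamiltonian (x i)
      (diffAt i (symmetricValue U i t) x)
      - ∑ j ∈ Finset.univ.erase i, inner ℝ
          (𝒢.optControl (x j) (diffAt j (symmetricValue U j t) x))
          (diffAt j (symmetricValue U i t) x)
      - 𝒢.F (x i) (empiricalOther i x)) with hrdef
  -- Differences of the other players' controls are tested against `Δ^j` of the approximate value,
  -- which is `O(1 / N)`, so only an average over players enters.
  set S₁ := ∑ j ∈ Finset.univ.erase i, inner ℝ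
      (𝒢.optControl (x j) (diffAt j (symmetricValue U j t) x) -
        𝒢.optControl (x j) (diffAt j (v j t) x)) (diffAt j (symmetricValue U i t) x) with hS₁
  -- The time derivative of the error plus the linear part of the generator: the transport terms
  -- over `j ≠ i` cancel except for `S₁`.
  set g := 𝒢.hamiltonian (x i) (diffAt i (symmetricValue U i t) x) -
      𝒢.hamiltonian (x i) (diffAt i (v i t) x) - S₁ + r +
      inner ℝ (𝒢.optControl (x i) (diffAt i (v i t) x)) (diffAt i (valueError U v i t) x) with hg
  have hS₁le : |S₁| ≤ 2 * R ^ 3 * (c * ∑ j ∈ Finset.univ.erase i, a j) := by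
    rw [Finset.mul_sum, Finset.mul_sum]
    refine (Finset.abs_sum_le_sum_abs _ _).trans (Finset.sum_le_sum fun j hj => ?_)
    refine (abs_real_inner_le_norm _ _).trans ((mul_le_mul (hα j) (hsmall j hj) (norm_nonneg _)
      (mul_nonneg hR0 (norm_nonneg _))).trans_eq (by ring))
  have hin : |inner ℝ (𝒢.optControl (x i) (diffAt i (v i t) x))
      (diffAt i (valueError U v i t) x)| ≤ R * a i :=
    (abs_real_inner_le_norm _ _).trans
      (mul_le_mul_of_nonneg_right (h.norm_optControl _ _) (norm_nonneg _))
  have hgle : |g| ≤ 2 * R * a i + 2 * R ^ 3 * (c * ∑ j ∈ Finset.univ.erase i, a j) +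
      3 * R ^ 4 * c := by
    have h1 := _root_.abs_le.1 hH
    have h2 := _root_.abs_le.1 hS₁le
    have h3 := _root_.abs_le.1 hin
    have h4 := _root_.abs_le.1 hres
    rw [_root_.abs_le, hg]
    constructor <;> linarith
  have hb : (c * ∑ j ∈ Finset.univ.erase i, a j) ^ 2 ≤
      c * ∑ j ∈ Finset.univ.erase i, a j ^ 2 := by
    have h1 := sq_sum_le_card_mul_sum_sq (s := Finset.univ.erase i) (f := a)
    have h2 : ((Finset.univ.erase i).card : ℝ) = (N : ℝ) - 1 := by
      rw [Finset.card_erase_of_mem (Finset.mem_univ i), Finset.card_univ, Fintype.card_fin,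
        Nat.cast_sub (by lia), Nat.cast_one]
    rw [h2] at h1
    calc _ = c ^ 2 * (∑ j ∈ Finset.univ.erase i, a j) ^ 2 := by ring
      _ ≤ c ^ 2 * (((N : ℝ) - 1) * ∑ j ∈ Finset.univ.erase i, a j ^ 2) := by gcongr
      _ = _ := by rw [hc]; field_simp
  have hs : 𝒢.κ * a i ^ 2 ≤
      ∑ j, ∑ y, 𝒢.nashFeedback v j t x y * (diffAt j (valueError U v i t) x y) ^ 2 := by
    have h1 : ∀ j, 0 ≤ ∑ y, 𝒢.nashFeedback v j t x y * (diffAt j (valueError U v i t) x y) ^ 2 :=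
      fun j => Finset.sum_nonneg fun y _ =>
        mul_nonneg (h.standing.optControl_nonneg _ _ _) (sq_nonneg _)
    refine le_trans ?_ (Finset.single_le_sum (fun j _ => h1 j) (Finset.mem_univ i))
    rw [ha]
    simp only
    rw [norm_sq_eq_sum, Finset.mul_sum]
    exact Finset.sum_le_sum fun y _ =>
      mul_le_mul_of_nonneg_right (h.standing.le_optControl _ _ _) (sq_nonneg _)
  refine (energy_algebra (w := valueError U v i t x) hκ hgle hb hs).trans_eq ?_
  have e2 : ∑ j ∈ Finset.univ.erase i,
      inner ℝ (𝒢.nashFeedback v j t x) (diffAt j (valueError U v i t) x) =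
      ∑ j ∈ Finset.univ.erase i, inner ℝ (𝒢.optControl (x j)
        (diffAt j (symmetricValue U j t) x)) (diffAt j (symmetricValue U i t) x) - S₁ -
      ∑ j ∈ Finset.univ.erase i, inner ℝ (𝒢.optControl (x j) (diffAt j (v j t) x))
        (diffAt j (v i t) x) := by
    rw [hS₁, ← Finset.sum_sub_distrib, ← Finset.sum_sub_distrib]
    refine Finset.sum_congr rfl fun j _ => ?_
    rw [hdiff, Game.nashFeedback, inner_sub_right, inner_sub_left]
    ring
  rw [e2, hg, hrdef, valueError, symmetricValue, Game.nashFeedback]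
  push_cast
  ring

/-! ### The energy estimate integrated along the Nash dynamics. -/

variable {d N : ℕ} {Ω : Type*} [MeasurableSpace Ω] {P : Measure Ω} [IsProbabilityMeasure P]
  {m₀ : Vec d} {Z : Fin N → Ω → Fin d} {Nm : Fin N → Ω → Measure (ℝ × (Fin d → ℝ))}

/-- Dynkin's formula for time dependent functions. -/
theorem SolvesSDE.hasDerivWithinAt_integral_time {T M : ℝ}
    {β : Fin N → ℝ → (Fin N → Fin d) → Vec d} {X : Fin N → ℝ → Ω → Fin d}
    (hX : SolvesSDE P T Z Nm β X) (hN : IsNoise P T M m₀ Z Nm) (hM : 0 ≤ M)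
    (hβ : IsRegularFeedback M β) {φ : ℝ → (Fin N → Fin d) → ℝ} {φ' : (Fin N → Fin d) → ℝ} {t : ℝ}
    (ht : t ∈ Icc 0 T) (hφ : ∀ x, HasDerivWithinAt (fun s => φ s x) (φ' x) (Icc 0 T) t) :
    HasDerivWithinAt (fun s => ∫ ω, φ s (fun i => X i s ω) ∂P)
      (∫ ω, (φ' (fun i => X i t ω) + generator β (φ t) t (fun i => X i t ω)) ∂P) (Icc 0 T) t := by
  classical
  have hW : ∀ t ∈ Icc 0 T, Measurable fun ω i => X i t ω := fun t ht => hX.measurable_state ht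
  have h1 := hX.hasDerivWithinAt_integral hN hM hβ (φ t) ht
  let p : ℝ → (Fin N → Fin d) → ℝ := fun s x => ∫ ω, (fun y => if y = x then (1 : ℝ) else 0)
    (fun i => X i s ω) ∂P
  have hp : ∀ x, HasDerivWithinAt (fun s => p s x) _ (Icc 0 T) t := fun x =>
    hX.hasDerivWithinAt_integral hN hM hβ (fun y => if y = x then 1 else 0) ht
  have hpr : ∀ s ∈ Icc 0 T, ∀ x, p s x = P.real {ω | (fun i => X i s ω) = x} := fun s hs x => by
    simp only [p]
    rw [integral_comp_fintype (hW s hs) (fun y => if y = x then (1 : ℝ) else 0)]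
    simp
  -- The function is frozen at time `t` and this sum is the correction. Its factor `φ s x - φ t x`
  -- vanishes at `s = t`, so the derivative of the probabilities drops out.
  have h2 : HasDerivWithinAt (fun s => ∑ x, p s x * (φ s x - φ t x)) (∑ x, p t x * φ' x)
      (Icc 0 T) t := by
    refine HasDerivWithinAt.fun_sum fun x _ => ?_
    refine ((hp x).fun_mul ((hφ x).sub_const (φ t x))).congr_deriv ?_
    rw [sub_self, mul_zero, zero_add]
  have h3 := h1.fun_add h2
  have e : ∀ s ∈ Icc 0 T, ∫ ω, φ s (fun i => X i s ω) ∂P =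
      ∫ ω, φ t (fun i => X i s ω) ∂P + ∑ x, p s x * (φ s x - φ t x) := fun s hs => by
    rw [integral_comp_fintype (hW s hs) (φ s), integral_comp_fintype (hW s hs) (φ t),
      ← Finset.sum_add_distrib]
    exact Finset.sum_congr rfl fun x _ => by rw [hpr s hs x]; ring
  refine (h3.congr e (e t ht)).congr_deriv ?_
  rw [integral_add (integrable_comp_fintype (hW t ht) φ')
    (integrable_comp_fintype (hW t ht) (generator β (φ t) t)),
    integral_comp_fintype (hW t ht) φ', add_comm]
  congr 1
  exact Finset.sum_congr rfl fun x _ => by rw [hpr t ht x]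

section LinearCombination

lemma integral_linear_combination {f g h : Ω → ℝ} (hf : Integrable f P) (hg : Integrable g P)
    (hh : Integrable h P) (a b c e : ℝ) :
    ∫ ω, (a * f ω - b * g ω - c * h ω - e) ∂P =
      a * ∫ ω, f ω ∂P - b * ∫ ω, g ω ∂P - c * ∫ ω, h ω ∂P - e := by
  have i1 : Integrable (fun ω => a * f ω - b * g ω) P := (hf.const_mul a).sub (hg.const_mul b)
  have i2 : Integrable (fun ω => a * f ω - b * g ω - c * h ω) P := i1.sub (hh.const_mul c)
  rw [integral_sub i2 (integrable_const _), integral_sub i1 (hh.const_mul c),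
    integral_sub (hf.const_mul a) (hg.const_mul b), integral_const_mul, integral_const_mul,
    integral_const_mul]
  simp

lemma intervalIntegral_linear_combination {T : ℝ} (hT : 0 ≤ T) {f g h : ℝ → ℝ}
    (hf : ContinuousOn f (Icc 0 T)) (hg : ContinuousOn g (Icc 0 T)) (hh : ContinuousOn h (Icc 0 T))
    (a b c : ℝ) :
    ∫ t in (0 : ℝ)..T, (a * f t - b * g t - c * h t) =
      a * (∫ t in (0 : ℝ)..T, f t) - b * (∫ t in (0 : ℝ)..T, g t) -
        c * ∫ t in (0 : ℝ)..T, h t := by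
  have i1 := ((hf.const_mul a).fun_sub (hg.const_mul b)).intervalIntegrable_of_Icc hT (μ := volume)
  rw [intervalIntegral.integral_sub i1 ((hh.const_mul c).intervalIntegrable_of_Icc hT),
    intervalIntegral.integral_sub ((hf.const_mul a).intervalIntegrable_of_Icc hT)
      ((hg.const_mul b).intervalIntegrable_of_Icc hT),
    intervalIntegral.integral_const_mul, intervalIntegral.integral_const_mul,
    intervalIntegral.integral_const_mul]

end LinearCombination

section LinearSystem

/-- At the index of the largest `a` the average over the others is at most that value and is
absorbed, leaving `κ / 2`. -/
lemma le_of_average_le {κ q : ℝ} {a : Fin N → ℝ} (hκ : 0 < κ) (hN : 2 ≤ N)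
    (h : ∀ i, 3 * κ / 4 * a i ≤
      κ / 4 * (1 / ((N : ℝ) - 1) * ∑ j ∈ Finset.univ.erase i, a j) + q) (i : Fin N) :
    a i ≤ 2 * q / κ := by
  have : Nonempty (Fin N) := ⟨i⟩
  have hN1 := cast_sub_one_pos hN
  obtain ⟨k, hk⟩ := Finite.exists_max a
  have h1 : 1 / ((N : ℝ) - 1) * ∑ j ∈ Finset.univ.erase k, a j ≤ a k := by
    rw [Finset.mul_sum]
    refine (Finset.sum_le_sum fun j _ => mul_le_mul_of_nonneg_left (hk j) ?_).trans_eq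
      (card_erase_mul hN k _)
    positivity
  have h2 := h k
  have h3 : κ / 4 * (1 / ((N : ℝ) - 1) * ∑ j ∈ Finset.univ.erase k, a j) ≤ κ / 4 * a k := by
    gcongr
  refine (hk i).trans ?_
  rw [le_div_iff₀ hκ]
  linarith

end LinearSystem

variable {𝒢 : Game d} {U Ut : ℝ → Fin d → Vec d → ℝ}
  {D : ℝ → Fin d → Vec d → Fin d → Vec d} {K R : ℝ}
  {v : Fin N → ℝ → (Fin N → Fin d) → ℝ} {Y : Fin N → ℝ → Ω → Fin d}

lemma Game.IsHJBSolution.continuousOn (hv : 𝒢.IsHJBSolution v) (i : Fin N) (x : Fin N → Fin d) :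
    ContinuousOn (fun t => v i t x) (Icc 0 𝒢.T) := fun t ht =>
  ((hv i x).1 t ht).continuousWithinAt

lemma Game.Estimates.isRegularFeedback_nash (h : 𝒢.Estimates U Ut D K R)
    (hv : 𝒢.IsHJBSolution v) (hvK : ∀ i, ∀ t ∈ Icc 0 𝒢.T, ∀ x, ‖diffAt i (v i t) x‖ ≤ K) :
    IsRegularFeedback 𝒢.M (clampFeedback 𝒢.T (𝒢.nashFeedback v)) := by
  refine isRegularFeedback_clampFeedback h.standing.T_pos.le (fun i x y => ?_)
    (fun _ _ _ _ _ => h.standing.optControl_nonneg _ _ _)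
    (fun _ _ _ _ _ => h.standing.optControl_le _ _ _)
  have h2 : ContinuousOn (fun t => diffAt i (v i t) x) (Icc 0 𝒢.T) :=
    (PiLp.continuous_toLp 2 _).comp_continuousOn
      (continuousOn_pi.2 fun z => (hv.continuousOn i _).sub (hv.continuousOn i _))
  exact (EuclideanSpace.proj (𝕜 := ℝ) y).continuous.comp_continuousOn
    ((h.continuousOn_optControl (x i)).comp h2 fun t ht =>
      mem_closedBall_zero_iff.2 (hvK i t ht x))

lemma Game.Estimates.continuousOn_valueError (h : 𝒢.Estimates U Ut D K R) (hN2 : 2 ≤ N)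
    (hv : 𝒢.IsHJBSolution v) (i : Fin N) (x : Fin N → Fin d) :
    ContinuousOn (fun t => valueError U v i t x) (Icc 0 𝒢.T) :=
  (h.continuousOn_time (empiricalOther_mem_simplex hN2 x) (x i)).sub (hv.continuousOn i x)

lemma Game.Estimates.continuousOn_norm_diffAt (h : 𝒢.Estimates U Ut D K R) (hN2 : 2 ≤ N)
    (hv : 𝒢.IsHJBSolution v) (i : Fin N) (x : Fin N → Fin d) :
    ContinuousOn (fun t => ‖diffAt i (valueError U v i t) x‖) (Icc 0 𝒢.T) :=
  ((PiLp.continuous_toLp 2 _).comp_continuousOn (continuousOn_pi.2 fun y =>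
    (h.continuousOn_valueError hN2 hv i (Function.update x i y)).sub
      (h.continuousOn_valueError hN2 hv i x))).norm

/-- The constant in the integrated energy estimate. -/
noncomputable def energyBound (T κ R : ℝ) : ℝ :=
  2 * (9 * R ^ 8 * (T * Real.exp (energyConst κ R * T))) / κ

/-- The weight `exp (C t)` removes the zero order term. The boundary terms have the right sign: the
error vanishes at `T`, where `U` and `v` share the terminal cost, and enters as a square at `0`. The
resulting linear system couples each player to the average of the others. -/
theorem Game.Estimates.integral_sq_le (h : 𝒢.Estimates U Ut D K R) (hN2 : 2 ≤ N)
    (hv : 𝒢.IsHJBSolution v) (hvK : ∀ i, ∀ t ∈ Icc 0 𝒢.T, ∀ x, ‖diffAt i (v i t) x‖ ≤ K)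
    (hN : IsNoise P 𝒢.T 𝒢.M m₀ Z Nm) (hY : SolvesSDE P 𝒢.T Z Nm (𝒢.nashFeedback v) Y)
    (i : Fin N) :
    ∫ t in (0 : ℝ)..𝒢.T, ∫ ω, ‖diffAt i (valueError U v i t) (fun j => Y j t ω)‖ ^ 2 ∂P ≤
      energyBound 𝒢.T 𝒢.κ R * (1 / ((N : ℝ) - 1)) ^ 2 := by
  obtain ⟨Λ, hr⟩ := h.regular
  have hT := h.standing.T_pos.le
  have hM := h.standing.M_pos.le
  have hκ := h.standing.κ_pos
  have hN1 := cast_sub_one_pos hN2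
  have hW : ∀ t ∈ Icc 0 𝒢.T, Measurable fun ω j => Y j t ω := fun t ht => hY.measurable_state ht
  have hreg := h.isRegularFeedback_nash hv hvK
  set C := energyConst 𝒢.κ R with hC
  have hC0 : 0 ≤ C := by rw [hC, energyConst]; have := h.nonneg; positivity
  set c := 1 / ((N : ℝ) - 1) with hc
  have hc0 : 0 ≤ c := by positivity
  let A : Fin N → ℝ → ℝ := fun i t =>
    ∫ ω, ‖diffAt i (valueError U v i t) (fun j => Y j t ω)‖ ^ 2 ∂P
  let e : Fin N → ℝ → ℝ := fun i t => ∫ ω, valueError U v i t (fun j => Y j t ω) ^ 2 ∂P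
  have hcA : ∀ i, ContinuousOn (A i) (Icc 0 𝒢.T) := fun i =>
    continuousOn_integral_comp (W := fun t ω j => Y j t ω)
      (φ := fun t x => ‖diffAt i (valueError U v i t) x‖ ^ 2) hW
      (fun a b ha hab hb => hY.real_state_ne_le hN hM ha hab hb)
      fun x => (h.continuousOn_norm_diffAt hN2 hv i x).pow 2
  have hA0 : ∀ i t, 0 ≤ A i t := fun i t => integral_nonneg fun ω => sq_nonneg _
  let B : Fin N → ℝ → ℝ := fun i t => c * ∑ j ∈ Finset.univ.erase i, A j t
  have hcB : ∀ i, ContinuousOn (B i) (Icc 0 𝒢.T) := fun i =>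
    (continuousOn_finsetSum _ fun j _ => hcA j).const_mul _
  have hder : ∀ i, ∀ t ∈ Icc 0 𝒢.T, ∃ e', HasDerivWithinAt (e i) e' (Icc 0 𝒢.T) t ∧
      3 * 𝒢.κ / 4 * A i t - 𝒢.κ / 4 * B i t - C * e i t - 9 * R ^ 8 * c ^ 2 ≤ e' := by
    intro i t ht
    choose φ' hφ' hle using fun x => h.energy_le hN2 hv hvK i ht x
    refine ⟨_, hY.clamp.hasDerivWithinAt_integral_time hN hM hreg ht hφ', ?_⟩
    have hI : ∀ g : (Fin N → Fin d) → ℝ, Integrable (fun ω => g (fun j => Y j t ω)) P :=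
      fun g => integrable_comp_fintype (hW t ht) g
    let F : (Fin N → Fin d) → ℝ := fun x =>
      3 * 𝒢.κ / 4 * ‖diffAt i (valueError U v i t) x‖ ^ 2
        - 𝒢.κ / 4 * (c * ∑ j ∈ Finset.univ.erase i, ‖diffAt j (valueError U v j t) x‖ ^ 2)
        - C * valueError U v i t x ^ 2 - 9 * R ^ 8 * c ^ 2
    have e1 : 3 * 𝒢.κ / 4 * A i t - 𝒢.κ / 4 * B i t - C * e i t - 9 * R ^ 8 * c ^ 2 =
        ∫ ω, F (fun j => Y j t ω) ∂P := by
      refine Eq.trans ?_ (integral_linear_combination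
        (hI fun x => ‖diffAt i (valueError U v i t) x‖ ^ 2)
        (hI fun x => c * ∑ j ∈ Finset.univ.erase i, ‖diffAt j (valueError U v j t) x‖ ^ 2)
        (hI fun x => valueError U v i t x ^ 2) _ _ _ _).symm
      rw [integral_const_mul, integral_finsetSum _ fun j _ =>
        hI fun x => ‖diffAt j (valueError U v j t) x‖ ^ 2]
    rw [e1]
    refine integral_mono (hI F) (hI fun x => φ' x + generator (clampFeedback 𝒢.T
      (𝒢.nashFeedback v)) (fun x => valueError U v i t x ^ 2) t x) fun ω => ?_
    refine (hle _).trans_eq ?_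
    simp only [generator, clampFeedback_eq ht]
  choose! e' he' hle' using hder
  have hee : ContinuousOn (fun t => Real.exp (C * t)) (Icc 0 𝒢.T) := by fun_prop
  have hcφ : ∀ i, ContinuousOn (fun t => Real.exp (C * t) *
      (3 * 𝒢.κ / 4 * A i t - 𝒢.κ / 4 * B i t - 9 * R ^ 8 * c ^ 2)) (Icc 0 𝒢.T) := fun i =>
    hee.mul ((((hcA i).const_mul _).sub ((hcB i).const_mul _)).sub continuousOn_const)
  have hgd : ∀ i, ∀ t ∈ Icc 0 𝒢.T, HasDerivWithinAt (fun t => Real.exp (C * t) * e i t)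
      (Real.exp (C * t) * C * e i t + Real.exp (C * t) * e' i t) (Icc 0 𝒢.T) t := by
    intro i t ht
    have h1 : HasDerivWithinAt (fun t : ℝ => Real.exp (C * t)) (Real.exp (C * t) * C)
        (Icc 0 𝒢.T) t := by
      have := ((hasDerivAt_id t).const_mul C).exp.hasDerivWithinAt (s := Icc 0 𝒢.T)
      simpa using this
    exact h1.fun_mul (he' i t ht)
  have heT : ∀ i, e i 𝒢.T = 0 := fun i => by
    have : ∀ x, valueError U v i 𝒢.T x = 0 := fun x => by
      rw [valueError, symmetricValue, hr.terminal _ _ (empiricalOther_mem_simplex hN2 x),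
        (hv i x).2, sub_self]
    simp [e, this]
  have he0 : ∀ i, 0 ≤ e i 0 := fun i => integral_nonneg fun ω => sq_nonneg _
  have hint : ∀ i, ∫ t in (0 : ℝ)..𝒢.T, Real.exp (C * t) *
      (3 * 𝒢.κ / 4 * A i t - 𝒢.κ / 4 * B i t - 9 * R ^ 8 * c ^ 2) ≤ 0 := fun i => by
    have h1 := intervalIntegral.integral_le_sub_of_hasDeriv_right_of_le hT
      (fun t ht => (hgd i t ht).continuousWithinAt)
      (fun t ht => (hgd i t ⟨ht.1.le, ht.2.le⟩).mono_of_mem_nhdsWithin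
        (mem_of_superset (Ioc_mem_nhdsGT ht.2) fun s hs => ⟨ht.1.le.trans hs.1.le, hs.2⟩))
      ((hcφ i).integrableOn_Icc) fun t ht => ?_
    · rw [heT, mul_zero] at h1
      have h2 : 0 ≤ Real.exp (C * 0) * e i 0 := mul_nonneg (Real.exp_nonneg _) (he0 i)
      linarith
    · have h2 := mul_le_mul_of_nonneg_left (hle' i t ⟨ht.1.le, ht.2.le⟩) (Real.exp_nonneg (C * t))
      linarith
  let a : Fin N → ℝ := fun i => ∫ t in (0 : ℝ)..𝒢.T, Real.exp (C * t) * A i t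
  have hi : ∀ f : ℝ → ℝ, ContinuousOn f (Icc 0 𝒢.T) → IntervalIntegrable f volume 0 𝒢.T :=
    fun f hf => hf.intervalIntegrable_of_Icc hT
  have hEA : ∀ i, ContinuousOn (fun t => Real.exp (C * t) * A i t) (Icc 0 𝒢.T) := fun i =>
    hee.mul (hcA i)
  set Θ := ∫ t in (0 : ℝ)..𝒢.T, Real.exp (C * t) with hΘ
  have hΘle : Θ ≤ 𝒢.T * Real.exp (C * 𝒢.T) := by
    have h1 := intervalIntegral.integral_mono_on hT (hi _ hee)
      (intervalIntegrable_const (c := Real.exp (C * 𝒢.T))) fun t ht =>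
        Real.exp_le_exp.2 (mul_le_mul_of_nonneg_left ht.2 hC0)
    simpa using h1
  have hsys : ∀ i, 3 * 𝒢.κ / 4 * a i ≤
      𝒢.κ / 4 * (c * ∑ j ∈ Finset.univ.erase i, a j) + 9 * R ^ 8 * c ^ 2 * Θ := by
    intro i
    have e1 : (fun t => Real.exp (C * t) *
        (3 * 𝒢.κ / 4 * A i t - 𝒢.κ / 4 * B i t - 9 * R ^ 8 * c ^ 2)) =
        fun t => 3 * 𝒢.κ / 4 * (Real.exp (C * t) * A i t) -
          𝒢.κ / 4 * (c * ∑ j ∈ Finset.univ.erase i, Real.exp (C * t) * A j t) -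
          9 * R ^ 8 * c ^ 2 * Real.exp (C * t) := by
      funext t
      rw [← Finset.mul_sum]
      simp only [B]; ring
    have hs : ContinuousOn (fun t => ∑ j ∈ Finset.univ.erase i, Real.exp (C * t) * A j t)
        (Icc 0 𝒢.T) := continuousOn_finsetSum _ fun j _ => hEA j
    have h1 := hint i
    rw [e1, intervalIntegral_linear_combination hT (hEA i) (hs.const_mul _) hee,
      intervalIntegral.integral_const_mul,
      intervalIntegral.integral_finsetSum fun j _ => hi _ (hEA j)] at h1
    linarith
  have h1 := le_of_average_le hκ hN2 hsys i
  have h2 : ∫ t in (0 : ℝ)..𝒢.T, A i t ≤ a i :=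
    intervalIntegral.integral_mono_on hT (hi _ (hcA i)) (hi _ (hEA i)) fun t ht =>
      le_mul_of_one_le_left (hA0 i t) (Real.one_le_exp (mul_nonneg hC0 ht.1))
  refine (h2.trans h1).trans ?_
  rw [energyBound, ← hC, div_mul_eq_mul_div]
  have hR := h.nonneg
  have h3 : 9 * R ^ 8 * c ^ 2 * Θ ≤ 9 * R ^ 8 * c ^ 2 * (𝒢.T * Real.exp (C * 𝒢.T)) := by
    gcongr
  refine div_le_div_of_nonneg_right ?_ hκ.le
  linarith

/-- The equilibrium feedback is close to the one given by the master equation. -/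
theorem Game.Estimates.integral_norm_le (h : 𝒢.Estimates U Ut D K R) (hN2 : 2 ≤ N)
    (hv : 𝒢.IsHJBSolution v) (hvK : ∀ i, ∀ t ∈ Icc 0 𝒢.T, ∀ x, ‖diffAt i (v i t) x‖ ≤ K)
    (hN : IsNoise P 𝒢.T 𝒢.M m₀ Z Nm) (hY : SolvesSDE P 𝒢.T Z Nm (𝒢.nashFeedback v) Y)
    (i : Fin N) :
    ∫ t in (0 : ℝ)..𝒢.T, ∫ ω, ‖diffAt i (valueError U v i t) (fun j => Y j t ω)‖ ∂P ≤
      (energyBound 𝒢.T 𝒢.κ R + 𝒢.T) / ((N : ℝ) - 1) := by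
  have hT := h.standing.T_pos.le
  have hM := h.standing.M_pos.le
  have hN1 := cast_sub_one_pos hN2
  have hW : ∀ t ∈ Icc 0 𝒢.T, Measurable fun ω j => Y j t ω := fun t ht => hY.measurable_state ht
  have h0 := h.integral_sq_le hN2 hv hvK hN hY i
  set n := (N : ℝ) - 1 with hn
  have hc1 : ContinuousOn (fun t => ∫ ω, ‖diffAt i (valueError U v i t) (fun j => Y j t ω)‖ ^ 2 ∂P)
      (Icc 0 𝒢.T) :=
    continuousOn_integral_comp (W := fun t ω j => Y j t ω)
      (φ := fun t x => ‖diffAt i (valueError U v i t) x‖ ^ 2) hW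
      (fun a b ha hab hb => hY.real_state_ne_le hN hM ha hab hb)
      fun x => (h.continuousOn_norm_diffAt hN2 hv i x).pow 2
  have hc2 : ContinuousOn (fun t => ∫ ω, ‖diffAt i (valueError U v i t) (fun j => Y j t ω)‖ ∂P)
      (Icc 0 𝒢.T) :=
    continuousOn_integral_comp (W := fun t ω j => Y j t ω)
      (φ := fun t x => ‖diffAt i (valueError U v i t) x‖) hW
      (fun a b ha hab hb => hY.real_state_ne_le hN hM ha hab hb)
      fun x => h.continuousOn_norm_diffAt hN2 hv i x
  have h1 : ∫ t in (0 : ℝ)..𝒢.T, ∫ ω, ‖diffAt i (valueError U v i t) (fun j => Y j t ω)‖ ∂P ≤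
      ∫ t in (0 : ℝ)..𝒢.T,
        (n * ∫ ω, ‖diffAt i (valueError U v i t) (fun j => Y j t ω)‖ ^ 2 ∂P + 1 / n) := by
    refine intervalIntegral.integral_mono_on hT (hc2.intervalIntegrable_of_Icc hT)
      (((hc1.const_mul _).add continuousOn_const).intervalIntegrable_of_Icc hT) fun t ht => ?_
    have i1 := (integrable_comp_fintype (P := P) (hW t ht)
      (fun x => ‖diffAt i (valueError U v i t) x‖ ^ 2)).const_mul n
    have i2 : Integrable (fun _ : Ω => 1 / n) P := integrable_const _
    have e1 : n * ∫ ω, ‖diffAt i (valueError U v i t) (fun j => Y j t ω)‖ ^ 2 ∂P + 1 / n =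
        ∫ ω, (n * ‖diffAt i (valueError U v i t) (fun j => Y j t ω)‖ ^ 2 + 1 / n) ∂P := by
      rw [integral_add i1 i2, integral_const_mul]
      simp
    rw [e1]
    refine integral_mono (integrable_comp_fintype (hW t ht)
      (fun x => ‖diffAt i (valueError U v i t) x‖)) (i1.add i2) fun ω => ?_
    show _ ≤ n * _ + 1 / n
    set b := ‖diffAt i (valueError U v i t) (fun j => Y j t ω)‖
    -- Yields `b ≤ n b² + 1 / (4 n)`; the weight `n` suits a second moment of order `1 / n²`.
    have h2 : 0 ≤ (n * b - 1 / 2) ^ 2 / n := by positivity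
    have h3 : (n * b - 1 / 2) ^ 2 / n = n * b ^ 2 - b + 1 / (4 * n) := by field_simp; ring
    have h4 : 1 / (4 * n) ≤ 1 / n := by gcongr; linarith
    linarith
  refine h1.trans ?_
  rw [intervalIntegral.integral_add ((hc1.const_mul _).intervalIntegrable_of_Icc hT)
    intervalIntegrable_const, intervalIntegral.integral_const_mul, intervalIntegral.integral_const,
    sub_zero, smul_eq_mul]
  calc _ ≤ n * (energyBound 𝒢.T 𝒢.κ R * (1 / n) ^ 2) + 𝒢.T * (1 / n) := by gcongr
    _ = _ := by field_simp

/-! ### The law of large numbers in mean. -/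

section LawOfLargeNumbers

variable {Ω ι : Type*} [MeasurableSpace Ω] {P : Measure Ω} [IsProbabilityMeasure P]

/-- The mean deviation of an average of independent random variables with values in `[0,1]`. -/
theorem integral_abs_average_sub_le {s : Finset ι} (hs : s.Nonempty) {f : ι → Ω → ℝ} {q : ℝ}
    (hf : ∀ i, Measurable (f i)) (h01 : ∀ i ω, f i ω ∈ Icc 0 1) (hq : ∀ i ∈ s, ∫ ω, f i ω ∂P = q)
    (hind : iIndepFun f P) :
    Integrable (fun ω => |1 / (s.card : ℝ) * ∑ i ∈ s, f i ω - q|) P ∧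
      ∫ ω, |1 / (s.card : ℝ) * ∑ i ∈ s, f i ω - q| ∂P ≤ 1 / √(s.card : ℝ) := by
  have hn : (0 : ℝ) < s.card := by exact_mod_cast hs.card_pos
  set n : ℝ := (s.card : ℝ) with hndef
  have hlp : ∀ i, MemLp (f i) 2 P := fun i =>
    MemLp.of_bound (hf i).aestronglyMeasurable 1 (ae_of_all _ fun ω => by
      rw [Real.norm_of_nonneg (h01 i ω).1]; exact (h01 i ω).2)
  have hint : ∀ i, Integrable (f i) P := fun i => (hlp i).integrable (by norm_num)
  have hvar := IndepFun.variance_sum (s := s) (fun i _ => hlp i)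
    (fun i _ j _ hij => hind.indepFun hij)
  have hle : variance (∑ i ∈ s, f i) P ≤ n := by
    rw [hvar]
    calc ∑ i ∈ s, variance (f i) P ≤ ∑ _i ∈ s, (1 : ℝ) := Finset.sum_le_sum fun i _ =>
          (variance_le_sq_of_bounded (ae_of_all _ (h01 i)) (hf i).aemeasurable).trans (by norm_num)
      _ = n := by simp [hndef]
  have hmean : ∫ ω, (∑ i ∈ s, f i) ω ∂P = n * q := by
    simp only [Finset.sum_apply]
    rw [integral_finsetSum _ fun i _ => hint i, Finset.sum_congr rfl hq]
    simp [hndef]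
  have hlpS : MemLp (∑ i ∈ s, f i) 2 P := memLp_finsetSum' s fun i _ => hlp i
  rw [variance_eq_integral hlpS.aemeasurable, hmean] at hle
  have hsq : Integrable (fun ω => ((∑ i ∈ s, f i) ω - n * q) ^ 2) P :=
    (hlpS.sub (memLp_const (n * q))).integrable_sq
  have habs : Integrable (fun ω => |1 / n * ∑ i ∈ s, f i ω - q|) P :=
    (((integrable_finsetSum s fun i _ => hint i).const_mul (1 / n)).sub (integrable_const q)).abs
  refine ⟨habs, ?_⟩
  have hsn : 0 < √n := Real.sqrt_pos.2 hn
  have hsn2 : √n * √n = n := Real.mul_self_sqrt hn.le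
  -- From `2 √n |y| ≤ y² + n` with `y = S - n q`: a pointwise substitute for Cauchy–Schwarz, matched
  -- to a variance of at most `n`.
  have hpt : ∀ ω, |1 / n * ∑ i ∈ s, f i ω - q| ≤
      1 / (2 * (n * √n)) * ((∑ i ∈ s, f i) ω - n * q) ^ 2 + 1 / (2 * √n) := by
    intro ω
    rw [Finset.sum_apply]
    set S := ∑ i ∈ s, f i ω
    have e : 1 / n * S - q = (S - n * q) / n := by field_simp
    rw [e, abs_div, abs_of_pos hn]
    have h1 : 0 ≤ (|S - n * q| - √n) ^ 2 / (2 * (n * √n)) := by positivity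
    have h2 : (|S - n * q| - √n) ^ 2 / (2 * (n * √n)) =
        1 / (2 * (n * √n)) * (S - n * q) ^ 2 + 1 / (2 * √n) - |S - n * q| / n := by
      rw [sub_sq, sq_abs, Real.sq_sqrt hn.le]
      field_simp
      ring
    linarith
  calc ∫ ω, |1 / n * ∑ i ∈ s, f i ω - q| ∂P
      ≤ ∫ ω, (1 / (2 * (n * √n)) * ((∑ i ∈ s, f i) ω - n * q) ^ 2 + 1 / (2 * √n)) ∂P :=
        integral_mono habs ((hsq.const_mul _).add (integrable_const _)) hpt
    _ = 1 / (2 * (n * √n)) * ∫ ω, ((∑ i ∈ s, f i) ω - n * q) ^ 2 ∂P + 1 / (2 * √n) := by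
        rw [integral_add (hsq.const_mul _) (integrable_const _), integral_const_mul]
        simp
    _ ≤ 1 / (2 * (n * √n)) * n + 1 / (2 * √n) := by gcongr
    _ = 1 / √n := by field_simp; norm_num

variable {d N : ℕ}

/-- The law of large numbers for the empirical measures of i.i.d. states. -/
theorem integral_norm_average_dirac_sub_le {s : Finset (Fin N)} (hs : s.Nonempty)
    {W : Fin N → Ω → Fin d} {μ : Vec d} (hW : ∀ i, Measurable (W i))
    (hμ : ∀ i, lawVec P (W i) = μ) (hind : iIndepFun W P) :
    Integrable (fun ω => ‖(1 / (s.card : ℝ)) • ∑ j ∈ s, (dirac (W j ω) : Vec d) - μ‖) P ∧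
      ∫ ω, ‖(1 / (s.card : ℝ)) • ∑ j ∈ s, (dirac (W j ω) : Vec d) - μ‖ ∂P ≤
        d * (1 / √(s.card : ℝ)) := by
  have key : ∀ z : Fin d, _ := fun z =>
    integral_abs_average_sub_le (P := P) hs (f := fun j ω => (dirac (W j ω) : Vec d) z) (q := μ z)
      (fun j => (Measurable.of_discrete (f := fun y : Fin d => (dirac y : Vec d) z)).comp (hW j))
      (fun j ω => by rw [dirac_apply]; split_ifs <;> simp)
      (fun j _ => by
        rw [integral_comp_fintype (hW j) (fun y => (dirac y : Vec d) z), ← hμ j]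
        simp [dirac_apply, lawVec])
      (hind.comp (fun _ y => (dirac y : Vec d) z) fun _ => Measurable.of_discrete)
  have hint : Integrable
      (fun ω => ‖(1 / (s.card : ℝ)) • ∑ j ∈ s, (dirac (W j ω) : Vec d) - μ‖) P :=
    integrable_comp_fintype (W := fun ω j => W j ω) (measurable_pi_lambda _ hW)
      (fun x => ‖(1 / (s.card : ℝ)) • ∑ j ∈ s, (dirac (x j) : Vec d) - μ‖)
  refine ⟨hint, ?_⟩
  calc _ ≤ ∫ ω, ∑ z, |1 / (s.card : ℝ) * ∑ j ∈ s, (dirac (W j ω) : Vec d) z - μ z| ∂P := by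
        refine integral_mono hint (integrable_finsetSum _ fun z _ => (key z).1) fun ω => ?_
        refine (norm_le_sum_abs _).trans_eq (Finset.sum_congr rfl fun z _ => ?_)
        simp
    _ = ∑ z, ∫ ω, |1 / (s.card : ℝ) * ∑ j ∈ s, (dirac (W j ω) : Vec d) z - μ z| ∂P :=
        integral_finsetSum _ fun z _ => (key z).1
    _ ≤ ∑ _z : Fin d, 1 / √(s.card : ℝ) := Finset.sum_le_sum fun z _ => (key z).2
    _ = d * (1 / √(s.card : ℝ)) := by simp

end LawOfLargeNumbers

/-! ### Ingredients of the Gronwall estimate for the coupling. -/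

section Coupling

variable {d N : ℕ} {Ω : Type*} [MeasurableSpace Ω] {P : Measure Ω} [IsProbabilityMeasure P]
  {m₀ : Vec d} {Z : Fin N → Ω → Fin d} {Nm : Fin N → Ω → Measure (ℝ × (Fin d → ℝ))}
  {𝒢 : Game d} {U Ut : ℝ → Fin d → Vec d → ℝ}
  {D : ℝ → Fin d → Vec d → Fin d → Vec d} {K R : ℝ}
  {v : Fin N → ℝ → (Fin N → Fin d) → ℝ} {X Y : Fin N → ℝ → Ω → Fin d} {μ : ℝ → Vec d}

lemma norm_empiricalOther_sub_le_sum (hN : 2 ≤ N) (i : Fin N) (x y : Fin N → Fin d) :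
    ‖empiricalOther i y - empiricalOther i x‖ ≤
      1 / ((N : ℝ) - 1) * ∑ j ∈ Finset.univ.erase i, 2 * if y j = x j then (0 : ℝ) else 1 := by
  have hN1 := cast_sub_one_pos hN
  rw [empiricalOther, empiricalOther, ← smul_sub, ← Finset.sum_sub_distrib, norm_smul,
    Real.norm_of_nonneg (by positivity)]
  gcongr
  refine norm_sum_le_of_le _ fun j _ => ?_
  split_ifs with hj
  · rw [hj]; simp
  · rw [mul_one]; exact norm_dirac_sub_le _ _

/-- Three replacements: the Nash value by `U` at the empirical measure of the first state, that
measure by the one of the second state, and the latter by `μ`. The last two use that the optimal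
rates are Lipschitz in the measure. -/
lemma Game.Estimates.rateGap_le (h : 𝒢.Estimates U Ut D K R) (hN2 : 2 ≤ N)
    (hvK : ∀ i, ∀ t ∈ Icc 0 𝒢.T, ∀ x, ‖diffAt i (v i t) x‖ ≤ K) (hμ : 𝒢.IsLimitFlow U μ)
    (i : Fin N) {r : ℝ} (hr : r ∈ Icc 0 𝒢.T) (p : (Fin N → Fin d) × (Fin N → Fin d)) :
    rateGap (clampFeedback 𝒢.T (𝒢.nashFeedback v)) (fun i t x => 𝒢.limitRate U μ t (x i)) i r p ≤
      R ^ 4 * (‖diffAt i (valueError U v i r) p.1‖ +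
        (1 / ((N : ℝ) - 1) * ∑ j ∈ Finset.univ.erase i, 2 * if p.1 j = p.2 j then (0 : ℝ) else 1) +
        ‖empiricalOther i p.2 - μ r‖) := by
  have hN1 := cast_sub_one_pos hN2
  have hR := h.one_le
  have hR0 := h.nonneg
  have hs0 : 0 ≤ 1 / ((N : ℝ) - 1) *
      ∑ j ∈ Finset.univ.erase i, 2 * if p.1 j = p.2 j then (0 : ℝ) else 1 :=
    mul_nonneg (by positivity) (Finset.sum_nonneg fun j _ => by split_ifs <;> simp)
  unfold rateGap
  split_ifs with hp
  swap
  · have := norm_nonneg (diffAt i (valueError U v i r) p.1)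
    have := norm_nonneg (empiricalOther i p.2 - μ r)
    positivity
  simp only [clampFeedback_eq hr, Game.limitRate_eq hr, ← hp, Game.nashFeedback]
  set α := 𝒢.optControl (p.1 i) (diffAt i (v i r) p.1)
  set α' := 𝒢.optControl (p.1 i) (diffAt i (symmetricValue U i r) p.1) with hα'
  have h1 : ‖α - α'‖ ≤ R * ‖diffAt i (valueError U v i r) p.1‖ := by
    have := h.optControl_lip (p.1 i) _ _ (hvK i r hr p.1)
      (h.norm_diffAt_symmetricValue_self hN2 i hr p.1)
    refine this.trans_eq ?_
    rw [norm_sub_rev, ← diffAt_sub]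
    rfl
  have h2 : ‖α' - 𝒢.optimalRate U r (μ r) (p.1 i)‖ ≤
      R ^ 3 * ‖empiricalOther i p.1 - μ r‖ := by
    rw [hα', diffAt_symmetricValue_self]
    exact h.norm_optimalRate_sub_le hr (empiricalOther_mem_simplex hN2 _) (hμ.mem r hr) _
  have h3 := norm_empiricalOther_sub_le_sum hN2 i p.2 p.1
  have h4 : ‖empiricalOther i p.1 - μ r‖ ≤ ‖empiricalOther i p.1 - empiricalOther i p.2‖ +
      ‖empiricalOther i p.2 - μ r‖ := norm_sub_le_norm_sub_add_norm_sub _ _ _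
  have h5 : ‖α - 𝒢.optimalRate U r (μ r) (p.1 i)‖ ≤ ‖α - α'‖ +
      ‖α' - 𝒢.optimalRate U r (μ r) (p.1 i)‖ := norm_sub_le_norm_sub_add_norm_sub _ _ _
  have h6 : R * ‖diffAt i (valueError U v i r) p.1‖ ≤
      R ^ 3 * ‖diffAt i (valueError U v i r) p.1‖ := by
    gcongr
    exact le_self_pow₀ hR (by norm_num)
  have h7 : ‖α - 𝒢.optimalRate U r (μ r) (p.1 i)‖ ≤
      R ^ 3 * (‖diffAt i (valueError U v i r) p.1‖ +
        (1 / ((N : ℝ) - 1) * ∑ j ∈ Finset.univ.erase i, 2 * if p.1 j = p.2 j then (0 : ℝ) else 1) +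
        ‖empiricalOther i p.2 - μ r‖) := by
    have h8 : R ^ 3 * ‖empiricalOther i p.1 - μ r‖ ≤ R ^ 3 * ((1 / ((N : ℝ) - 1) *
        ∑ j ∈ Finset.univ.erase i, 2 * if p.1 j = p.2 j then (0 : ℝ) else 1) +
        ‖empiricalOther i p.2 - μ r‖) := by
      gcongr
      linarith
    linarith
  calc ∑ y, |α y - 𝒢.optimalRate U r (μ r) (p.1 i) y|
      ≤ d * ‖α - 𝒢.optimalRate U r (μ r) (p.1 i)‖ := by
        simpa only [PiLp.sub_apply] using sum_abs_le (α - 𝒢.optimalRate U r (μ r) (p.1 i))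
    _ ≤ R * (R ^ 3 * (‖diffAt i (valueError U v i r) p.1‖ +
        (1 / ((N : ℝ) - 1) * ∑ j ∈ Finset.univ.erase i, 2 * if p.1 j = p.2 j then (0 : ℝ) else 1) +
        ‖empiricalOther i p.2 - μ r‖)) := mul_le_mul h.card_le h7 (norm_nonneg _) hR0
    _ = _ := by ring

/-- The right-hand side is differentiable although `q` is only continuous, and it satisfies the
differential form of Gronwall's inequality. -/
lemma le_mul_exp_of_le_integral {T ε k : ℝ} {q : ℝ → ℝ} (hk : 0 ≤ k)
    (hq : ContinuousOn q (Icc 0 T)) (hq0 : ∀ t, 0 ≤ q t)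
    (h : ∀ t ∈ Icc 0 T, q t ≤ ε + k * ∫ s in (0 : ℝ)..t, q s) :
    ∀ t ∈ Icc 0 T, q t ≤ ε * Real.exp (k * T) := by
  intro t ht
  have hT : 0 ≤ T := ht.1.trans ht.2
  have hε : 0 ≤ ε := by simpa using (hq0 0).trans (h 0 ⟨le_rfl, hT⟩)
  let G : ℝ → ℝ := fun t => ε + k * ∫ s in (0 : ℝ)..t, q s
  have hG0 : ∀ t ∈ Icc 0 T, 0 ≤ G t := fun t ht => (hq0 t).trans (h t ht)
  have hint : IntervalIntegrable q volume 0 T := hq.intervalIntegrable_of_Icc hT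
  have hcont : ContinuousOn G (Icc 0 T) := by
    have := intervalIntegral.continuousOn_primitive_interval' hint (left_mem_uIcc)
    rw [uIcc_of_le hT] at this
    exact continuousOn_const.add (this.const_mul k)
  have hd : ∀ t ∈ Ico 0 T, HasDerivWithinAt G (k * q t) (Ici t) t := fun t ht => by
    have h1 : HasDerivWithinAt (fun u => ∫ s in (0 : ℝ)..u, q s) (q t) (Ici t) t := by
      have hi : IntervalIntegrable q volume 0 t :=
        (hq.mono (Icc_subset_Icc_right ht.2.le)).intervalIntegrable_of_Icc ht.1
      have hcw : ContinuousWithinAt q (Ici t) t :=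
        (hq t ⟨ht.1, ht.2.le⟩).mono_of_mem_nhdsWithin
          (mem_of_superset (Icc_mem_nhdsGE ht.2) (Icc_subset_Icc_left ht.1))
      refine intervalIntegral.integral_hasDerivWithinAt_right hi ?_ (hcw.mono Ioi_subset_Ici_self)
      exact ⟨Ioc t T, Ioc_mem_nhdsGT ht.2, ((hq.mono (Ioc_subset_Icc_self.trans
        (Icc_subset_Icc_left ht.1))).aestronglyMeasurable measurableSet_Ioc)⟩
    exact (h1.const_mul k).const_add ε
  have h2 := norm_le_gronwallBound_of_norm_deriv_right_le (K := k) (δ := ε) (ε := 0) hcont hd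
    (by simp [G, abs_of_nonneg hε]) (fun t ht => by
      have ht' : t ∈ Icc 0 T := ⟨ht.1, ht.2.le⟩
      rw [Real.norm_of_nonneg (mul_nonneg hk (hq0 t)), Real.norm_of_nonneg (hG0 t ht'), add_zero]
      exact mul_le_mul_of_nonneg_left (h t ht') hk) t ht
  rw [Real.norm_of_nonneg (hG0 t ht), gronwallBound_ε0, sub_zero] at h2
  refine (h t ht).trans (h2.trans ?_)
  gcongr
  exact ht.2

end Coupling

/-! ### Separation probabilities of order `N^{-1/2}`. -/

variable {d N : ℕ} {Ω : Type*} [MeasurableSpace Ω] {P : Measure Ω} [IsProbabilityMeasure P]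
  {m₀ : Vec d} {Z : Fin N → Ω → Fin d} {Nm : Fin N → Ω → Measure (ℝ × (Fin d → ℝ))}
  {𝒢 : Game d} {U Ut : ℝ → Fin d → Vec d → ℝ}
  {D : ℝ → Fin d → Vec d → Fin d → Vec d} {K R : ℝ}
  {v : Fin N → ℝ → (Fin N → Fin d) → ℝ} {X Y : Fin N → ℝ → Ω → Fin d} {μ : ℝ → Vec d}

/-- The constant in the estimate of the coupling. -/
noncomputable def couplingConst (T κ R : ℝ) : ℝ :=
  R ^ 4 * (energyBound T κ R + T + T * R) * (1 + 4 * R ^ 4 * T * Real.exp (2 * R ^ 4 * T))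

/-- The limit dynamics: decoupled players with common rates and law `μ`. -/
structure IsLimitSystem (P : Measure Ω) (𝒢 : Game d) (U : ℝ → Fin d → Vec d → ℝ) (m₀ : Vec d)
    (Z : Fin N → Ω → Fin d) (Nm : Fin N → Ω → Measure (ℝ × (Fin d → ℝ))) (μ : ℝ → Vec d)
    (X : Fin N → ℝ → Ω → Fin d) : Prop where
  noise : IsNoise P 𝒢.T 𝒢.M m₀ Z Nm
  flow : 𝒢.IsLimitFlow U μ
  law : ∀ i, ∀ t ∈ Icc 0 𝒢.T, lawVec P (X i t) = μ t
  solves : SolvesSDE P 𝒢.T Z Nm (fun i t x => 𝒢.limitRate U μ t (x i)) X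

lemma Game.Estimates.iIndepFun_state (h : 𝒢.Estimates U Ut D K R)
    (hX : IsLimitSystem P 𝒢 U m₀ Z Nm μ X) {t : ℝ} (ht : t ∈ Icc 0 𝒢.T) :
    iIndepFun (fun i => X i t) P :=
  (SolvesSDE.iIndepFun_path h.standing.M_pos.le hX.noise
    (h.isRegularFeedback_limitRate hX.flow 1) hX.solves).comp
    (fun _ (p : Icc 0 𝒢.T → Fin d) => p ⟨t, ht⟩) fun _ => measurable_pi_apply _

lemma Game.Estimates.integral_norm_empiricalOther_le (h : 𝒢.Estimates U Ut D K R) (hN2 : 2 ≤ N)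
    (hX : IsLimitSystem P 𝒢 U m₀ Z Nm μ X) (i : Fin N) {t : ℝ} (ht : t ∈ Icc 0 𝒢.T) :
    ∫ ω, ‖empiricalOther i (fun j => X j t ω) - μ t‖ ∂P ≤ R / √((N : ℝ) - 1) := by
  have hN1 := cast_sub_one_pos hN2
  have hcard : (Finset.univ.erase i).card = N - 1 := by
    rw [Finset.card_erase_of_mem (Finset.mem_univ i), Finset.card_univ, Fintype.card_fin]
  have hne : (Finset.univ.erase i).Nonempty := Finset.card_pos.1 (by rw [hcard]; lia)
  have h1 := (integral_norm_average_dirac_sub_le hne (hX.solves.measurable · t ht)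
    (fun i => hX.law i t ht) (h.iIndepFun_state hX ht)).2
  rw [hcard, Nat.cast_sub (by lia), Nat.cast_one] at h1
  refine h1.trans ?_
  rw [mul_one_div]
  gcongr
  exact h.card_le

/-- The bound for player `i` involves the value error, the law of large numbers and the average of
the other players' probabilities of disagreement. Gronwall for the sum over all players bounds this
average, which is put back into the estimate for `i`. -/
theorem Game.Estimates.real_exists_ne_le (h : 𝒢.Estimates U Ut D K R) (hN2 : 2 ≤ N)
    (hv : 𝒢.IsHJBSolution v) (hvK : ∀ i, ∀ t ∈ Icc 0 𝒢.T, ∀ x, ‖diffAt i (v i t) x‖ ≤ K)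
    (hY : SolvesSDE P 𝒢.T Z Nm (𝒢.nashFeedback v) Y) (hX : IsLimitSystem P 𝒢 U m₀ Z Nm μ X)
    (i : Fin N) :
    P.real {ω | ∃ r ∈ Icc 0 𝒢.T, Y i r ω ≠ X i r ω} ≤
      couplingConst 𝒢.T 𝒢.κ R / √((N : ℝ) - 1) := by
  classical
  have hT := h.standing.T_pos.le
  have hM := h.standing.M_pos.le
  have hκ := h.standing.κ_pos
  have hR := h.nonneg
  have hN1 := cast_sub_one_pos hN2
  have hN := hX.noise
  have hW : ∀ t ∈ Icc 0 𝒢.T, Measurable fun ω j => Y j t ω := fun t ht => hY.measurable_state ht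
  have hWp : ∀ t ∈ Icc 0 𝒢.T, Measurable fun ω => ((fun j => Y j t ω), (fun j => X j t ω)) :=
    fun t ht => hY.measurable_pair hX.solves ht
  have hregY := h.isRegularFeedback_nash hv hvK
  have hregX := h.isRegularFeedback_limitRate hX.flow N
  set c := 1 / ((N : ℝ) - 1) with hc
  have hc0 : 0 ≤ c := by positivity
  let φ : Fin N → (Fin N → Fin d) × (Fin N → Fin d) → ℝ := fun j p => if p.1 j = p.2 j then 0 else 1
  let q : Fin N → ℝ → ℝ := fun j r => ∫ ω, φ j ((fun j => Y j r ω), (fun j => X j r ω)) ∂P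
  have hqc : ∀ j, ContinuousOn (q j) (Icc 0 𝒢.T) := fun j =>
    SolvesSDE.continuousOn_integral_pair (φ := fun _ => φ j) hN hM hY hX.solves
      fun _ => continuousOn_const
  have hq0 : ∀ j r, 0 ≤ q j r := fun j r => integral_nonneg fun ω => by
    simp only [φ]; split_ifs <;> simp
  have hqle : ∀ j, ∀ t ∈ Icc 0 𝒢.T,
      q j t ≤ P.real {ω | ∃ r ∈ Icc 0 t, Y j r ω ≠ X j r ω} := fun j t ht => by
    have hm : MeasurableSet {ω | Y j t ω ≠ X j t ω} :=
      (measurableSet_eq_fun (hY.measurable j t ht) (hX.solves.measurable j t ht)).compl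
    have e : q j t = P.real {ω | Y j t ω ≠ X j t ω} := by
      have : ∀ ω, φ j ((fun j => Y j t ω), (fun j => X j t ω)) =
          {ω | Y j t ω ≠ X j t ω}.indicator (fun _ => (1 : ℝ)) ω := fun ω => by
        by_cases h : Y j t ω = X j t ω <;> simp [φ, h]
      simp only [q, this]
      rw [integral_indicator_const _ hm, smul_eq_mul, mul_one]
    rw [e]
    exact measureReal_mono fun ω hω => ⟨t, ⟨ht.1, le_rfl⟩, hω⟩
  set E₀ := (energyBound 𝒢.T 𝒢.κ R + 𝒢.T) / ((N : ℝ) - 1) with hE₀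
  set lam := R / √((N : ℝ) - 1) with hlam
  have hstep : ∀ i, ∀ t ∈ Icc 0 𝒢.T, P.real {ω | ∃ r ∈ Icc 0 t, Y i r ω ≠ X i r ω} ≤
      R ^ 4 * (E₀ + 𝒢.T * lam) +
        2 * R ^ 4 * (c * ∑ j ∈ Finset.univ.erase i, ∫ r in (0 : ℝ)..t, q j r) := by
    intro i t ht
    have hsub : Icc 0 t ⊆ Icc 0 𝒢.T := Icc_subset_Icc_right ht.2
    have hac : ContinuousOn
        (fun r => ∫ ω, ‖diffAt i (valueError U v i r) (fun j => Y j r ω)‖ ∂P) (Icc 0 𝒢.T) :=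
      continuousOn_integral_comp (W := fun t ω j => Y j t ω)
        (φ := fun t x => ‖diffAt i (valueError U v i t) x‖) hW
        (fun a b ha hab hb => hY.real_state_ne_le hN hM ha hab hb)
        fun x => h.continuousOn_norm_diffAt hN2 hv i x
    have hsc : ContinuousOn (fun r => ∑ j ∈ Finset.univ.erase i, q j r) (Icc 0 𝒢.T) :=
      continuousOn_finsetSum _ fun j _ => hqc j
    refine (SolvesSDE.real_exists_ne_le hN hM hregY hregX hY.clamp hX.solves i ht).trans ?_
    have hrc := SolvesSDE.continuousOn_integral_pair hN hM hY hX.solves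
      fun p => (continuous_rateGap hregY hregX i p).continuousOn
    have hbound : ∀ r ∈ Icc 0 t, ∫ ω, rateGap (clampFeedback 𝒢.T (𝒢.nashFeedback v))
        (fun i t x => 𝒢.limitRate U μ t (x i)) i r
          ((fun j => Y j r ω), (fun j => X j r ω)) ∂P ≤
        R ^ 4 * (∫ ω, ‖diffAt i (valueError U v i r) (fun j => Y j r ω)‖ ∂P) -
          (-(2 * R ^ 4 * c)) * ∑ j ∈ Finset.univ.erase i, q j r - (-(R ^ 4 * lam)) * 1 := by
      intro r hr
      have hr' := hsub hr
      have hI : ∀ g : (Fin N → Fin d) × (Fin N → Fin d) → ℝ,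
          Integrable (fun ω => g ((fun j => Y j r ω), (fun j => X j r ω))) P :=
        fun g => integrable_comp_fintype (hWp r hr') g
      have i1 := hI fun p => ‖diffAt i (valueError U v i r) p.1‖
      have i2 := hI fun p => c * ∑ j ∈ Finset.univ.erase i, 2 * φ j p
      have i3 := hI fun p => ‖empiricalOther i p.2 - μ r‖
      have i12 : Integrable (fun ω => ‖diffAt i (valueError U v i r) (fun j => Y j r ω)‖ +
          c * ∑ j ∈ Finset.univ.erase i, 2 * φ j ((fun j => Y j r ω), (fun j => X j r ω))) P :=
        i1.add i2
      calc _ ≤ ∫ ω, R ^ 4 * (‖diffAt i (valueError U v i r) (fun j => Y j r ω)‖ +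
            c * ∑ j ∈ Finset.univ.erase i, 2 * φ j ((fun j => Y j r ω), (fun j => X j r ω)) +
            ‖empiricalOther i (fun j => X j r ω) - μ r‖) ∂P :=
            integral_mono (hI _) ((i12.add i3).const_mul _) fun ω =>
              h.rateGap_le hN2 hvK hX.flow i hr' ((fun j => Y j r ω), (fun j => X j r ω))
        _ = R ^ 4 * ((∫ ω, ‖diffAt i (valueError U v i r) (fun j => Y j r ω)‖ ∂P) +
            c * ∑ j ∈ Finset.univ.erase i, 2 * q j r +
            ∫ ω, ‖empiricalOther i (fun j => X j r ω) - μ r‖ ∂P) := by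
            rw [integral_const_mul, integral_add i12 i3, integral_add i1 i2, integral_const_mul,
              integral_finsetSum _ fun j _ => hI fun p => 2 * φ j p]
            simp only [integral_const_mul, q]
        _ ≤ R ^ 4 * ((∫ ω, ‖diffAt i (valueError U v i r) (fun j => Y j r ω)‖ ∂P) +
            c * ∑ j ∈ Finset.univ.erase i, 2 * q j r + lam) := by
            gcongr
            exact h.integral_norm_empiricalOther_le hN2 hX i hr'
        _ = _ := by rw [← Finset.mul_sum]; ring
    have h1 := intervalIntegral.integral_mono_on (μ := volume) ht.1
      ((hrc.mono hsub).intervalIntegrable_of_Icc ht.1)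
      (((((hac.mono hsub).const_mul _).fun_sub ((hsc.mono hsub).const_mul _)).fun_sub
        (continuousOn_const.fun_mul continuousOn_const)).intervalIntegrable_of_Icc (μ := volume) ht.1) hbound
    rw [intervalIntegral_linear_combination ht.1 (hac.mono hsub) (hsc.mono hsub)
      continuousOn_const, intervalIntegral.integral_finsetSum fun j _ =>
        ((hqc j).mono hsub).intervalIntegrable_of_Icc ht.1] at h1
    have h2 : ∫ r in (0 : ℝ)..t, ∫ ω, ‖diffAt i (valueError U v i r) (fun j => Y j r ω)‖ ∂P ≤ E₀ :=
      (intervalIntegral.integral_mono_interval le_rfl ht.1 ht.2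
        (ae_of_all _ fun r => integral_nonneg fun ω => norm_nonneg _)
        (hac.intervalIntegrable_of_Icc hT)).trans (h.integral_norm_le hN2 hv hvK hN hY i)
    have h3 : R ^ 4 * ∫ r in (0 : ℝ)..t,
        ∫ ω, ‖diffAt i (valueError U v i r) (fun j => Y j r ω)‖ ∂P ≤ R ^ 4 * E₀ := by gcongr
    have h4 : R ^ 4 * lam * t ≤ R ^ 4 * lam * 𝒢.T :=
      mul_le_mul_of_nonneg_left ht.2 (by positivity)
    simp only [intervalIntegral.integral_const, sub_zero, smul_eq_mul, mul_one] at h1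
    linarith
  have hB0 : 0 ≤ energyBound 𝒢.T 𝒢.κ R := by
    rw [energyBound]; positivity
  set ε := R ^ 4 * (E₀ + 𝒢.T * lam) with hε
  have hε0 : 0 ≤ ε := by positivity
  have hQ := le_mul_exp_of_le_integral (q := fun t => ∑ j, q j t) (T := 𝒢.T) (k := 2 * R ^ 4)
    (ε := N * ε) (by positivity) (continuousOn_finsetSum _ fun j _ => hqc j)
    (fun t => Finset.sum_nonneg fun j _ => hq0 j t) fun t ht => by
      have hi : ∀ j, IntervalIntegrable (q j) volume 0 t := fun j =>
        ((hqc j).mono (Icc_subset_Icc_right ht.2)).intervalIntegrable_of_Icc ht.1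
      rw [intervalIntegral.integral_finsetSum fun j _ => hi j,
        ← sum_sum_erase hN2 fun j => ∫ r in (0 : ℝ)..t, q j r]
      refine (Finset.sum_le_sum fun j _ => (hqle j t ht).trans (hstep j t ht)).trans_eq ?_
      rw [Finset.sum_add_distrib, Finset.sum_const, Finset.card_univ, Fintype.card_fin,
        nsmul_eq_mul, ← Finset.mul_sum Finset.univ _ (2 * R ^ 4)]
  have hTmem : 𝒢.T ∈ Icc 0 𝒢.T := ⟨hT, le_rfl⟩
  have hi : ∀ j, IntervalIntegrable (q j) volume 0 𝒢.T := fun j =>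
    (hqc j).intervalIntegrable_of_Icc hT
  set κ' := Real.exp (2 * R ^ 4 * 𝒢.T) with hκ'
  have hsum : ∑ j ∈ Finset.univ.erase i, ∫ r in (0 : ℝ)..𝒢.T, q j r ≤ N * ε * κ' * 𝒢.T := by
    calc _ ≤ ∑ j, ∫ r in (0 : ℝ)..𝒢.T, q j r :=
          Finset.sum_le_sum_of_subset_of_nonneg (Finset.erase_subset _ _) fun j _ _ =>
            intervalIntegral.integral_nonneg hT fun r _ => hq0 j r
      _ = ∫ r in (0 : ℝ)..𝒢.T, ∑ j, q j r :=
          (intervalIntegral.integral_finsetSum fun j _ => hi j).symm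
      _ ≤ ∫ _r in (0 : ℝ)..𝒢.T, N * ε * κ' :=
          intervalIntegral.integral_mono_on hT
            ((continuousOn_finsetSum _ fun j _ => hqc j).intervalIntegrable_of_Icc hT)
            intervalIntegrable_const hQ
      _ = _ := by simp; ring
  -- The Gronwall bound concerns a sum over `N` players, while the average divides by `N - 1`.
  have hcN : c * N ≤ 2 := by
    rw [hc, one_div_mul_eq_div, div_le_iff₀ hN1]
    have : (2 : ℝ) ≤ N := by exact_mod_cast hN2
    linarith
  have hfin := hstep i 𝒢.T hTmem
  have h1 : c * ∑ j ∈ Finset.univ.erase i, ∫ r in (0 : ℝ)..𝒢.T, q j r ≤ 2 * (ε * κ' * 𝒢.T) := by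
    calc _ ≤ c * (N * ε * κ' * 𝒢.T) := by gcongr
      _ = c * N * (ε * κ' * 𝒢.T) := by ring
      _ ≤ 2 * (ε * κ' * 𝒢.T) := by gcongr
  have h2 : P.real {ω | ∃ r ∈ Icc 0 𝒢.T, Y i r ω ≠ X i r ω} ≤
      ε * (1 + 4 * R ^ 4 * 𝒢.T * κ') := by
    have h3 := mul_le_mul_of_nonneg_left h1 (by positivity : 0 ≤ 2 * R ^ 4)
    linarith
  -- Weakens the decay `1 / (N - 1)` of the value error to that of the law of large numbers.
  have hs1 : √((N : ℝ) - 1) ≤ (N : ℝ) - 1 := by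
    rw [Real.sqrt_le_left hN1.le]
    have : (2 : ℝ) ≤ N := by exact_mod_cast hN2
    nlinarith
  have hs0 : 0 < √((N : ℝ) - 1) := Real.sqrt_pos.2 hN1
  have hεle : ε ≤ R ^ 4 * (energyBound 𝒢.T 𝒢.κ R + 𝒢.T + 𝒢.T * R) / √((N : ℝ) - 1) := by
    have h3 : E₀ ≤ (energyBound 𝒢.T 𝒢.κ R + 𝒢.T) / √((N : ℝ) - 1) := by
      rw [hE₀]; gcongr
    calc ε ≤ R ^ 4 * ((energyBound 𝒢.T 𝒢.κ R + 𝒢.T) / √((N : ℝ) - 1) + 𝒢.T * lam) := by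
          rw [hε]; gcongr
      _ = _ := by rw [hlam]; ring
  refine h2.trans ?_
  rw [couplingConst, mul_div_right_comm]
  gcongr

/-! ### Suprema over time. -/

variable {d N : ℕ} {Ω : Type*} [MeasurableSpace Ω] {P : Measure Ω}
  {m₀ : Vec d} {Z : Fin N → Ω → Fin d} {Nm : Fin N → Ω → Measure (ℝ × (Fin d → ℝ))}
  {𝒢 : Game d} {U Ut : ℝ → Fin d → Vec d → ℝ}
  {D : ℝ → Fin d → Vec d → Fin d → Vec d} {K R : ℝ}
  {X Y : Fin N → ℝ → Ω → Fin d} {μ : ℝ → Vec d}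

section Supremum

/-- A supremum over uncountably many times need not be measurable; only an integrable majorant is
integrated. -/
lemma lintegral_iSup_ofReal_le {T C : ℝ} {g : ℝ → Ω → ℝ} {Φ : Ω → ℝ} (hΦ : Integrable Φ P)
    (h0 : ∀ ω, 0 ≤ Φ ω) (h : ∀ᵐ ω ∂P, ∀ t ∈ Icc 0 T, g t ω ≤ Φ ω) (hC : ∫ ω, Φ ω ∂P ≤ C) :
    ∫⁻ ω, ⨆ t ∈ Icc 0 T, ENNReal.ofReal (g t ω) ∂P ≤ ENNReal.ofReal C := by
  calc _ ≤ ∫⁻ ω, ENNReal.ofReal (Φ ω) ∂P := by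
        refine lintegral_mono_ae ?_
        filter_upwards [h] with ω hω
        exact iSup₂_le fun t ht => ENNReal.ofReal_le_ofReal (hω t ht)
    _ = ENNReal.ofReal (∫ ω, Φ ω ∂P) :=
        (ofReal_integral_eq_lintegral_ofReal hΦ (ae_of_all _ h0)).symm
    _ ≤ _ := ENNReal.ofReal_le_ofReal hC

/-- The indicator of a measurable superset with the same probability. -/
noncomputable def outerIndicator (P : Measure Ω) (S : Set Ω) : Ω → ℝ :=
  (toMeasurable P S).indicator fun _ => 1

lemma outerIndicator_nonneg (S : Set Ω) (ω : Ω) : 0 ≤ outerIndicator P S ω :=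
  indicator_nonneg (fun _ _ => zero_le_one) ω

lemma outerIndicator_of_mem {S : Set Ω} {ω : Ω} (h : ω ∈ S) : outerIndicator P S ω = 1 :=
  indicator_of_mem (subset_toMeasurable P S h) _

lemma integral_outerIndicator (S : Set Ω) : ∫ ω, outerIndicator P S ω ∂P = P.real S := by
  rw [outerIndicator, integral_indicator_const _ (measurableSet_toMeasurable P S), smul_eq_mul,
    mul_one, measureReal_def, measure_toMeasurable, measureReal_def]

lemma integrable_outerIndicator [IsFiniteMeasure P] (S : Set Ω) :
    Integrable (outerIndicator P S) P :=
  (integrable_const 1).indicator (measurableSet_toMeasurable P S)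

end Supremum

section Empirical

lemma norm_empirical_sub_le_sum (x y : Fin N → Fin d) :
    ‖empirical y - empirical x‖ ≤
      1 / (N : ℝ) * ∑ j, 2 * if y j = x j then (0 : ℝ) else 1 := by
  rw [empirical, empirical, ← smul_sub, ← Finset.sum_sub_distrib, norm_smul,
    Real.norm_of_nonneg (by positivity)]
  gcongr
  refine norm_sum_le_of_le _ fun j _ => ?_
  split_ifs with hj
  · rw [hj]; simp
  · rw [mul_one]; exact norm_dirac_sub_le _ _

end Empirical

lemma exists_grid_mem {T t : ℝ} {n : ℕ} (hT : 0 < T) (hn : 0 < n) (ht : t ∈ Icc 0 T) :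
    ∃ k ∈ Finset.range n, t ∈ Icc (T * (k / n)) (T * ((k + 1 : ℕ) / n)) := by
  have hn' : (0 : ℝ) < n := by exact_mod_cast hn
  rcases eq_or_lt_of_le ht.2 with h | h
  · refine ⟨n - 1, Finset.mem_range.2 (by lia), ?_⟩
    rw [Nat.sub_add_cancel hn, div_self hn'.ne', mul_one, h]
    refine ⟨mul_le_of_le_one_right hT.le ((div_le_one hn').2 ?_), le_rfl⟩
    exact_mod_cast Nat.sub_le n 1
  · refine ⟨⌊t / T * n⌋₊, Finset.mem_range.2 ((Nat.floor_lt (mul_nonneg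
      (div_nonneg ht.1 hT.le) hn'.le)).2 (mul_lt_of_lt_one_left hn' ((div_lt_one hT).2 h))), ?_, ?_⟩
    · have h1 := Nat.floor_le (mul_nonneg (div_nonneg ht.1 hT.le) hn'.le)
      rw [mul_div_assoc', div_le_iff₀ hn']
      calc T * (⌊t / T * n⌋₊ : ℝ) ≤ T * (t / T * n) := by gcongr
        _ = t * n := by field_simp
    · have h1 := (Nat.lt_floor_add_one (t / T * n)).le
      rw [mul_div_assoc', le_div_iff₀ hn']
      push_cast
      calc t * n = T * (t / T * n) := by field_simp
        _ ≤ _ := by gcongr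

variable [IsProbabilityMeasure P]

/-- The flow is the law of one player, who changes site between `a` and `b` with probability at most
`d M (b - a)`. -/
lemma IsLimitSystem.norm_flow_sub_le (hM : 0 ≤ 𝒢.M) (hN : 0 < N)
    (hX : IsLimitSystem P 𝒢 U m₀ Z Nm μ X) {a b : ℝ} (ha : 0 ≤ a) (hab : a ≤ b) (hb : b ≤ 𝒢.T) :
    ‖μ b - μ a‖ ≤ 2 * d ^ 2 * 𝒢.M * (b - a) := by
  classical
  have hma : a ∈ Icc 0 𝒢.T := ⟨ha, hab.trans hb⟩
  have hmb : b ∈ Icc 0 𝒢.T := ⟨ha.trans hab, hb⟩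
  let i : Fin N := ⟨0, hN⟩
  have h1 := hX.solves.real_ne_le hX.noise hM i ha hab hb
  have h2 : ∀ z, |(μ b - μ a) z| ≤ 2 * (d * 𝒢.M * (b - a)) := fun z => by
    have e : ∀ t ∈ Icc 0 𝒢.T, μ t z = ∫ ω, (fun y => if y = z then (1 : ℝ) else 0) (X i t ω) ∂P :=
      fun t ht => by
        rw [integral_comp_fintype (hX.solves.measurable i t ht)
          (fun y => if y = z then (1 : ℝ) else 0), ← hX.law i t ht]
        simp [lawVec]
    rw [PiLp.sub_apply, e b hmb, e a hma]
    have := abs_integral_sub_le (P := P) (hX.solves.measurable i b hmb)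
      (hX.solves.measurable i a hma) (g := fun y => if y = z then (1 : ℝ) else 0) (B := 1)
      (fun s => by split_ifs <;> simp)
    linarith
  calc ‖μ b - μ a‖ ≤ ∑ z, |(μ b - μ a) z| := norm_le_sum_abs _
    _ ≤ ∑ _z : Fin d, 2 * (d * 𝒢.M * (b - a)) := Finset.sum_le_sum fun z _ => h2 z
    _ = _ := by simp; ring

/-- A bound for the running maximum of the deviation of the empirical measure of the limit
processes from their law, on a grid of `n` time steps. -/
theorem Game.Estimates.exists_bound_empirical_sub (h : 𝒢.Estimates U Ut D K R) (hN : 0 < N)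
    (hX : IsLimitSystem P 𝒢 U m₀ Z Nm μ X) {n : ℕ} (hn : 0 < n) :
    ∃ Φ : Ω → ℝ, Integrable Φ P ∧ (∀ ω, 0 ≤ Φ ω) ∧
      (∀ᵐ ω ∂P, ∀ t ∈ Icc 0 𝒢.T, ‖empirical (fun j => X j t ω) - μ t‖ ≤ Φ ω) ∧
      ∫ ω, Φ ω ∂P ≤ (R + 2) * (n / √(N : ℝ)) + (2 * R ^ 2 + 2 * R ^ 3) * 𝒢.T / n := by
  classical
  have hT := h.standing.T_pos
  have hM := h.standing.M_pos.le
  have hR := h.nonneg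
  have hn' : (0 : ℝ) < n := by exact_mod_cast hn
  have hN' : (0 : ℝ) < N := by exact_mod_cast hN
  have hne : (Finset.univ : Finset (Fin N)).Nonempty := ⟨⟨0, hN⟩, Finset.mem_univ _⟩
  have hcard : ((Finset.univ : Finset (Fin N)).card : ℝ) = N := by simp
  let t : ℕ → ℝ := fun k => 𝒢.T * (k / n)
  have ht0 : ∀ k, 0 ≤ t k := fun k => by positivity
  have htmono : ∀ k, t k ≤ t (k + 1) := fun k => by
    simp only [t]; gcongr; simp
  have htT : ∀ k ≤ n, t k ≤ 𝒢.T := fun k hk =>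
    mul_le_of_le_one_right hT.le ((div_le_one hn').2 (by exact_mod_cast hk))
  have hstep : ∀ k, t (k + 1) - t k = 𝒢.T / n := fun k => by
    simp only [t]; push_cast; field_simp; ring
  -- Indicator that player `j` has a point of noise in the `k`-th step. Only such players can move
  -- there, so their fraction controls the whole supremum within the step, and it is again an
  -- average of independent variables.
  let B : ℕ → Fin N → Ω → ℝ := fun k j =>
    {ω | Nm j ω (slab d (t k) (t (k + 1))) ≠ 0}.indicator fun _ => 1
  let q : ℕ → ℝ := fun k =>
    1 - Real.exp (-((intensity d 𝒢.T 𝒢.M).real (slab d (t k) (t (k + 1)))))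
  have hmeasB : ∀ k j, MeasurableSet {ω | Nm j ω (slab d (t k) (t (k + 1))) ≠ 0} := fun k j =>
    (hX.noise.poisson j).measurable_apply (measurableSet_slab d _ _)
      (measurableSet_singleton (0 : ℝ≥0∞)).compl
  have hBq : ∀ k j, ∫ ω, B k j ω ∂P = q k := fun k j => by
    simp only [B, q]
    rw [integral_indicator_const _ (hmeasB k j), smul_eq_mul, mul_one,
      (hX.noise.poisson j).real_ne_zero (measurableSet_slab d _ _)]
  have hqle : ∀ k < n, q k ≤ d * 𝒢.M * (𝒢.T / n) := fun k hk => by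
    have h1 := (hX.noise.poisson ⟨0, hN⟩).real_ne_zero_le
      (measurableSet_slab d (t k) (t (k + 1)))
    rw [(hX.noise.poisson ⟨0, hN⟩).real_ne_zero (measurableSet_slab d _ _), slab,
      intensity_slab_real hM (ht0 k) (htmono k) (htT _ hk), hstep] at h1
    simp only [q, slab]
    rw [intensity_slab_real hM (ht0 k) (htmono k) (htT _ hk), hstep]
    linarith
  have hB := fun k => integral_abs_average_sub_le (P := P) hne (f := B k) (q := q k)
    (fun j => measurable_const.indicator (hmeasB k j))
    (fun j ω => by by_cases hω : Nm j ω (slab d (t k) (t (k + 1))) = 0 <;> simp [B, hω])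
    (fun j _ => hBq k j)
    (hX.noise.indep_poisson.comp (fun _ => {ν : Measure (ℝ × (Fin d → ℝ)) |
        ν (slab d (t k) (t (k + 1))) ≠ 0}.indicator fun _ => (1 : ℝ)) fun _ =>
      measurable_const.indicator (Measure.measurable_coe (measurableSet_slab d _ _)
        (measurableSet_singleton (0 : ℝ≥0∞)).compl))
  have hA := fun k (hk : k < n) => integral_norm_average_dirac_sub_le (P := P) hne
    (fun i => hX.solves.measurable i (t k) ⟨ht0 k, htT k hk.le⟩)
    (fun i => hX.law i (t k) ⟨ht0 k, htT k hk.le⟩)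
    (h.iIndepFun_state hX ⟨ht0 k, htT k hk.le⟩)
  simp only [hcard] at hA hB
  -- The maximum over grid times is bounded by a sum, which costs the factor `n` against `1 / √N`.
  let Φ₁ : Ω → ℝ := fun ω => ∑ k ∈ Finset.range n,
    ‖(1 / (N : ℝ)) • ∑ j, (dirac (X j (t k) ω) : Vec d) - μ (t k)‖
  let Φ₂ : Ω → ℝ := fun ω => ∑ k ∈ Finset.range n, |1 / (N : ℝ) * ∑ j, B k j ω - q k|
  -- The deterministic part: twice the bound on the mean `q k`, and the variation of the flow over
  -- one step.
  set c := 2 * (d * 𝒢.M * (𝒢.T / n)) + 2 * d ^ 2 * 𝒢.M * (𝒢.T / n) with hc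
  have hc0 : 0 ≤ c := by positivity
  have hΦ₁ : Integrable Φ₁ P :=
    integrable_finsetSum _ fun k hk => (hA k (Finset.mem_range.1 hk)).1
  have hΦ₂ : Integrable Φ₂ P := integrable_finsetSum _ fun k _ => (hB k).1
  have hΦ₁₂ : Integrable (fun ω => Φ₁ ω + 2 * Φ₂ ω) P := hΦ₁.add (hΦ₂.const_mul 2)
  have hΦ₁0 : ∀ ω, 0 ≤ Φ₁ ω := fun ω => Finset.sum_nonneg fun _ _ => norm_nonneg _
  have hΦ₂0 : ∀ ω, 0 ≤ Φ₂ ω := fun ω => Finset.sum_nonneg fun _ _ => abs_nonneg _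
  refine ⟨fun ω => Φ₁ ω + 2 * Φ₂ ω + c, hΦ₁₂.add (integrable_const c), fun ω => ?_, ?_, ?_⟩
  · linarith [hΦ₁0 ω, hΦ₂0 ω]
  · filter_upwards [hX.noise.ae_isPath hX.solves] with ω hω s hs
    obtain ⟨k, hk, hsk⟩ := exists_grid_mem hT hn hs
    have hkn := Finset.mem_range.1 hk
    have h1 : ‖empirical (fun j => X j s ω) - empirical (fun j => X j (t k) ω)‖ ≤
        2 * (1 / (N : ℝ) * ∑ j, B k j ω) := by
      refine (norm_empirical_sub_le_sum _ _).trans ?_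
      rw [← Finset.mul_sum, mul_left_comm]
      gcongr with j
      split_ifs with heq
      · exact indicator_nonneg (fun _ _ => zero_le_one) _
      · simp only [B]
        rw [indicator_of_mem]
        intro h0
        exact heq (hω.eq_of_slab_eq_zero (ht0 k) hsk.1 hs.2
          (measure_mono_null (slab_mono le_rfl hsk.2) h0))
    have h2 : 1 / (N : ℝ) * ∑ j, B k j ω ≤ Φ₂ ω + q k := by
      have h3 := Finset.single_le_sum (f := fun k => |1 / (N : ℝ) * ∑ j, B k j ω - q k|)
        (fun _ _ => abs_nonneg _) hk
      have h4 := le_abs_self (1 / (N : ℝ) * ∑ j, B k j ω - q k)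
      simp only [Φ₂]
      linarith
    have h3 : ‖empirical (fun j => X j (t k) ω) - μ (t k)‖ ≤ Φ₁ ω :=
      Finset.single_le_sum
        (f := fun k => ‖(1 / (N : ℝ)) • ∑ j, (dirac (X j (t k) ω) : Vec d) - μ (t k)‖)
        (fun _ _ => norm_nonneg _) hk
    have h4 : ‖μ (t k) - μ s‖ ≤ 2 * d ^ 2 * 𝒢.M * (𝒢.T / n) := by
      rw [norm_sub_rev]
      refine (hX.norm_flow_sub_le hM hN (ht0 k) hsk.1 hs.2).trans ?_
      gcongr
      have : s ≤ t (k + 1) := hsk.2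
      linarith [hstep k]
    have h5 := norm_sub_le_norm_sub_add_norm_sub (empirical fun j => X j s ω)
      (empirical fun j => X j (t k) ω) (μ s)
    have h6 := norm_sub_le_norm_sub_add_norm_sub (empirical fun j => X j (t k) ω) (μ (t k)) (μ s)
    have h7 := hqle k hkn
    linarith
  · have e : ∫ ω, (Φ₁ ω + 2 * Φ₂ ω + c) ∂P = ∫ ω, Φ₁ ω ∂P + 2 * ∫ ω, Φ₂ ω ∂P + c := by
      rw [integral_add hΦ₁₂ (integrable_const c), integral_add hΦ₁ (hΦ₂.const_mul 2),
        integral_const_mul]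
      simp
    have h1 : ∫ ω, Φ₁ ω ∂P ≤ n * (d * (1 / √(N : ℝ))) := by
      rw [integral_finsetSum _ fun k hk => (hA k (Finset.mem_range.1 hk)).1]
      refine (Finset.sum_le_sum fun k hk => (hA k (Finset.mem_range.1 hk)).2).trans_eq ?_
      simp
    have h2 : ∫ ω, Φ₂ ω ∂P ≤ n * (1 / √(N : ℝ)) := by
      rw [integral_finsetSum _ fun k _ => (hB k).1]
      refine (Finset.sum_le_sum fun k _ => (hB k).2).trans_eq ?_
      simp
    have h3 : n * (d * (1 / √(N : ℝ))) ≤ n * (R * (1 / √(N : ℝ))) := by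
      gcongr; exact h.card_le
    have h4 : c ≤ 2 * (R * R * (𝒢.T / n)) + 2 * R ^ 2 * R * (𝒢.T / n) := by
      have := h.card_le
      have := h.M_le
      have := h.standing.T_pos
      rw [hc]; gcongr
    rw [e]
    calc _ ≤ n * (R * (1 / √(N : ℝ))) + 2 * (n * (1 / √(N : ℝ))) +
          (2 * (R * R * (𝒢.T / n)) + 2 * R ^ 2 * R * (𝒢.T / n)) := by linarith
      _ = _ := by ring

/-! ### Rates in `N`. -/

section Rates

lemma rpow_neg_le_ninth {x s : ℝ} (hx : 1 ≤ x) (hs : 1 / 9 ≤ s) :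
    x ^ (-s) ≤ x ^ (-(1 / 9) : ℝ) := Real.rpow_le_rpow_of_exponent_le hx (by linarith)

lemma inv_sqrt_sub_one_le (hN : 2 ≤ N) :
    1 / √((N : ℝ) - 1) ≤ 2 * (N : ℝ) ^ (-(1 / 9) : ℝ) := by
  have hN' : (2 : ℝ) ≤ N := by exact_mod_cast hN
  have h1 : √(N : ℝ) ≤ 2 * √((N : ℝ) - 1) := by
    rw [Real.sqrt_le_left (by positivity), mul_pow, Real.sq_sqrt (by linarith)]
    linarith
  have h2 : 0 < √((N : ℝ) - 1) := Real.sqrt_pos.2 (by linarith)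
  have h3 : (N : ℝ) ^ (-(1 / 2) : ℝ) = 1 / √(N : ℝ) := by
    rw [Real.rpow_neg (by positivity), ← Real.sqrt_eq_rpow, one_div]
  have h4 := rpow_neg_le_ninth (x := N) (s := 1 / 2) (by linarith) (by norm_num)
  rw [h3] at h4
  have h5 : 0 < √(N : ℝ) := Real.sqrt_pos.2 (by linarith)
  calc 1 / √((N : ℝ) - 1) ≤ 2 * (1 / √(N : ℝ)) := by
        rw [mul_one_div, div_le_div_iff₀ h2 h5]
        linarith
    _ ≤ _ := by gcongr

lemma exists_grid_size (hN : 1 ≤ N) : ∃ n : ℕ, 0 < n ∧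
    n / √(N : ℝ) ≤ 2 * (N : ℝ) ^ (-(1 / 9) : ℝ) ∧ 1 / (n : ℝ) ≤ (N : ℝ) ^ (-(1 / 9) : ℝ) := by
  have hN' : (1 : ℝ) ≤ N := by exact_mod_cast hN
  have hN0 : (0 : ℝ) < N := by linarith
  -- The grid size `⌈N^{1/4}⌉` balances `n / √N` against `1 / n`; both are then of order `N^{-1/4}`,
  -- below the required `N^{-1/9}`.
  set r := (N : ℝ) ^ (1 / 4 : ℝ) with hr
  have hr1 : 1 ≤ r := Real.one_le_rpow hN' (by norm_num)
  have h4 := rpow_neg_le_ninth (x := N) (s := 1 / 4) hN' (by norm_num)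
  have hr4 : (N : ℝ) ^ (-(1 / 4) : ℝ) = 1 / r := by
    rw [Real.rpow_neg hN0.le, inv_eq_one_div]
  have hrr : √(N : ℝ) = r * r := by
    rw [Real.sqrt_eq_rpow, hr, ← Real.rpow_add hN0]; norm_num
  have hle : r ≤ ⌈r⌉₊ := Nat.le_ceil r
  have hlt : (⌈r⌉₊ : ℝ) < r + 1 := Nat.ceil_lt_add_one (by linarith)
  refine ⟨⌈r⌉₊, Nat.ceil_pos.2 (by linarith), ?_, ?_⟩
  · calc (⌈r⌉₊ : ℝ) / √(N : ℝ) ≤ (2 * r) / √(N : ℝ) := by gcongr; linarith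
      _ = 2 * (1 / r) := by rw [hrr]; field_simp
      _ ≤ _ := by rw [← hr4]; gcongr
  · calc 1 / (⌈r⌉₊ : ℝ) ≤ 1 / r := by gcongr
      _ ≤ _ := by rw [← hr4]; exact h4

end Rates

/-! ### From separation probabilities to the two estimates. -/

section Conclusion

variable {d N : ℕ} {Ω : Type*} [MeasurableSpace Ω] {P : Measure Ω} [IsProbabilityMeasure P]
  {m₀ : Vec d} {Z : Fin N → Ω → Fin d} {Nm : Fin N → Ω → Measure (ℝ × (Fin d → ℝ))}
  {𝒢 : Game d} {U Ut : ℝ → Fin d → Vec d → ℝ}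
  {D : ℝ → Fin d → Vec d → Fin d → Vec d} {K R : ℝ}
  {v : Fin N → ℝ → (Fin N → Fin d) → ℝ} {X Y : Fin N → ℝ → Ω → Fin d} {μ : ℝ → Vec d}

lemma abs_state_sub_le (x y : Fin d) : |((y : ℕ) : ℝ) - ((x : ℕ) : ℝ)| ≤ d := by
  have hx : ((x : ℕ) : ℝ) ≤ d := by exact_mod_cast x.is_lt.le
  have hy : ((y : ℕ) : ℝ) ≤ d := by exact_mod_cast y.is_lt.le
  have hx0 : (0 : ℝ) ≤ ((x : ℕ) : ℝ) := by positivity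
  have hy0 : (0 : ℝ) ≤ ((y : ℕ) : ℝ) := by positivity
  rw [abs_le]
  constructor <;> linarith

/-- Two sites differ by at most `d`, so the running distance is at most `d` on the event of
separation and zero off it; a measurable hull replaces that event. -/
lemma lintegral_iSup_abs_sub_le (T : ℝ) (i : Fin N) :
    ∫⁻ ω, ⨆ t ∈ Icc 0 T, ENNReal.ofReal |((Y i t ω : ℕ) : ℝ) - ((X i t ω : ℕ) : ℝ)| ∂P ≤
      ENNReal.ofReal (d * P.real {ω | ∃ r ∈ Icc 0 T, Y i r ω ≠ X i r ω}) := by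
  set S := {ω | ∃ r ∈ Icc 0 T, Y i r ω ≠ X i r ω} with hS
  refine lintegral_iSup_ofReal_le (g := fun t ω => |((Y i t ω : ℕ) : ℝ) - ((X i t ω : ℕ) : ℝ)|)
    (Φ := fun ω => d * outerIndicator P S ω)
    ((integrable_outerIndicator S).const_mul _)
    (fun ω => mul_nonneg (by positivity) (outerIndicator_nonneg S ω)) (ae_of_all _ fun ω t ht => ?_)
    (by rw [integral_const_mul, integral_outerIndicator])
  by_cases h : Y i t ω = X i t ω
  · rw [h, sub_self, abs_zero]
    exact mul_nonneg (by positivity) (outerIndicator_nonneg S ω)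
  · rw [outerIndicator_of_mem (show ω ∈ S from ⟨t, ht, h⟩), mul_one]
    exact abs_state_sub_le _ _

/-- The empirical measures of `Y` and `X` differ by at most twice the fraction of separated players,
uniformly in time. -/
lemma Game.Estimates.lintegral_iSup_empirical_sub_le (h : 𝒢.Estimates U Ut D K R) (hN : 0 < N)
    (hX : IsLimitSystem P 𝒢 U m₀ Z Nm μ X) {n : ℕ} (hn : 0 < n) {p : ℝ}
    (hp : ∀ i, P.real {ω | ∃ r ∈ Icc 0 𝒢.T, Y i r ω ≠ X i r ω} ≤ p) :
    ∫⁻ ω, ⨆ t ∈ Icc 0 𝒢.T, ENNReal.ofReal ‖empirical (fun j => Y j t ω) - μ t‖ ∂P ≤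
      ENNReal.ofReal (2 * p + ((R + 2) * (n / √(N : ℝ)) +
        (2 * R ^ 2 + 2 * R ^ 3) * 𝒢.T / n)) := by
  obtain ⟨Φ, hΦ, hΦ0, hle, hint⟩ := h.exists_bound_empirical_sub hN hX hn
  have hN' : (0 : ℝ) < N := by exact_mod_cast hN
  let S : Fin N → Set Ω := fun j => {ω | ∃ r ∈ Icc 0 𝒢.T, Y j r ω ≠ X j r ω}
  have hI : ∀ j, Integrable (fun ω => 2 * outerIndicator P (S j) ω) P := fun j =>
    (integrable_outerIndicator (S j)).const_mul 2
  have hI' : Integrable (fun ω => 1 / (N : ℝ) * ∑ j, 2 * outerIndicator P (S j) ω) P :=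
    (integrable_finsetSum _ fun j _ => hI j).const_mul _
  refine lintegral_iSup_ofReal_le (g := fun t ω => ‖empirical (fun j => Y j t ω) - μ t‖)
    (Φ := fun ω => 1 / (N : ℝ) * (∑ j, 2 * outerIndicator P (S j) ω) + Φ ω) (hI'.add hΦ)
    (fun ω => add_nonneg (mul_nonneg (by positivity) (Finset.sum_nonneg fun j _ =>
      mul_nonneg zero_le_two (outerIndicator_nonneg _ ω))) (hΦ0 ω)) ?_ ?_
  · filter_upwards [hle] with ω hω t ht
    refine (norm_sub_le_norm_sub_add_norm_sub _ (empirical fun j => X j t ω) _).trans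
      (add_le_add ((norm_empirical_sub_le_sum _ _).trans ?_) (hω t ht))
    gcongr with j
    split_ifs with hj
    · exact outerIndicator_nonneg _ ω
    · rw [outerIndicator_of_mem (show ω ∈ S j from ⟨t, ht, hj⟩)]
  · rw [integral_add hI' hΦ, integral_const_mul, integral_finsetSum _ fun j _ => hI j]
    simp only [integral_const_mul, integral_outerIndicator]
    refine add_le_add ?_ hint
    calc 1 / (N : ℝ) * ∑ j, 2 * P.real (S j) ≤ 1 / (N : ℝ) * ∑ _j : Fin N, 2 * p := by
          gcongr with j; exact hp j
      _ = 2 * p := by simp; field_simp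

/-- The constant in the rate of convergence. -/
noncomputable def rateConst (d : ℕ) (T κ R : ℝ) : ℝ :=
  1 + (d + 2) * (1 + 2 * couplingConst T κ R) + (2 * (R + 2) + (2 * R ^ 2 + 2 * R ^ 3) * T)

lemma Game.Estimates.couplingConst_nonneg (h : 𝒢.Estimates U Ut D K R) :
    0 ≤ couplingConst 𝒢.T 𝒢.κ R := by
  have := h.nonneg
  have := h.standing.T_pos.le
  have := h.standing.κ_pos
  rw [couplingConst, energyBound]
  positivity

lemma Game.Estimates.rateConst_pos (h : 𝒢.Estimates U Ut D K R) : 0 < rateConst d 𝒢.T 𝒢.κ R := by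
  have := h.nonneg
  have := h.standing.T_pos.le
  have := h.couplingConst_nonneg
  rw [rateConst]
  positivity

/-- The probability that a player separates from its limit. -/
lemma Game.Estimates.real_exists_ne_le_rpow (h : 𝒢.Estimates U Ut D K R) (hN1 : 1 ≤ N)
    (hv : 𝒢.IsHJBSolution v)
    (hvK : 2 ≤ N → ∀ i, ∀ t ∈ Icc 0 𝒢.T, ∀ x, ‖diffAt i (v i t) x‖ ≤ K)
    (hY : SolvesSDE P 𝒢.T Z Nm (𝒢.nashFeedback v) Y) (hX : IsLimitSystem P 𝒢 U m₀ Z Nm μ X)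
    (i : Fin N) :
    P.real {ω | ∃ r ∈ Icc 0 𝒢.T, Y i r ω ≠ X i r ω} ≤
      (1 + 2 * couplingConst 𝒢.T 𝒢.κ R) * (N : ℝ) ^ (-(1 / 9) : ℝ) := by
  have hC := h.couplingConst_nonneg
  rcases hN1.eq_or_lt with h1 | h1
  -- For a single player the estimates with `1 / (N - 1)` are void. The trivial bound by `1` is paid
  -- for by the summand `1` of the constant, as `N^{-1/9} = 1`.
  · subst h1
    refine measureReal_le_one.trans ?_
    rw [Nat.cast_one, Real.one_rpow]
    linarith
  · have hpos : 0 ≤ (N : ℝ) ^ (-(1 / 9) : ℝ) := by positivity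
    have h2 := h.real_exists_ne_le h1 hv (hvK h1) hY hX i
    have h3 := mul_le_mul_of_nonneg_left (inv_sqrt_sub_one_le h1) hC
    rw [mul_one_div] at h3
    linarith

end Conclusion

end FiniteMFG

theorem theorem3p2 {d : ℕ} (𝒢 : Game d) (h𝒢 : 𝒢.Standing)
    (cL cF cG K : ℝ)
    (hcL : ∀ x, ∀ a ∈ 𝒢.controls, |𝒢.L x a| ≤ cL)
    (hcF : ∀ x, ∀ m ∈ simplex d, |𝒢.F x m| ≤ cF)
    (hcG : ∀ x, ∀ m ∈ simplex d, |𝒢.G x m| ≤ cG)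
    (hK : 2 * √(d : ℝ) * (𝒢.T * (cL + cF) + cG) ≤ K)
    (hH1 : 𝒢.H1 K)
    (U : ℝ → Fin d → Vec d → ℝ) (hU : 𝒢.IsRegularSolution U) :
    ∃ C : ℝ, 0 < C ∧
      ∀ (N : ℕ), 1 ≤ N → ∀ m₀ ∈ simplex d,
      ∀ (v : Fin N → ℝ → (Fin N → Fin d) → ℝ), 𝒢.IsHJBSolution v →
      ∀ (Ω : Type*) [MeasurableSpace Ω] (P : Measure Ω) [IsProbabilityMeasure P]
        (Z : Fin N → Ω → Fin d) (Nm : Fin N → Ω → Measure (ℝ × (Fin d → ℝ))),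
      IsNoise P 𝒢.T 𝒢.M m₀ Z Nm →
      ∀ (Y X : Fin N → ℝ → Ω → Fin d),
      SolvesSDE P 𝒢.T Z Nm (𝒢.nashFeedback v) Y →
      SolvesSDE P 𝒢.T Z Nm (𝒢.limitFeedback U (fun i t => lawVec P (X i t))) X →
      -- the limit processes are i.i.d. on path space
      (iIndepFun (fun i ω (t : Icc 0 𝒢.T) => X i t ω) P ∧
        ∀ i j, IdentDistrib (fun ω (t : Icc 0 𝒢.T) => X i t ω)
          (fun ω (t : Icc 0 𝒢.T) => X j t ω) P P) ∧
      -- propagation of chaos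
      (∀ i, ∫⁻ ω, ⨆ t ∈ Icc 0 𝒢.T,
          ENNReal.ofReal |((Y i t ω : ℕ) : ℝ) - ((X i t ω : ℕ) : ℝ)| ∂P
        ≤ ENNReal.ofReal (C * (N : ℝ) ^ (-(1 / 9) : ℝ))) ∧
      -- law of large numbers along the mean field game flow
      ∀ (u : ℝ → Fin d → ℝ) (m : ℝ → Vec d), 𝒢.IsMFGSolution m₀ u m →
        (∀ i, ∀ t ∈ Icc 0 𝒢.T, lawVec P (X i t) = m t) ∧
        ∫⁻ ω, ⨆ t ∈ Icc 0 𝒢.T,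
            ENNReal.ofReal ‖empirical (fun j => Y j t ω) - m t‖ ∂P
          ≤ ENNReal.ofReal (C * (N : ℝ) ^ (-(1 / 9) : ℝ)) := by
  -- Without sites the simplex is empty, because the empty sum is not `1`.
  rcases Nat.eq_zero_or_pos d with hd | hd
  · subst hd
    exact ⟨1, one_pos, fun N _ m₀ hm₀ => by simpa using hm₀.2⟩
  have : NeZero d := ⟨hd.ne'⟩
  have hc : 𝒢.CostBound cL cF cG := ⟨hcL, hcF, hcG⟩
  obtain ⟨Ut, D, R, h⟩ := Game.exists_estimates h𝒢 hc hK hH1 hU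
  refine ⟨rateConst d 𝒢.T 𝒢.κ R, h.rateConst_pos, ?_⟩
  intro N hN m₀ _ v hv Ω _ P _ Z Nm hnoise Y X hY hX
  have hM := h𝒢.M_pos.le
  have hT := h𝒢.T_pos.le
  obtain ⟨μ, hμ, hμ0, hlaw⟩ := h.exists_limitFlow hN hnoise hX
  -- All laws coincide with one flow `μ`, so the feedbacks along them become a common deterministic
  -- rate.
  have hlim : IsLimitSystem P 𝒢 U m₀ Z Nm μ X :=
    ⟨hnoise, hμ, hlaw, Game.solvesSDE_limitRate hX hlaw⟩
  have hreg := h.isRegularFeedback_limitRate hμ 1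
  have hp := h.real_exists_ne_le_rpow hN hv (fun hN2 i t ht x =>
    norm_diffAt_le (fun y => hv.abs_le h𝒢 hc hN2 i ht y) i x) hY hlim
  have hR := h.nonneg
  have hC := h.couplingConst_nonneg
  set ρ := (N : ℝ) ^ (-(1 / 9) : ℝ) with hρ
  have hρ0 : 0 ≤ ρ := by positivity
  set p := (1 + 2 * couplingConst 𝒢.T 𝒢.κ R) with hpdef
  have hp0 : 0 ≤ p := by positivity
  set q := 2 * (R + 2) + (2 * R ^ 2 + 2 * R ^ 3) * 𝒢.T with hq
  have hq0 : 0 ≤ q := by positivity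
  refine ⟨⟨SolvesSDE.iIndepFun_path hM hnoise hreg hlim.solves,
    SolvesSDE.identDistrib_path hM hnoise hreg hlim.solves⟩, fun i => ?_, fun u m hum => ?_⟩
  · refine (lintegral_iSup_abs_sub_le 𝒢.T i).trans (ENNReal.ofReal_le_ofReal ?_)
    calc (d : ℝ) * P.real {ω | ∃ r ∈ Icc 0 𝒢.T, Y i r ω ≠ X i r ω} ≤ d * (p * ρ) := by
          gcongr; exact hp i
      _ = (d * p) * ρ := by ring
      _ ≤ _ := by
          refine mul_le_mul_of_nonneg_right ?_ hρ0
          rw [rateConst]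
          linarith
  · have huK : ∀ t ∈ Icc 0 𝒢.T, ∀ x, ‖diff (u t) x‖ ≤ _ := fun t ht x =>
      norm_diff_le (fun y => hum.abs_le h𝒢 hc ht y) x
    -- `m` solves the same closed flow equation because `U` equals the value function along it;
    -- uniqueness identifies it with the law of the limit processes.
    have hμm := h.limitFlow_unique hμ (h.isLimitFlow_of_isMFGSolution hum huK)
      (hμ0.trans hum.2.2.2.2.symm)
    refine ⟨fun i t ht => (hlaw i t ht).trans (hμm t ht), ?_⟩
    obtain ⟨n, hn, hn1, hn2⟩ := exists_grid_size hN
    have key := h.lintegral_iSup_empirical_sub_le hN hlim hn hp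
    have e : ∫⁻ ω, ⨆ t ∈ Icc 0 𝒢.T, ENNReal.ofReal ‖empirical (fun j => Y j t ω) - m t‖ ∂P =
        ∫⁻ ω, ⨆ t ∈ Icc 0 𝒢.T, ENNReal.ofReal ‖empirical (fun j => Y j t ω) - μ t‖ ∂P :=
      lintegral_congr fun ω => iSup_congr fun t => iSup_congr fun ht => by rw [hμm t ht]
    rw [e]
    refine key.trans (ENNReal.ofReal_le_ofReal ?_)
    calc _ ≤ 2 * (p * ρ) + ((R + 2) * (2 * ρ) + (2 * R ^ 2 + 2 * R ^ 3) * 𝒢.T * ρ) := by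
          rw [div_eq_mul_one_div _ (n : ℝ)]
          gcongr
      _ = (2 * p + q) * ρ := by rw [hq]; ring
      _ ≤ _ := by
          refine mul_le_mul_of_nonneg_right ?_ hρ0
          rw [rateConst]
          nlinarith [mul_nonneg (Nat.cast_nonneg (α := ℝ) d) hp0]
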